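/- **Theorem 3.2 (Upper bound for the chemical potential).** Let $V:\mathbb R^3\to[0,\infty)$ be measurable and locally bounded, and let $\Omega$ be either $\mathbb R^3$, in which case $V(x)\to\infty$ as $|x|\to\infty$, or an open box $\prod_{k=1}^3(p_k,q_k)$ with $p_k<q_k$ (Neumann conditions). For $M,a>0$ let $E^*(M,a)$ be the infimum of $$\mathcal E^*[\Phi]=\int_\Omega\left(|\nabla\Phi|^2+V|\Phi|^2+8\pi a\|\Phi\|_\infty^2|\Phi|^2\right)dx$$ over functions $\Phi:\Omega\to\mathbb C$ with $\int_\Omega|\Phi|^2=M$ (with $\mathcal E^*[\Phi]=\infty$ unless $\Phi$ has a weak gradient in $L^2(\Omega)$; no boundary condition is imposed). Let $v_1\ge0$ be a measurable radial interaction on $[0,\infty)$, equal to $+\infty$ on a hard core $[0,d)$ ($d\ge 0$; no core if $d=0$) and locally integrable on $(d,\infty)$, with finite scattering length $a_1>0$: $a_1=\lim_{r\to\infty}(r-u(r)/u'(r))$, where $u$ is continuous on $[0,\infty)$, $u=0$ on $[0,d]$, $u>0$ and $-u''+\frac12v_1u=0$ on $(d,\infty)$. For $a>0$ put $v(r)=(a_1/a)^2v_1(a_1r/a)$,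 and let $E^{\rm QM}(N,a)\in[0,\infty]$ be the infimum of the quadratic form $$\int_{\Omega^N}\Big(\sum_{i=1}^N\left(|\nabla_i\psi|^2+V(x_i)|\psi|^2\right)+\sum_{i<j}v(|x_i-x_j|)|\psi|^2\Big)$$ over totally symmetric $\psi$ on $\Omega^N$ with $\int_{\Omega^N}|\psi|^2=1$ (again without boundary conditions). Then, for all integers $N\ge1$ and all $a>0$, the functional $\mathcal E^*$ has a strictly positive minimizer under $\int_\Omega|\Phi|^2=N$. Moreover, for every $\kappa$ there are constants $C$ and $\delta>0$, depending only on $\Omega$, $V$ and $\kappa$, such that for all $v_1$ as above, all $N\ge1$ and $a>0$ with $Na\le\kappa$, and every strictly positive minimizer $\Phi^*$ of $\mathcal E^*$ under $\int_\Omega|\Phi|^2=N$, with $\bar\rho^*=\frac1N\int_\Omega\Phi^{*4}$: if $a\bar\rho^{*1/3}\le\delta$, then $$E^{\rm QM}(N+1,a)\le E^{\rm QM}(N,a)+E^*(1,Na)\left(1+C\,a\bar\rho^{*1/3}\right).$$ -/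

import Mathlib

section WeakDerivative

variable {X : Type*} [NormedAddCommGroup X] [NormedSpace ℝ X] [MeasureTheory.MeasureSpace X]

/-- `g` is the weak (distributional) partial derivative of `f` on the open set `U` in the
direction `w`: both are locally integrable on `U`, and the integration by parts formula holds
against every smooth test function with compact support in `U`. -/
def IsWeakDeriv (U : Set X) (w : X) (f g : X → ℂ) : Prop :=
  MeasureTheory.LocallyIntegrableOn f U MeasureTheory.volume ∧
  MeasureTheory.LocallyIntegrableOn g U MeasureTheory.volume ∧
  ∀ η : X → ℝ, ContDiff ℝ ((⊤ : ℕ∞) : WithTop ℕ∞) η → HasCompactSupport η → tsupport η ⊆ U →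
    ∫ x in U, ((fderiv ℝ η x w : ℝ) : ℂ) * f x = - ∫ x in U, ((η x : ℝ) : ℂ) * g x

/-- `∫_U |∂_w f|²`, with value `∞` if `f` has no weak derivative in the direction `w` on `U`.
The weak derivative is unique up to null sets, so that the infimum runs over one value at most. -/
noncomputable def weakDerivSq (U : Set X) (w : X) (f : X → ℂ) : ENNReal :=
  ⨅ (g : X → ℂ) (_ : IsWeakDeriv U w f g), ∫⁻ x in U, ‖g x‖ₑ ^ 2

end WeakDerivative

/-- Physical space `ℝ³` with its Euclidean norm. -/
abbrev Space3 : Type := EuclideanSpace ℝ (Fin 3)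

/-- The open box `∏ₖ (pₖ, qₖ)` in `ℝ³`. -/
def openBox (p q : Fin 3 → ℝ) : Set Space3 := {x | ∀ k, x k ∈ Set.Ioo (p k) (q k)}

/-! ### The modified Gross-Pitaevskii functional -/

/-- The functional `∫_Ω (|∇Φ|² + V|Φ|² + 8πa‖Φ‖_∞²|Φ|²)` with values in `[0, ∞]`. On a domain `Ω`
with boundary the form domain `H¹(Ω)` without boundary conditions is the one of the Neumann
problem. -/
noncomputable def starFunctional (Ω : Set Space3) (V : Space3 → ℝ) (a : ℝ) (Φ : Space3 → ℂ) :
    ENNReal :=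
  (∑ k : Fin 3, weakDerivSq Ω (EuclideanSpace.single k (1 : ℝ)) Φ)
    + ∫⁻ x in Ω, (ENNReal.ofReal (V x) * ‖Φ x‖ₑ ^ 2
        + ENNReal.ofReal (8 * Real.pi * a)
          * MeasureTheory.eLpNorm Φ ⊤ (MeasureTheory.volume.restrict Ω) ^ 2 * ‖Φ x‖ₑ ^ 2)

/-- `E*(M, a)`: the infimum of the modified functional under `∫_Ω |Φ|² = M`. -/
noncomputable def starEnergy (Ω : Set Space3) (V : Space3 → ℝ) (M a : ℝ) : ENNReal :=
  ⨅ (Φ : Space3 → ℂ) (_ : ∫⁻ x in Ω, ‖Φ x‖ₑ ^ 2 = ENNReal.ofReal M), starFunctional Ω V a Φ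

/-- `φ` is a strictly positive minimizer of the modified functional under `∫_Ω |Φ|² = M`. -/
def IsPositiveStarMinimizer (Ω : Set Space3) (V : Space3 → ℝ) (M a : ℝ) (φ : Space3 → ℝ) : Prop :=
  (∀ x ∈ Ω, 0 < φ x) ∧
  ∫⁻ x in Ω, ‖(φ x : ℂ)‖ₑ ^ 2 = ENNReal.ofReal M ∧
  starFunctional Ω V a (fun x => (φ x : ℂ)) = starEnergy Ω V M a

/-- The mean density `(1/M) ∫_Ω φ⁴`. -/
noncomputable def meanDensity (Ω : Set Space3) (M : ℝ) (φ : Space3 → ℝ) : ℝ :=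
  (∫ x in Ω, φ x ^ 4) / M

/-! ### The many-body ground state energy -/

/-- The configuration space `Ω^N` of `N` particles in `Ω`. -/
def configSpace (Ω : Set Space3) (N : ℕ) : Set (Fin N → Space3) := {x | ∀ i, x i ∈ Ω}

/-- The quadratic form `⟨ψ|H^(N)ψ⟩` of `∑ᵢ (-Δᵢ + V(xᵢ)) + ∑_{i<j} v(|xᵢ - xⱼ|)` on `Ω^N`, with
values in `[0, ∞]`; on a domain with boundary it is the form of the Neumann Laplacian. -/
noncomputable def manyBodyForm (Ω : Set Space3) (V : Space3 → ℝ) (v : ℝ → ENNReal) (N : ℕ)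
    (ψ : (Fin N → Space3) → ℂ) : ENNReal :=
  (∑ i : Fin N, ∑ k : Fin 3,
      weakDerivSq (configSpace Ω N) (Pi.single i (EuclideanSpace.single k (1 : ℝ))) ψ)
    + (∑ i : Fin N, ∫⁻ x in configSpace Ω N, ENNReal.ofReal (V (x i)) * ‖ψ x‖ₑ ^ 2)
    + ∑ i : Fin N, ∑ j ∈ Finset.Ioi i,
        ∫⁻ x in configSpace Ω N, v (dist (x i) (x j)) * ‖ψ x‖ₑ ^ 2

/-- The bosonic ground state energy: the infimum of the form over totally symmetric wave functions
with `∫ |ψ|² = 1`. -/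
noncomputable def bosonEnergy (Ω : Set Space3) (V : Space3 → ℝ) (v : ℝ → ENNReal) (N : ℕ) :
    ENNReal :=
  ⨅ (ψ : (Fin N → Space3) → ℂ)
    (_ : (∀ (σ : Equiv.Perm (Fin N)) (x : Fin N → Space3), ψ (x ∘ σ) = ψ x) ∧
      ∫⁻ x in configSpace Ω N, ‖ψ x‖ₑ ^ 2 = 1),
    manyBodyForm Ω V v N ψ

/-! ### The scattering length -/

/-- `u` (with derivative `u'` on `(d, ∞)`) is the solution, unique up to a positive factor, of the
zero energy scattering equation `-u'' + ½ v u = 0` with `u(0) = 0`, for a nonnegative interaction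
`v` with a hard core of radius `d ≥ 0` (no hard core if `d = 0`) that is locally integrable outside
the core. In the core `u = 0`; outside it the equation is integrated once, so that it makes sense
for merely locally integrable `v`. -/
def IsScatteringSolution (v : ℝ → ENNReal) (d : ℝ) (u u' : ℝ → ℝ) : Prop :=
  0 ≤ d ∧ (∀ r ∈ Set.Ico 0 d, v r = ⊤) ∧
  (∀ r s, d < r → r ≤ s → ∫⁻ t in Set.Icc r s, v t < ⊤) ∧
  ContinuousOn u (Set.Ici 0) ∧ (∀ r ∈ Set.Icc 0 d, u r = 0) ∧ (∀ r, d < r → 0 < u r) ∧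
  (∀ r, d < r → HasDerivAt u (u' r) r) ∧
  ∀ r s, d < r → r ≤ s → u' s - u' r = ∫ t in r..s, (1 / 2) * (v t).toReal * u t

/-- `v` has the (finite) scattering length `a = lim_{r → ∞} (r - u(r)/u'(r))`. -/
def HasScatteringLength (v : ℝ → ENNReal) (a : ℝ) : Prop :=
  ∃ (d : ℝ) (u u' : ℝ → ℝ), IsScatteringSolution v d u u' ∧
    Filter.Tendsto (fun r => r - u r / u' r) Filter.atTop (nhds a)

/-- The scaled interaction `v(r) = (a₁/a)² v₁(a₁ r/a)`, which has scattering length `a` if `v₁` has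
scattering length `a₁`. -/
noncomputable def scaledInteraction (v₁ : ℝ → ENNReal) (a₁ a : ℝ) (r : ℝ) : ENNReal :=
  ENNReal.ofReal ((a₁ / a) ^ 2) * v₁ (a₁ * r / a)

open MeasureTheory Filter Topology Set
open scoped ENNReal NNReal ContDiff

set_option linter.unusedSectionVars false

/-! One particle is added to an almost optimal `N`-particle state `ψ`. Let `f` be the normalized
one-particle minimizer at coupling `A = N a`. The trial state is `F(x, y) f(x) ψ(y)` with `F(x, y) =
min_j Γ(x - y_j)`, where `Γ` is the zero-energy scattering function, made Lipschitz and frozen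
beyond a radius `b`. It is not symmetric, but it need not be: for a real function, the root of the
sum of squares of its permuted copies is symmetric and has no larger Rayleigh quotient
(`bosonEnergy_mul_le`).

Two variational inequalities make the multiplication by `F` cheap. First, `f` is a supersolution of
`-Δ + V`: cutting `f + tη` off at the supremum of `f` leaves the supremum term unchanged, so that
term drops out of the variation (`IsStarMin.formInner_nonneg`). Testing with `η = (1 - F²) f ≥ 0`
shows that `F f` has at most the energy of `f` plus `∫ |∇ₓF|² f²`. Second, comparing `ψ` with `ψ - t
F² ψ` shows that `F ψ` has energy at most `E_N ∫ F² ψ² + ∫ |∇_y F|² ψ²` up to `O(t)`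
(`lintegral_multiplier_le_of_near_minimizer`). In neither bound does `∇F` meet a derivative of `f`
or `ψ`. Almost everywhere `∇F` is the gradient of one pair function, so with the interaction of the
new particle the excess is at most the sum over `j` of `2|∇Γ|² + vΓ²` at `x - y_j`, integrated
against `f² ψ²`. As `f ≤ m`, this is at most `N m² · 8πa / (1 - a/b)²`, by integrating the
scattering equation by parts (`exists_scattering_function`).

The squared norm of the trial state is, up to a vanishing error, at least `1 - 4πab² N m²`, because
`1 - Γ² ≤ 2a/r` for `r < b`. Division by it gives `E_{N+1} - E_N ≤ (T + 8πaNm²/(1 - a/b)²) / (1 -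
4πab²Nm²)`, where `T` is the form energy of `f` and `T + 8πaNm² ≤ E*(1, Na)`
(`IsStarMin.bosonEnergy_succ_le`).

With `b = ρ^(-1/3)`, where `ρ = N ∫ f⁴` is the mean density, both corrections are of order `a
ρ^(1/3)` once `N m²` is at most a constant times `ρ`. So `f` needs an upper bound on its supremum
and a lower bound on `∫ f⁴`, uniform for `Na ≤ κ`. The first is a De Giorgi iteration
(`exists_sup_bound`); the second holds because a trap of bounded energy cannot let the mass spread
out (`exists_integral_pow_four_lower`).

Existence of `f` follows from a Rellich theorem, proved by a Poincaré inequality on small cells, and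
the parallelogram law. Positivity follows from an `L²` bound on `∇ log f`, obtained by testing the
supersolution inequality with a regularized `1/f`. -/

theorem eLpNorm_two_sq {α : Type*} {m : MeasurableSpace α} {E : Type*} [NormedAddCommGroup E]
    (f : α → E) (μ : Measure α) : eLpNorm f 2 μ ^ 2 = ∫⁻ x, ‖f x‖ₑ ^ 2 ∂μ := by
  have := eLpNorm_nnreal_pow_eq_lintegral (f := f) (μ := μ) (p := 2) two_ne_zero
  norm_num at this
  exact_mod_cast this

theorem sq_lintegral_mul_le {α : Type*} {m : MeasurableSpace α} (μ : Measure α) {f g : α → ℝ≥0∞}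
    (hf : AEMeasurable f μ) (hg : AEMeasurable g μ) :
    (∫⁻ x, f x * g x ∂μ) ^ 2 ≤ (∫⁻ x, f x ^ 2 ∂μ) * ∫⁻ x, g x ^ 2 ∂μ := by
  have h := ENNReal.lintegral_mul_le_Lp_mul_Lq μ (p := 2) (q := 2)
    (by constructor <;> norm_num) hf hg
  have h2 : (∫⁻ x, f x * g x ∂μ) ^ (2 : ℝ) ≤ _ := ENNReal.rpow_le_rpow h (by norm_num)
  rw [ENNReal.mul_rpow_of_nonneg _ _ (by norm_num), ← ENNReal.rpow_mul, ← ENNReal.rpow_mul] at h2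
  norm_num at h2
  exact_mod_cast h2

/-- Weighted Cauchy-Schwarz (Jensen) for a weight of total mass at most one. -/
theorem sq_lintegral_weight_mul_le {α : Type*} {m : MeasurableSpace α} (μ : Measure α)
    {ρ h : α → ℝ≥0∞} (hρ : AEMeasurable ρ μ) (hh : AEMeasurable h μ) (h1 : ∫⁻ x, ρ x ∂μ ≤ 1) :
    (∫⁻ x, ρ x * h x ∂μ) ^ 2 ≤ ∫⁻ x, ρ x * h x ^ 2 ∂μ := by
  have key := sq_lintegral_mul_le μ (f := fun x => ρ x ^ (1 / 2 : ℝ))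
    (g := fun x => ρ x ^ (1 / 2 : ℝ) * h x) (hρ.pow_const _) ((hρ.pow_const _).mul hh)
  have e1 : ∀ x, (ρ x ^ (1 / 2 : ℝ)) ^ 2 = ρ x := by
    intro x
    rw [← ENNReal.rpow_natCast, ← ENNReal.rpow_mul]; norm_num
  simp only [mul_pow, e1, ← mul_assoc, ← pow_two] at key
  exact key.trans (by simpa using mul_le_mul_left h1 (∫⁻ x, ρ x * h x ^ 2 ∂μ))

/-! ### Mollification of square integrable weakly differentiable functions. -/

section L2WeakDeriv

variable {X : Type*} [NormedAddCommGroup X] [NormedSpace ℝ X] [MeasureSpace X]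

/-- `g` is the weak derivative of the real function `f` in the direction `w`, both being square
integrable on `U`. -/
def L2WeakDeriv (U : Set X) (w : X) (f g : X → ℝ) : Prop :=
  MemLp f 2 (volume.restrict U) ∧ MemLp g 2 (volume.restrict U) ∧
  ∀ η : X → ℝ, ContDiff ℝ ∞ η → HasCompactSupport η → tsupport η ⊆ U →
    ∫ x in U, fderiv ℝ η x w * f x = - ∫ x in U, η x * g x

variable [FiniteDimensional ℝ X] [BorelSpace X] [(volume : Measure X).IsAddHaarMeasure]

/-- Strong continuity of the action of translations on `Lp`, restated for functions. -/
theorem tendsto_eLpNorm_translate {f : X → ℝ} (hf : MemLp f 2 (volume : Measure X)) :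
    Tendsto (fun t : X => eLpNorm (fun x => f (t + x) - f x) 2 volume) (𝓝 0) (𝓝 0) := by
  have : Fact ((2 : ℝ≥0∞) ≠ ⊤) := ⟨by norm_num⟩
  have hc : Continuous fun t : X => (DomAddAct.mk t +ᵥ hf.toLp f : Lp ℝ 2 (volume : Measure X)) :=
    (continuous_id.vadd continuous_const).comp DomAddAct.continuous_mk
  have h0 : Tendsto (fun t : X => edist (DomAddAct.mk t +ᵥ hf.toLp f : Lp ℝ 2 (volume : Measure X))
      (DomAddAct.mk (0 : X) +ᵥ hf.toLp f)) (𝓝 0) (𝓝 0) := by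
    have := (hc.tendsto 0).edist (tendsto_const_nhds (x := (DomAddAct.mk (0 : X) +ᵥ hf.toLp f)))
    simpa using this
  refine h0.congr fun t => ?_
  rw [DomAddAct.mk_vadd_toLp, DomAddAct.mk_vadd_toLp, Lp.edist_toLp_toLp]
  refine eLpNorm_congr_ae (Eventually.of_forall fun x => ?_)
  simp

/-- The standard sequence of mollifiers. -/
noncomputable def stdBump (X : Type*) [NormedAddCommGroup X] [NormedSpace ℝ X] (n : ℕ) :
    ContDiffBump (0 : X) where
  rIn := 1 / (n + 2)
  rOut := 1 / (n + 1)
  rIn_pos := by positivity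
  rIn_lt_rOut := by
    apply one_div_lt_one_div_of_lt <;> [positivity; linarith]

/-- The mollification of `f` restricted to `U`. -/
noncomputable def mollify (U : Set X) (f : X → ℝ) (n : ℕ) (x : X) : ℝ :=
  ∫ t, (stdBump X n).normed volume t * U.indicator f (x - t)

omit [(volume : Measure X).IsAddHaarMeasure] [FiniteDimensional ℝ X] [BorelSpace X] in
theorem mollify_eq_convolution [FiniteDimensional ℝ X] (U : Set X) (f : X → ℝ) (n : ℕ) :
    mollify U f n = convolution ((stdBump X n).normed volume) (U.indicator f)
      (ContinuousLinearMap.lsmul ℝ ℝ) volume := rfl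

theorem lintegral_normed_bump (φ : ContDiffBump (0 : X)) :
    ∫⁻ t, ENNReal.ofReal (φ.normed volume t) = 1 := by
  rw [← ofReal_integral_eq_lintegral_ofReal φ.integrable_normed
    (Eventually.of_forall φ.nonneg_normed), φ.integral_normed, ENNReal.ofReal_one]

theorem memLp_indicator_of {U : Set X} (hU : MeasurableSet U) {f : X → ℝ}
    (hf : MemLp f 2 (volume.restrict U)) : MemLp (U.indicator f) 2 (volume : Measure X) :=
  (memLp_indicator_iff_restrict hU).2 hf

/-- A mollification averages translates with a probability weight, so Jensen and Tonelli bound its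
error by that of the worst translate within the support radius `1 / (n + 1)`. -/
theorem mollify_sub_eLpNorm_le {U : Set X} (hU : MeasurableSet U) {f : X → ℝ}
    (hf : MemLp f 2 (volume.restrict U)) (n : ℕ) {ε : ℝ≥0∞}
    (hε : ∀ t : X, ‖t‖ ≤ 1 / (n + 1 : ℝ) →
      eLpNorm (fun x => U.indicator f (t + x) - U.indicator f x) 2 volume ≤ ε) :
    eLpNorm (fun x => mollify U f n x - U.indicator f x) 2 volume ≤ ε := by
  set F := U.indicator f with hF
  have hFm : MemLp F 2 (volume : Measure X) := memLp_indicator_of hU hf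
  set ρ := (stdBump X n).normed (volume : Measure X) with hρ
  have hρc : Continuous ρ := (stdBump X n).continuous_normed
  have hρ1 : ∫⁻ t, ENNReal.ofReal (ρ t) = 1 := lintegral_normed_bump _
  have hm1 : AEStronglyMeasurable (fun p : X × X => F (p.1 - p.2))
      ((volume : Measure X).prod volume) :=
    hFm.1.comp_quasiMeasurePreserving (quasiMeasurePreserving_sub volume volume)
  have hm2 : AEStronglyMeasurable (fun p : X × X => F p.1) ((volume : Measure X).prod volume) :=
    hFm.1.comp_quasiMeasurePreserving Measure.quasiMeasurePreserving_fst
  have hFli : LocallyIntegrable F volume := hFm.locallyIntegrable (by norm_num)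
  have hconv : ∀ x, Integrable (fun t => ρ t * F (x - t)) volume := by
    intro x
    have := (stdBump X n).hasCompactSupport_normed (μ := (volume : Measure X))
      |>.convolutionExists_left (ContinuousLinearMap.lsmul ℝ ℝ) hρc hFli x
    exact this
  have hpt : ∀ x, ‖mollify U f n x - F x‖ₑ ^ 2
      ≤ (∫⁻ t, ENNReal.ofReal (ρ t) * ‖F (x - t) - F x‖ₑ) ^ 2 := by
    intro x
    gcongr
    have : mollify U f n x - F x = ∫ t, ρ t * (F (x - t) - F x) := by
      simp only [mul_sub]
      rw [integral_sub (hconv x) ((stdBump X n).integrable_normed.mul_const _),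
        integral_mul_const, (stdBump X n).integral_normed, one_mul]
      rfl
    rw [this]
    refine (enorm_integral_le_lintegral_enorm _).trans (le_of_eq ?_)
    refine lintegral_congr fun t => ?_
    rw [enorm_mul, Real.enorm_eq_ofReal ((stdBump X n).nonneg_normed t)]
  have hJ : ∀ᵐ x, (∫⁻ t, ENNReal.ofReal (ρ t) * ‖F (x - t) - F x‖ₑ) ^ 2
      ≤ ∫⁻ t, ENNReal.ofReal (ρ t) * ‖F (x - t) - F x‖ₑ ^ 2 := by
    filter_upwards [(hm1.sub hm2).prodMk_left] with x hx
    exact sq_lintegral_weight_mul_le _ hρc.measurable.ennreal_ofReal.aemeasurable hx.enorm hρ1.le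
  rw [← ENNReal.pow_le_pow_left_iff two_ne_zero, eLpNorm_two_sq]
  calc ∫⁻ x, ‖mollify U f n x - F x‖ₑ ^ 2
      ≤ ∫⁻ x, ∫⁻ t, ENNReal.ofReal (ρ t) * ‖F (x - t) - F x‖ₑ ^ 2 := by
        refine lintegral_mono_ae ?_
        filter_upwards [hJ] with x hx using (hpt x).trans hx
    _ = ∫⁻ t, ∫⁻ x, ENNReal.ofReal (ρ t) * ‖F (x - t) - F x‖ₑ ^ 2 := by
        refine lintegral_lintegral_swap ?_
        refine AEMeasurable.mul ?_ ((hm1.sub hm2).enorm.pow_const 2)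
        exact (hρc.measurable.ennreal_ofReal.comp measurable_snd).aemeasurable
    _ ≤ ∫⁻ t, ENNReal.ofReal (ρ t) * ε ^ 2 := by
        refine lintegral_mono fun t => ?_
        dsimp only
        rw [lintegral_const_mul' _ _ ENNReal.ofReal_ne_top]
        by_cases ht : ‖t‖ ≤ 1 / (n + 1 : ℝ)
        · gcongr
          have := hε (-t) (by simpa using ht)
          rw [← ENNReal.pow_le_pow_left_iff two_ne_zero, eLpNorm_two_sq] at this
          simpa [sub_eq_neg_add] using this
        · have : ρ t = 0 := by
            have : t ∉ Function.support ρ := by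
              rw [hρ, ContDiffBump.support_normed_eq]
              simp only [Metric.mem_ball, dist_zero_right, stdBump]
              push Not at ht ⊢
              exact ht.le
            simpa using this
          simp [this]
    _ = ε ^ 2 := by
        rw [lintegral_mul_const _ hρc.measurable.ennreal_ofReal, hρ1, one_mul]

theorem tendsto_mollify {U : Set X} (hU : MeasurableSet U) {f : X → ℝ}
    (hf : MemLp f 2 (volume.restrict U)) :
    Tendsto (fun n => eLpNorm (fun x => mollify U f n x - U.indicator f x) 2 volume)
      atTop (𝓝 0) := by
  rw [ENNReal.tendsto_nhds_zero]
  intro ε hε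
  have h := ENNReal.tendsto_nhds_zero.1 (tendsto_eLpNorm_translate (memLp_indicator_of hU hf)) ε hε
  rw [Metric.eventually_nhds_iff] at h
  obtain ⟨δ, hδ, h⟩ := h
  obtain ⟨N, hN⟩ := exists_nat_one_div_lt hδ
  filter_upwards [eventually_ge_atTop N] with n hn
  refine mollify_sub_eLpNorm_le hU hf n fun t ht => h ?_
  rw [dist_zero_right]
  refine ht.trans_lt (lt_of_le_of_lt ?_ hN)
  gcongr

theorem mollify_contDiff {U : Set X} (hU : MeasurableSet U) {f : X → ℝ}
    (hf : MemLp f 2 (volume.restrict U)) (n : ℕ) : ContDiff ℝ ∞ (mollify U f n) := by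
  rw [mollify_eq_convolution]
  exact (stdBump X n).hasCompactSupport_normed.contDiff_convolution_left _
    (stdBump X n).contDiff_normed
    ((memLp_indicator_of hU hf).locallyIntegrable (by norm_num))

/-- The derivative falls on the kernel, and `y ↦ ρ (x - y)` is an admissible test function when its
support lies in `U`. Near the boundary the identity would fail, since `f` is extended by zero; hence
the condition on the closed ball. -/
theorem fderiv_mollify {U : Set X} (hU : MeasurableSet U) {w : X} {f g : X → ℝ}
    (h : L2WeakDeriv U w f g) (n : ℕ) {x : X}
    (hx : Metric.closedBall x (1 / (n + 1 : ℝ)) ⊆ U) :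
    fderiv ℝ (mollify U f n) x w = mollify U g n x := by
  obtain ⟨hf, hg, hwd⟩ := h
  set ρ := (stdBump X n).normed (volume : Measure X) with hρ
  have hρs : ContDiff ℝ ∞ ρ := (stdBump X n).contDiff_normed
  have hρk : HasCompactSupport ρ := (stdBump X n).hasCompactSupport_normed
  have hli := (memLp_indicator_of hU hf).locallyIntegrable (μ := volume) (by norm_num)
  have h1 := hρk.hasFDerivAt_convolution_left (ContinuousLinearMap.lsmul ℝ ℝ)
    (hρs.of_le (by simp)) hli x
  have hη : ContDiff ℝ ∞ (fun y => ρ (x - y)) := hρs.comp (contDiff_const.sub contDiff_id)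
  have hηs : tsupport (fun y => ρ (x - y)) ⊆ Metric.closedBall x (1 / (n + 1 : ℝ)) := by
    refine closure_minimal (fun y hy => ?_) Metric.isClosed_closedBall
    have : x - y ∈ Function.support ρ := hy
    rw [hρ, ContDiffBump.support_normed_eq] at this
    simp only [Metric.mem_ball, dist_zero_right, stdBump] at this
    rw [Metric.mem_closedBall, dist_comm, dist_eq_norm]
    exact this.le
  have hηk : HasCompactSupport (fun y => ρ (x - y)) :=
    HasCompactSupport.of_support_subset_isCompact (isCompact_closedBall x _)
      ((subset_tsupport _).trans hηs)
  have h2 := hwd _ hη hηk (hηs.trans hx)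
  have hfd : ∀ y, fderiv ℝ (fun y => ρ (x - y)) y w = - fderiv ℝ ρ (x - y) w := by
    intro y
    have : HasFDerivAt (fun y => ρ (x - y)) ((fderiv ℝ ρ (x - y)).comp
        (-ContinuousLinearMap.id ℝ X)) y :=
      ((hρs.differentiable (by simp)) (x - y)).hasFDerivAt.comp y
        ((hasFDerivAt_id y).const_sub x)
    rw [this.fderiv]; simp
  simp only [hfd, neg_mul, integral_neg, neg_inj] at h2
  rw [mollify_eq_convolution, h1.fderiv]
  have h3 : (convolution (fderiv ℝ ρ) (U.indicator f)
      ((ContinuousLinearMap.lsmul ℝ ℝ).precompL X) volume x) w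
      = ∫ t, fderiv ℝ ρ t w * U.indicator f (x - t) := by
    rw [convolution]
    rw [ContinuousLinearMap.integral_apply]
    · simp
    · exact (hρk.fderiv ℝ).convolutionExists_left _
        (hρs.continuous_fderiv (by simp)) hli x
  rw [h3, ← integral_sub_left_eq_self (fun t => fderiv ℝ ρ t w * U.indicator f (x - t)) volume x]
  rw [mollify, ← integral_sub_left_eq_self (fun t => ρ t * U.indicator g (x - t)) volume x]
  simp only [sub_sub_cancel]
  have e : ∀ (a : X → ℝ) (b : X → ℝ), ∫ t, a t * U.indicator b t = ∫ t in U, a t * b t := by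
    intro a b
    rw [← integral_indicator hU]
    congr 1; ext t; by_cases ht : t ∈ U <;> simp [ht]
  rw [e (fun t => fderiv ℝ ρ (x - t) w), e (fun t => ρ (x - t))]
  exact h2

theorem exists_closedBall_subset {U K : Set X} (hU : IsOpen U) (hK : IsCompact K) (hKU : K ⊆ U) :
    ∃ N : ℕ, ∀ n ≥ N, ∀ x ∈ K, Metric.closedBall x (1 / (n + 1 : ℝ)) ⊆ U := by
  obtain ⟨δ, hδ, h⟩ := hK.exists_cthickening_subset_open hU hKU
  obtain ⟨N, hN⟩ := exists_nat_one_div_lt hδ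
  refine ⟨N, fun n hn x hx => (Metric.closedBall_subset_cthickening hx _).trans
    ((Metric.cthickening_mono ?_ K).trans h)⟩
  refine le_trans ?_ hN.le
  gcongr

theorem tendsto_fderiv_mollify {U K : Set X} (hU : IsOpen U) (hK : IsCompact K) (hKU : K ⊆ U)
    {w : X} {f g : X → ℝ} (h : L2WeakDeriv U w f g) :
    Tendsto (fun n => eLpNorm (fun x => fderiv ℝ (mollify U f n) x w - g x) 2 (volume.restrict K))
      atTop (𝓝 0) := by
  obtain ⟨N, hN⟩ := exists_closedBall_subset hU hK hKU
  refine tendsto_of_tendsto_of_tendsto_of_le_of_le' tendsto_const_nhds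
    (tendsto_mollify hU.measurableSet h.2.1) (Eventually.of_forall fun _ => zero_le) ?_
  filter_upwards [eventually_ge_atTop N] with n hn
  refine le_trans (le_of_eq ?_) (eLpNorm_mono_measure _ (Measure.restrict_le_self (s := K)))
  refine eLpNorm_congr_ae ?_
  filter_upwards [ae_restrict_mem hK.measurableSet] with x hx
  rw [fderiv_mollify hU.measurableSet h n (hN n hn x hx), indicator_of_mem (hKU hx)]

theorem tendsto_mollify_restrict {U K : Set X} (hU : IsOpen U) (hK : MeasurableSet K) (hKU : K ⊆ U)
    {f : X → ℝ} (hf : MemLp f 2 (volume.restrict U)) :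
    Tendsto (fun n => eLpNorm (fun x => mollify U f n x - f x) 2 (volume.restrict K))
      atTop (𝓝 0) := by
  refine tendsto_of_tendsto_of_tendsto_of_le_of_le tendsto_const_nhds
    (tendsto_mollify hU.measurableSet hf) (fun _ => zero_le) fun n => ?_
  refine le_trans (le_of_eq ?_) (eLpNorm_mono_measure _ (Measure.restrict_le_self (s := K)))
  refine eLpNorm_congr_ae ?_
  filter_upwards [ae_restrict_mem hK] with x hx
  rw [indicator_of_mem (hKU hx)]

end L2WeakDeriv

/-! ### Elementary operations on weak derivatives and their stability under limits. -/

theorem tendsto_eLpNorm_one_of_two {α : Type*} {m : MeasurableSpace α} {μ : Measure α}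
    [IsFiniteMeasure μ] {F : ℕ → α → ℝ} (hF : ∀ n, AEStronglyMeasurable (F n) μ)
    (h : Tendsto (fun n => eLpNorm (F n) 2 μ) atTop (𝓝 0)) :
    Tendsto (fun n => eLpNorm (F n) 1 μ) atTop (𝓝 0) := by
  have h1 := fun n => eLpNorm_le_eLpNorm_mul_rpow_measure_univ (μ := μ) (p := 1) (q := 2)
    (by norm_num) (hF n)
  refine tendsto_of_tendsto_of_tendsto_of_le_of_le tendsto_const_nhds ?_ (fun _ => zero_le) h1
  have := ENNReal.Tendsto.mul_const h (b := μ univ ^ (1 / (1 : ℝ≥0∞).toReal - 1 / (2 : ℝ≥0∞).toReal))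
    (Or.inr (by
      refine ENNReal.rpow_ne_top_of_nonneg ?_ (measure_ne_top _ _)
      norm_num))
  simpa using this

section L2WeakDeriv

variable {X : Type*} [NormedAddCommGroup X] [NormedSpace ℝ X] [MeasureSpace X]

theorem setIntegral_eq_of_support {U K : Set X} {b : X → ℝ} (hKU : K ⊆ U)
    (hU : MeasurableSet U) (hb : ∀ x ∉ K, b x = 0) : ∫ x in U, b x = ∫ x in K, b x :=
  setIntegral_eq_of_subset_of_forall_sdiff_eq_zero hU hKU fun x hx => hb x hx.2

theorem fderiv_eq_zero_of_notMem_tsupport' {η : X → ℝ} {x : X} (hx : x ∉ tsupport η) :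
    fderiv ℝ η x = 0 :=
  image_eq_zero_of_notMem_tsupport fun h => hx (tsupport_fderiv_subset ℝ h)

variable [FiniteDimensional ℝ X] [BorelSpace X] [(volume : Measure X).IsAddHaarMeasure]

theorem exists_bound_of_test {η : X → ℝ} (hη : ContDiff ℝ ∞ η) (hc : HasCompactSupport η) (w : X) :
    ∃ B, (∀ x, |η x| ≤ B) ∧ ∀ x, |fderiv ℝ η x w| ≤ B := by
  obtain ⟨B₁, h₁⟩ := hc.exists_bound_of_continuous hη.continuous
  obtain ⟨B₂, h₂⟩ := (hc.fderiv_apply ℝ w).exists_bound_of_continuous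
    ((hη.continuous_fderiv (by simp)).clm_apply continuous_const)
  exact ⟨max B₁ B₂, fun x => (h₁ x).trans (le_max_left _ _), fun x => (h₂ x).trans (le_max_right _ _)⟩

theorem continuous_fderiv_apply_test {η : X → ℝ} (hη : ContDiff ℝ ∞ η) (w : X) :
    Continuous fun x => fderiv ℝ η x w :=
  (hη.continuous_fderiv (by simp)).clm_apply continuous_const

namespace L2WeakDeriv

variable {U : Set X} {w : X} {f g f' g' : X → ℝ}

theorem congr (h : L2WeakDeriv U w f g) (hf : f =ᵐ[volume.restrict U] f')
    (hg : g =ᵐ[volume.restrict U] g') : L2WeakDeriv U w f' g' := by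
  refine ⟨(memLp_congr_ae hf).1 h.1, (memLp_congr_ae hg).1 h.2.1, fun η h1 h2 h3 => ?_⟩
  have e1 : ∫ x in U, fderiv ℝ η x w * f x = ∫ x in U, fderiv ℝ η x w * f' x :=
    integral_congr_ae (hf.mono fun x hx => by simp only [hx])
  have e2 : ∫ x in U, η x * g x = ∫ x in U, η x * g' x :=
    integral_congr_ae (hg.mono fun x hx => by simp only [hx])
  rw [← e1, ← e2, h.2.2 η h1 h2 h3]

theorem integrable_test_mul {η : X → ℝ} (hη : Continuous η) (hc : HasCompactSupport η)
    (hf : MemLp f 2 (volume.restrict U)) : Integrable (fun x => η x * f x) (volume.restrict U) := by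
  have h1 : MemLp η 2 (volume.restrict U) :=
    (hη.memLp_of_hasCompactSupport hc)
  exact h1.integrable_mul hf

theorem integrable_deriv_test_mul {η : X → ℝ} (hη : ContDiff ℝ ∞ η) (hc : HasCompactSupport η)
    (hf : MemLp f 2 (volume.restrict U)) :
    Integrable (fun x => fderiv ℝ η x w * f x) (volume.restrict U) :=
  integrable_test_mul (continuous_fderiv_apply_test hη w) (hc.fderiv_apply ℝ w) hf

theorem add (h : L2WeakDeriv U w f g) (h' : L2WeakDeriv U w f' g') :
    L2WeakDeriv U w (fun x => f x + f' x) (fun x => g x + g' x) := by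
  refine ⟨h.1.add h'.1, h.2.1.add h'.2.1, fun η h1 h2 h3 => ?_⟩
  simp only [mul_add]
  rw [integral_add (integrable_deriv_test_mul h1 h2 h.1) (integrable_deriv_test_mul h1 h2 h'.1),
    integral_add (integrable_test_mul h1.continuous h2 h.2.1)
      (integrable_test_mul h1.continuous h2 h'.2.1), h.2.2 η h1 h2 h3, h'.2.2 η h1 h2 h3]
  ring

theorem const_mul (h : L2WeakDeriv U w f g) (c : ℝ) :
    L2WeakDeriv U w (fun x => c * f x) (fun x => c * g x) := by
  refine ⟨h.1.const_mul c, h.2.1.const_mul c, fun η h1 h2 h3 => ?_⟩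
  simp only [mul_left_comm _ c]
  rw [integral_const_mul, integral_const_mul, h.2.2 η h1 h2 h3]
  ring

theorem sub (h : L2WeakDeriv U w f g) (h' : L2WeakDeriv U w f' g') :
    L2WeakDeriv U w (fun x => f x - f' x) (fun x => g x - g' x) := by
  simpa [sub_eq_add_neg] using h.add (h'.const_mul (-1))

theorem mono (hU : MeasurableSet U) {V : Set X} (hVU : V ⊆ U)
    (h : L2WeakDeriv U w f g) : L2WeakDeriv V w f g := by
  refine ⟨h.1.mono_measure (Measure.restrict_mono hVU le_rfl),
    h.2.1.mono_measure (Measure.restrict_mono hVU le_rfl), fun η h1 h2 h3 => ?_⟩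
  have := h.2.2 η h1 h2 (h3.trans hVU)
  rwa [setIntegral_eq_of_support (K := V) hVU hU, setIntegral_eq_of_support (K := V) hVU hU] at this
  · intro x hx
    rw [image_eq_zero_of_notMem_tsupport fun h => hx (h3 h), zero_mul]
  · intro x hx
    rw [fderiv_eq_zero_of_notMem_tsupport' fun h => hx (h3 h)]; simp

theorem locallyIntegrableOn (hf : MemLp f 2 (volume.restrict U)) :
    LocallyIntegrableOn f U volume := by
  intro x _
  obtain ⟨K, hK, hx⟩ := exists_compact_mem_nhds x
  have hfin : IsFiniteMeasure ((volume.restrict U).restrict K) :=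
    ⟨by rw [Measure.restrict_apply_univ]
        exact (Measure.restrict_le_self _).trans_lt hK.measure_lt_top⟩
  refine ⟨U ∩ K, inter_mem_nhdsWithin U hx, ?_⟩
  have h1 : Integrable f ((volume.restrict U).restrict K) :=
    (hf.mono_measure Measure.restrict_le_self).integrable (by norm_num)
  rwa [Measure.restrict_restrict hK.measurableSet, inter_comm] at h1

/-- Both sides of the integration by parts formula converge by dominated convergence. This is how
functions with corners, such as positive parts and moduli, are reached from `C¹` regularizations. -/
theorem of_dominated {F G : ℕ → X → ℝ} {b c : X → ℝ} (h : ∀ n, L2WeakDeriv U w (F n) (G n))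
    (hb : MemLp b 2 (volume.restrict U)) (hc : MemLp c 2 (volume.restrict U))
    (hFb : ∀ n, ∀ᵐ x ∂volume.restrict U, |F n x| ≤ b x)
    (hGc : ∀ n, ∀ᵐ x ∂volume.restrict U, |G n x| ≤ c x)
    (hF : ∀ᵐ x ∂volume.restrict U, Tendsto (fun n => F n x) atTop (𝓝 (f x)))
    (hG : ∀ᵐ x ∂volume.restrict U, Tendsto (fun n => G n x) atTop (𝓝 (g x))) :
    L2WeakDeriv U w f g := by
  have aux : ∀ {F : ℕ → X → ℝ} {b f : X → ℝ}, MemLp b 2 (volume.restrict U) →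
      (∀ n, MemLp (F n) 2 (volume.restrict U)) →
      (∀ n, ∀ᵐ x ∂volume.restrict U, |F n x| ≤ b x) →
      (∀ᵐ x ∂volume.restrict U, Tendsto (fun n => F n x) atTop (𝓝 (f x))) →
      MemLp f 2 (volume.restrict U) ∧ ∀ η : X → ℝ, Continuous η → HasCompactSupport η →
        Tendsto (fun n => ∫ x in U, η x * F n x) atTop (𝓝 (∫ x in U, η x * f x)) := by
    intro F b f hb hFm hFb hF
    have hm : AEStronglyMeasurable f (volume.restrict U) :=
      aestronglyMeasurable_of_tendsto_ae _ (fun n => (hFm n).1) hF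
    refine ⟨hb.of_le hm ?_, fun η h1 h2 => ?_⟩
    · filter_upwards [hF, ae_all_iff.2 hFb] with x h1 h2
      exact (le_of_tendsto h1.abs (Eventually.of_forall h2)).trans (le_abs_self _)
    · refine tendsto_integral_of_dominated_convergence (fun x => |η x| * b x)
        (fun n => h1.aestronglyMeasurable.mul (hFm n).1)
        (integrable_test_mul h1.abs h2.norm hb) ?_ ?_
      · intro n
        filter_upwards [hFb n] with x hx
        rw [norm_mul]
        exact mul_le_mul_of_nonneg_left hx (abs_nonneg _)
      · filter_upwards [hF] with x hx using hx.const_mul _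
  obtain ⟨hf, h1⟩ := aux hb (fun n => (h n).1) hFb hF
  obtain ⟨hg, h2⟩ := aux hc (fun n => (h n).2.1) hGc hG
  refine ⟨hf, hg, fun η e1 e2 e3 => ?_⟩
  have t1 := h1 _ (continuous_fderiv_apply_test e1 w) (e2.fderiv_apply ℝ w)
  have t2 := (h2 η e1.continuous e2).neg
  exact tendsto_nhds_unique (t1.congr fun n => (h n).2.2 η e1 e2 e3) t2

/-- Weak differentiability from approximations that satisfy the integration by parts formula and
converge in `L¹` on the support of each test function. -/
theorem of_approx (hU : MeasurableSet U) (hf : MemLp f 2 (volume.restrict U))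
    (hg : MemLp g 2 (volume.restrict U))
    (H : ∀ η : X → ℝ, ContDiff ℝ ∞ η → HasCompactSupport η → tsupport η ⊆ U →
      ∃ F G : ℕ → X → ℝ, (∀ n, IntegrableOn (F n) (tsupport η)) ∧
        (∀ n, IntegrableOn (G n) (tsupport η)) ∧
        Tendsto (fun n => eLpNorm (fun x => F n x - f x) 1 (volume.restrict (tsupport η)))
          atTop (𝓝 0) ∧
        Tendsto (fun n => eLpNorm (fun x => G n x - g x) 1 (volume.restrict (tsupport η)))
          atTop (𝓝 0) ∧
        ∀ n, ∫ x, fderiv ℝ η x w * F n x = - ∫ x, η x * G n x) :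
    L2WeakDeriv U w f g := by
  refine ⟨hf, hg, fun η e1 e2 e3 => ?_⟩
  obtain ⟨F, G, hF, hG, tF, tG, hFG⟩ := H η e1 e2 e3
  set K := tsupport η with hKdef
  have hK : IsCompact K := e2
  obtain ⟨B, hB1, hB2⟩ := exists_bound_of_test e1 e2 w
  have : IsFiniteMeasure (volume.restrict K) := ⟨by simpa using hK.measure_lt_top⟩
  have aux : ∀ (b : X → ℝ) (F : ℕ → X → ℝ) (f : X → ℝ), Continuous b → (∀ x, |b x| ≤ B) →
      IntegrableOn f K → (∀ n, IntegrableOn (F n) K) →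
      Tendsto (fun n => eLpNorm (fun x => F n x - f x) 1 (volume.restrict K)) atTop (𝓝 0) →
      Tendsto (fun n => ∫ x in K, b x * F n x) atTop (𝓝 (∫ x in K, b x * f x)) := by
    intro b F f hb hbB hf hF ht
    refine tendsto_integral_of_L1' _ (hf.bdd_mul hb.aestronglyMeasurable
      (Eventually.of_forall hbB)).1 (Eventually.of_forall fun n =>
        (hF n).bdd_mul hb.aestronglyMeasurable (Eventually.of_forall hbB)) ?_
    have h0 : Tendsto (fun n => ENNReal.ofReal B *
        eLpNorm (fun x => F n x - f x) 1 (volume.restrict K)) atTop (𝓝 0) := by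
      simpa using ENNReal.Tendsto.const_mul ht (Or.inr ENNReal.ofReal_ne_top)
    refine tendsto_of_tendsto_of_tendsto_of_le_of_le tendsto_const_nhds h0 (fun _ => zero_le)
      fun n => ?_
    refine eLpNorm_le_mul_eLpNorm_of_ae_le_mul (Eventually.of_forall fun x => ?_) 1
    simp only [Pi.sub_apply, ← mul_sub, norm_mul]
    exact mul_le_mul_of_nonneg_right (hbB x) (norm_nonneg _)
  have iK : ∀ {f : X → ℝ}, MemLp f 2 (volume.restrict U) → IntegrableOn f K := fun hf =>
    (hf.mono_measure (Measure.restrict_mono e3 le_rfl)).integrable (by norm_num)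
  have t1 := aux _ F f (continuous_fderiv_apply_test e1 w) hB2 (iK hf) hF tF
  have t2 := (aux _ G g e1.continuous hB1 (iK hg) hG tG).neg
  have s1 : ∀ (f : X → ℝ), ∀ x ∉ K, fderiv ℝ η x w * f x = 0 := fun f x hx => by
    rw [fderiv_eq_zero_of_notMem_tsupport' hx]; simp
  have s2 : ∀ (f : X → ℝ), ∀ x ∉ K, η x * f x = 0 := fun f x hx => by
    rw [image_eq_zero_of_notMem_tsupport hx, zero_mul]
  rw [setIntegral_eq_of_support e3 hU (s1 f), setIntegral_eq_of_support e3 hU (s2 g)]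
  refine tendsto_nhds_unique (t1.congr fun n => ?_) t2
  have := hFG n
  rwa [← setIntegral_eq_integral_of_forall_compl_eq_zero (s1 (F n)),
    ← setIntegral_eq_integral_of_forall_compl_eq_zero (s2 (G n))] at this

end L2WeakDeriv

theorem ae_tendsto_mollify {U : Set X} (hU : MeasurableSet U) {f : X → ℝ}
    (hf : MemLp f 2 (volume.restrict U)) :
    ∀ᵐ x ∂volume.restrict U, Tendsto (fun n => mollify U f n x) atTop (𝓝 (f x)) := by
  rw [ae_restrict_iff' hU]
  have h := ContDiffBump.ae_convolution_tendsto_right_of_locallyIntegrable (μ := (volume : Measure X))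
    (φ := stdBump X) (l := atTop) (K := 2) (g := U.indicator f) ?_ ?_
    ((memLp_indicator_of hU hf).locallyIntegrable (by norm_num))
  · filter_upwards [h] with x hx hxU
    rw [indicator_of_mem hxU] at hx
    exact hx
  · exact tendsto_one_div_add_atTop_nhds_zero_nat
  -- The radii satisfy `1/(n+1) ≤ 2/(n+2)`, the bounded ratio that the Lebesgue differentiation
  -- argument requires.
  · refine Eventually.of_forall fun n => ?_
    simp only [stdBump]
    rw [mul_one_div, div_le_div_iff₀ (by positivity) (by positivity)]
    nlinarith

theorem integral_fderiv_mul_eq_of_test {η φ : X → ℝ} (hη : ContDiff ℝ ∞ η)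
    (hc : HasCompactSupport η) (hφ : ContDiff ℝ 1 φ) (w : X) :
    ∫ x, fderiv ℝ η x w * φ x = - ∫ x, η x * fderiv ℝ φ x w := by
  have c1 := continuous_fderiv_apply_test hη w
  have c2 : Continuous fun x => fderiv ℝ φ x w :=
    (hφ.continuous_fderiv one_ne_zero).clm_apply continuous_const
  rw [integral_mul_fderiv_eq_neg_fderiv_mul_of_integrable (f := η) (g := φ) (v := w)
    (μ := volume) ?_ ?_ ?_ (fun x _ => hη.differentiable (by simp) x)
    (fun x _ => hφ.differentiable one_ne_zero x), neg_neg]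
  · exact (c1.mul hφ.continuous).integrable_of_hasCompactSupport ((hc.fderiv_apply ℝ w).mul_right)
  · exact (hη.continuous.mul c2).integrable_of_hasCompactSupport hc.mul_right
  · exact (hη.continuous.mul hφ.continuous).integrable_of_hasCompactSupport hc.mul_right

end L2WeakDeriv

/-! ### Chain rules, truncation and moduli. -/

theorem tendsto_eLpNorm_of_le_sum {α ι : Type*} {m : MeasurableSpace α} {μ : Measure α} [Fintype ι]
    {p : ℝ≥0∞} (hp : 1 ≤ p) {D : ℕ → α → ℝ} {E : ι → ℕ → α → ℝ} {C : ℝ} 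
    (hE : ∀ i n, AEStronglyMeasurable (E i n) μ)
    (hle : ∀ n x, |D n x| ≤ C * ∑ i, |E i n x|)
    (ht : ∀ i, Tendsto (fun n => eLpNorm (E i n) p μ) atTop (𝓝 0)) :
    Tendsto (fun n => eLpNorm (D n) p μ) atTop (𝓝 0) := by
  have h0 : Tendsto (fun n => ENNReal.ofReal C * ∑ i, eLpNorm (E i n) p μ) atTop (𝓝 0) := by
    have := ENNReal.Tendsto.const_mul (tendsto_finsetSum Finset.univ fun i _ => ht i)
      (Or.inr (ENNReal.ofReal_ne_top (r := C)))
    simpa using this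
  refine tendsto_of_tendsto_of_tendsto_of_le_of_le tendsto_const_nhds h0 (fun _ => zero_le)
    fun n => ?_
  have h1 : eLpNorm (D n) p μ ≤ ENNReal.ofReal C * eLpNorm (∑ i, fun x => |E i n x|) p μ := by
    refine eLpNorm_le_mul_eLpNorm_of_ae_le_mul (Eventually.of_forall fun x => ?_) p
    rw [Real.norm_eq_abs, Real.norm_eq_abs, Finset.sum_apply,
      abs_of_nonneg (Finset.sum_nonneg fun i _ => abs_nonneg (E i n x))]
    exact hle n x
  refine h1.trans ?_
  gcongr
  refine (eLpNorm_sum_le (fun i _ => (hE i n).norm) hp).trans (le_of_eq ?_)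
  exact Finset.sum_congr rfl fun i _ => eLpNorm_norm _

theorem norm_pi_le_sum_abs {ι : Type*} [Fintype ι] (v : ι → ℝ) : ‖v‖ ≤ ∑ i, |v i| :=
  (pi_norm_le_iff_of_nonneg (Finset.sum_nonneg fun _ _ => abs_nonneg _)).2 fun i =>
    Finset.single_le_sum (f := fun i => |v i|) (fun _ _ => abs_nonneg _) (Finset.mem_univ i)

section L2WeakDeriv

variable {X : Type*} [NormedAddCommGroup X] [NormedSpace ℝ X] [MeasureSpace X]
variable [FiniteDimensional ℝ X] [BorelSpace X] [(volume : Measure X).IsAddHaarMeasure]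

namespace L2WeakDeriv

variable {U : Set X} {w : X}

/-- Chain rule for a `C¹` function of several weakly differentiable functions. -/
theorem chain {ι : Type*} [Fintype ι] (hU : IsOpen U) {f g : ι → X → ℝ}
    (h : ∀ i, L2WeakDeriv U w (f i) (g i)) {H : (ι → ℝ) → ℝ} (hH : ContDiff ℝ 1 H) {C : ℝ}
    (hC : ∀ v, ‖fderiv ℝ H v‖ ≤ C) (h0 : H 0 = 0) :
    L2WeakDeriv U w (fun x => H fun i => f i x)
      (fun x => fderiv ℝ H (fun i => f i x) fun i => g i x) := by
  have hC0 : 0 ≤ C := (norm_nonneg _).trans (hC 0)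
  have hdiff : Differentiable ℝ H := hH.differentiable one_ne_zero
  have hlip : ∀ u v, |H v - H u| ≤ C * ‖v - u‖ := fun u v =>
    Convex.norm_image_sub_le_of_norm_fderiv_le (s := univ) (fun x _ => hdiff x) (fun x _ => hC x)
      convex_univ (mem_univ u) (mem_univ v)
  have hcf : Continuous (fderiv ℝ H) := hH.continuous_fderiv one_ne_zero
  have hc2 : Continuous fun p : (ι → ℝ) × (ι → ℝ) => fderiv ℝ H p.1 p.2 :=
    (hcf.comp continuous_fst).clm_apply continuous_snd
  have mpi : ∀ {μ : Measure X} {f : ι → X → ℝ}, (∀ i, AEStronglyMeasurable (f i) μ) →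
      AEStronglyMeasurable (fun x => fun i => f i x) μ := fun hf =>
    (aemeasurable_pi_lambda _ fun i => (hf i).aemeasurable).aestronglyMeasurable
  have hfL : MemLp (fun x => H fun i => f i x) 2 (volume.restrict U) := by
    refine MemLp.of_le_mul (g := fun x => ∑ i, |f i x|) (c := C)
      (memLp_finsetSum _ fun i _ => (h i).1.norm)
      (hH.continuous.comp_aestronglyMeasurable (mpi fun i => (h i).1.1))
      (Eventually.of_forall fun x => ?_)
    have := hlip 0 (fun i => f i x)
    rw [h0, sub_zero, sub_zero] at this
    rw [Real.norm_eq_abs, Real.norm_eq_abs,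
      abs_of_nonneg (Finset.sum_nonneg fun i _ => abs_nonneg (f i x))]
    exact this.trans (mul_le_mul_of_nonneg_left (norm_pi_le_sum_abs _) hC0)
  have hgb : ∀ (v u : ι → ℝ), |fderiv ℝ H v u| ≤ C * ∑ i, |u i| := fun v u =>
    ((fderiv ℝ H v).le_of_opNorm_le (hC v) u).trans
      (mul_le_mul_of_nonneg_left (norm_pi_le_sum_abs _) hC0)
  have hgL : MemLp (fun x => fderiv ℝ H (fun i => f i x) fun i => g i x) 2
      (volume.restrict U) := by
    refine MemLp.of_le_mul (g := fun x => ∑ i, |g i x|) (c := C)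
      (memLp_finsetSum _ fun i _ => (h i).2.1.norm)
      (hc2.comp_aestronglyMeasurable ((mpi fun i => (h i).1.1).prodMk (mpi fun i => (h i).2.1.1)))
      (Eventually.of_forall fun x => ?_)
    rw [Real.norm_eq_abs, Real.norm_eq_abs,
      abs_of_nonneg (Finset.sum_nonneg fun i _ => abs_nonneg (g i x))]
    exact hgb _ _
  refine of_approx hU.measurableSet hfL hgL fun η e1 e2 e3 => ?_
  set K := tsupport η
  have hK : IsCompact K := e2
  have hKm := hK.measurableSet
  have : IsFiniteMeasure (volume.restrict K) := ⟨by simpa using hK.measure_lt_top⟩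
  have hms : ∀ n i, ContDiff ℝ ∞ (mollify U (f i) n) := fun n i =>
    mollify_contDiff hU.measurableSet (h i).1 n
  have hFs : ∀ n, ContDiff ℝ 1 fun x => H fun i => mollify U (f i) n x := fun n =>
    hH.comp (contDiff_pi.2 fun i => (hms n i).of_le (by simp))
  have hFd : ∀ n x, fderiv ℝ (fun x => H fun i => mollify U (f i) n x) x w
      = fderiv ℝ H (fun i => mollify U (f i) n x) fun i => fderiv ℝ (mollify U (f i) n) x w := by
    intro n x
    have h1 : HasFDerivAt (fun x => fun i => mollify U (f i) n x)
        (ContinuousLinearMap.pi fun i => fderiv ℝ (mollify U (f i) n) x) x :=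
      hasFDerivAt_pi.2 fun i => ((hms n i).differentiable (by simp) x).hasFDerivAt
    have h2 : HasFDerivAt (H ∘ fun x => fun i => mollify U (f i) n x) _ x :=
      (hdiff _).hasFDerivAt.comp x h1
    change fderiv ℝ (H ∘ fun x => fun i => mollify U (f i) n x) x w = _
    rw [h2.fderiv]; rfl
  have cd : ∀ n i, Continuous fun x => fderiv ℝ (mollify U (f i) n) x w := fun n i =>
    continuous_fderiv_apply_test (hms n i) w
  have cG : ∀ n, Continuous fun x => fderiv ℝ H (fun i => mollify U (f i) n x)
      fun i => fderiv ℝ (mollify U (f i) n) x w := fun n =>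
    hc2.comp ((continuous_pi fun i => (hms n i).continuous).prodMk (continuous_pi fun i => cd n i))
  have mfK : ∀ i, AEStronglyMeasurable (f i) (volume.restrict K) := fun i =>
    (h i).1.1.mono_measure (Measure.restrict_mono e3 le_rfl)
  have gK : ∀ i, MemLp (g i) 2 (volume.restrict K) := fun i =>
    (h i).2.1.mono_measure (Measure.restrict_mono e3 le_rfl)
  refine ⟨_, _, fun n => (hFs n).continuous.continuousOn.integrableOn_compact hK,
    fun n => (cG n).continuousOn.integrableOn_compact hK, ?_, ?_, fun n => ?_⟩
  · refine tendsto_eLpNorm_of_le_sum le_rfl (C := C) (E := fun i n x => mollify U (f i) n x - f i x)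
      (fun i n => (hms n i).continuous.aestronglyMeasurable.sub (mfK i)) (fun n x => ?_) fun i =>
        tendsto_eLpNorm_one_of_two
          (fun n => (hms n i).continuous.aestronglyMeasurable.sub (mfK i))
          (tendsto_mollify_restrict hU hKm e3 (h i).1)
    exact (hlip _ _).trans (mul_le_mul_of_nonneg_left (norm_pi_le_sum_abs _) hC0)
  -- The error of the derivative is `H'(fₙ)(gₙ - g)`, small in `L¹` because `H'` is bounded, plus
  -- `(H'(fₙ) - H'(f)) g`, which tends to zero by dominated convergence since `fₙ → f` almost
  -- everywhere.
  · have t1 : Tendsto (fun n => eLpNorm (fun x => fderiv ℝ H (fun i => mollify U (f i) n x)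
        fun i => fderiv ℝ (mollify U (f i) n) x w - g i x) 1 (volume.restrict K)) atTop (𝓝 0) :=
      tendsto_eLpNorm_of_le_sum le_rfl
        (E := fun i n x => fderiv ℝ (mollify U (f i) n) x w - g i x)
        (fun i n => (cd n i).aestronglyMeasurable.sub (gK i).1) (fun n x => hgb _ _) fun i =>
        tendsto_eLpNorm_one_of_two
          (fun n => (cd n i).aestronglyMeasurable.sub (gK i).1)
          (tendsto_fderiv_mollify hU hK e3 (h i))
    have m2 : ∀ n, AEStronglyMeasurable (fun x => fderiv ℝ H (fun i => mollify U (f i) n x)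
        fun i => g i x) (volume.restrict K) := fun n =>
      hc2.comp_aestronglyMeasurable ((continuous_pi fun i =>
        (hms n i).continuous).aestronglyMeasurable.prodMk (mpi fun i => (gK i).1))
    have m3 : AEStronglyMeasurable (fun x => fderiv ℝ H (fun i => f i x)
        fun i => g i x) (volume.restrict K) :=
      hc2.comp_aestronglyMeasurable ((mpi mfK).prodMk (mpi fun i => (gK i).1))
    have t2 : Tendsto (fun n => eLpNorm (fun x => fderiv ℝ H (fun i => mollify U (f i) n x)
        (fun i => g i x) - fderiv ℝ H (fun i => f i x) fun i => g i x) 1 (volume.restrict K))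
        atTop (𝓝 0) := by
      simp only [eLpNorm_one_eq_lintegral_enorm]
      have := tendsto_lintegral_norm_of_dominated_convergence (μ := volume.restrict K)
        (F := fun n x => fderiv ℝ H (fun i => mollify U (f i) n x) fun i => g i x)
        (f := fun x => fderiv ℝ H (fun i => f i x) fun i => g i x)
        (bound := fun x => C * ∑ i, |g i x|) m2 ?_ ?_ ?_
      · simpa only [ofReal_norm] using this
      · refine HasFiniteIntegral.const_mul ?_ C
        exact (integrable_finsetSum _ fun i _ => ((gK i).integrable (by norm_num)).abs).2
      · exact fun n => Eventually.of_forall fun x => hgb _ _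
      · have : ∀ i, ∀ᵐ x ∂volume.restrict K,
            Tendsto (fun n => mollify U (f i) n x) atTop (𝓝 (f i x)) := fun i =>
          ae_restrict_of_ae_restrict_of_subset e3 (ae_tendsto_mollify hU.measurableSet (h i).1)
        filter_upwards [ae_all_iff.2 this] with x hx
        exact (hc2.tendsto _).comp ((tendsto_pi_nhds.2 hx).prodMk_nhds tendsto_const_nhds)
    refine tendsto_of_tendsto_of_tendsto_of_le_of_le tendsto_const_nhds
      (by simpa using t1.add t2) (fun _ => zero_le) fun n => ?_
    refine le_trans (le_of_eq (congrArg (fun F => eLpNorm F 1 _) ?_)) (eLpNorm_add_le ?_ ?_ le_rfl)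
    · ext x
      simp only [Pi.add_apply]
      have : (fun i => fderiv ℝ (mollify U (f i) n) x w - g i x)
        = (fun i => fderiv ℝ (mollify U (f i) n) x w) - fun i => g i x := rfl
      rw [this, map_sub]; ring
    · refine hc2.comp_aestronglyMeasurable ((continuous_pi fun i =>
        (hms n i).continuous).aestronglyMeasurable.prodMk (mpi fun i => ?_))
      exact (cd n i).aestronglyMeasurable.sub (gK i).1
    · exact (m2 n).sub m3
  · simp only [← hFd]
    exact integral_fderiv_mul_eq_of_test e1 e2 (hFs n) w

/-- One-variable chain rule. -/
theorem comp (hU : IsOpen U) {f g : X → ℝ} (h : L2WeakDeriv U w f g) {H H' : ℝ → ℝ}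
    (hH : ∀ s, HasDerivAt H (H' s) s) (hc : Continuous H') {C : ℝ} (hC : ∀ s, |H' s| ≤ C)
    (h0 : H 0 = 0) : L2WeakDeriv U w (fun x => H (f x)) (fun x => H' (f x) * g x) := by
  have hd : deriv H = H' := funext fun s => (hH s).deriv
  have hHc : ContDiff ℝ 1 H := by
    rw [contDiff_one_iff_deriv]
    exact ⟨fun s => (hH s).differentiableAt, hd ▸ hc⟩
  have hf : ∀ v : Unit → ℝ, HasFDerivAt (fun v : Unit → ℝ => H (v ()))
      (H' (v ()) • ContinuousLinearMap.proj (R := ℝ) (φ := fun _ : Unit => ℝ) ()) v := fun v =>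
    (hH (v ())).comp_hasFDerivAt v
      (ContinuousLinearMap.proj (R := ℝ) (φ := fun _ : Unit => ℝ) ()).hasFDerivAt
  have := chain (ι := Unit) hU (fun _ => h) (H := fun v => H (v ())) (C := C)
    (hHc.comp (contDiff_apply ℝ ℝ ())) (fun v => ?_) h0
  · simp only [(hf _).fderiv] at this
    exact this
  · rw [(hf v).fderiv]
    refine ContinuousLinearMap.opNorm_le_bound _ ((abs_nonneg _).trans (hC 0)) fun u => ?_
    simp only [smul_apply, ContinuousLinearMap.proj_apply, norm_smul,
      Real.norm_eq_abs]
    exact mul_le_mul (hC _) (norm_le_pi_norm u ()) (abs_nonneg _) ((abs_nonneg _).trans (hC 0))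

/-- The square removes the corner at `K`, so that `√(δ² + (s - K)₊²)` is a `C¹` regularization of
the positive part. -/
theorem hasDerivAt_max_sub_sq (K s : ℝ) :
    HasDerivAt (fun s => max (s - K) 0 ^ 2) (2 * max (s - K) 0) s := by
  rcases lt_trichotomy s K with h | h | h
  · rw [max_eq_right (by linarith), mul_zero]
    refine (hasDerivAt_const s (0 : ℝ)).congr_of_eventuallyEq ?_
    filter_upwards [Iio_mem_nhds h] with t ht
    rw [max_eq_right (sub_nonpos.2 (le_of_lt ht))]; simp
  · subst h
    simp only [sub_self, max_self, mul_zero]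
    rw [hasDerivAt_iff_isLittleO]
    simp only [sub_self, max_self, smul_zero, sub_zero, ne_eq, OfNat.ofNat_ne_zero,
      not_false_eq_true, zero_pow]
    have h1 : (fun x : ℝ => max (x - s) 0 ^ 2) =O[𝓝 s] fun x => (x - s) ^ 2 := by
      refine Asymptotics.IsBigO.of_bound 1 (Eventually.of_forall fun x => ?_)
      rw [one_mul, norm_pow, norm_pow]
      gcongr
      rw [Real.norm_eq_abs, abs_of_nonneg (le_max_right _ _)]
      exact max_le (le_abs_self _) (abs_nonneg _)
    refine h1.trans_isLittleO ?_
    simpa using Asymptotics.isLittleO_pow_sub_sub s (m := 2) (by norm_num)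
  · rw [max_eq_left (by linarith)]
    have : HasDerivAt (fun s => (s - K) ^ 2) (2 * (s - K)) s := by
      have h := ((hasDerivAt_id s).sub_const K).fun_pow 2
      simpa using h
    refine this.congr_of_eventuallyEq ?_
    filter_upwards [Ioi_mem_nhds h] with t ht
    rw [max_eq_left (sub_nonneg.2 (le_of_lt ht))]

theorem sqrt_add_sq_sub_le {δ t : ℝ} (hδ : 0 ≤ δ) (ht : 0 ≤ t) :
    0 ≤ √(δ ^ 2 + t) - δ ∧ √(δ ^ 2 + t) - δ ≤ √t := by
  constructor
  · rw [sub_nonneg]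
    exact Real.le_sqrt_of_sq_le (by linarith)
  · rw [sub_le_iff_le_add, Real.sqrt_le_left (by positivity)]
    nlinarith [Real.sq_sqrt ht, Real.sqrt_nonneg t]

theorem tendsto_inv_nat_zero : Tendsto (fun n : ℕ => 1 / ((n : ℝ) + 1)) atTop (𝓝 0) :=
  tendsto_one_div_add_atTop_nhds_zero_nat

/-- The part of a function above a nonnegative level. -/
theorem posPart_sub (hU : IsOpen U) {f g : X → ℝ} (h : L2WeakDeriv U w f g) {K : ℝ} (hK : 0 ≤ K) :
    L2WeakDeriv U w (fun x => max (f x - K) 0) (fun x => if K < f x then g x else 0) := by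
  set δ : ℕ → ℝ := fun n => 1 / ((n : ℝ) + 1)
  have hδ : ∀ n, 0 < δ n := fun n => by positivity
  have hpos : ∀ n (s : ℝ), 0 < δ n ^ 2 + max (s - K) 0 ^ 2 := fun n s => by
    have := hδ n; positivity
  have hq : ∀ n (s : ℝ), |max (s - K) 0 / √(δ n ^ 2 + max (s - K) 0 ^ 2)| ≤ 1 := fun n s => by
    rw [abs_div, abs_of_nonneg (Real.sqrt_nonneg _), div_le_one (Real.sqrt_pos.2 (hpos n s))]
    refine Real.le_sqrt_of_sq_le ?_
    rw [sq_abs]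
    nlinarith [sq_nonneg (δ n)]
  -- As `δ → 0`, `√(δ² + (f - K)₊²) - δ` tends to `(f - K)₊`, with derivative factors bounded by
  -- one. The condition `K ≥ 0` makes the regularization vanish where `f = 0`, as the chain rule
  -- demands on a set of infinite measure. On `{f = K}` the factors vanish, in agreement with the
  -- strict inequality in the statement.
  refine of_dominated (b := fun x => |f x|) (c := fun x => |g x|)
    (F := fun n x => √(δ n ^ 2 + max (f x - K) 0 ^ 2) - δ n)
    (G := fun n x => max (f x - K) 0 / √(δ n ^ 2 + max (f x - K) 0 ^ 2) * g x)
    (fun n => ?_) h.1.norm h.2.1.norm ?_ ?_ ?_ ?_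
  · refine h.comp hU (H := fun s => √(δ n ^ 2 + max (s - K) 0 ^ 2) - δ n)
      (H' := fun s => max (s - K) 0 / √(δ n ^ 2 + max (s - K) 0 ^ 2)) (C := 1) (fun s => ?_) ?_
      (hq n) ?_
    · have := (((hasDerivAt_max_sub_sq K s).const_add (δ n ^ 2)).sqrt (hpos n s).ne').sub_const (δ n)
      rwa [mul_div_mul_left _ _ two_ne_zero] at this
    · refine Continuous.div (by fun_prop) (by fun_prop) fun s => (Real.sqrt_pos.2 (hpos n s)).ne'
    · simp only [zero_sub, max_eq_right (neg_nonpos.2 hK)]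
      simp [Real.sqrt_sq (hδ n).le]
  · refine fun n => Eventually.of_forall fun x => ?_
    have h1 := sqrt_add_sq_sub_le (hδ n).le (sq_nonneg (max (f x - K) 0))
    rw [abs_of_nonneg h1.1]
    refine h1.2.trans ?_
    rw [Real.sqrt_sq (le_max_right _ _)]
    exact max_le ((sub_le_self _ hK).trans (le_abs_self _)) (abs_nonneg _)
  · refine fun n => Eventually.of_forall fun x => ?_
    rw [abs_mul]
    exact mul_le_of_le_one_left (abs_nonneg _) (hq n _)
  · refine Eventually.of_forall fun x => ?_
    have : Tendsto (fun n => √(δ n ^ 2 + max (f x - K) 0 ^ 2) - δ n) atTop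
        (𝓝 (√(0 ^ 2 + max (f x - K) 0 ^ 2) - 0)) :=
      (((tendsto_inv_nat_zero.pow 2).add_const _).sqrt).sub tendsto_inv_nat_zero
    simpa [Real.sqrt_sq (le_max_right (f x - K) 0)] using this
  · refine Eventually.of_forall fun x => ?_
    by_cases hx : K < f x
    · rw [if_pos hx]
      have h1 : 0 < max (f x - K) 0 := lt_max_of_lt_left (by linarith)
      have h2 : Tendsto (fun n => √(δ n ^ 2 + max (f x - K) 0 ^ 2)) atTop
        (𝓝 (√(0 ^ 2 + max (f x - K) 0 ^ 2))) := ((tendsto_inv_nat_zero.pow 2).add_const _).sqrt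
      have h3 := ((tendsto_const_nhds (x := max (f x - K) 0)).div h2 (by
        simp only [ne_eq, OfNat.ofNat_ne_zero, not_false_eq_true, zero_pow, zero_add]
        rw [Real.sqrt_sq h1.le]; exact h1.ne')).mul_const (g x)
      simpa [Real.sqrt_sq h1.le, div_self h1.ne'] using h3
    · rw [if_neg hx, max_eq_right (by linarith)]
      simp

/-- The function `√(∑ᵢ fᵢ²)` and its weak derivative. -/
theorem sqrt_sum_sq {ι : Type*} [Fintype ι] (hU : IsOpen U) {f g : ι → X → ℝ}
    (h : ∀ i, L2WeakDeriv U w (f i) (g i)) :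
    L2WeakDeriv U w (fun x => √(∑ i, f i x ^ 2))
      (fun x => (∑ i, f i x * g i x) / √(∑ i, f i x ^ 2)) := by
  set δ : ℕ → ℝ := fun n => 1 / ((n : ℝ) + 1)
  have hδ : ∀ n, 0 < δ n := fun n => by positivity
  have hs0 : ∀ v : ι → ℝ, 0 ≤ ∑ i, v i ^ 2 := fun v => Finset.sum_nonneg fun i _ => sq_nonneg _
  have hpos : ∀ n (v : ι → ℝ), 0 < δ n ^ 2 + ∑ i, v i ^ 2 := fun n v => by
    have := hδ n; have := hs0 v; positivity
  have hcs : ∀ (t : ℝ) (u v : ι → ℝ), 0 ≤ t → |(∑ i, v i * u i) / √(t + ∑ i, v i ^ 2)|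
      ≤ √(∑ i, u i ^ 2) := fun t u v ht => by
    rw [abs_div, abs_of_nonneg (Real.sqrt_nonneg _)]
    refine div_le_of_le_mul₀ (Real.sqrt_nonneg _) (Real.sqrt_nonneg _) ?_
    rw [← Real.sqrt_mul (hs0 u), ← Real.sqrt_sq_eq_abs]
    refine Real.sqrt_le_sqrt ((Finset.sum_mul_sq_le_sq_mul_sq _ _ _).trans ?_)
    rw [mul_comm]
    exact mul_le_mul_of_nonneg_left (by linarith) (hs0 u)
  have hsl : ∀ v : ι → ℝ, √(∑ i, v i ^ 2) ≤ ∑ i, |v i| := fun v => by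
    rw [Real.sqrt_le_left (Finset.sum_nonneg fun _ _ => abs_nonneg _)]
    simpa using Finset.sum_sq_le_sq_sum_of_nonneg (s := Finset.univ) (f := fun i => |v i|)
      fun i _ => abs_nonneg _
  have hHd : ∀ n (v : ι → ℝ), HasFDerivAt (fun v : ι → ℝ => √(δ n ^ 2 + ∑ i, v i ^ 2) - δ n)
      ((1 / (2 * √(δ n ^ 2 + ∑ i, v i ^ 2))) • ∑ i, (2 * v i) •
        ContinuousLinearMap.proj (R := ℝ) (φ := fun _ : ι => ℝ) i) v := fun n v => by
    refine HasFDerivAt.sub_const _ (HasFDerivAt.sqrt (HasFDerivAt.const_add _ ?_) (hpos n v).ne')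
    refine HasFDerivAt.fun_sum fun i _ => ?_
    simpa using ((ContinuousLinearMap.proj (R := ℝ) (φ := fun _ : ι => ℝ) i).hasFDerivAt
      (x := v)).pow 2
  have hHa : ∀ n (v u : ι → ℝ), fderiv ℝ (fun v : ι → ℝ => √(δ n ^ 2 + ∑ i, v i ^ 2) - δ n) v u
      = (∑ i, v i * u i) / √(δ n ^ 2 + ∑ i, v i ^ 2) := fun n v u => by
    rw [(hHd n v).fderiv]
    simp only [smul_apply, sum_apply,
      ContinuousLinearMap.proj_apply, smul_eq_mul, mul_assoc, ← Finset.mul_sum]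
    have := (Real.sqrt_pos.2 (hpos n v)).ne'
    field_simp
  have hch : ∀ n, L2WeakDeriv U w (fun x => √(δ n ^ 2 + ∑ i, f i x ^ 2) - δ n)
      (fun x => (∑ i, f i x * g i x) / √(δ n ^ 2 + ∑ i, f i x ^ 2)) := fun n => by
    have := chain hU h (H := fun v : ι → ℝ => √(δ n ^ 2 + ∑ i, v i ^ 2) - δ n)
      (C := Fintype.card ι) ?_ (fun v => ?_) (by simp [Real.sqrt_sq (hδ n).le])
    · simpa only [hHa] using this
    · exact (ContDiff.sqrt (by fun_prop) fun v => (hpos n v).ne').sub contDiff_const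
    · refine ContinuousLinearMap.opNorm_le_bound _ (by positivity) fun u => ?_
      rw [hHa]
      refine (hcs _ u v (sq_nonneg _)).trans ((hsl u).trans ?_)
      refine (Finset.sum_le_card_nsmul _ _ ‖u‖ fun i _ => norm_le_pi_norm u i).trans ?_
      simp
  have sumL : ∀ {f : ι → X → ℝ}, (∀ i, MemLp (f i) 2 (volume.restrict U)) →
      MemLp (fun x => ∑ i, |f i x|) 2 (volume.restrict U) := fun hf =>
    memLp_finsetSum _ fun i _ => (hf i).norm
  refine of_dominated hch (sumL fun i => (h i).1) (sumL fun i => (h i).2.1) ?_ ?_ ?_ ?_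
  · refine fun n => Eventually.of_forall fun x => ?_
    have h1 := sqrt_add_sq_sub_le (hδ n).le (hs0 fun i => f i x)
    rw [abs_of_nonneg h1.1]
    exact h1.2.trans (hsl _)
  · exact fun n => Eventually.of_forall fun x => (hcs _ _ _ (sq_nonneg _)).trans (hsl _)
  · refine Eventually.of_forall fun x => ?_
    have : Tendsto (fun n => √(δ n ^ 2 + ∑ i, f i x ^ 2) - δ n) atTop
        (𝓝 (√(0 ^ 2 + ∑ i, f i x ^ 2) - 0)) :=
      (((tendsto_inv_nat_zero.pow 2).add_const _).sqrt).sub tendsto_inv_nat_zero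
    simpa using this
  · refine Eventually.of_forall fun x => ?_
    by_cases hx : ∑ i, f i x ^ 2 = 0
    -- Where all `f i` vanish the regularized derivatives are zero, which is also the value of `0 /
    -- 0` in the claimed derivative.
    · have : ∀ i, f i x = 0 := fun i => by
        have := (Finset.sum_eq_zero_iff_of_nonneg (fun i _ => sq_nonneg (f i x))).1 hx i
          (Finset.mem_univ i)
        simpa using this
      simp [this]
    · have h2 : Tendsto (fun n => √(δ n ^ 2 + ∑ i, f i x ^ 2)) atTop
        (𝓝 (√(0 ^ 2 + ∑ i, f i x ^ 2))) := ((tendsto_inv_nat_zero.pow 2).add_const _).sqrt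
      rw [zero_pow two_ne_zero, zero_add] at h2
      refine tendsto_const_nhds.div h2 ?_
      exact (Real.sqrt_pos.2 ((hs0 _).lt_of_ne' hx)).ne'

/-- By Cauchy-Schwarz, `√(∑ fᵢ²)` has at most the total kinetic energy of the `fᵢ`. For real and
imaginary parts this is the diamagnetic inequality; for permuted copies of one function it is what
makes symmetrization harmless. -/
theorem sq_div_sqrt_sum_le {ι : Type*} [Fintype ι] (u v : ι → ℝ) :
    ((∑ i, v i * u i) / √(∑ i, v i ^ 2)) ^ 2 ≤ ∑ i, u i ^ 2 := by
  have h0 : ∀ v : ι → ℝ, 0 ≤ ∑ i, v i ^ 2 := fun v => Finset.sum_nonneg fun i _ => sq_nonneg _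
  rw [div_pow, Real.sq_sqrt (h0 v)]
  refine div_le_of_le_mul₀ (h0 v) (h0 u) ?_
  rw [mul_comm]
  exact Finset.sum_mul_sq_le_sq_mul_sq _ _ _

end L2WeakDeriv
end L2WeakDeriv

/-! ### Products with Lipschitz multipliers. -/

section L2WeakDeriv

variable {X : Type*} [NormedAddCommGroup X] [NormedSpace ℝ X] [MeasureSpace X]
variable [FiniteDimensional ℝ X] [BorelSpace X] [(volume : Measure X).IsAddHaarMeasure]

theorem tendsto_eLpNorm_mul_left {μ : Measure X} {F : X → ℝ} {B : ℝ}
    (hB : ∀ x, |F x| ≤ B) {D : ℕ → X → ℝ}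
    (h : Tendsto (fun n => eLpNorm (D n) 1 μ) atTop (𝓝 0)) :
    Tendsto (fun n => eLpNorm (fun x => F x * D n x) 1 μ) atTop (𝓝 0) := by
  have h0 : Tendsto (fun n => ENNReal.ofReal B * eLpNorm (D n) 1 μ) atTop (𝓝 0) := by
    simpa using ENNReal.Tendsto.const_mul h (Or.inr ENNReal.ofReal_ne_top)
  refine tendsto_of_tendsto_of_tendsto_of_le_of_le tendsto_const_nhds h0 (fun _ => zero_le)
    fun n => ?_
  refine eLpNorm_le_mul_eLpNorm_of_ae_le_mul (Eventually.of_forall fun x => ?_) 1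
  rw [norm_mul]
  exact mul_le_mul_of_nonneg_right (hB x) (norm_nonneg _)

theorem abs_lineDeriv_le_of_lipschitz {F : X → ℝ} {L : ℝ≥0} (hF : LipschitzWith L F) (w x : X) :
    |lineDeriv ℝ F x w| ≤ L * ‖w‖ := by
  have := norm_lineDeriv_le_of_lipschitz ℝ hF (x₀ := x) (v := w)
  exact this

theorem memLp_two_mul_of_bounded {μ : Measure X} {F f : X → ℝ} {B : ℝ}
    (hF : AEStronglyMeasurable F μ) (hB : ∀ x, |F x| ≤ B) (hf : MemLp f 2 μ) :
    MemLp (fun x => F x * f x) 2 μ :=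
  hf.of_le_mul (c := B) (hF.mul hf.1) (Eventually.of_forall fun x => by
    rw [norm_mul]; exact mul_le_mul_of_nonneg_right (hB x) (norm_nonneg _))

/-- Integration by parts between two Lipschitz functions, `F` and the compactly supported `η φ`; the
product rule is applied only to the smooth pair. -/
theorem integral_fderiv_mul_lipschitz {η φ F : X → ℝ} (hη : ContDiff ℝ ∞ η)
    (hc : HasCompactSupport η) (hφ : ContDiff ℝ 1 φ) {L : ℝ≥0} (hF : LipschitzWith L F) (w : X) :
    ∫ x, fderiv ℝ η x w * (F x * φ x)
      = - ∫ x, η x * (F x * fderiv ℝ φ x w + lineDeriv ℝ F x w * φ x) := by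
  have hp : ContDiff ℝ 1 fun x => η x * φ x := (hη.of_le (by simp)).mul hφ
  have hpc : HasCompactSupport fun x => η x * φ x := hc.mul_right
  obtain ⟨D, hD⟩ := hp.lipschitzWith_of_hasCompactSupport hpc one_ne_zero
  have key := LipschitzWith.integral_lineDeriv_mul_eq (μ := (volume : Measure X)) hF hD hpc w
  have hfd : ∀ x, lineDeriv ℝ (fun x => η x * φ x) x (-w)
      = - (fderiv ℝ η x w * φ x + η x * fderiv ℝ φ x w) := by
    intro x
    have h1 := hη.differentiable (by simp) x
    have h2 := hφ.differentiable one_ne_zero x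
    rw [(hp.differentiable one_ne_zero x).lineDeriv_eq_fderiv, fderiv_fun_mul h1 h2]
    simp only [add_apply, smul_apply, map_neg, smul_eq_mul]
    ring
  simp only [hfd] at key
  have cη := continuous_fderiv_apply_test hη w
  have cφ : Continuous fun x => fderiv ℝ φ x w :=
    (hφ.continuous_fderiv one_ne_zero).clm_apply continuous_const
  have i1 : Integrable (fun x => fderiv ℝ η x w * (F x * φ x)) (volume : Measure X) :=
    (cη.mul (hF.continuous.mul hφ.continuous)).integrable_of_hasCompactSupport
      ((hc.fderiv_apply ℝ w).mul_right)
  have i2 : Integrable (fun x => η x * (F x * fderiv ℝ φ x w)) (volume : Measure X) :=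
    (hη.continuous.mul (hF.continuous.mul cφ)).integrable_of_hasCompactSupport hc.mul_right
  have i3 : Integrable (fun x => lineDeriv ℝ F x w * (η x * φ x)) (volume : Measure X) :=
    ((hη.continuous.mul hφ.continuous).integrable_of_hasCompactSupport hpc).bdd_mul
      (hF.memLp_lineDeriv w).1 (Eventually.of_forall (abs_lineDeriv_le_of_lipschitz hF w))
  have e1 : ∫ x, η x * (F x * fderiv ℝ φ x w + lineDeriv ℝ F x w * φ x)
      = (∫ x, η x * (F x * fderiv ℝ φ x w)) + ∫ x, lineDeriv ℝ F x w * (η x * φ x) := by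
    rw [← integral_add i2 i3]
    exact integral_congr_ae (Eventually.of_forall fun x => by ring)
  have e2 : ∫ x, -(fderiv ℝ η x w * φ x + η x * fderiv ℝ φ x w) * F x
      = -(∫ x, fderiv ℝ η x w * (F x * φ x)) - ∫ x, η x * (F x * fderiv ℝ φ x w) := by
    rw [← integral_neg, ← integral_sub (f := fun x => -(fderiv ℝ η x w * (F x * φ x))) i1.neg i2]
    exact integral_congr_ae (Eventually.of_forall fun x => by ring)
  rw [e1, key, e2]
  ring

namespace L2WeakDeriv

variable {U : Set X} {w : X}

/-- Product rule for a bounded Lipschitz multiplier. -/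
theorem lipschitz_mul (hU : IsOpen U) {f g F : X → ℝ} (h : L2WeakDeriv U w f g) {L : ℝ≥0}
    (hF : LipschitzWith L F) {B : ℝ} (hB : ∀ x, |F x| ≤ B) :
    L2WeakDeriv U w (fun x => F x * f x) (fun x => F x * g x + lineDeriv ℝ F x w * f x) := by
  have hFm : ∀ {μ : Measure X}, AEStronglyMeasurable F μ := hF.continuous.aestronglyMeasurable
  have hLm : ∀ {μ : Measure X}, AEStronglyMeasurable (fun x => lineDeriv ℝ F x w) μ :=
    fun {μ} => (hF.memLp_lineDeriv (μ := μ) w).1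
  have hLb := abs_lineDeriv_le_of_lipschitz hF w
  refine of_approx hU.measurableSet (memLp_two_mul_of_bounded hFm hB h.1)
    ((memLp_two_mul_of_bounded hFm hB h.2.1).add (memLp_two_mul_of_bounded hLm hLb h.1))
    fun η e1 e2 e3 => ?_
  set K := tsupport η
  have hK : IsCompact K := e2
  have hKm := hK.measurableSet
  have : IsFiniteMeasure (volume.restrict K) := ⟨by simpa using hK.measure_lt_top⟩
  have hms : ∀ n, ContDiff ℝ ∞ (mollify U f n) := fun n => mollify_contDiff hU.measurableSet h.1 n
  have cd : ∀ n, Continuous fun x => fderiv ℝ (mollify U f n) x w := fun n =>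
    continuous_fderiv_apply_test (hms n) w
  have fK : MemLp f 2 (volume.restrict K) := h.1.mono_measure (Measure.restrict_mono e3 le_rfl)
  have gK : MemLp g 2 (volume.restrict K) := h.2.1.mono_measure (Measure.restrict_mono e3 le_rfl)
  have t1 := tendsto_eLpNorm_one_of_two
    (fun n => (hms n).continuous.aestronglyMeasurable.sub fK.1)
    (tendsto_mollify_restrict hU hKm e3 h.1)
  have t2 := tendsto_eLpNorm_one_of_two
    (fun n => (cd n).aestronglyMeasurable.sub gK.1) (tendsto_fderiv_mollify hU hK e3 h)
  refine ⟨fun n x => F x * mollify U f n x,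
    fun n x => F x * fderiv ℝ (mollify U f n) x w + lineDeriv ℝ F x w * mollify U f n x,
    fun n => (hF.continuous.mul (hms n).continuous).continuousOn.integrableOn_compact hK,
    fun n => ?_, ?_, ?_, fun n => ?_⟩
  · refine ((hF.continuous.mul (cd n)).continuousOn.integrableOn_compact hK).add ?_
    exact ((hms n).continuous.continuousOn.integrableOn_compact hK).bdd_mul hLm
      (Eventually.of_forall hLb)
  · simpa only [Pi.sub_apply, mul_sub] using tendsto_eLpNorm_mul_left hB t1
  · have s1 := tendsto_eLpNorm_mul_left hB t2
    have s2 := tendsto_eLpNorm_mul_left hLb t1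
    refine tendsto_of_tendsto_of_tendsto_of_le_of_le tendsto_const_nhds
      (by simpa using s1.add s2) (fun _ => zero_le) fun n => ?_
    refine le_trans (le_of_eq (congrArg (fun F => eLpNorm F 1 _) ?_)) (eLpNorm_add_le
      (hFm.mul ((cd n).aestronglyMeasurable.sub gK.1))
      (hLm.mul ((hms n).continuous.aestronglyMeasurable.sub fK.1)) le_rfl)
    ext x
    simp only [Pi.add_apply]
    ring
  · exact integral_fderiv_mul_lipschitz e1 e2 ((hms n).of_le (by simp)) hF w

theorem of_lipschitz_hasCompactSupport (hU : MeasurableSet U) {F : X → ℝ} {L : ℝ≥0}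
    (hF : LipschitzWith L F) (hc : HasCompactSupport F) :
    L2WeakDeriv U w F (fun x => lineDeriv ℝ F x w) := by
  have hL2 : MemLp (fun x => lineDeriv ℝ F x w) 2 (volume : Measure X) := by
    have h0 : (fun x => lineDeriv ℝ F x w) = (tsupport F).indicator fun x => lineDeriv ℝ F x w := by
      ext x
      by_cases hx : x ∈ tsupport F
      · rw [indicator_of_mem hx]
      · rw [indicator_of_notMem hx]
        have h1 : F =ᶠ[𝓝 x] fun _ => 0 := notMem_tsupport_iff_eventuallyEq.1 hx
        rw [h1.lineDeriv_eq]
        simp [lineDeriv]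
    have hK : IsCompact (tsupport F) := hc
    have : IsFiniteMeasure ((volume : Measure X).restrict (tsupport F)) :=
      ⟨by simpa using hK.measure_lt_top⟩
    rw [h0, memLp_indicator_iff_restrict hK.measurableSet]
    exact MemLp.of_bound (hF.memLp_lineDeriv w).1 _
      (Eventually.of_forall (abs_lineDeriv_le_of_lipschitz hF w))
  refine ⟨hF.continuous.memLp_of_hasCompactSupport hc, hL2.mono_measure Measure.restrict_le_self,
    fun η e1 e2 e3 => ?_⟩
  have key := integral_fderiv_mul_lipschitz e1 e2 (φ := fun _ => (1 : ℝ)) contDiff_const hF w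
  simp only [mul_one, fderiv_fun_const, Pi.zero_apply, zero_apply, mul_zero, zero_add] at key
  have s1 : ∀ x ∉ tsupport η, fderiv ℝ η x w * F x = 0 := fun x hx => by
    rw [fderiv_eq_zero_of_notMem_tsupport' hx]; simp
  have s2 : ∀ x ∉ tsupport η, η x * lineDeriv ℝ F x w = 0 := fun x hx => by
    rw [image_eq_zero_of_notMem_tsupport hx, zero_mul]
  rw [setIntegral_eq_of_support e3 hU s1, setIntegral_eq_of_support e3 hU s2]
  rwa [← setIntegral_eq_integral_of_forall_compl_eq_zero s1,
    ← setIntegral_eq_integral_of_forall_compl_eq_zero s2] at key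

end L2WeakDeriv
end L2WeakDeriv

/-! ### The Poincaré inequality on convex sets. -/

theorem enorm_sq_eq_ofReal (a : ℝ) : ‖a‖ₑ ^ 2 = ENNReal.ofReal (a ^ 2) := by
  rw [Real.enorm_eq_ofReal_abs, ← ENNReal.ofReal_pow (abs_nonneg _), sq_abs]

/-- The standard unit vectors of `ℝ³`. -/
noncomputable abbrev unitVec (k : Fin 3) : Space3 := EuclideanSpace.single k (1 : ℝ)

theorem fderiv_apply_sq_le {f : Space3 → ℝ} (z v : Space3) :
    (fderiv ℝ f z v) ^ 2 ≤ ‖v‖ ^ 2 * ∑ k, (fderiv ℝ f z (unitVec k)) ^ 2 := by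
  have hv : v = ∑ k, v k • unitVec k := by
    conv_lhs => rw [← (EuclideanSpace.basisFun (Fin 3) ℝ).sum_repr v]
    simp
  have h1 : fderiv ℝ f z v = ∑ k, v k * fderiv ℝ f z (unitVec k) := by
    conv_lhs => rw [hv]
    simp [map_sum]
  rw [h1, EuclideanSpace.real_norm_sq_eq]
  exact Finset.sum_mul_sq_le_sq_mul_sq _ _ _

theorem lintegral_comp_smul_add {h : Space3 → ℝ≥0∞} (hm : Measurable h) {t : ℝ} (ht : 1 / 2 ≤ t)
    (c : Space3) : ∫⁻ x, h (t • x + c) ≤ 8 * ∫⁻ x, h x := by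
  have h1 : ∫⁻ x, h (t • x + c) = ENNReal.ofReal |(t ^ 3)⁻¹| * ∫⁻ x, h x := by
    have hmap := Measure.map_addHaar_smul (volume : Measure Space3) (r := t) (by linarith)
    rw [← lintegral_map (f := fun x => h (x + c)) (hm.comp (measurable_add_const c))
      (measurable_const_smul t), hmap, lintegral_smul_measure, lintegral_add_right_eq_self]
    simp
  rw [h1]
  gcongr
  have : |(t ^ 3)⁻¹| ≤ 8 := by
    rw [abs_of_nonneg (by positivity)]
    have : (1 / 2 : ℝ) ^ 3 ≤ t ^ 3 := by gcongr
    calc (t ^ 3)⁻¹ ≤ ((1 / 2 : ℝ) ^ 3)⁻¹ := by gcongr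
      _ = 8 := by norm_num
  exact (ENNReal.ofReal_le_ofReal this).trans (by simp)

/-- The point `t x + (1 - t) y` stays in `Q` by convexity. As a function of `x` it has Jacobian
`t³`, as a function of `y` it has `(1 - t)³`. One of `t`, `1 - t` is at least `1/2`; integrating
first over the corresponding variable costs at most `2³ = 8`. -/
theorem lintegral_prod_comp_segment_le {Q : Set Space3} (hQ : Convex ℝ Q) (hQm : MeasurableSet Q)
    {h : Space3 → ℝ≥0∞} (hm : Measurable h) {t : ℝ} (ht : t ∈ Icc (0 : ℝ) 1) :
    ∫⁻ p in Q ×ˢ Q, h (p.2 + t • (p.1 - p.2)) ≤ 8 * volume Q * ∫⁻ x in Q, h x := by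
  set H := Q.indicator h
  have hHm : Measurable H := hm.indicator hQm
  have hseg : ∀ x ∈ Q, ∀ y ∈ Q, h (y + t • (x - y)) = H (t • x + (1 - t) • y) := by
    intro x hx y hy
    have e : y + t • (x - y) = t • x + (1 - t) • y := by module
    have hmem : t • x + (1 - t) • y ∈ Q :=
      hQ hx hy ht.1 (by linarith [ht.2]) (by ring)
    rw [e]
    exact (indicator_of_mem hmem h).symm
  have hI : ∫⁻ x, H x = ∫⁻ x in Q, h x := lintegral_indicator hQm _
  have hmp : Measurable fun p : Space3 × Space3 => H (t • p.1 + (1 - t) • p.2) :=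
    hHm.comp (by fun_prop)
  have h0 : ∫⁻ p in Q ×ˢ Q, h (p.2 + t • (p.1 - p.2))
      = ∫⁻ p in Q ×ˢ Q, H (t • p.1 + (1 - t) • p.2) :=
    setLIntegral_congr_fun (hQm.prod hQm) fun p hp => hseg _ hp.1 _ hp.2
  rw [h0, Measure.volume_eq_prod, ← Measure.prod_restrict]
  rcases le_total (1 / 2) t with h2 | h2
  · rw [lintegral_prod_symm' _ hmp]
    calc ∫⁻ y in Q, ∫⁻ x in Q, H (t • x + (1 - t) • y)
        ≤ ∫⁻ y in Q, 8 * ∫⁻ x in Q, h x := by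
          refine lintegral_mono fun y => (setLIntegral_le_lintegral _ _).trans ?_
          rw [← hI]
          exact lintegral_comp_smul_add hHm h2 _
      _ = _ := by rw [setLIntegral_const]; ring
  · rw [lintegral_prod _ hmp.aemeasurable]
    calc ∫⁻ x in Q, ∫⁻ y in Q, H (t • x + (1 - t) • y)
        ≤ ∫⁻ x in Q, 8 * ∫⁻ y in Q, h y := by
          refine lintegral_mono fun x => (setLIntegral_le_lintegral _ _).trans ?_
          rw [← hI]
          simp only [add_comm (t • x)]
          exact lintegral_comp_smul_add hHm (by linarith) _
      _ = _ := by rw [setLIntegral_const]; ring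

theorem enorm_sub_sq_le_segment {f : Space3 → ℝ} (hf : ContDiff ℝ 1 f) (x y : Space3) {d : ℝ}
    (hd : ‖x - y‖ ≤ d) :
    ‖f x - f y‖ₑ ^ 2 ≤ ENNReal.ofReal (d ^ 2) * ∫⁻ t in Icc (0 : ℝ) 1,
      ∑ k, ‖fderiv ℝ f (y + t • (x - y)) (unitVec k)‖ₑ ^ 2 := by
  have hd0 : 0 ≤ d := (norm_nonneg _).trans hd
  have hc : Continuous fun t : ℝ => fderiv ℝ f (y + t • (x - y)) (x - y) :=
    ((hf.continuous_fderiv one_ne_zero).comp (by fun_prop)).clm_apply continuous_const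
  have hFTC : f x - f y = ∫ t in (0 : ℝ)..1, fderiv ℝ f (y + t • (x - y)) (x - y) := by
    rw [intervalIntegral.integral_eq_sub_of_hasDerivAt
      (f := fun t : ℝ => f (y + t • (x - y))) ?_ (hc.intervalIntegrable _ _)]
    · simp
    · intro t _
      have h1 : HasDerivAt (fun t : ℝ => y + t • (x - y)) (x - y) t := by
        simpa using ((hasDerivAt_id t).smul_const (x - y)).const_add y
      exact ((hf.differentiable one_ne_zero _).hasFDerivAt).comp_hasDerivAt t h1
  have hcs := sq_lintegral_weight_mul_le (volume.restrict (Icc (0 : ℝ) 1)) (ρ := fun _ => 1)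
    (h := fun t => ‖fderiv ℝ f (y + t • (x - y)) (x - y)‖ₑ) aemeasurable_const
    hc.measurable.enorm.aemeasurable (by simp)
  simp only [one_mul] at hcs
  rw [hFTC, intervalIntegral.integral_of_le zero_le_one, ← integral_Icc_eq_integral_Ioc]
  calc _ ≤ (∫⁻ t in Icc (0 : ℝ) 1, ‖fderiv ℝ f (y + t • (x - y)) (x - y)‖ₑ) ^ 2 := by
        gcongr
        exact enorm_integral_le_lintegral_enorm _
    _ ≤ _ := hcs
    _ ≤ _ := by
      rw [← lintegral_const_mul' _ _ ENNReal.ofReal_ne_top]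
      refine lintegral_mono fun t => ?_
      simp only [enorm_sq_eq_ofReal]
      rw [← ENNReal.ofReal_sum_of_nonneg (fun i _ => sq_nonneg _),
        ← ENNReal.ofReal_mul (sq_nonneg _)]
      refine ENNReal.ofReal_le_ofReal ((fderiv_apply_sq_le _ _).trans ?_)
      gcongr

/-- The difference is written as an integral along the segment and the order of integration is
exchanged. The double integral is kept, rather than the deviation from the mean, because both the
Faber-Krahn inequality and the approximation by step functions use it directly. -/
theorem poincare_of_contDiff {Q : Set Space3} (hQ : Convex ℝ Q) (hQm : MeasurableSet Q) {d : ℝ}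
    (hd : ∀ x ∈ Q, ∀ y ∈ Q, ‖x - y‖ ≤ d) {f : Space3 → ℝ} (hf : ContDiff ℝ 1 f) :
    ∫⁻ p in Q ×ˢ Q, ‖f p.1 - f p.2‖ₑ ^ 2 ≤ 8 * ENNReal.ofReal (d ^ 2) * volume Q *
      ∫⁻ x in Q, ∑ k, ‖fderiv ℝ f x (unitVec k)‖ₑ ^ 2 := by
  set G : Space3 → ℝ≥0∞ := fun z => ∑ k, ‖fderiv ℝ f z (unitVec k)‖ₑ ^ 2
  have hG : Measurable G := by
    refine Finset.measurable_sum _ fun k _ => ?_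
    exact ((hf.continuous_fderiv one_ne_zero).clm_apply continuous_const).measurable.enorm.pow_const 2
  have hmj : Measurable fun q : (Space3 × Space3) × ℝ => G (q.1.2 + q.2 • (q.1.1 - q.1.2)) :=
    hG.comp (by fun_prop)
  calc ∫⁻ p in Q ×ˢ Q, ‖f p.1 - f p.2‖ₑ ^ 2
      ≤ ∫⁻ p in Q ×ˢ Q, ENNReal.ofReal (d ^ 2) *
          ∫⁻ t in Icc (0 : ℝ) 1, G (p.2 + t • (p.1 - p.2)) :=
        setLIntegral_mono' (hQm.prod hQm) fun p hp =>
          enorm_sub_sq_le_segment hf p.1 p.2 (hd _ hp.1 _ hp.2)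
    _ = ENNReal.ofReal (d ^ 2) *
          ∫⁻ t in Icc (0 : ℝ) 1, ∫⁻ p in Q ×ˢ Q, G (p.2 + t • (p.1 - p.2)) := by
        rw [lintegral_const_mul' _ _ ENNReal.ofReal_ne_top]
        congr 1
        exact lintegral_lintegral_swap hmj.aemeasurable
    _ ≤ ENNReal.ofReal (d ^ 2) * ∫⁻ t in Icc (0 : ℝ) 1, 8 * volume Q * ∫⁻ x in Q, G x := by
        refine mul_le_mul' le_rfl ?_
        exact setLIntegral_mono' measurableSet_Icc fun t ht =>
          lintegral_prod_comp_segment_le hQ hQm hG ht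
    _ = _ := by
        rw [setLIntegral_const]
        simp only [Real.volume_Icc, sub_zero, ENNReal.ofReal_one, mul_one]
        ring

/-- Interior points of `Q` at distance more than `1/(n+1)` from the complement. -/
def innerSet (Q : Set Space3) (n : ℕ) : Set Space3 := (Metric.cthickening (1 / (n + 1 : ℝ)) Qᶜ)ᶜ

theorem mem_innerSet {Q : Set Space3} (hQ : IsOpen Q) {n : ℕ} {x : Space3} :
    x ∈ innerSet Q n ↔ Metric.closedBall x (1 / (n + 1 : ℝ)) ⊆ Q := by
  rw [innerSet, hQ.isClosed_compl.cthickening_eq_biUnion_closedBall (by positivity)]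
  simp only [mem_compl_iff, mem_iUnion, Metric.mem_closedBall, not_exists, not_le, subset_def]
  refine ⟨fun h z hz => ?_, fun h z hz => ?_⟩
  · by_contra hzQ
    exact absurd (h z hzQ) (by rw [dist_comm]; exact not_lt.2 hz)
  · by_contra! hlt
    exact hz (h z (by rwa [dist_comm]))

theorem innerSet_isOpen (Q : Set Space3) (n : ℕ) : IsOpen (innerSet Q n) :=
  Metric.isClosed_cthickening.isOpen_compl

theorem innerSet_subset {Q : Set Space3} (hQ : IsOpen Q) (n : ℕ) : innerSet Q n ⊆ Q := fun x hx =>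
  (mem_innerSet hQ).1 hx (Metric.mem_closedBall_self (by positivity))

theorem innerSet_mono (Q : Set Space3) : Monotone (innerSet Q) := fun m n hmn => by
  refine compl_subset_compl.2 (Metric.cthickening_mono ?_ _)
  gcongr

theorem iUnion_innerSet {Q : Set Space3} (hQ : IsOpen Q) : ⋃ n, innerSet Q n = Q := by
  refine subset_antisymm (iUnion_subset fun n => innerSet_subset hQ n) fun x hx => ?_
  obtain ⟨N, hN⟩ := exists_closedBall_subset hQ isCompact_singleton (singleton_subset_iff.2 hx)
  exact mem_iUnion.2 ⟨N, (mem_innerSet hQ).2 (hN N le_rfl x rfl)⟩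

/-- A point near `a • x + b • y` is the same convex combination of `x` and `y` shifted by one common
small vector. -/
theorem innerSet_convex {Q : Set Space3} (hQ : IsOpen Q) (hc : Convex ℝ Q) (n : ℕ) :
    Convex ℝ (innerSet Q n) := by
  intro x hx y hy a b ha hb hab
  rw [mem_innerSet hQ] at hx hy ⊢
  intro z hz
  set v := z - (a • x + b • y) with hv
  have hvn : ‖v‖ ≤ 1 / (n + 1 : ℝ) := by rw [hv, ← dist_eq_norm]; exact hz
  have e : z = a • (x + v) + b • (y + v) := by
    have : a • (x + v) + b • (y + v) = a • x + b • y + (a + b) • v := by module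
    rw [this, hab, one_smul, hv]; abel
  rw [e]
  exact hc (hx (by simpa using hvn)) (hy (by simpa using hvn)) ha hb hab

/-- Poincaré inequality on a convex open set. -/
theorem poincare {Q : Set Space3} (hQ : Convex ℝ Q) (hQo : IsOpen Q) {d : ℝ}
    (hd : ∀ x ∈ Q, ∀ y ∈ Q, ‖x - y‖ ≤ d) (hvol : volume Q ≠ ⊤) {f : Space3 → ℝ}
    {g : Fin 3 → Space3 → ℝ} (h : ∀ k, L2WeakDeriv Q (unitVec k) f (g k)) :
    ∫⁻ p in Q ×ˢ Q, ‖f p.1 - f p.2‖ₑ ^ 2 ≤ 8 * ENNReal.ofReal (d ^ 2) * volume Q *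
      ∑ k, ∫⁻ x in Q, ‖g k x‖ₑ ^ 2 := by
  have hf := (h 0).1
  have hQm := hQo.measurableSet
  set C := 8 * ENNReal.ofReal (d ^ 2) * volume Q with hC
  have hCt : C ≠ ⊤ := by finiteness
  -- On the convex set `innerSet Q n` the mollifications of order `m ≥ n` have the mollified weak
  -- gradient, so the `C¹` inequality applies to them. Fatou lets `m → ∞`; monotone exhaustion by
  -- inner sets then lets `n → ∞`.
  have key : ∀ n, ∫⁻ p in innerSet Q n ×ˢ innerSet Q n, ‖f p.1 - f p.2‖ₑ ^ 2
      ≤ C * ∑ k, ∫⁻ x in Q, ‖g k x‖ₑ ^ 2 := by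
    intro n
    set V := innerSet Q n with hV
    have hVQ : V ⊆ Q := innerSet_subset hQo n
    have hVm : MeasurableSet V := (innerSet_isOpen Q n).measurableSet
    have hae : ∀ᵐ p ∂(volume : Measure (Space3 × Space3)).restrict (V ×ˢ V),
        Tendsto (fun m => ‖mollify Q f m p.1 - mollify Q f m p.2‖ₑ ^ 2) atTop
          (𝓝 (‖f p.1 - f p.2‖ₑ ^ 2)) := by
      rw [Measure.volume_eq_prod, ← Measure.prod_restrict]
      have a1 := ae_restrict_of_ae_restrict_of_subset hVQ (ae_tendsto_mollify hQm hf)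
      filter_upwards [Measure.quasiMeasurePreserving_fst.ae a1,
        Measure.quasiMeasurePreserving_snd.ae a1] with p h1 h2
      exact ENNReal.Tendsto.pow (h1.sub h2).enorm
    have hsm : ∀ m, ContDiff ℝ ∞ (mollify Q f m) := fun m => mollify_contDiff hQm hf m
    have hbd : ∀ m ≥ n, ∫⁻ p in V ×ˢ V, ‖mollify Q f m p.1 - mollify Q f m p.2‖ₑ ^ 2
        ≤ C * ∑ k, (eLpNorm (g k) 2 (volume.restrict Q) +
          eLpNorm (fun x => mollify Q (g k) m x - Q.indicator (g k) x) 2 volume) ^ 2 := by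
      intro m hm
      refine (poincare_of_contDiff (innerSet_convex hQo hQ n) hVm
        (fun x hx y hy => hd x (hVQ hx) y (hVQ hy)) ((hsm m).of_le (by simp))).trans ?_
      rw [lintegral_finsetSum']
      · refine mul_le_mul' (mul_le_mul' le_rfl (measure_mono hVQ))
          (Finset.sum_le_sum fun k _ => ?_)
        rw [← eLpNorm_two_sq]
        gcongr
        have e : eLpNorm (fun x => fderiv ℝ (mollify Q f m) x (unitVec k)) 2 (volume.restrict V)
            = eLpNorm (fun x => g k x + (mollify Q (g k) m x - Q.indicator (g k) x)) 2
              (volume.restrict V) := by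
          refine eLpNorm_congr_ae ?_
          filter_upwards [ae_restrict_mem hVm] with x hx
          rw [fderiv_mollify hQm (h k) m
            ((mem_innerSet hQo).1 (innerSet_mono Q hm hx)), indicator_of_mem (hVQ hx)]
          ring
        rw [e]
        refine (eLpNorm_add_le ((h k).2.1.1.mono_measure (Measure.restrict_mono hVQ le_rfl)) ?_
          (by norm_num)).trans (add_le_add (eLpNorm_mono_measure _ (Measure.restrict_mono hVQ le_rfl))
            (eLpNorm_mono_measure _ Measure.restrict_le_self))
        exact ((mollify_contDiff hQm (h k).2.1 m).continuous.aestronglyMeasurable).sub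
          ((memLp_indicator_of hQm (h k).2.1).1.mono_measure Measure.restrict_le_self)
      · exact fun k _ => (continuous_fderiv_apply_test (hsm m) _).measurable.enorm.pow_const 2
          |>.aemeasurable
    have hlim : Tendsto (fun m => C * ∑ k, (eLpNorm (g k) 2 (volume.restrict Q) +
          eLpNorm (fun x => mollify Q (g k) m x - Q.indicator (g k) x) 2 volume) ^ 2) atTop
        (𝓝 (C * ∑ k, (eLpNorm (g k) 2 (volume.restrict Q) + 0) ^ 2)) := by
      refine ENNReal.Tendsto.const_mul (tendsto_finsetSum _ fun k _ => ?_) (Or.inr hCt)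
      exact ENNReal.Tendsto.pow ((tendsto_mollify hQm (h k).2.1).const_add _)
    simp only [add_zero, eLpNorm_two_sq] at hlim
    calc ∫⁻ p in V ×ˢ V, ‖f p.1 - f p.2‖ₑ ^ 2
        = ∫⁻ p in V ×ˢ V, liminf (fun m => ‖mollify Q f m p.1 - mollify Q f m p.2‖ₑ ^ 2) atTop :=
          lintegral_congr_ae (hae.mono fun p hp => hp.liminf_eq.symm)
      _ ≤ liminf (fun m => ∫⁻ p in V ×ˢ V, ‖mollify Q f m p.1 - mollify Q f m p.2‖ₑ ^ 2) atTop := by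
          refine lintegral_liminf_le fun m => ?_
          have := (hsm m).continuous.measurable
          exact ((this.comp measurable_fst).sub (this.comp measurable_snd)).enorm.pow_const 2
      _ ≤ _ := by
          rw [← hlim.liminf_eq]
          exact liminf_le_liminf (by filter_upwards [eventually_ge_atTop n] with m hm using hbd m hm)
  have hU : Q ×ˢ Q = ⋃ n, innerSet Q n ×ˢ innerSet Q n := by
    conv_lhs => rw [← iUnion_innerSet hQo]
    exact (iUnion_prod_of_monotone (innerSet_mono Q) (innerSet_mono Q)).symm
  have hmono : Monotone fun n => innerSet Q n ×ˢ innerSet Q n := fun m n hmn =>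
    prod_mono (innerSet_mono Q hmn) (innerSet_mono Q hmn)
  rw [hU, setLIntegral_iUnion_of_directed _ hmono.directed_le]
  exact iSup_le key

/-! ### Boxes -/

theorem isOpen_openBox (p q : Fin 3 → ℝ) : IsOpen (openBox p q) := by
  have : openBox p q = ⋂ k, {x : Space3 | x k ∈ Ioo (p k) (q k)} := by
    ext x; simp [openBox]
  rw [this]
  exact isOpen_iInter_of_finite fun k => isOpen_Ioo.preimage (EuclideanSpace.proj k).continuous

theorem convex_openBox (p q : Fin 3 → ℝ) : Convex ℝ (openBox p q) := by
  intro x hx y hy a b ha hb hab k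
  simpa using convex_Ioo (p k) (q k) (hx k) (hy k) ha hb hab

theorem volume_openBox (p q : Fin 3 → ℝ) :
    volume (openBox p q) = ∏ k, ENNReal.ofReal (q k - p k) := by
  have : openBox p q = WithLp.ofLp ⁻¹' (univ.pi fun k => Ioo (p k) (q k)) := by
    ext x; simp [openBox]
  rw [this, (PiLp.volume_preserving_ofLp (Fin 3)).measure_preimage
    (MeasurableSet.univ_pi fun k => measurableSet_Ioo).nullMeasurableSet, Real.volume_pi_Ioo]

theorem volume_hyperplane (k : Fin 3) (c : ℝ) : volume {x : Space3 | x k = c} = 0 := by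
  have : {x : Space3 | x k = c} = WithLp.ofLp ⁻¹' {y : Fin 3 → ℝ | y k = c} := rfl
  rw [this, (PiLp.volume_preserving_ofLp (Fin 3)).measure_preimage
    (measurableSet_eq_fun (measurable_pi_apply k) measurable_const).nullMeasurableSet]
  exact Measure.pi_hyperplane (fun _ : Fin 3 => (volume : Measure ℝ)) k c

theorem norm_le_sum_abs (x : Space3) : ‖x‖ ≤ ∑ k, |x k| := by
  rw [EuclideanSpace.norm_eq, Real.sqrt_le_left (Finset.sum_nonneg fun _ _ => abs_nonneg _)]
  simpa using Finset.sum_sq_le_sq_sum_of_nonneg (s := Finset.univ) (f := fun i => |x i|)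
      fun i _ => abs_nonneg _

theorem abs_apply_le_norm (x : Space3) (k : Fin 3) : |x k| ≤ ‖x‖ := by
  simpa using PiLp.norm_apply_le x k

/-- A partition of `Ω`, up to a null set, into convex cells of diameter at most `d` and volume `v`,
such that `V` is as large as one likes outside of finitely many cells. -/
structure IsGrid (Ω : Set Space3) (V : Space3 → ℝ) {ι : Type} (Q : ι → Set Space3) (d v : ℝ) :
    Prop where
  isOpen : ∀ j, IsOpen (Q j)
  convex : ∀ j, Convex ℝ (Q j)
  diam_le : ∀ j, ∀ x ∈ Q j, ∀ y ∈ Q j, ‖x - y‖ ≤ d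
  volume_eq : ∀ j, volume (Q j) = ENNReal.ofReal v
  subset : ∀ j, Q j ⊆ Ω
  disjoint : Pairwise (Function.onFun Disjoint Q)
  ae_cover : volume (Ω \ ⋃ j, Q j) = 0
  confining : ∀ B : ℝ, ∃ F : Finset ι, ∀ᵐ x ∂volume.restrict Ω, x ∉ ⋃ j ∈ F, Q j → B ≤ V x

/-- The standing assumption on the domain and the potential. -/
def IsTrap (Ω : Set Space3) (V : Space3 → ℝ) : Prop :=
  (Ω = univ ∧ Tendsto V (cocompact Space3) atTop) ∨
    ∃ p q : Fin 3 → ℝ, (∀ k, p k < q k) ∧ Ω = openBox p q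

/-- The cell with index `j` of the lattice of boxes with side lengths `s`, based at `p`. -/
def latticeCell (p s : Fin 3 → ℝ) (j : Fin 3 → ℤ) : Set Space3 :=
  openBox (fun k => p k + j k * s k) (fun k => p k + (j k + 1) * s k)

theorem latticeCell_diam {p s : Fin 3 → ℝ} {j : Fin 3 → ℤ} {x y : Space3}
    (hx : x ∈ latticeCell p s j) (hy : y ∈ latticeCell p s j) : ‖x - y‖ ≤ ∑ k, s k := by
  refine (norm_le_sum_abs _).trans (Finset.sum_le_sum fun k _ => ?_)
  have h1 := hx k
  have h2 := hy k
  simp only [mem_Ioo] at h1 h2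
  rw [PiLp.sub_apply, abs_le]
  constructor <;> nlinarith

theorem latticeCell_volume {p s : Fin 3 → ℝ} (hs : ∀ k, 0 < s k) (j : Fin 3 → ℤ) :
    volume (latticeCell p s j) = ENNReal.ofReal (∏ k, s k) := by
  rw [latticeCell, volume_openBox, ENNReal.ofReal_prod_of_nonneg fun k _ => (hs k).le]
  refine Finset.prod_congr rfl fun k _ => ?_
  congr 1; ring

theorem latticeCell_disjoint {p s : Fin 3 → ℝ} (hs : ∀ k, 0 < s k) :
    Pairwise (Function.onFun Disjoint (latticeCell p s)) := by
  intro i j hij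
  refine Set.disjoint_left.2 fun x hi hj => hij (funext fun k => ?_)
  have h1 := hi k
  have h2 := hj k
  simp only [mem_Ioo] at h1 h2
  have a1 : (i k : ℝ) < j k + 1 := by
    have : (i k : ℝ) * s k < (j k + 1) * s k := by linarith
    exact lt_of_mul_lt_mul_right this (hs k).le
  have a2 : (j k : ℝ) < i k + 1 := by
    have : (j k : ℝ) * s k < (i k + 1) * s k := by linarith
    exact lt_of_mul_lt_mul_right this (hs k).le
  have b1 : i k < j k + 1 := by exact_mod_cast a1
  have b2 : j k < i k + 1 := by exact_mod_cast a2
  omega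

theorem ae_mem_latticeCell (p : Fin 3 → ℝ) {s : Fin 3 → ℝ} (hs : ∀ k, 0 < s k) :
    ∀ᵐ x : Space3, x ∈ latticeCell p s fun k => ⌊(x k - p k) / s k⌋ := by
  have h : ∀ᵐ x : Space3, ∀ k, ∀ n : ℤ, x k ≠ p k + n * s k := by
    rw [ae_all_iff]; intro k
    rw [ae_all_iff]; intro n
    rw [ae_iff]; simpa using volume_hyperplane k (p k + n * s k)
  filter_upwards [h] with x hx k
  have h1 := Int.floor_le ((x k - p k) / s k)
  have h2 := Int.lt_floor_add_one ((x k - p k) / s k)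
  rw [le_div_iff₀ (hs k)] at h1
  rw [div_lt_iff₀ (hs k)] at h2
  exact ⟨lt_of_le_of_ne (by linarith) (hx k _).symm, by linarith⟩

/-- The constants `D` and `c` do not depend on `m`: diameter and volume scale as `1/m` and `1/m³`,
which the De Giorgi iteration exploits. In `ℝ³` the confinement clause is the growth of `V`; a box
is cut into `m³` equal cells, all of them are put into the finite family, and the clause is empty.
-/
theorem exists_grid {Ω : Set Space3} {V : Space3 → ℝ} (hΩ : IsTrap Ω V) :
    ∃ D c : ℝ, 0 < D ∧ 0 < c ∧ ∀ m : ℕ, 1 ≤ m →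
      ∃ (ι : Type) (_ : Countable ι) (Q : ι → Set Space3), IsGrid Ω V Q (D / m) (c / m ^ 3) := by
  rcases hΩ with ⟨rfl, hV⟩ | ⟨p, q, hpq, rfl⟩
  · refine ⟨3, 1, by norm_num, by norm_num, fun m hm => ?_⟩
    have hm0 : (0 : ℝ) < m := by exact_mod_cast hm
    set s : Fin 3 → ℝ := fun _ => 1 / (m : ℝ) with hs
    have hs0 : ∀ k, 0 < s k := fun k => by positivity
    have hcell := ae_mem_latticeCell (fun _ => 0) hs0
    refine ⟨Fin 3 → ℤ, inferInstance, latticeCell (fun _ => 0) s, fun j => isOpen_openBox _ _,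
      fun j => convex_openBox _ _, fun j x hx y hy => ?_, fun j => ?_, fun j => subset_univ _,
      latticeCell_disjoint hs0, ?_, fun B => ?_⟩
    · refine (latticeCell_diam hx hy).trans (le_of_eq ?_)
      simp [hs]; ring
    · rw [latticeCell_volume hs0]; simp [hs]
    · rw [← compl_eq_univ_sdiff]
      exact mem_ae_iff.1 (hcell.mono fun x hx => mem_iUnion.2 ⟨_, hx⟩)
    · obtain ⟨R, hR⟩ : ∃ R : ℝ, ∀ x : Space3, R < ‖x‖ → B ≤ V x := by
        have := hV.eventually_ge_atTop B
        rw [← Metric.cobounded_eq_cocompact, ← comap_norm_atTop, eventually_comap] at this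
        obtain ⟨R, hR⟩ := eventually_atTop.1 this
        exact ⟨R, fun x hx => hR ‖x‖ hx.le x rfl⟩
      obtain ⟨N, hN⟩ := exists_nat_gt (|R| * m + 1)
      refine ⟨Fintype.piFinset fun _ => Finset.Icc (-N : ℤ) N, ae_restrict_of_ae ?_⟩
      filter_upwards [hcell] with x hx hnot
      refine hR x ?_
      by_contra! hle
      refine hnot (mem_iUnion₂.2 ⟨_, ?_, hx⟩)
      rw [Fintype.mem_piFinset]
      intro k
      have hk := (abs_apply_le_norm x k).trans (hle.trans (le_abs_self R))
      have e : (x k - 0) / s k = x k * m := by simp [hs]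
      rw [e]
      have hk2 : |x k * m| ≤ |R| * m := by
        rw [abs_mul, abs_of_pos hm0]; gcongr
      rw [abs_le] at hk2
      rw [Finset.mem_Icc, Int.le_floor]
      constructor
      · push_cast; linarith
      · have := Int.floor_le (x k * m)
        have : ((⌊x k * m⌋ : ℤ) : ℝ) < N := by linarith
        exact_mod_cast this.le
  · have hd : ∀ k, 0 < q k - p k := fun k => sub_pos.2 (hpq k)
    refine ⟨∑ k, (q k - p k), ∏ k, (q k - p k), Finset.sum_pos (fun k _ => hd k)
      Finset.univ_nonempty, Finset.prod_pos fun k _ => hd k, fun m hm => ?_⟩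
    have hm0 : (0 : ℝ) < m := by exact_mod_cast hm
    set s : Fin 3 → ℝ := fun k => (q k - p k) / m with hs
    have hs0 : ∀ k, 0 < s k := fun k => div_pos (hd k) hm0
    set J : Finset (Fin 3 → ℤ) := Fintype.piFinset fun _ => Finset.Ico (0 : ℤ) m
    have hcov : ∀ᵐ x : Space3, x ∈ openBox p q → x ∈ ⋃ j : J, latticeCell p s j := by
      filter_upwards [ae_mem_latticeCell p hs0] with x hx hxΩ
      refine mem_iUnion.2 ⟨⟨fun k => ⌊(x k - p k) / s k⌋, ?_⟩, hx⟩
      rw [Fintype.mem_piFinset]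
      intro k
      have h1 := hxΩ k
      simp only [mem_Ioo] at h1
      rw [Finset.mem_Ico, Int.le_floor, Int.floor_lt]
      refine ⟨by push_cast; exact div_nonneg (by linarith) (hs0 k).le, ?_⟩
      rw [div_lt_iff₀ (hs0 k)]
      have : ((m : ℤ) : ℝ) * s k = q k - p k := by
        simp only [hs]; push_cast; field_simp
      linarith
    refine ⟨J, inferInstance, fun j => latticeCell p s j, fun j => isOpen_openBox _ _,
      fun j => convex_openBox _ _, fun j x hx y hy => ?_, fun j => ?_, fun j x hx k => ?_,
      fun i j hij => latticeCell_disjoint hs0 fun h => hij (Subtype.ext h), ?_, fun B => ?_⟩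
    · refine (latticeCell_diam hx hy).trans (le_of_eq ?_)
      rw [Finset.sum_div]
    · rw [latticeCell_volume hs0]; simp [hs, Finset.prod_div_distrib]
    · have hj := j.2
      rw [Fintype.mem_piFinset] at hj
      have hjk := Finset.mem_Ico.1 (hj k)
      have hx1 := hx k
      simp only [mem_Ioo] at hx1
      have c1 : (0 : ℝ) ≤ (j.1 k : ℝ) := by exact_mod_cast hjk.1
      have c2 : ((j.1 k : ℝ) + 1) ≤ m := by exact_mod_cast hjk.2
      have e : (m : ℝ) * s k = q k - p k := by simp only [hs]; field_simp
      have := hs0 k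
      exact ⟨by nlinarith, by nlinarith⟩
    · have h0 := ae_iff.1 hcov
      refine measure_mono_null (fun x hx => ?_) h0
      exact fun h => hx.2 (h hx.1)
    · refine ⟨Finset.univ, ?_⟩
      rw [ae_restrict_iff' (isOpen_openBox p q).measurableSet]
      filter_upwards [hcov] with x hx hxΩ hnot
      exact absurd (by simpa using hx hxΩ) (by simpa using hnot)

/-! ### Compactness and the Faber-Krahn inequality by cell decomposition. -/

theorem totallyBounded_of_finiteDimensional_approx {E : Type*} [NormedAddCommGroup E]
    [NormedSpace ℝ E] {S : Set E} {R : ℝ} (hR : ∀ x ∈ S, ‖x‖ ≤ R)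
    (h : ∀ ε > 0, ∃ W : Submodule ℝ E, FiniteDimensional ℝ W ∧ ∀ x ∈ S, ∃ w ∈ W, ‖x - w‖ ≤ ε) :
    TotallyBounded S := by
  rw [Metric.totallyBounded_iff]
  intro ε hε
  obtain ⟨W, hW, hSW⟩ := h (ε / 3) (by positivity)
  have : ProperSpace W := FiniteDimensional.proper ℝ W
  obtain ⟨t, ht, hcov⟩ := Metric.totallyBounded_iff.1
    (isCompact_closedBall (0 : W) (R + ε / 3)).totallyBounded (ε / 3) (by positivity)
  refine ⟨Subtype.val '' t, ht.image _, fun x hx => ?_⟩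
  obtain ⟨w, hw, hxw⟩ := hSW x hx
  have hwn : (⟨w, hw⟩ : W) ∈ Metric.closedBall (0 : W) (R + ε / 3) := by
    rw [mem_closedBall_zero_iff, Submodule.coe_norm]
    calc ‖w‖ = ‖x - (x - w)‖ := by rw [sub_sub_cancel]
      _ ≤ ‖x‖ + ‖x - w‖ := norm_sub_le _ _
      _ ≤ _ := add_le_add (hR x hx) hxw
  obtain ⟨y, hy, hyw⟩ := mem_iUnion₂.1 (hcov hwn)
  refine mem_iUnion₂.2 ⟨y, mem_image_of_mem _ hy, ?_⟩
  rw [Metric.mem_ball, dist_eq_norm] at hyw ⊢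
  have hyw' : ‖w - (y : E)‖ < ε / 3 := hyw
  calc ‖x - y‖ = ‖(x - w) + (w - y)‖ := by rw [sub_add_sub_cancel]
    _ ≤ ‖x - w‖ + ‖w - y‖ := norm_add_le _ _
    _ < ε := by linarith

theorem IsTrap.isOpen {Ω : Set Space3} {V : Space3 → ℝ} (h : IsTrap Ω V) : IsOpen Ω := by
  rcases h with ⟨rfl, -⟩ | ⟨p, q, -, rfl⟩
  exacts [isOpen_univ, isOpen_openBox p q]

theorem IsTrap.convex {Ω : Set Space3} {V : Space3 → ℝ} (h : IsTrap Ω V) : Convex ℝ Ω := by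
  rcases h with ⟨rfl, -⟩ | ⟨p, q, -, rfl⟩
  exacts [convex_univ, convex_openBox p q]

theorem IsTrap.nonempty {Ω : Set Space3} {V : Space3 → ℝ} (h : IsTrap Ω V) : Ω.Nonempty := by
  rcases h with ⟨rfl, -⟩ | ⟨p, q, hpq, rfl⟩
  · exact univ_nonempty
  · exact ⟨WithLp.toLp 2 fun k => (p k + q k) / 2, fun k =>
      ⟨by simp; linarith [hpq k], by simp; linarith [hpq k]⟩⟩

/-- Up to a null set the sublevel set lies in finitely many cells of one grid. -/
theorem IsTrap.volume_sublevel_ne_top {Ω : Set Space3} {V : Space3 → ℝ} (h : IsTrap Ω V) (B : ℝ) :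
    volume {x | x ∈ Ω ∧ V x < B} ≠ ⊤ := by
  obtain ⟨D, c, -, -, hg⟩ := exists_grid h
  obtain ⟨ι, _, Q, hQ⟩ := hg 1 le_rfl
  obtain ⟨F, hF⟩ := hQ.confining B
  rw [ae_restrict_iff' h.isOpen.measurableSet] at hF
  have h1 : {x | x ∈ Ω ∧ V x < B} ≤ᵐ[volume] (⋃ j ∈ F, Q j) := by
    filter_upwards [hF] with x hx hxB
    by_contra hn
    exact absurd (hx hxB.1 hn) (not_le.2 hxB.2)
  refine ((measure_mono_ae h1).trans_lt ((measure_biUnion_finset_le _ _).trans_lt ?_)).ne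
  refine ENNReal.sum_lt_top.2 fun j _ => ?_
  rw [hQ.volume_eq]
  exact ENNReal.ofReal_lt_top

namespace IsGrid

variable {Ω : Set Space3} {V : Space3 → ℝ} {ι : Type} {Q : ι → Set Space3} {d v : ℝ}

theorem lintegral_eq_tsum [Countable ι] (hQ : IsGrid Ω V Q d v) (h : Space3 → ℝ≥0∞) :
    ∫⁻ x in Ω, h x = ∑' j, ∫⁻ x in Q j, h x := by
  rw [← lintegral_iUnion (fun j => (hQ.isOpen j).measurableSet) hQ.disjoint]
  refine (setLIntegral_congr ?_).symm
  exact LE.le.eventuallyLE (iUnion_subset hQ.subset) |>.antisymm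
    (ae_le_set.2 hQ.ae_cover)

theorem poincare_cell (hQ : IsGrid Ω V Q d v) (hΩ : IsOpen Ω) {f : Space3 → ℝ}
    {g : Fin 3 → Space3 → ℝ}
    (h : ∀ k, L2WeakDeriv Ω (unitVec k) f (g k)) (j : ι) :
    ∫⁻ x in Q j, ∫⁻ y in Q j, ‖f x - f y‖ₑ ^ 2 ≤ 8 * ENNReal.ofReal (d ^ 2) * ENNReal.ofReal v *
      ∑ k, ∫⁻ x in Q j, ‖g k x‖ₑ ^ 2 := by
  have h1 := poincare (hQ.convex j) (hQ.isOpen j) (hQ.diam_le j)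
    (by rw [hQ.volume_eq]; exact ENNReal.ofReal_ne_top)
    fun k => (h k).mono hΩ.measurableSet (hQ.subset j)
  rw [hQ.volume_eq, Measure.volume_eq_prod, ← Measure.prod_restrict] at h1
  refine le_trans (le_of_eq ?_) h1
  have hf : AEStronglyMeasurable f (volume.restrict (Q j)) :=
    (h 0).1.1.mono_measure (Measure.restrict_mono (hQ.subset j) le_rfl)
  rw [lintegral_prod]
  exact ((hf.comp_quasiMeasurePreserving Measure.quasiMeasurePreserving_fst).sub
    (hf.comp_quasiMeasurePreserving Measure.quasiMeasurePreserving_snd)).enorm.pow_const 2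

/-- Faber-Krahn inequality: a function with small support has a large Rayleigh quotient. -/
theorem faberKrahn [Countable ι] (hQ : IsGrid Ω V Q d v) (hΩ : IsOpen Ω) (hv : 0 < v)
    {f : Space3 → ℝ} {g : Fin 3 → Space3 → ℝ} (h : ∀ k, L2WeakDeriv Ω (unitVec k) f (g k))
    (hs : volume.restrict Ω {x | f x ≠ 0} ≤ ENNReal.ofReal (v / 2)) :
    ∫⁻ x in Ω, ‖f x‖ₑ ^ 2 ≤ 16 * ENNReal.ofReal (d ^ 2) * ∑ k, ∫⁻ x in Ω, ‖g k x‖ₑ ^ 2 := by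
  have key : ∀ j, ∫⁻ x in Q j, ‖f x‖ₑ ^ 2
      ≤ 16 * ENNReal.ofReal (d ^ 2) * ∑ k, ∫⁻ x in Q j, ‖g k x‖ₑ ^ 2 := by
    intro j
    have hf : AEStronglyMeasurable f (volume.restrict (Q j)) :=
      (h 0).1.1.mono_measure (Measure.restrict_mono (hQ.subset j) le_rfl)
    -- At least half of every cell belongs to the zero set of `f`, and there `|f x - f y| = |f x|`.
    -- Hence the double integral in the Poincaré inequality controls `∫ f²` itself.
    have hz : ENNReal.ofReal (v / 2) ≤ volume.restrict (Q j) {y | f y = 0} := by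
      have h1 : ENNReal.ofReal v ≤ volume.restrict (Q j) {y | f y = 0}
          + volume.restrict (Q j) {y | f y ≠ 0} := by
        rw [← hQ.volume_eq j, ← Measure.restrict_apply_univ (Q j)]
        refine le_trans (measure_mono ?_) (measure_union_le _ _)
        intro y _; exact em _
      have h2 : volume.restrict (Q j) {y | f y ≠ 0} ≤ ENNReal.ofReal (v / 2) :=
        (Measure.restrict_mono (hQ.subset j) le_rfl _).trans hs
      have h3 : ENNReal.ofReal v = ENNReal.ofReal (v / 2) + ENNReal.ofReal (v / 2) := by
        rw [← ENNReal.ofReal_add (by positivity) (by positivity)]; ring_nf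
      rw [h3] at h1
      exact (ENNReal.add_le_add_iff_right ENNReal.ofReal_ne_top).1
        (h1.trans (add_le_add le_rfl h2))
    have h4 : (∫⁻ x in Q j, ‖f x‖ₑ ^ 2) * ENNReal.ofReal (v / 2)
        ≤ ∫⁻ x in Q j, ∫⁻ y in Q j, ‖f x - f y‖ₑ ^ 2 := by
      rw [← lintegral_mul_const' _ _ ENNReal.ofReal_ne_top]
      refine lintegral_mono fun x => ?_
      have := mul_meas_ge_le_lintegral₀ (μ := volume.restrict (Q j))
        (f := fun y => ‖f x - f y‖ₑ ^ 2)
        (((aestronglyMeasurable_const (b := f x)).sub hf).enorm.pow_const 2) (‖f x‖ₑ ^ 2)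
      refine le_trans (mul_le_mul' le_rfl (hz.trans (measure_mono fun y hy => ?_))) this
      have hy0 : f y = 0 := hy
      simp [hy0]
    have h5 := h4.trans (hQ.poincare_cell hΩ h j)
    have h6 : ENNReal.ofReal v = 2 * ENNReal.ofReal (v / 2) := by
      rw [← ENNReal.ofReal_ofNat, ← ENNReal.ofReal_mul (by norm_num)]; congr 1; ring
    have h7 : 8 * ENNReal.ofReal (d ^ 2) * ENNReal.ofReal v * ∑ k, ∫⁻ x in Q j, ‖g k x‖ₑ ^ 2
        = (16 * ENNReal.ofReal (d ^ 2) * ∑ k, ∫⁻ x in Q j, ‖g k x‖ₑ ^ 2)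
          * ENNReal.ofReal (v / 2) := by
      rw [h6]; ring
    rw [h7] at h5
    exact (ENNReal.mul_le_mul_iff_left (by simpa using hv) ENNReal.ofReal_ne_top).1 h5
  simp only [hQ.lintegral_eq_tsum]
  rw [← Summable.tsum_finsetSum fun _ _ => ENNReal.summable, ← ENNReal.tsum_mul_left]
  exact ENNReal.tsum_le_tsum key

/-- Approximation by functions that are constant on the cells. -/
theorem exists_step_approx [Countable ι] (hQ : IsGrid Ω V Q d v) (hΩ : IsOpen Ω) (hv : 0 < v)
    {B : ℝ} (hB : 0 < B)
    {F : Finset ι} (hF : ∀ᵐ x ∂volume.restrict Ω, x ∉ ⋃ j ∈ F, Q j → B ≤ V x)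
    {f : Space3 → ℝ} {g : Fin 3 → Space3 → ℝ} (h : ∀ k, L2WeakDeriv Ω (unitVec k) f (g k)) :
    ∃ c : ι → ℝ, ∫⁻ x in Ω, ‖f x - ∑ j ∈ F, c j * (Q j).indicator 1 x‖ₑ ^ 2
      ≤ 8 * ENNReal.ofReal (d ^ 2) * (∑ k, ∫⁻ x in Ω, ‖g k x‖ₑ ^ 2)
        + ENNReal.ofReal (1 / B) * ∫⁻ x in Ω, ENNReal.ofReal (V x) * ‖f x‖ₑ ^ 2 := by
  classical
  have hex : ∀ j, ∃ c : ℝ, ∫⁻ x in Q j, ‖f x - c‖ₑ ^ 2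
      ≤ 8 * ENNReal.ofReal (d ^ 2) * ∑ k, ∫⁻ x in Q j, ‖g k x‖ₑ ^ 2 := by
    intro j
    have hf : AEStronglyMeasurable f (volume.restrict (Q j)) :=
      (h 0).1.1.mono_measure (Measure.restrict_mono (hQ.subset j) le_rfl)
    have hm : AEMeasurable (fun y => ∫⁻ x in Q j, ‖f x - f y‖ₑ ^ 2) (volume.restrict (Q j)) := by
      have := ((hf.comp_quasiMeasurePreserving (Measure.quasiMeasurePreserving_snd
        (μ := volume.restrict (Q j)))).sub
        (hf.comp_quasiMeasurePreserving (Measure.quasiMeasurePreserving_fst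
        (ν := volume.restrict (Q j))))).enorm.pow_const 2
      exact this.lintegral_prod_right'
    have hvj : volume (Q j) ≠ 0 := by rw [hQ.volume_eq]; simpa using hv
    have hvt : volume (Q j) ≠ ⊤ := by rw [hQ.volume_eq]; exact ENNReal.ofReal_ne_top
    -- Instead of the mean of `f`, the constant is the value of `f` at a point where the inner
    -- integral does not exceed its average over the cell.
    obtain ⟨y, -, hy⟩ := exists_le_setLAverage hvj hvt hm
    refine ⟨f y, hy.trans ?_⟩
    rw [setLAverage_eq]
    refine ENNReal.div_le_of_le_mul ?_
    have hsym : ∫⁻ y in Q j, ∫⁻ x in Q j, ‖f x - f y‖ₑ ^ 2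
        = ∫⁻ y in Q j, ∫⁻ x in Q j, ‖f y - f x‖ₑ ^ 2 := by
      simp only [enorm_sub_rev]
    rw [hsym, hQ.volume_eq]
    refine (hQ.poincare_cell hΩ h j).trans (le_of_eq ?_)
    ring
  choose c hc using hex
  refine ⟨c, ?_⟩
  have hval : ∀ i, ∀ x ∈ Q i, ∑ j ∈ F, c j * (Q j).indicator 1 x = if i ∈ F then c i else 0 := by
    intro i x hx
    have : ∀ j ∈ F, c j * (Q j).indicator (1 : Space3 → ℝ) x = if j = i then c i else 0 := by
      intro j _
      split_ifs with hji
      · subst hji; simp [hx]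
      · rw [indicator_of_notMem, mul_zero]
        exact fun hxj => Set.disjoint_left.1 (hQ.disjoint hji) hxj hx
    rw [Finset.sum_congr rfl this, Finset.sum_ite_eq']
  rw [hQ.lintegral_eq_tsum fun x => ‖f x - ∑ j ∈ F, c j * (Q j).indicator 1 x‖ₑ ^ 2,
    hQ.lintegral_eq_tsum fun x => ENNReal.ofReal (V x) * ‖f x‖ₑ ^ 2]
  have hgs : ∀ k, ∫⁻ x in Ω, ‖g k x‖ₑ ^ 2 = ∑' j, ∫⁻ x in Q j, ‖g k x‖ₑ ^ 2 := fun k =>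
    hQ.lintegral_eq_tsum _
  simp only [hgs]
  rw [← Summable.tsum_finsetSum fun _ _ => ENNReal.summable, ← ENNReal.tsum_mul_left,
    ← ENNReal.tsum_mul_left, ← ENNReal.tsum_add]
  refine ENNReal.tsum_le_tsum fun i => ?_
  have hQm := (hQ.isOpen i).measurableSet
  rw [setLIntegral_congr_fun hQm fun x hx => by
    rw [hval i x hx]]
  -- On cells outside `F` the step function is zero, and `f² ≤ V f² / B` there since `V ≥ B`.
  by_cases hi : i ∈ F
  · simp only [hi, if_true]
    exact (hc i).trans le_self_add
  · simp only [hi, if_false, sub_zero]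
    refine le_trans ?_ le_add_self
    rw [← lintegral_const_mul' _ _ ENNReal.ofReal_ne_top]
    refine lintegral_mono_ae ?_
    filter_upwards [ae_restrict_mem hQm, ae_restrict_of_ae_restrict_of_subset (hQ.subset i) hF]
      with x hx hxF
    have hVx : B ≤ V x := hxF fun hmem => by
      obtain ⟨j, hj, hxj⟩ := mem_iUnion₂.1 hmem
      have hne : j ≠ i := fun e => hi (e ▸ hj)
      exact Set.disjoint_left.1 (hQ.disjoint hne) hxj hx
    rw [← mul_assoc, ← ENNReal.ofReal_mul (by positivity)]
    refine le_mul_of_one_le_left' ?_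
    rw [ENNReal.one_le_ofReal, one_div, ← div_eq_inv_mul, one_le_div hB]
    exact hVx

end IsGrid

/-- Rellich: sets of functions with bounded energy are totally bounded in `L²(Ω)`. -/
theorem totallyBounded_energy {Ω : Set Space3} {V : Space3 → ℝ} (hΩ : IsTrap Ω V) (B : ℝ) :
    TotallyBounded {F : Lp ℝ 2 (volume.restrict Ω) | ‖F‖ ≤ 1 ∧ ∃ g : Fin 3 → Space3 → ℝ,
      (∀ k, L2WeakDeriv Ω (unitVec k) F (g k)) ∧ ∑ k, ∫⁻ x in Ω, ‖g k x‖ₑ ^ 2 ≤ ENNReal.ofReal B ∧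
      ∫⁻ x in Ω, ENNReal.ofReal (V x) * ‖F x‖ₑ ^ 2 ≤ ENNReal.ofReal B} := by
  obtain ⟨D, c, hD, hc, hgrid⟩ := exists_grid hΩ
  refine totallyBounded_of_finiteDimensional_approx (R := 1) (fun x hx => hx.1) fun ε hε => ?_
  -- The fineness `m` makes the oscillation inside the cells contribute at most `ε² / 2`; the level
  -- `A` below does the same for the mass outside finitely many cells.
  obtain ⟨m, hm⟩ : ∃ m : ℕ, 16 * D ^ 2 * (|B| + 1) / ε ^ 2 < m := exists_nat_gt _
  have hm1 : 1 ≤ m := by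
    have : (0 : ℝ) < m := lt_of_le_of_lt (by positivity) hm
    exact_mod_cast this
  have hm0 : (1 : ℝ) ≤ m := by exact_mod_cast hm1
  obtain ⟨ι, _, Q, hQ⟩ := hgrid m hm1
  set A : ℝ := 2 * (|B| + 1) / ε ^ 2
  have hA : 0 < A := by positivity
  obtain ⟨F, hF⟩ := hQ.confining A
  have hind : ∀ j, MemLp ((Q j).indicator (1 : Space3 → ℝ)) 2 (volume.restrict Ω) := fun j =>
    memLp_indicator_const 2 (hQ.isOpen j).measurableSet (1 : ℝ) (Or.inr (by
      refine ((Measure.restrict_le_self _).trans_lt ?_).ne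
      rw [hQ.volume_eq]; exact ENNReal.ofReal_lt_top))
  refine ⟨Submodule.span ℝ (Set.range fun j : F => (hind j).toLp _),
    FiniteDimensional.span_of_finite ℝ (Set.finite_range _), fun f hf => ?_⟩
  obtain ⟨-, g, hg, hgB, hVB⟩ := hf
  obtain ⟨a, ha⟩ := hQ.exists_step_approx hΩ.isOpen (by positivity) hA hF hg
  refine ⟨∑ j ∈ F, a j • (hind j).toLp _, Submodule.sum_mem _ fun j hj =>
    Submodule.smul_mem _ _ (Submodule.subset_span ⟨⟨j, hj⟩, rfl⟩), ?_⟩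
  have hae : (f - ∑ j ∈ F, a j • (hind j).toLp _ : Lp ℝ 2 (volume.restrict Ω))
      =ᵐ[volume.restrict Ω] fun x => f x - ∑ j ∈ F, a j * (Q j).indicator 1 x := by
    have h1 : (∑ j ∈ F, a j • (hind j).toLp _ : Lp ℝ 2 (volume.restrict Ω))
        =ᵐ[volume.restrict Ω] fun x => ∑ j ∈ F, a j * (Q j).indicator 1 x := by
      refine (Lp.coeFn_finsetSum _ _).trans ?_
      have : ∀ᵐ x ∂volume.restrict Ω, ∀ j ∈ F, (a j • (hind j).toLp _ : Lp ℝ 2 _) x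
          = a j * (Q j).indicator 1 x := by
        refine (Finset.eventually_all F).2 fun j _ => ?_
        filter_upwards [Lp.coeFn_smul (a j) ((hind j).toLp _), (hind j).coeFn_toLp] with x h1 h2
        rw [h1, Pi.smul_apply, h2, smul_eq_mul]
      filter_upwards [this] with x hx
      rw [Finset.sum_apply]
      exact Finset.sum_congr rfl hx
    filter_upwards [Lp.coeFn_sub f (∑ j ∈ F, a j • (hind j).toLp _), h1] with x h2 h3
    rw [h2, Pi.sub_apply, h3]
  have hfin : ∫⁻ x in Ω, ‖f x - ∑ j ∈ F, a j * (Q j).indicator 1 x‖ₑ ^ 2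
      ≤ ENNReal.ofReal (ε ^ 2) := by
    refine ha.trans ?_
    calc 8 * ENNReal.ofReal ((D / m) ^ 2) * (∑ k, ∫⁻ x in Ω, ‖g k x‖ₑ ^ 2)
        + ENNReal.ofReal (1 / A) * ∫⁻ x in Ω, ENNReal.ofReal (V x) * ‖f x‖ₑ ^ 2
        ≤ 8 * ENNReal.ofReal ((D / m) ^ 2) * ENNReal.ofReal (|B| + 1)
          + ENNReal.ofReal (1 / A) * ENNReal.ofReal (|B| + 1) := by
          have hB : ENNReal.ofReal B ≤ ENNReal.ofReal (|B| + 1) :=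
            ENNReal.ofReal_le_ofReal (by linarith [le_abs_self B])
          exact add_le_add (mul_le_mul' le_rfl (hgB.trans hB)) (mul_le_mul' le_rfl (hVB.trans hB))
      _ = ENNReal.ofReal (8 * (D / m) ^ 2 * (|B| + 1) + 1 / A * (|B| + 1)) := by
          rw [ENNReal.ofReal_add (p := 8 * (D / m) ^ 2 * (|B| + 1)) (by positivity) (by positivity),
            ENNReal.ofReal_mul (p := 8 * (D / m) ^ 2) (by positivity),
            ENNReal.ofReal_mul (p := 8) (by positivity),
            ENNReal.ofReal_mul (p := 1 / A) (by positivity), ENNReal.ofReal_ofNat]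
      _ ≤ _ := by
          refine ENNReal.ofReal_le_ofReal ?_
          have e1 : 1 / A * (|B| + 1) = ε ^ 2 / 2 := by
            simp only [A]; field_simp
          have e2 : 8 * (D / m) ^ 2 * (|B| + 1) ≤ ε ^ 2 / 2 := by
            rw [div_lt_iff₀ (by positivity)] at hm
            have h1 : (D / m) ^ 2 ≤ D ^ 2 / m := by
              rw [div_pow]
              gcongr
              nlinarith
            calc 8 * (D / m) ^ 2 * (|B| + 1) ≤ 8 * (D ^ 2 / m) * (|B| + 1) := by gcongr
              _ = 16 * D ^ 2 * (|B| + 1) / m / 2 := by ring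
              _ ≤ ε ^ 2 / 2 := by
                gcongr
                rw [div_le_iff₀ (by positivity)]
                linarith
          linarith
  rw [← eLpNorm_two_sq, ENNReal.ofReal_pow hε.le, ENNReal.pow_le_pow_left_iff two_ne_zero] at hfin
  rw [Lp.norm_def, eLpNorm_congr_ae hae]
  exact ENNReal.toReal_le_of_le_ofReal hε.le hfin

@[simp]
theorem enorm_complex_ofReal (r : ℝ) : ‖(r : ℂ)‖ₑ = ‖r‖ₑ := by
  rw [← ofReal_norm, ← ofReal_norm, Complex.norm_real]

/-! ### From complex functions with weak derivatives to real ones. -/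

section WeakDerivSq

variable {X : Type*} [NormedAddCommGroup X] [NormedSpace ℝ X] [MeasureSpace X]
variable [FiniteDimensional ℝ X] [BorelSpace X] [(volume : Measure X).IsAddHaarMeasure]
variable {U : Set X} {w : X}

theorem memLp_two_of_lintegral {α E : Type*} [NormedAddCommGroup E] {m : MeasurableSpace α}
    {μ : Measure α} {f : α → E} (hf : AEStronglyMeasurable f μ) (h : ∫⁻ x, ‖f x‖ₑ ^ 2 ∂μ ≠ ⊤) :
    MemLp f 2 μ := by
  refine ⟨hf, ?_⟩
  rw [← eLpNorm_two_sq] at h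
  exact lt_top_iff_ne_top.2 fun h' => h (by simp [h'])

theorem lintegral_ne_top_of_memLp_two {α E : Type*} [NormedAddCommGroup E] {m : MeasurableSpace α}
    {μ : Measure α} {f : α → E} (hf : MemLp f 2 μ) : ∫⁻ x, ‖f x‖ₑ ^ 2 ∂μ ≠ ⊤ := by
  rw [← eLpNorm_two_sq]
  exact ENNReal.pow_ne_top hf.2.ne

theorem lintegral_enorm_sq_eq {α : Type*} {m : MeasurableSpace α}
    {μ : Measure α} {f : α → ℝ} (hf : MemLp f 2 μ) :
    ∫⁻ x, ‖f x‖ₑ ^ 2 ∂μ = ENNReal.ofReal (∫ x, f x ^ 2 ∂μ) := by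
  simp only [enorm_sq_eq_ofReal]
  rw [ofReal_integral_eq_lintegral_ofReal hf.integrable_sq
    (Eventually.of_forall fun x => sq_nonneg _)]

/-- The difference of two weak derivatives integrates to zero against all test functions in `U`.
Consequently the infimum in `weakDerivSq` is over a single value. -/
theorem IsWeakDeriv.ae_unique (hU : IsOpen U) {f g g' : X → ℂ} (h : IsWeakDeriv U w f g)
    (h' : IsWeakDeriv U w f g') : g =ᵐ[volume.restrict U] g' := by
  have hd : LocallyIntegrableOn (fun x => g x - g' x) U volume := h.2.1.sub h'.2.1
  have intg : ∀ {g : X → ℂ}, LocallyIntegrableOn g U volume → ∀ η : X → ℝ, Continuous η →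
      HasCompactSupport η → tsupport η ⊆ U →
      Integrable (fun x => ((η x : ℝ) : ℂ) * g x) (volume.restrict U) := by
    intro g hg η h1 h2 h3
    have hK : IsCompact (tsupport η) := h2
    have hi : IntegrableOn (fun x => ((η x : ℝ) : ℂ) * g x) (tsupport η) := by
      refine IntegrableOn.continuousOn_mul ?_ (hg.integrableOn_compact_subset h3 hK) hK
      exact (Complex.continuous_ofReal.comp h1).continuousOn
    have hi2 : Integrable (fun x => ((η x : ℝ) : ℂ) * g x) volume :=
      (integrableOn_iff_integrable_of_support_subset fun x hx => by
        by_contra hn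
        exact hx (by simp [image_eq_zero_of_notMem_tsupport hn])).1 hi
    exact hi2.integrableOn
  have := hU.ae_eq_zero_of_integral_contDiff_smul_eq_zero hd ?_
  · rw [EventuallyEq, ae_restrict_iff' hU.measurableSet]
    filter_upwards [this] with x hx hxU
    exact sub_eq_zero.1 (hx hxU)
  · intro η h1 h2 h3
    have e1 := h.2.2 η h1 h2 h3
    rw [h'.2.2 η h1 h2 h3, neg_inj] at e1
    have e2 : ∫ x in U, η x • (g x - g' x) = 0 := by
      simp only [Complex.real_smul, mul_sub]
      rw [integral_sub (intg h.2.1 η h1.continuous h2 h3) (intg h'.2.1 η h1.continuous h2 h3), e1,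
        sub_self]
    rw [← e2]
    refine (setIntegral_eq_integral_of_forall_compl_eq_zero fun x hx => ?_).symm
    rw [image_eq_zero_of_notMem_tsupport fun h => hx (h3 h), zero_smul]

theorem weakDerivSq_eq (hU : IsOpen U) {f g : X → ℂ} (h : IsWeakDeriv U w f g) :
    weakDerivSq U w f = ∫⁻ x in U, ‖g x‖ₑ ^ 2 := by
  refine le_antisymm (iInf₂_le g h) (le_iInf₂ fun g' h' => le_of_eq ?_)
  refine lintegral_congr_ae ?_
  filter_upwards [h.ae_unique hU h'] with x hx
  rw [hx]

theorem exists_isWeakDeriv (hU : IsOpen U) {f : X → ℂ} (h : weakDerivSq U w f ≠ ⊤) :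
    ∃ g, IsWeakDeriv U w f g ∧ ∫⁻ x in U, ‖g x‖ₑ ^ 2 = weakDerivSq U w f := by
  by_contra! hn
  refine h ?_
  rw [weakDerivSq, iInf₂_eq_top]
  intro g hg
  exact absurd (weakDerivSq_eq hU hg).symm (hn g hg)

theorem IsWeakDeriv.re_im {f g : X → ℂ} (h : IsWeakDeriv U w f g)
    (hf : ∫⁻ x in U, ‖f x‖ₑ ^ 2 ≠ ⊤) (hg : ∫⁻ x in U, ‖g x‖ₑ ^ 2 ≠ ⊤) :
    L2WeakDeriv U w (fun x => (f x).re) (fun x => (g x).re) ∧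
    L2WeakDeriv U w (fun x => (f x).im) (fun x => (g x).im) := by
  have hfL : MemLp f 2 (volume.restrict U) := memLp_two_of_lintegral h.1.aestronglyMeasurable hf
  have hgL : MemLp g 2 (volume.restrict U) := memLp_two_of_lintegral h.2.1.aestronglyMeasurable hg
  have intg : ∀ {f : X → ℂ}, MemLp f 2 (volume.restrict U) → ∀ η : X → ℝ, Continuous η →
      HasCompactSupport η → Integrable (fun x => ((η x : ℝ) : ℂ) * f x) (volume.restrict U) := by
    intro f hf η h1 h2
    have h3 : MemLp (fun x => ((η x : ℝ) : ℂ)) 2 (volume.restrict U) :=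
      (h1.memLp_of_hasCompactSupport h2).ofReal
    exact h3.integrable_mul hf
  have main : ∀ L : ℂ →L[ℝ] ℝ, (∀ (r : ℝ) (z : ℂ), L (r * z) = r * L z) →
      (∀ η : X → ℝ, ContDiff ℝ ∞ η → HasCompactSupport η → tsupport η ⊆ U →
        ∫ x in U, fderiv ℝ η x w * L (f x) = - ∫ x in U, η x * L (g x)) := by
    intro L hL η h1 h2 h3
    have e := congrArg L (h.2.2 η h1 h2 h3)
    rw [map_neg, ← L.integral_comp_comm (intg hfL _ (continuous_fderiv_apply_test h1 w)
      (h2.fderiv_apply ℝ w)), ← L.integral_comp_comm (intg hgL η h1.continuous h2)] at e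
    simpa only [hL] using e
  exact ⟨⟨hfL.re, hgL.re, main Complex.reCLM fun r z => by simp⟩,
    ⟨hfL.im, hgL.im, main Complex.imCLM fun r z => by simp⟩⟩

theorem L2WeakDeriv.isWeakDeriv {f g : X → ℝ} (h : L2WeakDeriv U w f g) :
    IsWeakDeriv U w (fun x => (f x : ℂ)) (fun x => (g x : ℂ)) := by
  have hli : ∀ {f : X → ℝ}, MemLp f 2 (volume.restrict U) →
      LocallyIntegrableOn (fun x => (f x : ℂ)) U volume := fun hf x hx => by
    obtain ⟨s, hs, hi⟩ := L2WeakDeriv.locallyIntegrableOn hf x hx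
    exact ⟨s, hs, hi.ofReal⟩
  refine ⟨hli h.1, hli h.2.1, fun η h1 h2 h3 => ?_⟩
  have := congrArg (fun r : ℝ => (r : ℂ)) (h.2.2 η h1 h2 h3)
  simp only [Complex.ofReal_neg] at this
  rw [← integral_complex_ofReal, ← integral_complex_ofReal] at this
  simpa using this

theorem L2WeakDeriv.weakDerivSq_le {f g : X → ℝ} (h : L2WeakDeriv U w f g) :
    weakDerivSq U w (fun x => (f x : ℂ)) ≤ ∫⁻ x in U, ‖g x‖ₑ ^ 2 := by
  refine (iInf₂_le _ h.isWeakDeriv).trans (le_of_eq ?_)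
  simp

/-- Diamagnetic inequality. -/
theorem exists_l2WeakDeriv_norm (hU : IsOpen U) {f : X → ℂ} (hf : ∫⁻ x in U, ‖f x‖ₑ ^ 2 ≠ ⊤)
    (h : weakDerivSq U w f ≠ ⊤) :
    ∃ g, L2WeakDeriv U w (fun x => ‖f x‖) g ∧ ∫⁻ x in U, ‖g x‖ₑ ^ 2 ≤ weakDerivSq U w f := by
  obtain ⟨g, hg, he⟩ := exists_isWeakDeriv hU h
  obtain ⟨h1, h2⟩ := hg.re_im hf (he ▸ h)
  have := L2WeakDeriv.sqrt_sum_sq (ι := Fin 2) hU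
    (f := ![fun x => (f x).re, fun x => (f x).im]) (g := ![fun x => (g x).re, fun x => (g x).im])
    (w := w) (fun i => by fin_cases i <;> [exact h1; exact h2])
  refine ⟨fun x => (∑ i, (![fun x => (f x).re, fun x => (f x).im] : Fin 2 → X → ℝ) i x *
    (![fun x => (g x).re, fun x => (g x).im] : Fin 2 → X → ℝ) i x) /
      √(∑ i, (![fun x => (f x).re, fun x => (f x).im] : Fin 2 → X → ℝ) i x ^ 2), ?_, ?_⟩
  · convert this using 2 with x
    rw [Complex.norm_eq_sqrt_sq_add_sq]
    simp
  · rw [← he]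
    refine lintegral_mono fun x => ?_
    rw [enorm_sq_eq_ofReal]
    refine (ENNReal.ofReal_le_ofReal (L2WeakDeriv.sq_div_sqrt_sum_le _ _)).trans (le_of_eq ?_)
    rw [← ofReal_norm, ← ENNReal.ofReal_pow (norm_nonneg _), Complex.sq_norm, Complex.normSq_apply]
    simp [pow_two]

end WeakDerivSq

/-! ### The real one-particle form -/

/-- The real function `f` lies in the form domain of `-Δ + V` on `Ω`, with weak gradient `g`. -/
structure InFormDomain (Ω : Set Space3) (V : Space3 → ℝ) (f : Space3 → ℝ)
    (g : Fin 3 → Space3 → ℝ) : Prop where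
  deriv : ∀ k, L2WeakDeriv Ω (unitVec k) f (g k)
  pot : Integrable (fun x => V x * f x ^ 2) (volume.restrict Ω)

/-- The quadratic form of `-Δ + V`. -/
noncomputable def formEnergy (Ω : Set Space3) (V : Space3 → ℝ) (f : Space3 → ℝ)
    (g : Fin 3 → Space3 → ℝ) : ℝ :=
  (∑ k, ∫ x in Ω, g k x ^ 2) + ∫ x in Ω, V x * f x ^ 2

section Star

variable {Ω : Set Space3} {V : Space3 → ℝ}

theorem formEnergy_nonneg (hV : ∀ x, 0 ≤ V x) (f : Space3 → ℝ) (g : Fin 3 → Space3 → ℝ) :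
    0 ≤ formEnergy Ω V f g :=
  add_nonneg (Finset.sum_nonneg fun _ _ => integral_nonneg fun _ => sq_nonneg _)
    (integral_nonneg fun x => mul_nonneg (hV x) (sq_nonneg _))

theorem InFormDomain.memLp {f : Space3 → ℝ} {g : Fin 3 → Space3 → ℝ} (h : InFormDomain Ω V f g) :
    MemLp f 2 (volume.restrict Ω) := (h.deriv 0).1

theorem InFormDomain.const_mul {f : Space3 → ℝ} {g : Fin 3 → Space3 → ℝ}
    (h : InFormDomain Ω V f g) (c : ℝ) :
    InFormDomain Ω V (fun x => c * f x) (fun k x => c * g k x) :=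
  ⟨fun k => (h.deriv k).const_mul c, by
    refine (h.pot.const_mul (c ^ 2)).congr (Eventually.of_forall fun x => ?_)
    simp only; ring⟩

theorem formEnergy_const_mul (f : Space3 → ℝ) (g : Fin 3 → Space3 → ℝ) (c : ℝ) :
    formEnergy Ω V (fun x => c * f x) (fun k x => c * g k x) = c ^ 2 * formEnergy Ω V f g := by
  simp only [formEnergy, mul_pow, integral_const_mul, mul_left_comm _ (c ^ 2), ← Finset.mul_sum]
  ring

theorem ofReal_formEnergy (hV : ∀ x, 0 ≤ V x) {f : Space3 → ℝ} {g : Fin 3 → Space3 → ℝ}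
    (h : InFormDomain Ω V f g) :
    ENNReal.ofReal (formEnergy Ω V f g) = (∑ k, ∫⁻ x in Ω, ‖g k x‖ₑ ^ 2)
      + ∫⁻ x in Ω, ENNReal.ofReal (V x) * ‖f x‖ₑ ^ 2 := by
  rw [formEnergy, ENNReal.ofReal_add (Finset.sum_nonneg fun _ _ => integral_nonneg fun _ =>
    sq_nonneg _) (integral_nonneg fun x => mul_nonneg (hV x) (sq_nonneg _)),
    ENNReal.ofReal_sum_of_nonneg fun _ _ => integral_nonneg fun _ => sq_nonneg _]
  congr 1
  · exact Finset.sum_congr rfl fun k _ => (lintegral_enorm_sq_eq (h.deriv k).2.1).symm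
  · rw [ofReal_integral_eq_lintegral_ofReal h.pot
      (Eventually.of_forall fun x => mul_nonneg (hV x) (sq_nonneg _))]
    refine lintegral_congr fun x => ?_
    rw [enorm_sq_eq_ofReal, ENNReal.ofReal_mul (hV x)]

theorem starFunctional_le (hV : ∀ x, 0 ≤ V x) (hVm : Measurable V) {a m : ℝ} (ha : 0 ≤ a)
    {f : Space3 → ℝ} {g : Fin 3 → Space3 → ℝ} (h : InFormDomain Ω V f g)
    (hm : ∀ᵐ x ∂volume.restrict Ω, |f x| ≤ m) (hm0 : 0 ≤ m) :
    starFunctional Ω V a (fun x => (f x : ℂ)) ≤ ENNReal.ofReal (formEnergy Ω V f g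
      + 8 * Real.pi * a * m ^ 2 * ∫ x in Ω, f x ^ 2) := by
  have hsup : eLpNorm (fun x => (f x : ℂ)) ⊤ (volume.restrict Ω) ≤ ENNReal.ofReal m := by
    rw [eLpNorm_exponent_top]
    refine essSup_le_of_ae_le _ (hm.mono fun x hx => ?_)
    simp only [enorm_complex_ofReal, Real.enorm_eq_ofReal_abs]
    exact ENNReal.ofReal_le_ofReal hx
  have hπ := Real.pi_pos
  have hi0 : 0 ≤ ∫ x in Ω, f x ^ 2 := integral_nonneg fun _ => sq_nonneg _
  rw [starFunctional, ENNReal.ofReal_add (formEnergy_nonneg hV _ _) (by positivity),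
    ofReal_formEnergy hV h, lintegral_add_left', ← add_assoc]
  · refine add_le_add (add_le_add (Finset.sum_le_sum fun k _ => (h.deriv k).weakDerivSq_le)
      (by simp)) ?_
    have e : ∫⁻ x in Ω, ‖(f x : ℂ)‖ₑ ^ 2 = ENNReal.ofReal (∫ x in Ω, f x ^ 2) := by
      rw [← lintegral_enorm_sq_eq h.memLp]; simp
    rw [lintegral_const_mul'' _ (by simpa using h.memLp.1.enorm.pow_const 2), e,
      ENNReal.ofReal_mul (p := 8 * Real.pi * a * m ^ 2) (by positivity),
      ENNReal.ofReal_mul (p := 8 * Real.pi * a) (by positivity), ENNReal.ofReal_pow hm0]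
    gcongr
  · refine hVm.ennreal_ofReal.aemeasurable.mul ?_
    simpa using h.memLp.1.enorm.pow_const 2

/-- Passing to `|Φ|` does not raise the energy, by the diamagnetic inequality. Finite energy with `a
> 0` and positive mass forces `Φ` to be essentially bounded, so the supremum norm becomes a real
number `m`. From here on the variational problem concerns real triples: a function, its gradient and
a bound `m`. -/
theorem exists_form_of_starFunctional (hΩ : IsOpen Ω) (hV : ∀ x, 0 ≤ V x) (hVm : Measurable V)
    {a M : ℝ} (ha : 0 < a) (hM : 0 < M) {Φ : Space3 → ℂ}
    (hΦ : ∫⁻ x in Ω, ‖Φ x‖ₑ ^ 2 = ENNReal.ofReal M) (hfin : starFunctional Ω V a Φ ≠ ⊤) :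
    ∃ (g : Fin 3 → Space3 → ℝ) (m : ℝ), 0 ≤ m ∧ InFormDomain Ω V (fun x => ‖Φ x‖) g ∧
      (∀ᵐ x ∂volume.restrict Ω, ‖Φ x‖ ≤ m) ∧ ∫ x in Ω, ‖Φ x‖ ^ 2 = M ∧
      ENNReal.ofReal (formEnergy Ω V (fun x => ‖Φ x‖) g + 8 * Real.pi * a * m ^ 2 * M)
        ≤ starFunctional Ω V a Φ := by
  have hΦt : ∫⁻ x in Ω, ‖Φ x‖ₑ ^ 2 ≠ ⊤ := by rw [hΦ]; exact ENNReal.ofReal_ne_top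
  rw [starFunctional] at hfin
  have hw : ∀ k, weakDerivSq Ω (EuclideanSpace.single k (1 : ℝ)) Φ ≠ ⊤ := fun k h => by
    refine hfin ?_
    rw [ENNReal.sum_eq_top.2 ⟨k, Finset.mem_univ k, h⟩, top_add]
  choose g hg hgle using fun k => exists_l2WeakDeriv_norm hΩ hΦt (hw k)
  have hm : AEStronglyMeasurable Φ (volume.restrict Ω) := by
    obtain ⟨g, hg, -⟩ := exists_isWeakDeriv hΩ (hw 0)
    exact hg.1.aestronglyMeasurable
  have hL : MemLp Φ 2 (volume.restrict Ω) := memLp_two_of_lintegral hm hΦt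
  have hmV : AEMeasurable (fun x => ENNReal.ofReal (V x) * ‖Φ x‖ₑ ^ 2) (volume.restrict Ω) :=
    hVm.ennreal_ofReal.aemeasurable.mul (hm.enorm.pow_const 2)
  rw [lintegral_add_left' hmV, lintegral_const_mul'' _ (hm.enorm.pow_const 2), hΦ] at hfin
  set S := eLpNorm Φ ⊤ (volume.restrict Ω) with hS
  have hπ := Real.pi_pos
  have hSt : S ≠ ⊤ := by
    intro hS'
    refine hfin ?_
    rw [hS', ENNReal.top_pow two_ne_zero, ENNReal.mul_top (by simpa using by positivity),
      ENNReal.top_mul (by simpa using hM)]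
    simp
  have hVfin : ∫⁻ x in Ω, ENNReal.ofReal (V x) * ‖Φ x‖ₑ ^ 2 ≠ ⊤ := by
    intro h; refine hfin ?_; simp [h]
  have hint : ∫ x in Ω, ‖Φ x‖ ^ 2 = M := by
    have h1 := lintegral_enorm_sq_eq hL.norm
    simp only [enorm_norm] at h1
    rw [hΦ] at h1
    have h2 : 0 ≤ ∫ x in Ω, ‖Φ x‖ ^ 2 := integral_nonneg fun _ => sq_nonneg _
    exact ((ENNReal.ofReal_eq_ofReal_iff hM.le h2).1 h1).symm
  have hdom : InFormDomain Ω V (fun x => ‖Φ x‖) g := by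
    refine ⟨hg, ⟨hVm.aestronglyMeasurable.mul (hm.norm.pow 2), ?_⟩⟩
    rw [hasFiniteIntegral_iff_enorm]
    refine lt_of_le_of_lt (lintegral_mono fun x => le_of_eq ?_) (lt_top_iff_ne_top.2 hVfin)
    rw [enorm_mul, enorm_pow, enorm_norm, Real.enorm_eq_ofReal (hV x)]
  refine ⟨g, S.toReal, ENNReal.toReal_nonneg, hdom, ?_, hint, ?_⟩
  · have := ae_le_eLpNormEssSup (f := Φ) (μ := volume.restrict Ω)
    filter_upwards [this] with x hx
    rw [← eLpNorm_exponent_top, ← hS] at hx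
    have := ENNReal.toReal_mono hSt hx
    simpa using this
  · rw [starFunctional, ENNReal.ofReal_add (formEnergy_nonneg hV _ _) (by positivity),
      ofReal_formEnergy hV hdom, lintegral_add_left' hmV, ← add_assoc]
    refine add_le_add (add_le_add (Finset.sum_le_sum fun k _ => hgle k) (by simp)) ?_
    rw [lintegral_const_mul'' _ (hm.enorm.pow_const 2), hΦ,
      ENNReal.ofReal_mul (p := 8 * Real.pi * a * S.toReal ^ 2) (by positivity),
      ENNReal.ofReal_mul (p := 8 * Real.pi * a) (by positivity),
      ENNReal.ofReal_pow ENNReal.toReal_nonneg,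
      ENNReal.ofReal_toReal hSt]

end Star

theorem integral_add_mul_sq {α : Type*} {m : MeasurableSpace α} {μ : Measure α} {u v : α → ℝ}
    (hu : MemLp u 2 μ) (hv : MemLp v 2 μ) (t : ℝ) :
    ∫ x, (u x + t * v x) ^ 2 ∂μ = (∫ x, u x ^ 2 ∂μ) + 2 * t * (∫ x, u x * v x ∂μ)
      + t ^ 2 * ∫ x, v x ^ 2 ∂μ := by
  have huv : Integrable (fun x => u x * v x) μ := hu.integrable_mul hv
  have h1 := integral_add (hu.integrable_sq.add (huv.const_mul (2 * t)))
    (hv.integrable_sq.const_mul (t ^ 2))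
  have h2 := integral_add hu.integrable_sq (huv.const_mul (2 * t))
  simp only [Pi.add_apply] at h1
  rw [← integral_const_mul, ← integral_const_mul, ← h2, ← h1]
  exact integral_congr_ae (Eventually.of_forall fun x => by simp only; ring)

theorem nonneg_of_forall_quadratic {b c : ℝ} (h : ∀ t > 0, 0 ≤ 2 * t * b + t ^ 2 * c) : 0 ≤ b := by
  have h1 : Tendsto (fun t : ℝ => 2 * b + t * c) (𝓝[>] 0) (𝓝 (2 * b + 0 * c)) :=
    ((continuous_const.add (continuous_id.mul continuous_const)).tendsto 0).mono_left
      nhdsWithin_le_nhds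
  have := ge_of_tendsto h1 (b := 0) (by
    filter_upwards [self_mem_nhdsWithin] with t ht
    have := h t ht
    have ht' : (0 : ℝ) < t := ht
    by_contra hn
    nlinarith)
  linarith

/-- The bilinear form of `-Δ + V`. -/
noncomputable def formInner (Ω : Set Space3) (V : Space3 → ℝ) (f : Space3 → ℝ)
    (g : Fin 3 → Space3 → ℝ) (f' : Space3 → ℝ) (g' : Fin 3 → Space3 → ℝ) : ℝ :=
  (∑ k, ∫ x in Ω, g k x * g' k x) + ∫ x in Ω, V x * (f x * f' x)

section Form

variable {Ω : Set Space3} {V : Space3 → ℝ} {f f' : Space3 → ℝ} {g g' : Fin 3 → Space3 → ℝ}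

theorem InFormDomain.memLp_sqrt_mul (hV : ∀ x, 0 ≤ V x) (hVm : Measurable V)
    (h : InFormDomain Ω V f g) : MemLp (fun x => √(V x) * f x) 2 (volume.restrict Ω) := by
  refine (memLp_two_iff_integrable_sq
    (hVm.sqrt.aestronglyMeasurable.mul h.memLp.1)).2 (h.pot.congr ?_)
  exact Eventually.of_forall fun x => by simp only [Pi.mul_apply]; rw [mul_pow, Real.sq_sqrt (hV x)]

theorem inFormDomain_of_memLp_sqrt_mul (hV : ∀ x, 0 ≤ V x)
    (hd : ∀ k, L2WeakDeriv Ω (unitVec k) f (g k))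
    (h : MemLp (fun x => √(V x) * f x) 2 (volume.restrict Ω)) : InFormDomain Ω V f g :=
  ⟨hd, h.integrable_sq.congr (Eventually.of_forall fun x => by
    simp only; rw [mul_pow, Real.sq_sqrt (hV x)])⟩

theorem formEnergy_eq_sqrt (hV : ∀ x, 0 ≤ V x) :
    formEnergy Ω V f g = (∑ k, ∫ x in Ω, g k x ^ 2) + ∫ x in Ω, (√(V x) * f x) ^ 2 := by
  simp only [formEnergy, mul_pow, Real.sq_sqrt (hV _)]

theorem formInner_eq_sqrt (hV : ∀ x, 0 ≤ V x) :
    formInner Ω V f g f' g' = (∑ k, ∫ x in Ω, g k x * g' k x)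
      + ∫ x in Ω, (√(V x) * f x) * (√(V x) * f' x) := by
  rw [formInner]
  congr 2
  ext x
  rw [mul_mul_mul_comm, Real.mul_self_sqrt (hV x)]

theorem InFormDomain.add_mul (hV : ∀ x, 0 ≤ V x) (hVm : Measurable V) (h : InFormDomain Ω V f g)
    (h' : InFormDomain Ω V f' g') (t : ℝ) :
    InFormDomain Ω V (fun x => f x + t * f' x) (fun k x => g k x + t * g' k x) := by
  refine inFormDomain_of_memLp_sqrt_mul hV (fun k => (h.deriv k).add ((h'.deriv k).const_mul t)) ?_
  refine ((h.memLp_sqrt_mul hV hVm).add ((h'.memLp_sqrt_mul hV hVm).const_mul t)).ae_eq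
    (Eventually.of_forall fun x => ?_)
  simp only [Pi.add_apply]; ring

theorem formEnergy_add_mul (hV : ∀ x, 0 ≤ V x) (hVm : Measurable V) (h : InFormDomain Ω V f g)
    (h' : InFormDomain Ω V f' g') (t : ℝ) :
    formEnergy Ω V (fun x => f x + t * f' x) (fun k x => g k x + t * g' k x)
      = formEnergy Ω V f g + 2 * t * formInner Ω V f g f' g' + t ^ 2 * formEnergy Ω V f' g' := by
  rw [formEnergy_eq_sqrt hV, formEnergy_eq_sqrt hV, formEnergy_eq_sqrt hV, formInner_eq_sqrt hV]
  simp only [integral_add_mul_sq (h.deriv _).2.1 (h'.deriv _).2.1]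
  have := integral_add_mul_sq (h.memLp_sqrt_mul hV hVm) (h'.memLp_sqrt_mul hV hVm) t
  have e : ∫ x in Ω, (√(V x) * (f x + t * f' x)) ^ 2
      = ∫ x in Ω, (√(V x) * f x + t * (√(V x) * f' x)) ^ 2 := by
    congr 1; ext x; ring
  rw [e, this, Finset.sum_add_distrib, Finset.sum_add_distrib, ← Finset.mul_sum, ← Finset.mul_sum]
  ring

theorem InFormDomain.congr (h : InFormDomain Ω V f g) (hf : f =ᵐ[volume.restrict Ω] f')
    (hg : ∀ k, g k =ᵐ[volume.restrict Ω] g' k) : InFormDomain Ω V f' g' :=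
  ⟨fun k => (h.deriv k).congr hf (hg k), h.pot.congr (by
    filter_upwards [hf] with x hx; rw [hx])⟩

/-- The truncation `min f K` of a function in the form domain. -/
theorem InFormDomain.truncate (hΩ : IsOpen Ω) (hV : ∀ x, 0 ≤ V x) (hVm : Measurable V)
    (h : InFormDomain Ω V f g) (h0 : ∀ᵐ x ∂volume.restrict Ω, 0 ≤ f x) {K : ℝ} (hK : 0 ≤ K) :
    InFormDomain Ω V (fun x => min (f x) K) (fun k x => if K < f x then 0 else g k x) := by
  have hd : ∀ k, L2WeakDeriv Ω (unitVec k) (fun x => min (f x) K)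
      (fun x => if K < f x then 0 else g k x) := fun k => by
    refine ((h.deriv k).sub ((h.deriv k).posPart_sub hΩ hK)).congr
      (Eventually.of_forall fun x => ?_) (Eventually.of_forall fun x => ?_)
    · simp only
      rcases le_total (f x) K with h | h
      · rw [max_eq_right (by linarith), min_eq_left h, sub_zero]
      · rw [max_eq_left (by linarith), min_eq_right h]; ring
    · simp only
      split_ifs <;> simp
  refine ⟨hd, h.pot.mono (hVm.aestronglyMeasurable.mul ((hd 0).1.1.pow 2)) ?_⟩
  filter_upwards [h0] with x hx
  rw [Real.norm_of_nonneg (mul_nonneg (hV x) (sq_nonneg _)),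
    Real.norm_of_nonneg (mul_nonneg (hV x) (sq_nonneg _))]
  refine mul_le_mul_of_nonneg_left ?_ (hV x)
  exact pow_le_pow_left₀ (le_min hx hK) (min_le_left _ _) 2

/-- The Dirichlet integral splits over `{K < f}` and its complement, and truncation keeps only the
latter. The potential energy does not grow because `0 ≤ min f K ≤ f`. -/
theorem formEnergy_min_le (hΩ : IsOpen Ω) (hV : ∀ x, 0 ≤ V x) (hVm : Measurable V)
    (h : InFormDomain Ω V f g) (h0 : ∀ᵐ x ∂volume.restrict Ω, 0 ≤ f x) {K : ℝ} (hK : 0 ≤ K) :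
    formEnergy Ω V (fun x => min (f x) K) (fun k x => if K < f x then 0 else g k x)
      + ∑ k, ∫ x in Ω, (if K < f x then g k x else 0) ^ 2 ≤ formEnergy Ω V f g := by
  have hm := h.truncate hΩ hV hVm h0 hK
  have e : ∀ k, ∫ x in Ω, g k x ^ 2 = (∫ x in Ω, (if K < f x then 0 else g k x) ^ 2)
      + ∫ x in Ω, (if K < f x then g k x else 0) ^ 2 := fun k => by
    rw [← integral_add (hm.deriv k).2.1.integrable_sq
      ((h.deriv k).posPart_sub hΩ hK).2.1.integrable_sq]
    congr 1; ext x; split_ifs <;> simp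
  have hpot : ∫ x in Ω, V x * min (f x) K ^ 2 ≤ ∫ x in Ω, V x * f x ^ 2 := by
    refine integral_mono_ae hm.pot h.pot ?_
    filter_upwards [h0] with x hx
    exact mul_le_mul_of_nonneg_left (pow_le_pow_left₀ (le_min hx hK) (min_le_left _ _) 2) (hV x)
  simp only [formEnergy, e, Finset.sum_add_distrib]
  linarith

end Form

/-- `f ≥ 0`, with weak gradient `g` and `f ≤ m`, is a normalized minimizer, with energy `e`, of the
form of `-Δ + V` plus `8πA` times the square of the supremum. -/
structure IsStarMin (Ω : Set Space3) (V : Space3 → ℝ) (A e : ℝ) (f : Space3 → ℝ)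
    (g : Fin 3 → Space3 → ℝ) (m : ℝ) : Prop where
  dom : InFormDomain Ω V f g
  nonneg : ∀ x, 0 ≤ f x
  mass : ∫ x in Ω, f x ^ 2 = 1
  sup_nonneg : 0 ≤ m
  le_sup : ∀ᵐ x ∂volume.restrict Ω, f x ≤ m
  energy_le : formEnergy Ω V f g + 8 * Real.pi * A * m ^ 2 ≤ e
  -- Both sides are homogeneous of degree two, so competitors need not be normalized, and `m'` may
  -- be any bound for `|f'|`, not just the least one.
  lower : ∀ f' g' m', InFormDomain Ω V f' g' → 0 ≤ m' →
    (∀ᵐ x ∂volume.restrict Ω, |f' x| ≤ m') →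
    e * ∫ x in Ω, f' x ^ 2 ≤ formEnergy Ω V f' g' + 8 * Real.pi * A * m' ^ 2

/-! ### Variational inequalities for a minimizer. -/

section StarMin

variable {Ω : Set Space3} {V : Space3 → ℝ} {A e : ℝ} {f η : Space3 → ℝ}
  {g gη : Fin 3 → Space3 → ℝ} {m : ℝ}

/-- A minimizer is a supersolution. -/
theorem IsStarMin.formInner_nonneg (h : IsStarMin Ω V A e f g m) (he : 0 ≤ e) (hΩ : IsOpen Ω)
    (hV : ∀ x, 0 ≤ V x) (hVm : Measurable V) (hη : InFormDomain Ω V η gη)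
    (hη0 : ∀ᵐ x ∂volume.restrict Ω, 0 ≤ η x) : 0 ≤ formInner Ω V f g η gη := by
  refine nonneg_of_forall_quadratic (c := formEnergy Ω V η gη) fun t ht => ?_
  have hd := h.dom.add_mul hV hVm hη t
  have h0 : ∀ᵐ x ∂volume.restrict Ω, 0 ≤ f x + t * η x := by
    filter_upwards [hη0] with x hx
    exact add_nonneg (h.nonneg x) (mul_nonneg ht.le hx)
  -- The competitor is `min (f + tη) m`. Truncation at `m` keeps the supremum term fixed and does
  -- not raise the form energy, and the mass stays at least one because `f ≤ min (f + tη) m`. Only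
  -- the first variation of the quadratic form remains.
  have hmin := hd.truncate hΩ hV hVm h0 h.sup_nonneg
  have h1 := h.lower _ _ m hmin h.sup_nonneg (by
    filter_upwards [h0] with x hx
    rw [abs_of_nonneg (le_min hx h.sup_nonneg)]
    exact min_le_right _ _)
  have h2 := formEnergy_min_le hΩ hV hVm hd h0 h.sup_nonneg
  have h3 : 0 ≤ ∑ k, ∫ x in Ω, (if m < f x + t * η x then g k x + t * gη k x else 0) ^ 2 :=
    Finset.sum_nonneg fun k _ => integral_nonneg fun x => sq_nonneg _
  have h4 : 1 ≤ ∫ x in Ω, min (f x + t * η x) m ^ 2 := by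
    rw [← h.mass]
    refine integral_mono_ae h.dom.memLp.integrable_sq hmin.memLp.integrable_sq ?_
    filter_upwards [hη0, h.le_sup] with x hx hx2
    exact pow_le_pow_left₀ (h.nonneg x) (le_min (by nlinarith) hx2) 2
  rw [formEnergy_add_mul hV hVm h.dom hη] at h2
  have h5 := h.energy_le
  nlinarith

/-- A Caccioppoli inequality without cutoff: the competitor `min f K` obeys the same bound `m`, so
the gradient energy it saves is at most `e` times the mass it loses. -/
theorem IsStarMin.gradient_superlevel_le (h : IsStarMin Ω V A e f g m) (hΩ : IsOpen Ω)
    (hV : ∀ x, 0 ≤ V x) (hVm : Measurable V) {K : ℝ} (hK : 0 ≤ K) :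
    ∑ k, ∫ x in Ω, (if K < f x then g k x else 0) ^ 2
      ≤ e * ∫ x in Ω, (f x ^ 2 - min (f x) K ^ 2) := by
  have h0 : ∀ᵐ x ∂volume.restrict Ω, 0 ≤ f x := Eventually.of_forall h.nonneg
  have hmin := h.dom.truncate hΩ hV hVm h0 hK
  have h1 := h.lower _ _ m hmin h.sup_nonneg (by
    filter_upwards [h.le_sup] with x hx
    rw [abs_of_nonneg (le_min (h.nonneg x) hK)]
    exact (min_le_left _ _).trans hx)
  have h2 := formEnergy_min_le hΩ hV hVm h.dom h0 hK
  rw [integral_sub h.dom.memLp.integrable_sq hmin.memLp.integrable_sq, h.mass]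
  have h5 := h.energy_le
  nlinarith

end StarMin

/-! ### Existence of a one-particle minimizer. -/

section Lp

variable {α : Type*} {m : MeasurableSpace α} {μ : Measure α}

theorem norm_toLp_two_sq {u : α → ℝ} (hu : MemLp u 2 μ) :
    ‖hu.toLp u‖ ^ 2 = ∫ x, u x ^ 2 ∂μ := by
  rw [Lp.norm_toLp, ← ENNReal.toReal_pow, eLpNorm_two_sq, lintegral_enorm_sq_eq hu,
    ENNReal.toReal_ofReal (integral_nonneg fun _ => sq_nonneg _)]

theorem norm_Lp_two_sq (u : Lp ℝ 2 μ) : ‖u‖ ^ 2 = ∫ x, u x ^ 2 ∂μ := by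
  conv_lhs => rw [← Lp.toLp_coeFn u (Lp.memLp u)]
  exact norm_toLp_two_sq (Lp.memLp u)

theorem dist_toLp_two_sq {u v : α → ℝ} (hu : MemLp u 2 μ) (hv : MemLp v 2 μ) :
    dist (hu.toLp u) (hv.toLp v) ^ 2 = ∫ x, (u x + (-1) * v x) ^ 2 ∂μ := by
  rw [dist_eq_norm, ← MemLp.toLp_sub, norm_toLp_two_sq]
  congr 1; ext x; simp only [Pi.sub_apply]; ring

theorem cauchySeq_toLp {u : ℕ → α → ℝ} (hu : ∀ n, MemLp (u n) 2 μ) {D : ℕ × ℕ → ℝ}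
    (hD : Tendsto D atTop (𝓝 0))
    (h : ∀ n, ∫ x, (u n.1 x + (-1) * u n.2 x) ^ 2 ∂μ ≤ D n) :
    CauchySeq fun n => (hu n).toLp (u n) := by
  rw [cauchySeq_iff_tendsto_dist_atTop_0]
  have h1 : Tendsto (fun n => √(D n)) atTop (𝓝 0) := by
    have := (Real.continuous_sqrt.tendsto 0).comp hD
    rwa [Real.sqrt_zero] at this
  refine squeeze_zero (fun _ => dist_nonneg) (fun n => ?_) h1
  refine Real.le_sqrt_of_sq_le ?_
  rw [dist_toLp_two_sq]
  exact h n

theorem tendsto_integral_mul_of_tendsto_toLp {u : ℕ → α → ℝ} (hu : ∀ n, MemLp (u n) 2 μ)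
    {U : Lp ℝ 2 μ} (h : Tendsto (fun n => (hu n).toLp (u n)) atTop (𝓝 U)) {w : α → ℝ}
    (hw : MemLp w 2 μ) :
    Tendsto (fun n => ∫ x, w x * u n x ∂μ) atTop (𝓝 (∫ x, w x * U x ∂μ)) := by
  have h1 : ∀ F : Lp ℝ 2 μ, inner ℝ (hw.toLp w) F = ∫ x, w x * F x ∂μ := fun F => by
    rw [L2.inner_def]
    refine integral_congr_ae ?_
    filter_upwards [hw.coeFn_toLp] with x hx
    rw [hx]; simp [mul_comm]
  have h2 := (tendsto_const_nhds (x := hw.toLp w)).inner (𝕜 := ℝ) h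
  simp only [h1] at h2
  refine h2.congr fun n => integral_congr_ae ?_
  filter_upwards [(hu n).coeFn_toLp] with x hx
  rw [hx]

theorem exists_subseq_tendsto_ae_of_toLp {u : ℕ → α → ℝ} (hu : ∀ n, MemLp (u n) 2 μ)
    {U : Lp ℝ 2 μ} (h : Tendsto (fun n => (hu n).toLp (u n)) atTop (𝓝 U)) :
    ∃ ns : ℕ → ℕ, StrictMono ns ∧ ∀ᵐ x ∂μ, Tendsto (fun j => u (ns j) x) atTop (𝓝 (U x)) := by
  obtain ⟨ns, h1, h2⟩ := (tendstoInMeasure_of_tendsto_Lp h).exists_seq_tendsto_ae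
  refine ⟨ns, h1, ?_⟩
  filter_upwards [h2, ae_all_iff.2 fun n => (hu n).coeFn_toLp] with x hx hx2
  simpa only [hx2] using hx

end Lp

theorem L2WeakDeriv.of_tendsto_toLp {X : Type*} [NormedAddCommGroup X] [NormedSpace ℝ X]
    [MeasureSpace X] [FiniteDimensional ℝ X] [BorelSpace X] [(volume : Measure X).IsAddHaarMeasure]
    {U : Set X} {w : X} {u v : ℕ → X → ℝ} (h : ∀ n, L2WeakDeriv U w (u n) (v n))
    {F G : Lp ℝ 2 (volume.restrict U)}
    (hu : Tendsto (fun n => (h n).1.toLp (u n)) atTop (𝓝 F))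
    (hv : Tendsto (fun n => (h n).2.1.toLp (v n)) atTop (𝓝 G)) : L2WeakDeriv U w F G := by
  refine ⟨Lp.memLp F, Lp.memLp G, fun η h1 h2 h3 => ?_⟩
  have m1 : MemLp (fun x => fderiv ℝ η x w) 2 (volume.restrict U) :=
    ((continuous_fderiv_apply_test h1 w).memLp_of_hasCompactSupport (h2.fderiv_apply ℝ w))
  have m2 : MemLp η 2 (volume.restrict U) := h1.continuous.memLp_of_hasCompactSupport h2
  have t1 := tendsto_integral_mul_of_tendsto_toLp _ hu m1
  have t2 := (tendsto_integral_mul_of_tendsto_toLp _ hv m2).neg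
  refine tendsto_nhds_unique t1 (t2.congr fun n => ((h n).2.2 η h1 h2 h3).symm)

section Existence

variable {Ω : Set Space3} {V : Space3 → ℝ} {A e : ℝ}

/-- Strong `L²` convergence of a minimizing sequence improves to convergence in the form norm. The
lower bound is applied to `fₙ + fₖ`, whose supremum is at most `mₙ + mₖ`; with the parallelogram law
and `(mₙ + mₖ)² ≤ 2mₙ² + 2mₖ²`, the form energy of `fₙ - fₖ` is at most `2εₙ + 2εₖ + e ‖fₙ - fₖ‖²`.
No weak compactness is needed. -/
theorem exists_isStarMin_of_tendsto (hV : ∀ x, 0 ≤ V x) (hVm : Measurable V)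
    (hA : 0 ≤ A) {f : ℕ → Space3 → ℝ} {g : ℕ → Fin 3 → Space3 → ℝ} {mm ε : ℕ → ℝ} {m : ℝ}
    (dom : ∀ n, InFormDomain Ω V (f n) (g n)) (nonneg : ∀ n x, 0 ≤ f n x)
    (mass : ∀ n, ∫ x in Ω, f n x ^ 2 = 1) (hmm : ∀ n, 0 ≤ mm n)
    (le_sup : ∀ n, ∀ᵐ x ∂volume.restrict Ω, f n x ≤ mm n)
    (energy_le : ∀ n, formEnergy Ω V (f n) (g n) + 8 * Real.pi * A * mm n ^ 2 ≤ e + ε n)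
    (hε : Tendsto ε atTop (𝓝 0))
    (lower : ∀ f' g' m', InFormDomain Ω V f' g' → 0 ≤ m' →
      (∀ᵐ x ∂volume.restrict Ω, |f' x| ≤ m') →
      e * ∫ x in Ω, f' x ^ 2 ≤ formEnergy Ω V f' g' + 8 * Real.pi * A * m' ^ 2)
    {F : Lp ℝ 2 (volume.restrict Ω)}
    (hF : Tendsto (fun n => (dom n).memLp.toLp (f n)) atTop (𝓝 F)) (hm : Tendsto mm atTop (𝓝 m)) :
    ∃ f g, IsStarMin Ω V A e f g m := by
  have hAπ : 0 ≤ 8 * Real.pi * A := by have := Real.pi_pos; positivity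
  set D : ℕ × ℕ → ℝ := fun n => 2 * ε n.1 + 2 * ε n.2
    + e * ∫ x in Ω, (f n.1 x + (-1) * f n.2 x) ^ 2 with hDdef
  have hDt : Tendsto D atTop (𝓝 0) := by
    have h1 := cauchySeq_iff_tendsto_dist_atTop_0.1 hF.cauchySeq
    have h2 : Tendsto (fun n : ℕ × ℕ => ε n.1) atTop (𝓝 0) := by
      rw [← prod_atTop_atTop_eq]; exact hε.comp tendsto_fst
    have h3 : Tendsto (fun n : ℕ × ℕ => ε n.2) atTop (𝓝 0) := by
      rw [← prod_atTop_atTop_eq]; exact hε.comp tendsto_snd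
    have h4 := ((h2.const_mul 2).add (h3.const_mul 2)).add ((h1.pow 2).const_mul e)
    simp only [dist_toLp_two_sq] at h4
    refine (h4.congr fun n => ?_).trans_eq (by simp)
    rfl
  have hTD : ∀ n : ℕ × ℕ, formEnergy Ω V (fun x => f n.1 x + (-1) * f n.2 x)
      (fun k x => g n.1 k x + (-1) * g n.2 k x) ≤ D n := fun n => by
    have h1 := formEnergy_add_mul hV hVm (dom n.1) (dom n.2) 1
    have h2 := formEnergy_add_mul hV hVm (dom n.1) (dom n.2) (-1)
    have h3 := integral_add_mul_sq (dom n.1).memLp (dom n.2).memLp 1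
    have h4 := integral_add_mul_sq (dom n.1).memLp (dom n.2).memLp (-1)
    have h5 := lower _ _ (mm n.1 + mm n.2) ((dom n.1).add_mul hV hVm (dom n.2) 1)
      (add_nonneg (hmm _) (hmm _)) (by
        filter_upwards [le_sup n.1, le_sup n.2] with x hx hx2
        rw [abs_of_nonneg (by have := nonneg n.1 x; have := nonneg n.2 x; linarith)]
        linarith)
    have h6 := energy_le n.1
    have h7 := energy_le n.2
    have h8 : 8 * Real.pi * A * (mm n.1 + mm n.2) ^ 2
        ≤ 8 * Real.pi * A * (2 * mm n.1 ^ 2 + 2 * mm n.2 ^ 2) :=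
      mul_le_mul_of_nonneg_left (by nlinarith [sq_nonneg (mm n.1 - mm n.2)]) hAπ
    rw [h3] at h5
    simp only [hDdef]
    rw [h4]
    rw [mass, mass] at *
    nlinarith
  have part : ∀ n : ℕ × ℕ, (∀ k, ∫ x in Ω, (g n.1 k x + (-1) * g n.2 k x) ^ 2 ≤ D n) ∧
      ∫ x in Ω, (√(V x) * f n.1 x + (-1) * (√(V x) * f n.2 x)) ^ 2 ≤ D n := fun n => by
    have h1 := hTD n
    rw [formEnergy_eq_sqrt hV] at h1
    have h2 : ∀ k, 0 ≤ ∫ x in Ω, (g n.1 k x + (-1) * g n.2 k x) ^ 2 :=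
      fun k => integral_nonneg fun _ => sq_nonneg _
    have h3 : 0 ≤ ∫ x in Ω, (√(V x) * (f n.1 x + (-1) * f n.2 x)) ^ 2 :=
      integral_nonneg fun _ => sq_nonneg _
    have h4 : ∫ x in Ω, (√(V x) * f n.1 x + (-1) * (√(V x) * f n.2 x)) ^ 2
        = ∫ x in Ω, (√(V x) * (f n.1 x + (-1) * f n.2 x)) ^ 2 := by
      congr 1; ext x; ring
    constructor
    · intro k
      have := Finset.single_le_sum (fun k _ => h2 k) (Finset.mem_univ k)
      linarith
    · have := Finset.sum_nonneg fun k (_ : k ∈ Finset.univ) => h2 k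
      rw [h4]; linarith
  have hg2 : ∀ k n, MemLp (g n k) 2 (volume.restrict Ω) := fun k n => ((dom n).deriv k).2.1
  have hp2 : ∀ n, MemLp (fun x => √(V x) * f n x) 2 (volume.restrict Ω) :=
    fun n => (dom n).memLp_sqrt_mul hV hVm
  choose G hG using fun k => cauchySeq_tendsto_of_complete
    (cauchySeq_toLp (hg2 k) hDt fun n => (part n).1 k)
  obtain ⟨P, hP⟩ := cauchySeq_tendsto_of_complete (cauchySeq_toLp hp2 hDt fun n => (part n).2)
  obtain ⟨ns, hns, hae⟩ := exists_subseq_tendsto_ae_of_toLp (fun n => (dom n).memLp) hF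
  obtain ⟨ms, hms, haeP⟩ := exists_subseq_tendsto_ae_of_toLp (fun n => hp2 (ns n))
    (hP.comp hns.tendsto_atTop)
  -- The `L²` limit of `√V fₙ` is identified through a subsequence along which both sequences
  -- converge almost everywhere.
  have hP' : ∀ᵐ x ∂volume.restrict Ω, P x = √(V x) * F x := by
    filter_upwards [hae, haeP] with x hx hx2
    exact tendsto_nhds_unique hx2 ((hx.comp hms.tendsto_atTop).const_mul _)
  have hF0 : ∀ᵐ x ∂volume.restrict Ω, 0 ≤ F x := by
    filter_upwards [hae] with x hx
    exact ge_of_tendsto' hx fun j => nonneg _ _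
  have hFm : ∀ᵐ x ∂volume.restrict Ω, F x ≤ m := by
    filter_upwards [hae, ae_all_iff.2 le_sup] with x hx hx2
    exact le_of_tendsto_of_tendsto' hx (hm.comp hns.tendsto_atTop) fun j => hx2 _
  have hdF : InFormDomain Ω V F (fun k => G k) :=
    inFormDomain_of_memLp_sqrt_mul hV
      (fun k => L2WeakDeriv.of_tendsto_toLp (fun n => (dom n).deriv k) hF (hG k))
      ((Lp.memLp P).ae_eq hP')
  -- `IsStarMin` asks for nonnegativity at every point, so the representative is changed on a null
  -- set.
  have hFe : F =ᵐ[volume.restrict Ω] fun x => max (F x) 0 := by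
    filter_upwards [hF0] with x hx
    rw [max_eq_left hx]
  have hmass : ∫ x in Ω, F x ^ 2 = 1 := by
    rw [← norm_Lp_two_sq]
    refine tendsto_nhds_unique (hF.norm.pow 2) ?_
    simp only [norm_toLp_two_sq, mass]
    exact tendsto_const_nhds
  have hen : formEnergy Ω V F (fun k => G k) + 8 * Real.pi * A * m ^ 2 ≤ e := by
    have e1 : formEnergy Ω V F (fun k => G k) = (∑ k, ‖G k‖ ^ 2) + ‖P‖ ^ 2 := by
      rw [formEnergy_eq_sqrt hV, norm_Lp_two_sq]
      simp only [norm_Lp_two_sq]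
      congr 1
      refine integral_congr_ae ?_
      filter_upwards [hP'] with x hx
      rw [hx]
    have t1 := ((tendsto_finsetSum Finset.univ fun k _ => (hG k).norm.pow 2).add
      (hP.norm.pow 2)).add ((hm.pow 2).const_mul (8 * Real.pi * A))
    rw [e1]
    have t2 := (tendsto_const_nhds (x := e)).add hε
    rw [add_zero] at t2
    refine le_of_tendsto_of_tendsto' t1 t2 fun n => ?_
    have := energy_le n
    rw [formEnergy_eq_sqrt hV] at this
    simpa only [norm_toLp_two_sq] using this
  refine ⟨fun x => max (F x) 0, fun k => G k, hdF.congr hFe fun k => ae_eq_refl _,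
    fun x => le_max_right _ _, ?_, ge_of_tendsto' hm hmm, ?_, ?_, lower⟩
  · rw [← hmass]
    refine integral_congr_ae ?_
    filter_upwards [hFe] with x hx
    rw [← hx]
  · filter_upwards [hFe, hFm] with x hx hx2
    rw [← hx]; exact hx2
  · refine le_trans (le_of_eq ?_) hen
    congr 1
    simp only [formEnergy]
    congr 1
    refine integral_congr_ae ?_
    filter_upwards [hFe] with x hx
    rw [← hx]

/-- Lipschitz functions with compact support are in the form domain. -/
theorem inFormDomain_of_lipschitz (hΩ : MeasurableSet Ω) (hV : ∀ x, 0 ≤ V x) (hVm : Measurable V)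
    (hVb : ∀ R : ℝ, ∃ M : ℝ, ∀ x, ‖x‖ ≤ R → V x ≤ M) {F : Space3 → ℝ} {L : ℝ≥0}
    (hF : LipschitzWith L F) (hc : HasCompactSupport F) :
    InFormDomain Ω V F fun k x => lineDeriv ℝ F x (unitVec k) := by
  have hd : ∀ k, L2WeakDeriv Ω (unitVec k) F (fun x => lineDeriv ℝ F x (unitVec k)) :=
    fun k => L2WeakDeriv.of_lipschitz_hasCompactSupport hΩ hF hc
  have hK : IsCompact (tsupport F) := hc
  obtain ⟨R, hR⟩ := hK.isBounded.exists_norm_le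
  obtain ⟨M, hM⟩ := hVb R
  refine ⟨hd, ((hd 0).1.integrable_sq.const_mul M).mono'
    (hVm.aestronglyMeasurable.mul ((hd 0).1.1.pow 2)) (Eventually.of_forall fun x => ?_)⟩
  rw [Real.norm_of_nonneg (mul_nonneg (hV x) (sq_nonneg _))]
  by_cases hx : x ∈ tsupport F
  · exact mul_le_mul_of_nonneg_right (hM x (hR x hx)) (sq_nonneg _)
  · rw [image_eq_zero_of_notMem_tsupport hx]; simp

/-- A Lipschitz cut-off function that is `1` on the ball of radius `R`. -/
noncomputable def cutoff (R : ℝ) (x : Space3) : ℝ := max 0 (min 1 (R + 1 - ‖x‖))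

theorem cutoff_nonneg (R : ℝ) (x : Space3) : 0 ≤ cutoff R x := le_max_left _ _

theorem cutoff_le_one (R : ℝ) (x : Space3) : cutoff R x ≤ 1 :=
  max_le zero_le_one (min_le_left _ _)

theorem cutoff_eq_one {R : ℝ} {x : Space3} (h : ‖x‖ ≤ R) : cutoff R x = 1 := by
  rw [cutoff, min_eq_left (by linarith), max_eq_right zero_le_one]

theorem lipschitzWith_cutoff (R : ℝ) : LipschitzWith 1 (cutoff R) := by
  have h1 : LipschitzWith 1 fun x : Space3 => R + 1 - ‖x‖ := by
    refine LipschitzWith.of_dist_le_mul fun x y => ?_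
    rw [Real.dist_eq, NNReal.coe_one, one_mul, dist_eq_norm, show R + 1 - ‖x‖ - (R + 1 - ‖y‖)
      = ‖y‖ - ‖x‖ by ring, norm_sub_rev]
    exact abs_norm_sub_norm_le _ _
  exact (h1.const_min 1).const_max 0

theorem hasCompactSupport_cutoff (R : ℝ) : HasCompactSupport (cutoff R) := by
  refine HasCompactSupport.intro (isCompact_closedBall (0 : Space3) (R + 1)) fun x hx => ?_
  rw [mem_closedBall_zero_iff, not_le] at hx
  rw [cutoff, max_eq_left ((min_le_right _ _).trans (by linarith))]

/-- There is a normalized bounded nonnegative function in the form domain. -/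
theorem exists_normalized (hΩ : IsTrap Ω V) (hV : ∀ x, 0 ≤ V x) (hVm : Measurable V)
    (hVb : ∀ R : ℝ, ∃ M : ℝ, ∀ x, ‖x‖ ≤ R → V x ≤ M) :
    ∃ f g m, InFormDomain Ω V f g ∧ 0 ≤ m ∧ (∀ x, |f x| ≤ m) ∧ ∫ x in Ω, f x ^ 2 = 1 := by
  obtain ⟨x₀, hx₀⟩ := hΩ.nonempty
  have hd := inFormDomain_of_lipschitz hΩ.isOpen.measurableSet hV hVm hVb
    (lipschitzWith_cutoff (‖x₀‖ + 1)) (hasCompactSupport_cutoff _)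
  have hpos : 0 < ∫ x in Ω, cutoff (‖x₀‖ + 1) x ^ 2 := by
    rw [integral_pos_iff_support_of_nonneg (fun _ => sq_nonneg _) hd.memLp.integrable_sq]
    have hO : IsOpen (Ω ∩ Metric.ball x₀ 1) := hΩ.isOpen.inter Metric.isOpen_ball
    have h1 : 0 < volume (Ω ∩ Metric.ball x₀ 1) :=
      hO.measure_pos _ ⟨x₀, hx₀, Metric.mem_ball_self one_pos⟩
    refine h1.trans_le ?_
    rw [Measure.restrict_apply' hΩ.isOpen.measurableSet]
    refine measure_mono fun x hx => ⟨?_, hx.1⟩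
    have : ‖x‖ ≤ ‖x₀‖ + 1 := by
      have := hx.2
      rw [mem_ball_iff_norm] at this
      have := norm_le_norm_add_norm_sub' x x₀
      linarith
    simp [cutoff_eq_one this]
  set c := ∫ x in Ω, cutoff (‖x₀‖ + 1) x ^ 2
  have hs : 0 < √c := Real.sqrt_pos.2 hpos
  refine ⟨_, _, (√c)⁻¹, hd.const_mul (√c)⁻¹, by positivity, fun x => ?_, ?_⟩
  · rw [abs_mul, abs_of_pos (inv_pos.2 hs), abs_of_nonneg (cutoff_nonneg _ _)]
    exact mul_le_of_le_one_right (by positivity) (cutoff_le_one _ _)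
  · simp only [mul_pow]
    rw [integral_const_mul, inv_pow, Real.sq_sqrt hpos.le]
    exact inv_mul_cancel₀ hpos.ne'

theorem starEnergy_le (hV : ∀ x, 0 ≤ V x) (hVm : Measurable V) (hA : 0 ≤ A) {M m : ℝ}
    {f : Space3 → ℝ} {g : Fin 3 → Space3 → ℝ} (h : InFormDomain Ω V f g)
    (hm : ∀ᵐ x ∂volume.restrict Ω, |f x| ≤ m) (hm0 : 0 ≤ m) (hM : ∫ x in Ω, f x ^ 2 = M) :
    starEnergy Ω V M A ≤ ENNReal.ofReal (formEnergy Ω V f g + 8 * Real.pi * A * m ^ 2 * M) := by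
  refine (iInf₂_le (fun x => (f x : ℂ)) ?_).trans ?_
  · simp only [enorm_complex_ofReal]
    rw [lintegral_enorm_sq_eq h.memLp, hM]
  · rw [← hM]
    exact starFunctional_le hV hVm hA h hm hm0

theorem starEnergy_ne_top (hΩ : IsTrap Ω V) (hV : ∀ x, 0 ≤ V x) (hVm : Measurable V)
    (hVb : ∀ R : ℝ, ∃ M : ℝ, ∀ x, ‖x‖ ≤ R → V x ≤ M) (hA : 0 ≤ A) : starEnergy Ω V 1 A ≠ ⊤ := by
  obtain ⟨f, g, m, h, hm0, hm, h1⟩ := exists_normalized hΩ hV hVm hVb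
  exact ne_top_of_le_ne_top ENNReal.ofReal_ne_top
    (starEnergy_le hV hVm hA h (Eventually.of_forall hm) hm0 h1)

theorem starEnergy_lower (hV : ∀ x, 0 ≤ V x) (hVm : Measurable V) (hA : 0 ≤ A) {m : ℝ}
    {f : Space3 → ℝ} {g : Fin 3 → Space3 → ℝ} (h : InFormDomain Ω V f g) (hm0 : 0 ≤ m)
    (hm : ∀ᵐ x ∂volume.restrict Ω, |f x| ≤ m) :
    (starEnergy Ω V 1 A).toReal * ∫ x in Ω, f x ^ 2
      ≤ formEnergy Ω V f g + 8 * Real.pi * A * m ^ 2 := by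
  have hT := formEnergy_nonneg (Ω := Ω) hV f g
  have hπ := Real.pi_pos
  rcases (integral_nonneg fun x => sq_nonneg (f x) :
    0 ≤ ∫ x in Ω, f x ^ 2).eq_or_lt with h0 | h0
  · rw [← h0, mul_zero]; positivity
  set c := ∫ x in Ω, f x ^ 2
  have hs : 0 < √c := Real.sqrt_pos.2 h0
  have h1 := starEnergy_le (M := 1) hV hVm hA (h.const_mul (√c)⁻¹) (m := (√c)⁻¹ * m) (by
    filter_upwards [hm] with x hx
    rw [abs_mul, abs_of_pos (inv_pos.2 hs)]
    gcongr) (by positivity) (by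
    simp only [mul_pow]
    rw [integral_const_mul, inv_pow, Real.sq_sqrt h0.le]
    exact inv_mul_cancel₀ h0.ne')
  rw [formEnergy_const_mul, mul_pow, inv_pow, Real.sq_sqrt h0.le] at h1
  have h2 := ENNReal.toReal_le_of_le_ofReal (by positivity) h1
  calc (starEnergy Ω V 1 A).toReal * c
      ≤ (c⁻¹ * formEnergy Ω V f g + 8 * Real.pi * A * (c⁻¹ * m ^ 2) * 1) * c := by gcongr
    _ = _ := by field_simp

/-- The one-particle minimization problem has a nonnegative solution. -/
theorem exists_isStarMin (hΩ : IsTrap Ω V) (hV : ∀ x, 0 ≤ V x) (hVm : Measurable V)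
    (hVb : ∀ R : ℝ, ∃ M : ℝ, ∀ x, ‖x‖ ≤ R → V x ≤ M) (hA : 0 < A) :
    ∃ f g m, IsStarMin Ω V A (starEnergy Ω V 1 A).toReal f g m := by
  set e := (starEnergy Ω V 1 A).toReal with he
  have he0 : 0 ≤ e := ENNReal.toReal_nonneg
  have hfin := starEnergy_ne_top hΩ hV hVm hVb hA.le
  have hπ := Real.pi_pos
  have hnear : ∀ n : ℕ, ∃ (f : Space3 → ℝ) (g : Fin 3 → Space3 → ℝ) (m : ℝ), 0 ≤ m ∧
      InFormDomain Ω V f g ∧ (∀ x, 0 ≤ f x) ∧ (∀ᵐ x ∂volume.restrict Ω, f x ≤ m) ∧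
      ∫ x in Ω, f x ^ 2 = 1 ∧
      formEnergy Ω V f g + 8 * Real.pi * A * m ^ 2 ≤ e + 1 / ((n : ℝ) + 1) := by
    intro n
    have h1 : starEnergy Ω V 1 A < ENNReal.ofReal (e + 1 / ((n : ℝ) + 1)) := by
      rw [← ENNReal.ofReal_toReal hfin, ENNReal.ofReal_lt_ofReal_iff (by positivity)]
      exact lt_add_of_pos_right _ (by positivity)
    rw [starEnergy] at h1
    simp only [iInf_lt_iff] at h1
    obtain ⟨Φ, hΦ, h2⟩ := h1
    obtain ⟨g, m, a1, a2, a3, a4, a5⟩ := exists_form_of_starFunctional hΩ.isOpen hV hVm hA one_pos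
      hΦ (h2.trans ENNReal.ofReal_lt_top).ne
    refine ⟨_, g, m, a1, a2, fun x => norm_nonneg _, a3, a4, ?_⟩
    have := a5.trans h2.le
    rw [ENNReal.ofReal_le_ofReal_iff (by positivity)] at this
    linarith
  choose f g mm hmm dom nonneg le_sup mass energy using hnear
  have hinv : ∀ n : ℕ, 1 / ((n : ℝ) + 1) ≤ 1 := fun n => by
    rw [div_le_one (by positivity)]
    linarith [(Nat.cast_nonneg n : (0 : ℝ) ≤ n)]
  set S := {F : Lp ℝ 2 (volume.restrict Ω) | ‖F‖ ≤ 1 ∧ ∃ g : Fin 3 → Space3 → ℝ,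
      (∀ k, L2WeakDeriv Ω (unitVec k) F (g k)) ∧
      ∑ k, ∫⁻ x in Ω, ‖g k x‖ₑ ^ 2 ≤ ENNReal.ofReal (e + 1) ∧
      ∫⁻ x in Ω, ENNReal.ofReal (V x) * ‖F x‖ₑ ^ 2 ≤ ENNReal.ofReal (e + 1)} with hS
  have hTB := totallyBounded_energy hΩ (e + 1)
  have hcomp : IsCompact (closure S) :=
    hTB.closure.isCompact_of_isClosed isClosed_closure
  have hmem : ∀ n, (dom n).memLp.toLp (f n) ∈ S := by
    intro n
    have hT : formEnergy Ω V (f n) (g n) ≤ e + 1 := by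
      have h1 := energy n
      have h2 := hinv n
      have h3 : 0 ≤ 8 * Real.pi * A * mm n ^ 2 := by positivity
      linarith
    have h3 := ENNReal.ofReal_le_ofReal hT
    rw [ofReal_formEnergy hV (dom n)] at h3
    refine ⟨?_, g n, fun k => ((dom n).deriv k).congr (dom n).memLp.coeFn_toLp.symm
      (ae_eq_refl _), le_self_add.trans h3, ?_⟩
    · have : ‖(dom n).memLp.toLp (f n)‖ ^ 2 = 1 := by rw [norm_toLp_two_sq, mass]
      nlinarith [norm_nonneg ((dom n).memLp.toLp (f n))]
    · refine le_trans (le_of_eq (lintegral_congr_ae ?_)) (le_add_self.trans h3)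
      filter_upwards [(dom n).memLp.coeFn_toLp] with x hx
      rw [hx]
  have hmm2 : ∀ n, mm n ∈ Icc 0 (√((e + 1) / (8 * Real.pi * A))) := fun n => by
    refine ⟨hmm n, Real.le_sqrt_of_sq_le ?_⟩
    rw [le_div_iff₀ (by positivity)]
    have h1 := energy n
    have h2 := hinv n
    have h3 := formEnergy_nonneg (Ω := Ω) hV (f n) (g n)
    linarith
  -- Functions and supremum bounds converge along a common subsequence; the bounds lie in a compact
  -- interval because `A > 0`.
  obtain ⟨⟨F, m⟩, -, φ, hφ, hlim⟩ := (hcomp.prod isCompact_Icc).tendsto_subseq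
    (x := fun n => ((dom n).memLp.toLp (f n), mm n)) fun n => ⟨subset_closure (hmem n), hmm2 n⟩
  rw [nhds_prod_eq] at hlim
  have hl1 := hlim.fst
  have hl2 := hlim.snd
  obtain ⟨f', g', h'⟩ := exists_isStarMin_of_tendsto (e := e) hV hVm hA.le
    (fun n => dom (φ n)) (fun n => nonneg (φ n)) (fun n => mass (φ n)) (fun n => hmm (φ n))
    (fun n => le_sup (φ n)) (fun n => energy (φ n))
    (L2WeakDeriv.tendsto_inv_nat_zero.comp hφ.tendsto_atTop)
    (fun f' g' m' h1 h2 h3 => starEnergy_lower hV hVm hA.le h1 h2 h3) hl1 hl2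
  exact ⟨f', g', m, h'⟩

end Existence

/-! ### Strict positivity of minimizers. -/

theorem arctan_le_of_nonneg {y : ℝ} (hy : 0 ≤ y) : Real.arctan y ≤ y := by
  rcases lt_or_ge y (Real.pi / 2) with h | h
  · have h1 := Real.le_tan hy h
    have h2 := Real.arctan_mono h1
    rwa [Real.arctan_tan (by linarith [Real.pi_pos]) h] at h2
  · exact (Real.arctan_lt_pi_div_two y).le.trans h

/-- For `t > 0`, `π/2 - arctan t = arctan (1/t) ≤ 1/t`. This lets an arctangent serve as a bounded
substitute for `1/f` in a test function. -/
theorem mul_pi_div_two_sub_arctan_le {t : ℝ} (ht : 0 ≤ t) :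
    t * (Real.pi / 2 - Real.arctan t) ≤ 1 := by
  rcases ht.eq_or_lt with rfl | h
  · simp
  rw [← Real.arctan_inv_of_pos h]
  calc t * Real.arctan t⁻¹ ≤ t * t⁻¹ := by gcongr; exact arctan_le_of_nonneg (by positivity)
    _ = 1 := mul_inv_cancel₀ h.ne'

section Positivity

variable {Ω : Set Space3} {V : Space3 → ℝ} {A e : ℝ} {f : Space3 → ℝ}
  {g : Fin 3 → Space3 → ℝ} {m : ℝ}

/-- The logarithmic gradient of a minimizer is locally square integrable. -/
theorem IsStarMin.exists_log_gradient_bound (h : IsStarMin Ω V A e f g m) (he : 0 ≤ e)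
    (hΩ : IsOpen Ω) (hV : ∀ x, 0 ≤ V x) (hVm : Measurable V)
    (hVb : ∀ R : ℝ, ∃ M : ℝ, ∀ x, ‖x‖ ≤ R → V x ≤ M) (R : ℝ) :
    ∃ C, ∀ ε > 0, ∑ k, ∫ x in Ω, cutoff R x ^ 2 * (g k x ^ 2 / (ε ^ 2 + f x ^ 2)) ≤ C := by
  set ζ := cutoff R with hζ
  have hζL := lipschitzWith_cutoff R
  have hζc := hasCompactSupport_cutoff R
  have hζb : ∀ x, |ζ x| ≤ 1 := fun x => by
    rw [abs_of_nonneg (cutoff_nonneg R x)]; exact cutoff_le_one R x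
  have hζd := inFormDomain_of_lipschitz hΩ.measurableSet hV hVm hVb hζL hζc
  set dζ : Fin 3 → Space3 → ℝ := fun k x => lineDeriv ℝ ζ x (unitVec k)
  refine ⟨16 * (∑ k, ∫ x in Ω, dζ k x ^ 2) + 2 * ∫ x in Ω, V x * ζ x ^ 2, fun ε hε => ?_⟩
  have hpos : ∀ x, 0 < ε ^ 2 + f x ^ 2 := fun x => by positivity
  have hπ := Real.pi_pos
  -- `H` is a regularized `1/s`: it is bounded, `H'(s) = -1/(ε² + s²)` and `s H(s) ≤ 1`. Testing the
  -- supersolution inequality with `ζ² H(f)` produces the logarithmic gradient with a bound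
  -- independent of `ε`.
  set H : ℝ → ℝ := fun s => (Real.pi / 2 - Real.arctan (s / ε)) / ε with hH
  -- The constant `π / (2ε)` is left out, since it need not be square integrable on `Ω`; it is
  -- restored below after multiplication by the cutoff.
  have hcomp : ∀ k, L2WeakDeriv Ω (unitVec k) (fun x => -(Real.arctan (f x / ε) / ε))
      (fun x => -(1 / (ε ^ 2 + f x ^ 2)) * g k x) := fun k => by
    refine (h.dom.deriv k).comp hΩ (H := fun s => -(Real.arctan (s / ε) / ε))
      (H' := fun s => -(1 / (ε ^ 2 + s ^ 2))) (C := 1 / ε ^ 2) (fun s => ?_) ?_ (fun s => ?_) ?_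
    · have h1 := ((((hasDerivAt_id s).div_const ε).arctan).div_const ε).neg
      refine h1.congr_deriv ?_
      have : ε ^ 2 + s ^ 2 ≠ 0 := by positivity
      simp only [id]
      field_simp
    · exact (continuous_const.div (by fun_prop) fun s => by positivity).neg
    · rw [abs_neg, abs_of_nonneg (by positivity)]
      gcongr
      nlinarith [sq_nonneg s]
    · simp
  have hηd : ∀ k, L2WeakDeriv Ω (unitVec k) (fun x => ζ x ^ 2 * H (f x))
      (fun x => -(ζ x ^ 2 * (g k x / (ε ^ 2 + f x ^ 2))) + 2 * ζ x * dζ k x * H (f x)) :=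
    fun k => by
    have h1 := ((hcomp k).lipschitz_mul hΩ hζL hζb).lipschitz_mul hΩ hζL hζb
    have h2 := ((hζd.deriv k).lipschitz_mul hΩ hζL hζb).const_mul (Real.pi / (2 * ε))
    refine (h1.add h2).congr (Eventually.of_forall fun x => ?_) (Eventually.of_forall fun x => ?_)
    · simp only [hH]; field_simp; ring
    · have := (hpos x).ne'
      simp only [hH, dζ]; field_simp; ring
  have hH0 : ∀ x, 0 ≤ H (f x) := fun x => by
    have := Real.arctan_lt_pi_div_two (f x / ε)
    exact div_nonneg (by linarith) hε.le
  have hH1 : ∀ x, H (f x) ≤ Real.pi / 2 / ε := fun x => by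
    have : 0 ≤ Real.arctan (f x / ε) :=
      Real.arctan_nonneg.2 (div_nonneg (h.nonneg x) hε.le)
    simp only [hH]
    gcongr
    linarith
  have hfH : ∀ x, f x * H (f x) ≤ 1 := fun x => by
    have := mul_pi_div_two_sub_arctan_le (div_nonneg (h.nonneg x) hε.le)
    simp only [hH]
    calc _ = f x / ε * (Real.pi / 2 - Real.arctan (f x / ε)) := by ring
      _ ≤ 1 := this
  -- The two parts are at most `(π/2)²` and `1`, and their sum is below `4`.
  have hHH : ∀ x, H (f x) ^ 2 * (ε ^ 2 + f x ^ 2) ≤ 4 := fun x => by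
    have h1 : ε * H (f x) ≤ Real.pi / 2 := by
      have := hH1 x
      rw [le_div_iff₀ hε] at this
      linarith
    have h2 : (ε * H (f x)) ^ 2 ≤ (Real.pi / 2) ^ 2 :=
      pow_le_pow_left₀ (mul_nonneg hε.le (hH0 x)) h1 2
    have h3 : (f x * H (f x)) ^ 2 ≤ 1 ^ 2 :=
      pow_le_pow_left₀ (mul_nonneg (h.nonneg x) (hH0 x)) (hfH x) 2
    have h4 := Real.pi_lt_d2
    nlinarith
  have hη : InFormDomain Ω V (fun x => ζ x ^ 2 * H (f x))
      (fun k x => -(ζ x ^ 2 * (g k x / (ε ^ 2 + f x ^ 2))) + 2 * ζ x * dζ k x * H (f x)) := by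
    refine ⟨hηd, (hζd.pot.const_mul ((Real.pi / 2 / ε) ^ 2)).mono'
      (hVm.aestronglyMeasurable.mul ((hηd 0).1.1.pow 2)) (Eventually.of_forall fun x => ?_)⟩
    rw [Real.norm_of_nonneg (mul_nonneg (hV x) (sq_nonneg _))]
    have h1 : (ζ x ^ 2 * H (f x)) ^ 2 ≤ (Real.pi / 2 / ε) ^ 2 * ζ x ^ 2 := by
      have h2 := pow_le_pow_left₀ (hH0 x) (hH1 x) 2
      have h3 : ζ x ^ 2 ≤ 1 := (sq_le_one_iff_abs_le_one _).2 (hζb x)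
      calc (ζ x ^ 2 * H (f x)) ^ 2 = H (f x) ^ 2 * (ζ x ^ 2 * ζ x ^ 2) := by ring
        _ ≤ (Real.pi / 2 / ε) ^ 2 * (ζ x ^ 2 * 1) := by gcongr
        _ = _ := by ring
    calc V x * (ζ x ^ 2 * H (f x)) ^ 2 ≤ V x * ((Real.pi / 2 / ε) ^ 2 * ζ x ^ 2) := by
          gcongr; exact hV x
      _ = _ := by ring
  have hsup := h.formInner_nonneg he hΩ hV hVm hη
    (Eventually.of_forall fun x => mul_nonneg (sq_nonneg _) (hH0 x))
  rw [formInner] at hsup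
  have hpotint : Integrable (fun x => V x * (f x * (ζ x ^ 2 * H (f x)))) (volume.restrict Ω) := by
    refine hζd.pot.mono' (hVm.aestronglyMeasurable.mul
      (h.dom.memLp.1.mul (hηd 0).1.1)) (Eventually.of_forall fun x => ?_)
    rw [Real.norm_of_nonneg (mul_nonneg (hV x) (mul_nonneg (h.nonneg x)
      (mul_nonneg (sq_nonneg _) (hH0 x))))]
    refine mul_le_mul_of_nonneg_left ?_ (hV x)
    nlinarith [hfH x, sq_nonneg (ζ x)]
  have hpot : ∫ x in Ω, V x * (f x * (ζ x ^ 2 * H (f x))) ≤ ∫ x in Ω, V x * ζ x ^ 2 := by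
    refine integral_mono hpotint hζd.pot fun x => ?_
    refine mul_le_mul_of_nonneg_left ?_ (hV x)
    nlinarith [hfH x, sq_nonneg (ζ x)]
  have hI : ∀ k, Integrable (fun x => ζ x ^ 2 * (g k x ^ 2 / (ε ^ 2 + f x ^ 2)))
      (volume.restrict Ω) := fun k => by
    have hgi := (h.dom.deriv k).2.1
    have hm : AEStronglyMeasurable (fun x => ζ x ^ 2 * (g k x ^ 2 / (ε ^ 2 + f x ^ 2)))
        (volume.restrict Ω) := by
      refine (hζL.continuous.aestronglyMeasurable.pow 2).mul ?_
      exact ((hgi.1.aemeasurable.pow_const 2).div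
        (aemeasurable_const.add (h.dom.memLp.1.aemeasurable.pow_const 2))).aestronglyMeasurable
    refine (hgi.integrable_sq.const_mul (1 / ε ^ 2)).mono' hm (Eventually.of_forall fun x => ?_)
    have h3 : ζ x ^ 2 ≤ 1 := (sq_le_one_iff_abs_le_one _).2 (hζb x)
    rw [Real.norm_of_nonneg (mul_nonneg (sq_nonneg _) (div_nonneg (sq_nonneg _) (hpos x).le))]
    calc ζ x ^ 2 * (g k x ^ 2 / (ε ^ 2 + f x ^ 2)) ≤ 1 * (g k x ^ 2 / (ε ^ 2)) := by
          gcongr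
          nlinarith [sq_nonneg (f x)]
      _ = _ := by ring
  -- By Young's inequality the cross term with `∇ζ` uses up half of the good term and leaves `8
  -- |∇ζ|²`. Doubling at the end gives the constants `16` and `2` of the bound.
  have hgrad : ∀ k, ∫ x in Ω, g k x * (-(ζ x ^ 2 * (g k x / (ε ^ 2 + f x ^ 2)))
      + 2 * ζ x * dζ k x * H (f x)) ≤ -(1 / 2) * (∫ x in Ω,
        ζ x ^ 2 * (g k x ^ 2 / (ε ^ 2 + f x ^ 2))) + 8 * ∫ x in Ω, dζ k x ^ 2 := fun k => by
    have i1 := (hI k).const_mul (-(1 / 2))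
    have i2 := ((hζd.deriv k).2.1.integrable_sq).const_mul 8
    rw [← integral_const_mul, ← integral_const_mul, ← integral_add i1 i2]
    refine integral_mono ((h.dom.deriv k).2.1.integrable_mul (hηd k).2.1) (i1.add i2) fun x => ?_
    have hx := hpos x
    set q := ε ^ 2 + f x ^ 2 with hq
    have e1 : g k x * (-(ζ x ^ 2 * (g k x / q)) + 2 * ζ x * dζ k x * H (f x))
        = -(ζ x ^ 2 * (g k x ^ 2 / q)) + 2 * (ζ x * g k x) * (dζ k x * H (f x)) := by ring
    have e2 : 2 * (ζ x * g k x) * (dζ k x * H (f x))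
        ≤ 1 / 2 * (ζ x ^ 2 * (g k x ^ 2 / q)) + 2 * dζ k x ^ 2 * (H (f x) ^ 2 * q) := by
      have e3 : 0 ≤ 1 / 2 / q * (ζ x * g k x - 2 * q * (dζ k x * H (f x))) ^ 2 := by positivity
      have e4 : 1 / 2 / q * (ζ x * g k x - 2 * q * (dζ k x * H (f x))) ^ 2
          = 1 / 2 * (ζ x ^ 2 * (g k x ^ 2 / q)) + 2 * dζ k x ^ 2 * (H (f x) ^ 2 * q)
            - 2 * (ζ x * g k x) * (dζ k x * H (f x)) := by
        field_simp; ring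
      linarith
    have e5 : 2 * dζ k x ^ 2 * (H (f x) ^ 2 * q) ≤ 2 * dζ k x ^ 2 * 4 := by
      gcongr; exact hHH x
    change g k x * (-(ζ x ^ 2 * (g k x / q)) + 2 * ζ x * dζ k x * H (f x)) ≤
      -(1 / 2) * (ζ x ^ 2 * (g k x ^ 2 / q)) + 8 * dζ k x ^ 2
    rw [e1]
    linarith
  have hsum := Finset.sum_le_sum fun k (_ : k ∈ Finset.univ) => hgrad k
  rw [Finset.sum_add_distrib, ← Finset.mul_sum, ← Finset.mul_sum] at hsum
  linarith

/-- Apply Poincaré on the convex set `Ω ∩ B_R` to `arsinh (f/ε)`, whose gradient `∇f / √(ε² + f²)`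
is bounded in `L²` uniformly in `ε`. For `ε = τ / sinh n` this function is at least `n` where `f >
τ` and zero where `f = 0`. So `n` times the product of the measures of these two sets is bounded
independently of `n`, and one of the sets is null. -/
theorem IsStarMin.ae_le_or_ae_ne_zero (h : IsStarMin Ω V A e f g m) (he : 0 ≤ e)
    (hΩ : IsTrap Ω V) (hV : ∀ x, 0 ≤ V x) (hVm : Measurable V)
    (hVb : ∀ R : ℝ, ∃ M : ℝ, ∀ x, ‖x‖ ≤ R → V x ≤ M) (R : ℝ) {τ : ℝ} (hτ : 0 < τ) :
    (∀ᵐ x ∂volume.restrict (Ω ∩ Metric.ball 0 R), f x ≤ τ) ∨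
      ∀ᵐ x ∂volume.restrict (Ω ∩ Metric.ball 0 R), f x ≠ 0 := by
  obtain ⟨C, hC⟩ := h.exists_log_gradient_bound he hΩ.isOpen hV hVm hVb R
  set Q := Ω ∩ Metric.ball (0 : Space3) R with hQ
  have hQo : IsOpen Q := hΩ.isOpen.inter Metric.isOpen_ball
  have hQc : Convex ℝ Q := hΩ.convex.inter (convex_ball _ _)
  have hQv : volume Q ≠ ⊤ := ((measure_mono inter_subset_right).trans_lt
    measure_ball_lt_top).ne
  have hQd : ∀ x ∈ Q, ∀ y ∈ Q, ‖x - y‖ ≤ 2 * R := fun x hx y hy => by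
    have h1 := mem_ball_zero_iff.1 hx.2
    have h2 := mem_ball_zero_iff.1 hy.2
    linarith [norm_sub_le x y]
  have hfm : AEStronglyMeasurable f (volume.restrict Q) :=
    h.dom.memLp.1.mono_measure (Measure.restrict_mono inter_subset_left le_rfl)
  set X := volume.restrict Q {x | τ < f x} * volume.restrict Q {x | f x = 0} with hX
  set K : ℝ≥0∞ := 8 * ENNReal.ofReal ((2 * R) ^ 2) * volume Q * ENNReal.ofReal C with hK
  have hKt : K ≠ ⊤ := by
    rw [hK]
    exact ENNReal.mul_ne_top (ENNReal.mul_ne_top (ENNReal.mul_ne_top (by simp)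
      ENNReal.ofReal_ne_top) hQv) ENNReal.ofReal_ne_top
  have main : ∀ n : ℕ, 1 ≤ n → (n : ℝ≥0∞) * X ≤ K := by
    intro n hn
    have hn0 : (0 : ℝ) < n := by exact_mod_cast hn
    have hsn : 0 < Real.sinh n := Real.sinh_pos_iff.2 hn0
    set ε := τ / Real.sinh n with hε
    have hε0 : 0 < ε := by positivity
    have hw : ∀ k, L2WeakDeriv Ω (unitVec k) (fun x => Real.arsinh (f x / ε))
        (fun x => (√(ε ^ 2 + f x ^ 2))⁻¹ * g k x) := fun k => by
      refine (h.dom.deriv k).comp hΩ.isOpen (H := fun s => Real.arsinh (s / ε))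
        (H' := fun s => (√(ε ^ 2 + s ^ 2))⁻¹) (C := 1 / ε) (fun s => ?_) ?_ (fun s => ?_) ?_
      · have h1 := ((hasDerivAt_id s).div_const ε).arsinh
        refine h1.congr_deriv ?_
        have h2 : √(ε ^ 2 + s ^ 2) = ε * √(1 + (s / ε) ^ 2) := by
          rw [← Real.sqrt_sq hε0.le, ← Real.sqrt_mul (sq_nonneg _), Real.sqrt_sq hε0.le]
          congr 1; field_simp
        rw [h2]
        simp only [id, smul_eq_mul]
        field_simp
      · refine Continuous.inv₀ (by fun_prop) fun s => ?_
        exact (Real.sqrt_pos.2 (by positivity)).ne'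
      · rw [abs_of_nonneg (by positivity), ← one_div]
        gcongr
        exact Real.le_sqrt_of_sq_le (by nlinarith [sq_nonneg s])
      · simp
    have hP := poincare hQc hQo hQd hQv
      (fun k => (hw k).mono hΩ.isOpen.measurableSet inter_subset_left)
    have hgr : ∑ k, ∫⁻ x in Q, ‖(√(ε ^ 2 + f x ^ 2))⁻¹ * g k x‖ₑ ^ 2 ≤ ENNReal.ofReal C := by
      refine le_trans ?_ (ENNReal.ofReal_le_ofReal (hC ε hε0))
      rw [ENNReal.ofReal_sum_of_nonneg fun k _ => integral_nonneg fun x => by positivity]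
      refine Finset.sum_le_sum fun k _ => ?_
      have hwi : Integrable (fun x => cutoff R x ^ 2 * (g k x ^ 2 / (ε ^ 2 + f x ^ 2)))
          (volume.restrict Ω) := by
        have hc := (memLp_two_mul_of_bounded (lipschitzWith_cutoff R).continuous.aestronglyMeasurable
          (B := 1) (fun x => by
            rw [abs_of_nonneg (cutoff_nonneg R x)]; exact cutoff_le_one R x)
          (hw k).2.1).integrable_sq
        refine hc.congr (Eventually.of_forall fun x => ?_)
        simp only [mul_pow, inv_pow]
        rw [Real.sq_sqrt (by positivity)]
        ring
      rw [ofReal_integral_eq_lintegral_ofReal hwi (Eventually.of_forall fun x => by positivity)]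
      refine le_trans ?_ (lintegral_mono_set (s := Q) inter_subset_left)
      refine setLIntegral_mono' hQo.measurableSet fun x hx => ?_
      rw [enorm_sq_eq_ofReal, cutoff_eq_one (mem_ball_zero_iff.1 hx.2).le]
      refine ENNReal.ofReal_le_ofReal (le_of_eq ?_)
      rw [mul_pow, inv_pow, Real.sq_sqrt (by positivity)]
      ring
    have hP2 := hP.trans (mul_le_mul_right hgr _)
    rw [← hK, Measure.volume_eq_prod, ← Measure.prod_restrict] at hP2
    refine le_trans ?_ hP2
    have hwm : AEStronglyMeasurable (fun x => Real.arsinh (f x / ε)) (volume.restrict Q) :=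
      Real.continuous_arsinh.comp_aestronglyMeasurable
        ((hfm.aemeasurable.div_const ε).aestronglyMeasurable)
    have hFm : AEMeasurable (fun p : Space3 × Space3 =>
        ‖Real.arsinh (f p.1 / ε) - Real.arsinh (f p.2 / ε)‖ₑ ^ 2)
        ((volume.restrict Q).prod (volume.restrict Q)) :=
      (hwm.comp_fst.sub hwm.comp_snd).enorm.pow_const 2
    refine le_trans ?_ (mul_meas_ge_le_lintegral₀ hFm (n : ℝ≥0∞))
    rw [hX, ← Measure.prod_prod]
    refine mul_le_mul_right (measure_mono fun p hp => ?_) _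
    have hp1 : τ < f p.1 := hp.1
    have hp2 : f p.2 = 0 := hp.2
    have h1 : (n : ℝ) ≤ Real.arsinh (f p.1 / ε) := by
      rw [← Real.arsinh_sinh (n : ℝ)]
      refine Real.arsinh_le_arsinh.2 ?_
      rw [le_div_iff₀ hε0, hε]
      field_simp
      exact hp1.le
    change (n : ℝ≥0∞) ≤ _
    rw [hp2, zero_div, Real.arsinh_zero, sub_zero, enorm_sq_eq_ofReal, ← ENNReal.ofReal_natCast]
    refine ENNReal.ofReal_le_ofReal ?_
    have : (1 : ℝ) ≤ n := by exact_mod_cast hn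
    nlinarith
  have hX0 : X = 0 := by
    by_contra hne
    obtain ⟨n, hn⟩ := ENNReal.exists_nat_gt (ENNReal.div_ne_top hKt hne)
    have hn1 : 1 ≤ n := by
      rw [Nat.one_le_iff_ne_zero]
      rintro rfl
      simp at hn
    have hXt : X ≠ ⊤ := by
      refine ENNReal.mul_ne_top ?_ ?_ <;>
      exact ((measure_mono (subset_univ _)).trans_lt (by
        rw [Measure.restrict_apply_univ]; exact lt_top_iff_ne_top.2 hQv)).ne
    rw [ENNReal.div_lt_iff (Or.inl hne) (Or.inl hXt)] at hn
    exact absurd (main n hn1) (not_le.2 hn)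
  rcases mul_eq_zero.1 hX0 with h0 | h0
  · left
    rw [ae_iff]; simpa using h0
  · right
    rw [ae_iff]; simpa using h0

/-- If `f` vanished on a set of positive measure in some ball, the alternative would give `f ≤ τ`
for every `τ > 0` on all larger balls, hence `f = 0`, against the normalization. -/
theorem IsStarMin.ae_pos (h : IsStarMin Ω V A e f g m) (he : 0 ≤ e)
    (hΩ : IsTrap Ω V) (hV : ∀ x, 0 ≤ V x) (hVm : Measurable V)
    (hVb : ∀ R : ℝ, ∃ M : ℝ, ∀ x, ‖x‖ ≤ R → V x ≤ M) :
    ∀ᵐ x ∂volume.restrict Ω, 0 < f x := by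
  have hU : Ω = ⋃ n : ℕ, Ω ∩ Metric.ball (0 : Space3) n := by
    rw [← inter_iUnion, Metric.iUnion_ball_nat, inter_univ]
  by_contra hn
  have hn' : ¬ ∀ᵐ x ∂volume.restrict Ω, f x ≠ 0 := fun h' => hn (by
    filter_upwards [h'] with x hx
    exact lt_of_le_of_ne (h.nonneg x) hx.symm)
  rw [hU, ae_restrict_iUnion_iff] at hn'
  push Not at hn'
  obtain ⟨n, hn'⟩ := hn'
  have hmono : ∀ {k l : ℕ}, k ≤ l → Ω ∩ Metric.ball (0 : Space3) k ⊆ Ω ∩ Metric.ball 0 l :=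
    fun hkl => inter_subset_inter_right _ (Metric.ball_subset_ball (by exact_mod_cast hkl))
  have hall : ∀ k j : ℕ, ∀ᵐ x ∂volume.restrict (Ω ∩ Metric.ball (0 : Space3) k),
      f x ≤ 1 / ((j : ℝ) + 1) := by
    intro k j
    refine ae_restrict_of_ae_restrict_of_subset (hmono (le_max_left k n)) ?_
    refine (h.ae_le_or_ae_ne_zero he hΩ hV hVm hVb _ (by positivity)).resolve_right fun h' => ?_
    exact hn' (ae_restrict_of_ae_restrict_of_subset (hmono (le_max_right k n)) h')
  have h0 : ∀ᵐ x ∂volume.restrict Ω, f x = 0 := by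
    rw [hU, ae_restrict_iUnion_iff]
    intro k
    filter_upwards [ae_all_iff.2 (hall k)] with x hx
    refine le_antisymm (ge_of_tendsto' L2WeakDeriv.tendsto_inv_nat_zero fun j => hx j) (h.nonneg x)
  have := h.mass
  rw [integral_congr_ae (g := fun _ => 0) (by
    filter_upwards [h0] with x hx; rw [hx]; simp)] at this
  simp at this

end Positivity

/-! ### Scaling from mass one to mass `N`. -/

section StarMinimizer

variable {Ω : Set Space3} {V : Space3 → ℝ}

theorem le_starFunctional (hΩ : IsOpen Ω) (hV : ∀ x, 0 ≤ V x) (hVm : Measurable V) {N : ℕ}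
    {a : ℝ} (hN : 1 ≤ N) (ha : 0 < a) {Φ : Space3 → ℂ}
    (hΦ : ∫⁻ x in Ω, ‖Φ x‖ₑ ^ 2 = ENNReal.ofReal N) :
    ENNReal.ofReal (N * (starEnergy Ω V 1 (N * a)).toReal) ≤ starFunctional Ω V a Φ := by
  have hN0 : (0 : ℝ) < N := by exact_mod_cast hN
  by_cases hfin : starFunctional Ω V a Φ = ⊤
  · rw [hfin]; exact le_top
  obtain ⟨g, m, h1, h2, h3, h4, h5⟩ := exists_form_of_starFunctional hΩ hV hVm ha hN0 hΦ hfin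
  refine le_trans (ENNReal.ofReal_le_ofReal ?_) h5
  have := starEnergy_lower (A := N * a) hV hVm (by positivity) h2 h1 (by
    filter_upwards [h3] with x hx
    rwa [abs_of_nonneg (norm_nonneg _)])
  rw [h4] at this
  linarith

/-- The substitution `Φ = √N f` turns coupling `a` at mass `N` into coupling `N a` at mass one, and
multiplies the energy by `N`. -/
theorem starEnergy_eq (hΩ : IsTrap Ω V) (hV : ∀ x, 0 ≤ V x) (hVm : Measurable V)
    (hVb : ∀ R : ℝ, ∃ M : ℝ, ∀ x, ‖x‖ ≤ R → V x ≤ M) {N : ℕ}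
    {a : ℝ} (hN : 1 ≤ N) (ha : 0 < a) :
    starEnergy Ω V N a = ENNReal.ofReal (N * (starEnergy Ω V 1 (N * a)).toReal) ∧
      ∃ φ : Space3 → ℝ, IsPositiveStarMinimizer Ω V N a φ := by
  have hN0 : (0 : ℝ) < N := by exact_mod_cast hN
  obtain ⟨f, g, m, h⟩ := exists_isStarMin hΩ hV hVm hVb (A := N * a) (by positivity)
  set e := (starEnergy Ω V 1 (N * a)).toReal
  have hpos := h.ae_pos ENNReal.toReal_nonneg hΩ hV hVm hVb
  have hlow : ENNReal.ofReal (N * e) ≤ starEnergy Ω V N a :=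
    le_iInf₂ fun Φ hΦ => le_starFunctional hΩ.isOpen hV hVm hN ha hΦ
  -- The value `1` on the null set where `f` vanishes makes `φ` positive at every point.
  set φ : Space3 → ℝ := fun x => if 0 < f x then √N * f x else 1 with hφ
  have hae : (fun x => √N * f x) =ᵐ[volume.restrict Ω] φ := by
    filter_upwards [hpos] with x hx
    rw [hφ]; simp only; rw [if_pos hx]
  have hd : InFormDomain Ω V φ (fun k x => √N * g k x) :=
    (h.dom.const_mul √N).congr hae fun k => ae_eq_refl _
  have hmass : ∫ x in Ω, φ x ^ 2 = N := by
    have : ∫ x in Ω, φ x ^ 2 = ∫ x in Ω, N * f x ^ 2 := by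
      refine integral_congr_ae ?_
      filter_upwards [hae] with x hx
      rw [← hx, mul_pow, Real.sq_sqrt hN0.le]
    rw [this, integral_const_mul, h.mass, mul_one]
  have hT : formEnergy Ω V φ (fun k x => √N * g k x) = N * formEnergy Ω V f g := by
    have : formEnergy Ω V φ (fun k x => √N * g k x)
        = formEnergy Ω V (fun x => √N * f x) (fun k x => √N * g k x) := by
      simp only [formEnergy]
      congr 1
      refine integral_congr_ae ?_
      filter_upwards [hae] with x hx
      rw [← hx]
    rw [this, formEnergy_const_mul, Real.sq_sqrt hN0.le]
  have hmass' : ∫⁻ x in Ω, ‖(φ x : ℂ)‖ₑ ^ 2 = ENNReal.ofReal N := by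
    simp only [enorm_complex_ofReal]
    rw [lintegral_enorm_sq_eq hd.memLp, hmass]
  have hup : starFunctional Ω V a (fun x => (φ x : ℂ)) ≤ ENNReal.ofReal (N * e) := by
    refine (starFunctional_le hV hVm ha.le hd (m := √N * m) ?_
      (mul_nonneg (Real.sqrt_nonneg _) h.sup_nonneg)).trans (ENNReal.ofReal_le_ofReal ?_)
    · filter_upwards [hae, h.le_sup] with x hx hx2
      rw [← hx, abs_of_nonneg (mul_nonneg (Real.sqrt_nonneg _) (h.nonneg x))]
      gcongr
    · rw [hT, hmass, mul_pow, Real.sq_sqrt hN0.le]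
      have := h.energy_le
      nlinarith
  have heq : starEnergy Ω V N a = ENNReal.ofReal (N * e) :=
    le_antisymm ((iInf₂_le (fun x => (φ x : ℂ)) hmass').trans hup) hlow
  refine ⟨heq, φ, fun x _ => ?_, hmass', ?_⟩
  · rw [hφ]; simp only
    split_ifs with h1
    · exact mul_pos (Real.sqrt_pos.2 hN0) h1
    · exact one_pos
  · rw [heq]
    exact le_antisymm hup (le_starFunctional hΩ.isOpen hV hVm hN ha hmass')

/-- A strictly positive minimizer is, up to normalization, a minimizer in the sense of
`IsStarMin`. -/
theorem IsPositiveStarMinimizer.exists_isStarMin (hΩ : IsTrap Ω V) (hV : ∀ x, 0 ≤ V x)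
    (hVm : Measurable V) (hVb : ∀ R : ℝ, ∃ M : ℝ, ∀ x, ‖x‖ ≤ R → V x ≤ M) {N : ℕ}
    {a : ℝ} (hN : 1 ≤ N) (ha : 0 < a) {φ : Space3 → ℝ} (hφ : IsPositiveStarMinimizer Ω V N a φ) :
    ∃ g m, IsStarMin Ω V (N * a) (starEnergy Ω V 1 (N * a)).toReal
      (fun x => (√N)⁻¹ * |φ x|) g m := by
  have hN0 : (0 : ℝ) < N := by exact_mod_cast hN
  have hs : 0 < √(N : ℝ) := Real.sqrt_pos.2 hN0
  have he : 0 ≤ (starEnergy Ω V 1 (N * a)).toReal := ENNReal.toReal_nonneg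
  obtain ⟨-, h1, h2⟩ := hφ
  have heq := (starEnergy_eq hΩ hV hVm hVb hN ha).1
  rw [heq] at h2
  obtain ⟨g, m, a1, a2, a3, a4, a5⟩ := exists_form_of_starFunctional hΩ.isOpen hV hVm ha hN0 h1
    (by rw [h2]; exact ENNReal.ofReal_ne_top)
  rw [h2, ENNReal.ofReal_le_ofReal_iff (by positivity)] at a5
  simp only [Complex.norm_real, Real.norm_eq_abs] at a2 a3 a4 a5
  refine ⟨_, (√N)⁻¹ * m, a2.const_mul (√N)⁻¹, fun x => by positivity, ?_, by positivity, ?_, ?_,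
    fun f' g' m' b1 b2 b3 => starEnergy_lower hV hVm (by positivity) b1 b2 b3⟩
  · simp only [mul_pow]
    rw [integral_const_mul, a4, inv_pow, Real.sq_sqrt hN0.le, inv_mul_cancel₀ hN0.ne']
  · filter_upwards [a3] with x hx
    gcongr
  · rw [formEnergy_const_mul, mul_pow, inv_pow, Real.sq_sqrt hN0.le]
    rw [← mul_le_mul_iff_right₀ hN0]
    refine le_trans (le_of_eq ?_) a5
    field_simp

end StarMinimizer

/-! ### Uniform bounds on minimizers. -/

section Sup

variable {Ω : Set Space3} {V : Space3 → ℝ} {A e : ℝ} {f : Space3 → ℝ}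
  {g : Fin 3 → Space3 → ℝ} {m : ℝ}

/-- One step of the De Giorgi iteration. -/
theorem IsStarMin.integral_posPart_step (h : IsStarMin Ω V A e f g m) (he : 0 ≤ e) (hΩ : IsOpen Ω)
    (hV : ∀ x, 0 ≤ V x) (hVm : Measurable V) {ι : Type} [Countable ι] {Q : ι → Set Space3}
    {d v : ℝ} (hQ : IsGrid Ω V Q d v) (hv : 0 < v) {K K' L : ℝ} (hK : 0 ≤ K) (hKK' : K < K')
    (hL : K' / (K' - K) ≤ L) (hsmall : (∫ x in Ω, max (f x - K) 0 ^ 2) / (K' - K) ^ 2 ≤ v / 2) :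
    ∫ x in Ω, max (f x - K') 0 ^ 2
      ≤ 16 * d ^ 2 * (e * (L ^ 2 * ∫ x in Ω, max (f x - K) 0 ^ 2)) := by
  have hKp : 0 < K' - K := by linarith
  have hK' : 0 ≤ K' := by linarith
  have hu := fun k => (h.dom.deriv k).posPart_sub hΩ hK
  have hu' := fun k => (h.dom.deriv k).posPart_sub hΩ hK'
  have hint := (hu 0).1.integrable_sq
  -- Chebyshev: little mass above `K` makes the set `{f > K'}` smaller than half a cell, so the
  -- Faber-Krahn inequality applies to `(f - K')₊`.
  have hset : volume.restrict Ω {x | max (f x - K') 0 ≠ 0} ≤ ENNReal.ofReal (v / 2) := by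
    refine le_trans ?_ (ENNReal.ofReal_le_ofReal hsmall)
    have h1 := mul_meas_ge_le_lintegral₀ (μ := volume.restrict Ω)
      (f := fun x => ENNReal.ofReal (max (f x - K) 0 ^ 2))
      hint.1.aemeasurable.ennreal_ofReal (ENNReal.ofReal ((K' - K) ^ 2))
    rw [← ofReal_integral_eq_lintegral_ofReal hint (Eventually.of_forall fun x => sq_nonneg _),
      mul_comm, ← ENNReal.le_div_iff_mul_le (Or.inl (by simpa using by positivity))
      (Or.inl ENNReal.ofReal_ne_top), ← ENNReal.ofReal_div_of_pos (by positivity)] at h1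
    refine (measure_mono fun x hx => ?_).trans h1
    have hx' : K' < f x := by
      by_contra hn
      exact hx (max_eq_right (by linarith [not_lt.1 hn]))
    refine ENNReal.ofReal_le_ofReal (pow_le_pow_left₀ hKp.le ?_ 2)
    exact le_max_of_le_left (by linarith)
  have hFK := hQ.faberKrahn hΩ hv hu' hset
  rw [lintegral_enorm_sq_eq (hu' 0).1] at hFK
  simp only [lintegral_enorm_sq_eq (hu' _).2.1] at hFK
  rw [← ENNReal.ofReal_sum_of_nonneg fun k _ => integral_nonneg fun x => sq_nonneg _,
    show (16 : ℝ≥0∞) = ENNReal.ofReal 16 by simp, ← ENNReal.ofReal_mul (by norm_num),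
    ← ENNReal.ofReal_mul (by positivity), ENNReal.ofReal_le_ofReal_iff (mul_nonneg (by positivity)
      (Finset.sum_nonneg fun k _ => integral_nonneg fun x => sq_nonneg _))] at hFK
  refine hFK.trans ?_
  gcongr
  refine (h.gradient_superlevel_le hΩ hV hVm hK').trans ?_
  gcongr
  rw [← integral_const_mul]
  have hm := h.dom.truncate hΩ hV hVm (Eventually.of_forall h.nonneg) hK'
  refine integral_mono (h.dom.memLp.integrable_sq.sub hm.memLp.integrable_sq)
    (hint.const_mul _) fun x => ?_
  simp only
  rcases le_or_gt (f x) K' with hx | hx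
  · rw [min_eq_left hx, sub_self]; positivity
  · rw [min_eq_right hx.le, max_eq_left (by linarith), ← mul_pow]
    -- Since `K' ≤ L (K' - K)` and `L ≥ 1`, the full value `f`, and with it the lost mass `f² -
    -- K'²`, is controlled by the excess over the lower level.
    have h1 : f x ≤ L * (f x - K) := by
      rw [div_le_iff₀ hKp] at hL
      have hL1 : 1 ≤ L := by
        by_contra hn
        nlinarith [not_le.1 hn]
      nlinarith
    have h2 : f x ^ 2 ≤ (L * (f x - K)) ^ 2 := pow_le_pow_left₀ (h.nonneg x) h1 2
    nlinarith [sq_nonneg K']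

/-- Minimizers are bounded, uniformly for bounded energies. -/
theorem exists_sup_bound (hΩ : IsTrap Ω V) (hV : ∀ x, 0 ≤ V x) (hVm : Measurable V) (E : ℝ)
    (hE : 0 ≤ E) : ∃ K > 0, ∀ A e f g m, IsStarMin Ω V A e f g m → 0 ≤ e → e ≤ E →
      ∀ᵐ x ∂volume.restrict Ω, f x ≤ K := by
  obtain ⟨D, c, hD, hc, hgrid⟩ := exists_grid hΩ
  -- At step `n` the grid has scale `1 / (m₀ 4ⁿ)` and the excess mass is at most `256⁻ⁿ`. The choice
  -- of `m₀` makes the contraction factor at most `1/256` for every energy up to `E`.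
  obtain ⟨m₀, hm₀⟩ : ∃ m₀ : ℕ, 2 ^ 18 * D ^ 2 * E + 1 < m₀ := exists_nat_gt _
  have hm1 : (1 : ℝ) ≤ m₀ := le_trans (by
    have : 0 ≤ 2 ^ 18 * D ^ 2 * E := by positivity
    linarith) hm₀.le
  have hm0 : (0 : ℝ) < m₀ := by linarith
  -- With level gaps `K 2^(-n-2)`, Chebyshev bounds the superlevel sets by `16 · 64⁻ⁿ / K²`. This
  -- `K` makes the bound exactly half the cell volume `c / (m₀ 4ⁿ)³`.
  set K : ℝ := √(32 * m₀ ^ 3 / c) with hKdef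
  have hK : 0 < K := Real.sqrt_pos.2 (by positivity)
  have hK2 : K ^ 2 = 32 * m₀ ^ 3 / c := Real.sq_sqrt (by positivity)
  refine ⟨K, hK, fun A e f g m h he heE => ?_⟩
  set k : ℕ → ℝ := fun n => K * (1 - (1 / 2) ^ (n + 1)) with hk
  have hp1 : ∀ n : ℕ, (1 / 2 : ℝ) ^ (n + 1) ≤ 1 := fun n => pow_le_one₀ (by norm_num) (by norm_num)
  have hk0 : ∀ n, 0 ≤ k n := fun n => mul_nonneg hK.le (by linarith [hp1 n])
  have hkd : ∀ n, k (n + 1) - k n = K * (1 / 2) ^ (n + 2) := fun n => by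
    simp only [hk]; ring
  have hkK : ∀ n, k n ≤ K := fun n => by
    have : (0 : ℝ) < (1 / 2) ^ (n + 1) := by positivity
    simp only [hk]; nlinarith
  have hdec : ∀ n, ∫ x in Ω, max (f x - k n) 0 ^ 2 ≤ (1 / 256) ^ n := by
    intro n
    induction n with
    | zero =>
      rw [pow_zero, ← h.mass]
      refine integral_mono ((h.dom.deriv 0).posPart_sub hΩ.isOpen (hk0 0)).1.integrable_sq
        h.dom.memLp.integrable_sq fun x => ?_
      refine pow_le_pow_left₀ (le_max_right _ _) (max_le ?_ (h.nonneg x)) 2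
      linarith [hk0 0]
    | succ n ih =>
      obtain ⟨ι, _, Q, hQ⟩ := hgrid (m₀ * 4 ^ n) (by
        have : 1 ≤ m₀ := by exact_mod_cast hm1
        exact Nat.one_le_iff_ne_zero.2 (by positivity))
      have h4 : (0 : ℝ) < 4 ^ n := by positivity
      have hY : 0 ≤ ∫ x in Ω, max (f x - k n) 0 ^ 2 := integral_nonneg fun _ => sq_nonneg _
      have e256 : (1 / 256 : ℝ) ^ n = 1 / (4 ^ n) ^ 4 := by
        rw [← pow_mul, mul_comm, pow_mul, div_pow, one_pow]; norm_num
      have e2 : ((1 / 2 : ℝ) ^ n) ^ 2 = 1 / 4 ^ n := by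
        rw [← pow_mul, mul_comm, pow_mul, ← one_div_pow]; norm_num
      have hstep := h.integral_posPart_step he hΩ.isOpen hV hVm hQ (by push_cast; positivity)
        (hk0 n) (K' := k (n + 1)) (L := 2 ^ (n + 2)) (by
          have := hkd n
          have : 0 < K * (1 / 2) ^ (n + 2) := by positivity
          linarith) (by
          rw [hkd, div_le_iff₀ (by positivity)]
          refine (hkK _).trans (le_of_eq ?_)
          rw [mul_comm K, ← mul_assoc, ← mul_pow]; norm_num) (by
          rw [hkd, div_le_iff₀ (by positivity)]
          refine ih.trans ?_
          rw [mul_pow, pow_add, mul_pow, e2, e256, hK2]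
          push_cast
          refine le_of_eq ?_
          field_simp
          norm_num)
      refine hstep.trans ?_
      have e3 : ((2 : ℝ) ^ (n + 2)) ^ 2 = 16 * 4 ^ n := by
        rw [pow_add, mul_pow, ← pow_mul, mul_comm n 2, pow_mul]; norm_num; ring
      rw [e3]
      push_cast
      have hcoef : 16 * (D / (m₀ * 4 ^ n)) ^ 2 * (e * (16 * 4 ^ n)) ≤ 1 / 256 := by
        have e4 : 16 * (D / (m₀ * 4 ^ n)) ^ 2 * (e * (16 * 4 ^ n))
            = 256 * D ^ 2 * e / (m₀ ^ 2 * 4 ^ n) := by field_simp; ring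
        rw [e4, div_le_div_iff₀ (by positivity) (by norm_num)]
        have h41 : (1 : ℝ) ≤ 4 ^ n := one_le_pow₀ (by norm_num)
        have a1 : 256 * D ^ 2 * e * 256 ≤ 2 ^ 18 * D ^ 2 * E := by
          have : D ^ 2 * e ≤ D ^ 2 * E := by gcongr
          have : 0 ≤ D ^ 2 * E := by positivity
          norm_num; nlinarith
        have a2 : (m₀ : ℝ) * 1 ≤ m₀ * m₀ := by gcongr
        have a3 : (m₀ : ℝ) ^ 2 * 1 ≤ m₀ ^ 2 * 4 ^ n := by gcongr
        nlinarith
      calc 16 * (D / (m₀ * 4 ^ n)) ^ 2 * (e * (16 * 4 ^ n * ∫ x in Ω, max (f x - k n) 0 ^ 2))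
          = 16 * (D / (m₀ * 4 ^ n)) ^ 2 * (e * (16 * 4 ^ n))
            * ∫ x in Ω, max (f x - k n) 0 ^ 2 := by ring
        _ ≤ 1 / 256 * (1 / 256) ^ n := by gcongr
        _ = (1 / 256) ^ (n + 1) := by ring
  have hKi := ((h.dom.deriv 0).posPart_sub hΩ.isOpen hK.le).1.integrable_sq
  have hz : ∫ x in Ω, max (f x - K) 0 ^ 2 ≤ 0 := by
    refine ge_of_tendsto' (tendsto_pow_atTop_nhds_zero_of_lt_one (r := (1 / 256 : ℝ))
      (by norm_num) (by norm_num)) fun n => le_trans ?_ (hdec n)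
    refine integral_mono hKi ((h.dom.deriv 0).posPart_sub hΩ.isOpen (hk0 n)).1.integrable_sq
      fun x => ?_
    exact pow_le_pow_left₀ (le_max_right _ _) (max_le_max_right _ (by linarith [hkK n])) 2
  have hz' := (integral_eq_zero_iff_of_nonneg (fun x => sq_nonneg _) hKi).1
    (le_antisymm hz (integral_nonneg fun _ => sq_nonneg _))
  filter_upwards [hz'] with x hx
  have hx' : max (f x - K) 0 = 0 := by simpa using hx
  linarith [le_max_left (f x - K) 0]

theorem IsStarMin.integrable_pow_four (h : IsStarMin Ω V A e f g m) :
    Integrable (fun x => f x ^ 4) (volume.restrict Ω) := by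
  refine (h.dom.memLp.integrable_sq.const_mul (m ^ 2)).mono' (h.dom.memLp.1.pow 4) ?_
  filter_upwards [h.le_sup] with x hx
  rw [Real.norm_of_nonneg (by positivity)]
  have := pow_le_pow_left₀ (h.nonneg x) hx 2
  nlinarith [sq_nonneg (f x)]

/-- The quartic integral of minimizers is bounded from below, uniformly for bounded energies. -/
theorem exists_integral_pow_four_lower (hΩ : IsTrap Ω V) (hV : ∀ x, 0 ≤ V x) (hVm : Measurable V)
    (E : ℝ) (hE : 0 ≤ E) : ∃ c > 0, ∀ A e f g m, 0 ≤ A → IsStarMin Ω V A e f g m → e ≤ E →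
      c ≤ ∫ x in Ω, f x ^ 4 := by
  -- The mass where `V ≥ B` is at most `E / B ≤ 1/2`. On the finite-measure set `S = {V < B}`, `f² ≤
  -- f⁴ / (2l) + l / 2`, and `l` below is small enough for `|S| l / 2 ≤ 1/4`. At least a quarter of
  -- the mass is left to `∫ f⁴ / (2l)`.
  set B := 2 * E + 1
  have hB : 0 < B := by positivity
  set S : Set Space3 := {x | V x < B} with hS
  have hSm : MeasurableSet S := measurableSet_lt hVm measurable_const
  have hSfin : volume.restrict Ω S ≠ ⊤ := by
    rw [Measure.restrict_apply hSm]
    refine ((measure_mono fun x hx => ?_).trans_lt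
      (lt_top_iff_ne_top.2 (hΩ.volume_sublevel_ne_top B))).ne
    exact ⟨hx.2, hx.1⟩
  set s := (volume.restrict Ω).real S with hs
  have hs0 : 0 ≤ s := measureReal_nonneg
  refine ⟨1 / (4 * (s + 1)), by positivity, fun A e f g m hA h he => ?_⟩
  set l := 1 / (2 * (s + 1)) with hl
  have hl0 : 0 < l := by positivity
  have i1 : Integrable (fun x => S.indicator (fun _ => l / 2) x) (volume.restrict Ω) :=
    (integrable_indicator_iff hSm).2 (integrableOn_const hSfin)
  have i2 := h.integrable_pow_four.const_mul (1 / (2 * l))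
  have i3 := h.dom.pot.const_mul (1 / B)
  have hle : ∫ x in Ω, f x ^ 2 ≤ ∫ x in Ω, (1 / B * (V x * f x ^ 2)
      + (S.indicator (fun _ => l / 2) x + 1 / (2 * l) * f x ^ 4)) := by
    refine integral_mono h.dom.memLp.integrable_sq (i3.add (i1.add i2)) fun x => ?_
    simp only
    have h1 : 0 ≤ 1 / B * (V x * f x ^ 2) := mul_nonneg (by positivity)
      (mul_nonneg (hV x) (sq_nonneg _))
    have h2 : 0 ≤ 1 / (2 * l) * f x ^ 4 := by positivity
    by_cases hx : x ∈ S
    · rw [indicator_of_mem hx]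
      have h3 : 0 ≤ 1 / (2 * l) * (f x ^ 2 - l) ^ 2 := by positivity
      have h4 : 1 / (2 * l) * (f x ^ 2 - l) ^ 2 = 1 / (2 * l) * f x ^ 4 + l / 2 - f x ^ 2 := by
        field_simp; ring
      linarith
    · rw [indicator_of_notMem hx]
      have h3 : B ≤ V x := not_lt.1 hx
      have h4 : f x ^ 2 ≤ 1 / B * (V x * f x ^ 2) := by
        rw [one_div, ← div_eq_inv_mul, le_div_iff₀ hB]
        nlinarith [sq_nonneg (f x)]
      linarith
  have hadd := integral_add i3 (i1.add i2)
  simp only [Pi.add_apply] at hadd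
  rw [hadd, integral_add i1 i2, integral_const_mul, integral_const_mul,
    integral_indicator hSm, setIntegral_const, h.mass, smul_eq_mul, ← hs] at hle
  have hpot : ∫ x in Ω, V x * f x ^ 2 ≤ E := by
    have h1 := h.energy_le
    have h2 : 0 ≤ 8 * Real.pi * A * m ^ 2 := by have := Real.pi_pos; positivity
    have h3 : 0 ≤ ∑ k, ∫ x in Ω, g k x ^ 2 :=
      Finset.sum_nonneg fun _ _ => integral_nonneg fun _ => sq_nonneg _
    rw [formEnergy] at h1
    linarith
  have hpot2 : 1 / B * ∫ x in Ω, V x * f x ^ 2 ≤ 1 / 2 := by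
    calc 1 / B * ∫ x in Ω, V x * f x ^ 2 ≤ 1 / B * E := by gcongr
      _ ≤ 1 / 2 := by
        rw [one_div, ← div_eq_inv_mul, div_le_div_iff₀ hB (by norm_num)]
        simp only [B]; linarith
  have hls : s * (l / 2) ≤ 1 / 4 := by
    rw [hl]
    field_simp
    nlinarith
  have e1 : 1 / (2 * l) = s + 1 := by rw [hl]; field_simp
  rw [e1] at hle
  rw [div_le_iff₀ (by positivity)]
  nlinarith

/-- The energies are bounded for bounded couplings. -/
theorem exists_starEnergy_bound (hΩ : IsTrap Ω V) (hV : ∀ x, 0 ≤ V x) (hVm : Measurable V)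
    (hVb : ∀ R : ℝ, ∃ M : ℝ, ∀ x, ‖x‖ ≤ R → V x ≤ M) (κ : ℝ) :
    ∃ E ≥ 0, ∀ A, 0 ≤ A → A ≤ κ → (starEnergy Ω V 1 A).toReal ≤ E := by
  obtain ⟨f, g, m, h, hm0, hm, h1⟩ := exists_normalized hΩ hV hVm hVb
  have hT := formEnergy_nonneg (Ω := Ω) hV f g
  have hπ := Real.pi_pos
  refine ⟨formEnergy Ω V f g + 8 * Real.pi * |κ| * m ^ 2 * 1, by positivity, fun A hA hAκ => ?_⟩
  refine (ENNReal.toReal_le_of_le_ofReal (by positivity)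
    (starEnergy_le hV hVm hA h (Eventually.of_forall hm) hm0 h1)).trans ?_
  gcongr
  exact hAκ.trans (le_abs_self _)

end Sup

/-- Integration by parts for a differentiable function and an indefinite integral. -/
theorem integral_mul_eq_of_primitive {h h' p G : ℝ → ℝ} {r s : ℝ} (hrs : r ≤ s)
    (hd : ∀ t ∈ Icc r s, HasDerivAt h (h' t) t) (hc : ContinuousOn h' (Icc r s))
    (hG : IntervalIntegrable G volume r s)
    (hp : ∀ t ∈ Icc r s, p t - p r = ∫ x in r..t, G x) :
    ∫ t in r..s, h t * G t = h s * p s - h r * p r - ∫ t in r..s, h' t * p t := by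
  have hu : uIcc r s = Icc r s := uIcc_of_le hrs
  have hK : IntervalIntegrable h' volume r s := (hu ▸ hc).intervalIntegrable
  have hh : ∀ t ∈ Icc r s, h t - h r = ∫ x in r..t, h' x := fun t ht => by
    have hut : uIcc r t = Icc r t := uIcc_of_le ht.1
    have hsub : Icc r t ⊆ Icc r s := Icc_subset_Icc_right ht.2
    refine (intervalIntegral.integral_eq_sub_of_hasDerivAt (fun x hx => hd x (hsub (hut ▸ hx)))
      ?_).symm
    exact (hut ▸ hc.mono hsub).intervalIntegrable
  have acP := hG.absolutelyContinuousOnInterval_intervalIntegral (c := r) (by simp)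
  have acH := hK.absolutelyContinuousOnInterval_intervalIntegral (c := r) (by simp)
  have key := AbsolutelyContinuousOnInterval.integral_mul_deriv_eq_deriv_mul acH acP
  have e1 : ∫ x in r..s, (∫ y in r..x, h' y) * deriv (fun x => ∫ y in r..x, G y) x
      = (∫ x in r..s, h x * G x) - h r * ∫ x in r..s, G x := by
    rw [← intervalIntegral.integral_const_mul, ← intervalIntegral.integral_sub]
    · refine intervalIntegral.integral_congr_ae ?_
      filter_upwards [hG.ae_hasDerivAt_integral] with x hx hxr
      have hxr' : x ∈ uIcc r s := uIoc_subset_uIcc hxr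
      rw [(hx hxr' r (by simp)).deriv, ← hh x (hu ▸ hxr')]
      ring
    · exact hG.continuousOn_mul (hu ▸ fun t ht => (hd t ht).continuousAt.continuousWithinAt)
    · exact hG.const_mul _
  have hpc : ContinuousOn p (Icc r s) := by
    have h1 : ContinuousOn (fun t => p r + ∫ x in r..t, G x) (Icc r s) :=
      continuousOn_const.add (hu ▸ acP.continuousOn)
    exact h1.congr fun t ht => by simp only; rw [← hp t ht]; ring
  have e2 : ∫ x in r..s, deriv (fun x => ∫ y in r..x, h' y) x * ∫ y in r..x, G y
      = (∫ x in r..s, h' x * p x) - p r * ∫ x in r..s, h' x := by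
    rw [← intervalIntegral.integral_const_mul, ← intervalIntegral.integral_sub]
    · refine intervalIntegral.integral_congr_ae ?_
      filter_upwards [hK.ae_hasDerivAt_integral] with x hx hxr
      have hxr' : x ∈ uIcc r s := uIoc_subset_uIcc hxr
      rw [(hx hxr' r (by simp)).deriv, ← hp x (hu ▸ hxr')]
      ring
    · exact hK.mul_continuousOn (hu ▸ hpc)
    · exact hK.const_mul _
  rw [e1, e2, ← hh s (right_mem_Icc.2 hrs), ← hp s (right_mem_Icc.2 hrs)] at key
  simp only [intervalIntegral.integral_same, zero_mul, sub_zero] at key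
  linarith

/-! ### The zero-energy scattering solution. -/

namespace IsScatteringSolution

variable {v : ℝ → ℝ≥0∞} {d a : ℝ} {u u' : ℝ → ℝ}

theorem ae_ne_top (hs : IsScatteringSolution v d u u') (hv : Measurable v) {r s : ℝ} (hr : d < r)
    (hrs : r ≤ s) : ∀ᵐ t ∂volume.restrict (Icc r s), v t ≠ ⊤ :=
  (ae_lt_top hv (hs.2.2.1 r s hr hrs).ne).mono fun _ h => h.ne

theorem intervalIntegrable (hs : IsScatteringSolution v d u u') (hv : Measurable v) {r s : ℝ}
    (hr : d < r) (hrs : r ≤ s) :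
    IntervalIntegrable (fun t => 1 / 2 * (v t).toReal * u t) volume r s := by
  have h1 : IntervalIntegrable (fun t => (v t).toReal) volume r s := by
    rw [intervalIntegrable_iff_integrableOn_Icc_of_le hrs]
    exact integrable_toReal_of_lintegral_ne_top hv.aemeasurable (hs.2.2.1 r s hr hrs).ne
  refine (h1.const_mul (1 / 2)).mul_continuousOn ?_
  rw [uIcc_of_le hrs]
  exact hs.2.2.2.1.mono fun t ht => le_trans (hs.1.trans hr.le) ht.1

theorem hasDerivAt (hs : IsScatteringSolution v d u u') {r : ℝ} (hr : d < r) :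
    HasDerivAt u (u' r) r := hs.2.2.2.2.2.2.1 r hr

theorem pos (hs : IsScatteringSolution v d u u') {r : ℝ} (hr : d < r) : 0 < u r :=
  hs.2.2.2.2.2.1 r hr

theorem deriv_sub (hs : IsScatteringSolution v d u u') {r s : ℝ} (hr : d < r) (hrs : r ≤ s) :
    u' s - u' r = ∫ t in r..s, 1 / 2 * (v t).toReal * u t := hs.2.2.2.2.2.2.2 r s hr hrs

theorem deriv_mono (hs : IsScatteringSolution v d u u') {r s : ℝ} (hr : d < r) (hrs : r ≤ s) :
    u' r ≤ u' s := by
  have h1 := hs.deriv_sub hr hrs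
  have h2 : 0 ≤ ∫ t in r..s, 1 / 2 * (v t).toReal * u t := by
    refine intervalIntegral.integral_nonneg hrs fun t ht => ?_
    have := hs.pos (hr.trans_le ht.1)
    positivity
  linarith

theorem exists_deriv_eq (hs : IsScatteringSolution v d u u') {r s : ℝ} (hr : d ≤ r) (hrs : r < s) :
    ∃ c ∈ Ioo r s, u' c = (u s - u r) / (s - r) :=
  exists_hasDerivAt_eq_slope u u' hrs
    (hs.2.2.2.1.mono fun _ ht => (hs.1.trans hr).trans ht.1)
    fun _ hx => hs.hasDerivAt (hr.trans_lt hx.1)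

theorem apply_core (hs : IsScatteringSolution v d u u') : u d = 0 :=
  hs.2.2.2.2.1 d ⟨hs.1, le_rfl⟩

/-- `u` is convex outside the core, as `u'` increases, and vanishes at `d`; its slope at `r`
dominates the slope of the chord from `d`. -/
theorem le_mul_deriv (hs : IsScatteringSolution v d u u') {r : ℝ} (hr : d < r) :
    u r ≤ (r - d) * u' r := by
  obtain ⟨c, hc, h⟩ := hs.exists_deriv_eq le_rfl hr
  rw [hs.apply_core, sub_zero, eq_div_iff (by linarith)] at h
  have := hs.deriv_mono hc.1 hc.2.le
  have h3 : 0 < r - d := by linarith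
  nlinarith

theorem deriv_pos (hs : IsScatteringSolution v d u u') {r : ℝ} (hr : d < r) : 0 < u' r := by
  have h1 := hs.le_mul_deriv hr
  have h2 := hs.pos hr
  have h3 : 0 < r - d := by linarith
  exact pos_of_mul_pos_right (h2.trans_le h1) h3.le

theorem le_add_mul_deriv (hs : IsScatteringSolution v d u u') {r s : ℝ} (hr : d < r)
    (hrs : r ≤ s) : u s ≤ u r + (s - r) * u' s := by
  rcases hrs.eq_or_lt with rfl | hlt
  · simp
  obtain ⟨c, hc, h⟩ := hs.exists_deriv_eq hr.le hlt
  rw [eq_div_iff (by linarith)] at h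
  have := hs.deriv_mono (hr.trans hc.1) hc.2.le
  have h3 : 0 < s - r := by linarith
  nlinarith

/-- `r - u/u'` is the point where the tangent at `r` meets the axis, and convexity moves it to the
right. The scattering length is therefore an upper bound for all intercepts, that is, `(r - a) u'(r)
≤ u(r)`. -/
theorem intercept_mono (hs : IsScatteringSolution v d u u') {r s : ℝ} (hr : d < r)
    (hrs : r ≤ s) : r - u r / u' r ≤ s - u s / u' s := by
  have h1 := hs.le_add_mul_deriv hr hrs
  have h2 := hs.deriv_pos hr
  have h3 := hs.deriv_pos (hr.trans_le hrs)
  have h4 : u s / u' s ≤ u r / u' s + (s - r) := by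
    rw [div_le_iff₀ h3, add_mul, div_mul_cancel₀ _ h3.ne']; exact h1
  have h5 : u r / u' s ≤ u r / u' r :=
    div_le_div_of_nonneg_left (hs.pos hr).le h2 (hs.deriv_mono hr hrs)
  linarith

theorem intercept_le (ha : Tendsto (fun r => r - u r / u' r) atTop (𝓝 a))
    (hs : IsScatteringSolution v d u u') {r : ℝ} (hr : d < r) :
    (r - a) * u' r ≤ u r := by
  have h1 : r - u r / u' r ≤ a := ge_of_tendsto ha (by
    filter_upwards [eventually_ge_atTop r] with s hrs
    exact hs.intercept_mono hr hrs)
  have h2 := hs.deriv_pos hr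
  have h3 : r - a ≤ u r / u' r := by linarith
  rwa [le_div_iff₀ h2] at h3

theorem core_le (ha : Tendsto (fun r => r - u r / u' r) atTop (𝓝 a))
    (hs : IsScatteringSolution v d u u') : d ≤ a := by
  have h1 := hs.intercept_le ha (r := d + 1) (by linarith)
  have h2 := hs.le_mul_deriv (r := d + 1) (by linarith)
  have h3 := hs.deriv_pos (r := d + 1) (by linarith)
  nlinarith

theorem continuousOn_deriv (hs : IsScatteringSolution v d u u') (hv : Measurable v) {r s : ℝ}
    (hr : d < r) (hrs : r ≤ s) : ContinuousOn u' (Icc r s) := by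
  have hu : uIcc r s = Icc r s := uIcc_of_le hrs
  have hG := hs.intervalIntegrable hv hr hrs
  have acP := hG.absolutelyContinuousOnInterval_intervalIntegral (c := r) (by simp)
  have h1 : ContinuousOn (fun t => u' r + ∫ x in r..t, 1 / 2 * (v x).toReal * u x) (Icc r s) :=
    continuousOn_const.add (hu ▸ acP.continuousOn)
  exact h1.congr fun t ht => by simp only; rw [← hs.deriv_sub hr ht.1]; ring

theorem continuousOn_self (hs : IsScatteringSolution v d u u') {r s : ℝ} (hr : d < r) :
    ContinuousOn u (Icc r s) :=
  fun _ ht => (hs.hasDerivAt (hr.trans_le ht.1)).continuousAt.continuousWithinAt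

theorem integral_parts (hs : IsScatteringSolution v d u u') (hv : Measurable v) {r s : ℝ}
    (hr : d < r) (hrs : r ≤ s) {h h' : ℝ → ℝ} (hd : ∀ t ∈ Icc r s, HasDerivAt h (h' t) t)
    (hc : ContinuousOn h' (Icc r s)) :
    ∫ t in r..s, h t * (1 / 2 * (v t).toReal * u t)
      = h s * u' s - h r * u' r - ∫ t in r..s, h' t * u' t :=
  integral_mul_eq_of_primitive hrs hd hc (hs.intervalIntegrable hv hr hrs)
    fun _ ht => hs.deriv_sub hr ht.1

/-- The energy of `u(t)/t` on an interval. -/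
theorem integral_energy (hs : IsScatteringSolution v d u u') (hv : Measurable v) {r s : ℝ}
    (hr : d < r) (hrs : r ≤ s) :
    IntervalIntegrable (fun t => (u' t - u t / t) ^ 2 + u t * (1 / 2 * (v t).toReal * u t))
      volume r s ∧
    ∫ t in r..s, ((u' t - u t / t) ^ 2 + u t * (1 / 2 * (v t).toReal * u t))
      = u s * (u' s - u s / s) - u r * (u' r - u r / r) := by
  have hu : uIcc r s = Icc r s := uIcc_of_le hrs
  have h0 : ∀ t ∈ Icc r s, t ≠ 0 := fun t ht => ((hs.1.trans_lt hr).trans_le ht.1).ne'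
  have cu := hs.continuousOn_self (s := s) hr
  have cu' := hs.continuousOn_deriv hv hr hrs
  have cq : ContinuousOn (fun t => u t / t) (Icc r s) := cu.div continuousOn_id h0
  have c1 : ContinuousOn (fun t => (u' t - u t / t) ^ 2) (Icc r s) := (cu'.sub cq).pow 2
  have i1 : IntervalIntegrable (fun t => (u' t - u t / t) ^ 2) volume r s :=
    (hu ▸ c1).intervalIntegrable
  have i2 : IntervalIntegrable (fun t => u t * (1 / 2 * (v t).toReal * u t)) volume r s :=
    (hs.intervalIntegrable hv hr hrs).continuousOn_mul (hu ▸ cu)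
  refine ⟨i1.add i2, ?_⟩
  -- The equation is tested with `u` itself. The mixed terms in `(u' - u/t)²` are `-(u²/t)'`, so
  -- everything apart from boundary values cancels.
  have e1 := hs.integral_parts hv hr hrs (h := u) (h' := u')
    (fun t ht => hs.hasDerivAt (hr.trans_le ht.1)) cu'
  have c3 : ContinuousOn (fun t => u' t * u' t) (Icc r s) := cu'.mul cu'
  have c4 : ContinuousOn (fun t => 2 * u' t * (u t / t) - (u t / t) ^ 2) (Icc r s) :=
    ((continuousOn_const.mul cu').mul cq).sub (cq.pow 2)
  have e2 : ∫ t in r..s, (2 * u' t * (u t / t) - (u t / t) ^ 2)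
      = u s ^ 2 / s - u r ^ 2 / r := by
    refine intervalIntegral.integral_eq_sub_of_hasDerivAt (f := fun t => u t ^ 2 / t)
      (fun t ht => ?_) (hu ▸ c4).intervalIntegrable
    have ht' : t ∈ Icc r s := hu ▸ ht
    have h1 := ((hs.hasDerivAt (hr.trans_le ht'.1)).pow 2).div (hasDerivAt_id t) (h0 t ht')
    refine h1.congr_deriv ?_
    have := h0 t ht'
    simp only [id, Pi.pow_apply]
    field_simp
    ring
  rw [intervalIntegral.integral_add i1 i2, e1]
  have e3 : ∫ t in r..s, (u' t - u t / t) ^ 2 = (∫ t in r..s, u' t * u' t)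
      - ∫ t in r..s, (2 * u' t * (u t / t) - (u t / t) ^ 2) := by
    rw [← intervalIntegral.integral_sub (hu ▸ c3).intervalIntegrable (hu ▸ c4).intervalIntegrable]
    congr 1; ext t; ring
  rw [e3, e2]
  ring

/-- The equation is tested with `t - a`; the boundary term at the far end has the right sign because
the intercept there is at most `a`. -/
theorem integral_tail_le (ha : Tendsto (fun r => r - u r / u' r) atTop (𝓝 a))
    (hs : IsScatteringSolution v d u u') (hv : Measurable v) {r s : ℝ}
    (hr : d < r) (hrs : r ≤ s) :
    ∫ t in r..s, (t - a) * (1 / 2 * (v t).toReal * u t) ≤ u r - (r - a) * u' r := by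
  have e1 := hs.integral_parts hv hr hrs (h := fun t => t - a) (h' := fun _ => 1)
    (fun t _ => (hasDerivAt_id t).sub_const a) continuousOn_const
  have hu : uIcc r s = Icc r s := uIcc_of_le hrs
  have e2 : ∫ t in r..s, 1 * u' t = u s - u r := by
    simp only [one_mul]
    refine intervalIntegral.integral_eq_sub_of_hasDerivAt
      (fun t ht => hs.hasDerivAt (hr.trans_le (hu ▸ ht : t ∈ Icc r s).1)) ?_
    exact (hu ▸ hs.continuousOn_deriv hv hr hrs).intervalIntegrable
  rw [e1, e2]
  have := hs.intercept_le ha (hr.trans_le hrs)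
  linarith

/-- For `f = b u / (t u(b))`, so that `f(b) = 1`, the integrand is `t² (2 f'² + v f²)`. The boundary
term at `r` is dropped by convexity, and the one at `b` is expressed through the tangent intercept
at `b`. Together with the tail estimate beyond `b`, which contributes `a` minus this intercept, the
intercept disappears and only `a` remains. -/
theorem lintegral_energy_le (ha : Tendsto (fun r => r - u r / u' r) atTop (𝓝 a))
    (hs : IsScatteringSolution v d u u') (hv : Measurable v) {r b : ℝ}
    (hr : d < r) (hrb : r ≤ b) (hab : a < b) :
    ∫⁻ t in Ioc r b, (ENNReal.ofReal (2 * (b / u b) ^ 2 * (u' t - u t / t) ^ 2)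
        + v t * ENNReal.ofReal ((b / u b) ^ 2 * u t ^ 2))
      ≤ ENNReal.ofReal (2 * ((b - u b / u' b) / (1 - a / b))) := by
  obtain ⟨hi, he⟩ := hs.integral_energy hv hr hrb
  have hb0 : 0 < b := (hs.1.trans_lt hr).trans_le hrb
  have hub := hs.pos (hr.trans_le hrb)
  have hub' := hs.deriv_pos (hr.trans_le hrb)
  have hae : ∀ᵐ t ∂volume.restrict (Ioc r b), v t ≠ ⊤ :=
    ae_restrict_of_ae_restrict_of_subset Ioc_subset_Icc_self (hs.ae_ne_top hv hr hrb)
  have e1 : ∫⁻ t in Ioc r b, (ENNReal.ofReal (2 * (b / u b) ^ 2 * (u' t - u t / t) ^ 2)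
        + v t * ENNReal.ofReal ((b / u b) ^ 2 * u t ^ 2))
      = ∫⁻ t in Ioc r b, ENNReal.ofReal (2 * (b / u b) ^ 2 *
        ((u' t - u t / t) ^ 2 + u t * (1 / 2 * (v t).toReal * u t))) := by
    refine lintegral_congr_ae ?_
    filter_upwards [hae] with t ht
    conv_lhs => rw [← ENNReal.ofReal_toReal ht]
    rw [← ENNReal.ofReal_mul ENNReal.toReal_nonneg, ← ENNReal.ofReal_add (by positivity)
      (by positivity)]
    congr 1; ring
  rw [e1, ← ofReal_integral_eq_lintegral_ofReal ((hi.1).const_mul _), integral_const_mul,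
    ← intervalIntegral.integral_of_le hrb, he]
  · refine ENNReal.ofReal_le_ofReal ?_
    have h1 : 0 ≤ u r * (u' r - u r / r) := by
      refine mul_nonneg (hs.pos hr).le ?_
      have hr0 : 0 < r := hs.1.trans_lt hr
      have := hs.le_mul_deriv hr
      rw [sub_nonneg, div_le_iff₀ hr0]
      nlinarith [hs.deriv_pos hr, hs.1]
    have h2 : 0 ≤ b * u' b - u b := by
      have := hs.le_mul_deriv (hr.trans_le hrb)
      nlinarith [hs.1]
    have h3 : (b - a) * u' b ≤ u b := hs.intercept_le ha (hr.trans_le hrb)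
    have hba : 0 < b - a := by linarith
    have h4 : 2 * (b / u b) ^ 2 * (u b * (u' b - u b / b)) = 2 * (b * (b * u' b - u b) / u b) := by
      field_simp
    have h5 : 2 * ((b - u b / u' b) / (1 - a / b))
        = 2 * (b * (b * u' b - u b) / ((b - a) * u' b)) := by
      have : b - a ≠ 0 := hba.ne'
      have e : 1 - a / b = (b - a) / b := by field_simp
      rw [e]
      field_simp
    calc 2 * (b / u b) ^ 2 * (u b * (u' b - u b / b) - u r * (u' r - u r / r))
        ≤ 2 * (b / u b) ^ 2 * (u b * (u' b - u b / b)) := by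
          gcongr; linarith
      _ ≤ _ := by
          rw [h4, h5]
          gcongr
  · rw [EventuallyLE, ae_restrict_iff' measurableSet_Ioc]
    refine Eventually.of_forall fun t _ => ?_
    simp only [Pi.zero_apply]
    have : u t * (1 / 2 * (v t).toReal * u t) = 1 / 2 * (v t).toReal * u t ^ 2 := by ring
    rw [this]
    positivity

/-- For `t > b`, `u(t) ≥ (t - a) u'(b)` and `t - a ≥ (1 - a/b) t`, so `t²` is at most a constant
times `(t - a) u(t)`, whose integral against the potential is already known. The potential beyond
`b` is thus paid for by the part of the scattering length not yet reached at `b`. -/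
theorem lintegral_tail_le (ha : Tendsto (fun r => r - u r / u' r) atTop (𝓝 a))
    (hs : IsScatteringSolution v d u u') (hv : Measurable v) {b s : ℝ}
    (hbs : b ≤ s) (hab : a < b) :
    ∫⁻ t in Ioc b s, v t * ENNReal.ofReal (t ^ 2)
      ≤ ENNReal.ofReal (2 * ((a - (b - u b / u' b)) / (1 - a / b) ^ 2)) := by
  have hda := hs.core_le ha
  have hdb : d < b := hda.trans_lt hab
  have hb0 : 0 < b := hs.1.trans_lt hdb
  have hub' := hs.deriv_pos hdb
  have hba : 0 < b - a := by linarith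
  have hθ : 0 < 1 - a / b := by
    have : a / b < 1 := (div_lt_one hb0).2 hab
    linarith
  have hae : ∀ᵐ t ∂volume.restrict (Ioc b s), v t ≠ ⊤ :=
    ae_restrict_of_ae_restrict_of_subset Ioc_subset_Icc_self (hs.ae_ne_top hv hdb hbs)
  have hi : IntervalIntegrable (fun t => (t - a) * (1 / 2 * (v t).toReal * u t)) volume b s :=
    (hs.intervalIntegrable hv hdb hbs).continuousOn_mul (by fun_prop)
  set c := 2 / (u' b * (1 - a / b) ^ 2) with hc
  have hc0 : 0 < c := by positivity
  have key : ∫⁻ t in Ioc b s, v t * ENNReal.ofReal (t ^ 2)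
      ≤ ∫⁻ t in Ioc b s, ENNReal.ofReal (c * ((t - a) * (1 / 2 * (v t).toReal * u t))) := by
    refine lintegral_mono_ae ?_
    filter_upwards [hae, ae_restrict_mem measurableSet_Ioc] with t ht htb
    conv_lhs => rw [← ENNReal.ofReal_toReal ht]
    rw [← ENNReal.ofReal_mul ENNReal.toReal_nonneg]
    refine ENNReal.ofReal_le_ofReal ?_
    have h1 : u' b ≤ u' t := hs.deriv_mono hdb htb.1.le
    have h2 := hs.intercept_le ha (hdb.trans htb.1)
    have ht0 : 0 < t := hb0.trans htb.1
    have h3 : (1 - a / b) * t ≤ t - a := by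
      have : a * 1 ≤ a * (t / b) := by
        refine mul_le_mul_of_nonneg_left ((one_le_div hb0).2 htb.1.le) (hs.1.trans hda)
      have e : (1 - a / b) * t = t - a * (t / b) := by ring
      rw [e]; linarith
    have hta : 0 < t - a := by linarith [htb.1]
    have h4 : (1 - a / b) ^ 2 * t ^ 2 * u' b ≤ (t - a) * u t := by
      calc (1 - a / b) ^ 2 * t ^ 2 * u' b = ((1 - a / b) * t) ^ 2 * u' b := by ring
        _ ≤ (t - a) ^ 2 * u' t := by gcongr
        _ = (t - a) * ((t - a) * u' t) := by ring
        _ ≤ _ := by gcongr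
    have h5 : t ^ 2 ≤ (t - a) * u t / (u' b * (1 - a / b) ^ 2) := by
      rw [le_div_iff₀ (by positivity)]; linarith
    calc (v t).toReal * t ^ 2 ≤ (v t).toReal * ((t - a) * u t / (u' b * (1 - a / b) ^ 2)) := by
          gcongr
      _ = _ := by rw [hc]; ring
  refine key.trans ?_
  rw [← ofReal_integral_eq_lintegral_ofReal ((hi.1).const_mul _), integral_const_mul,
    ← intervalIntegral.integral_of_le hbs]
  · refine ENNReal.ofReal_le_ofReal ?_
    have h1 := hs.integral_tail_le ha hv hdb hbs
    calc c * ∫ t in b..s, (t - a) * (1 / 2 * (v t).toReal * u t)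
        ≤ c * (u b - (b - a) * u' b) := by gcongr
      _ = _ := by rw [hc]; field_simp; ring
  · rw [EventuallyLE, ae_restrict_iff' measurableSet_Ioc]
    refine Eventually.of_forall fun t ht => ?_
    have h1 := (hs.pos (hdb.trans ht.1)).le
    have h2 : 0 ≤ t - a := by linarith [ht.1]
    simp only [Pi.zero_apply]
    positivity

theorem div_self_mono (hs : IsScatteringSolution v d u u') {r s : ℝ} (hr : d < r) (hrs : r ≤ s) :
    u r / r ≤ u s / s := by
  have hmono : MonotoneOn (fun t => u t / t) (Icc r s) := by
    refine monotoneOn_of_deriv_nonneg (convex_Icc r s) ?_ ?_ ?_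
    · exact (hs.continuousOn_self hr).div continuousOn_id fun t ht =>
        ((hs.1.trans_lt hr).trans_le ht.1).ne'
    · intro t ht
      rw [interior_Icc] at ht
      exact ((hs.hasDerivAt (hr.trans ht.1)).div (hasDerivAt_id t)
        ((hs.1.trans_lt hr).trans ht.1).ne').differentiableAt.differentiableWithinAt
    · intro t ht
      rw [interior_Icc] at ht
      have hdt := hr.trans ht.1
      have ht0 := hs.1.trans_lt hdt
      have h1 := (hs.hasDerivAt hdt).div (hasDerivAt_id t) ht0.ne'
      have h2 : deriv (fun t => u t / t) t = _ := h1.deriv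
      rw [h2]
      have := hs.le_mul_deriv hdt
      have := hs.deriv_pos hdt
      refine div_nonneg ?_ (sq_nonneg _)
      simp only [id]
      nlinarith [hs.1]
  exact hmono (left_mem_Icc.2 hrs) (right_mem_Icc.2 hrs) hrs

/-- The lower bound `f(r) ≥ 1 - a/r`. -/
theorem one_sub_div_le (ha : Tendsto (fun r => r - u r / u' r) atTop (𝓝 a))
    (hs : IsScatteringSolution v d u u') {r b : ℝ} (hr : d < r) (hrb : r ≤ b) (hab : a < b) :
    1 - a / r ≤ b * u r / (r * u b) := by
  have hr0 : 0 < r := hs.1.trans_lt hr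
  have hb0 : 0 < b := hr0.trans_le hrb
  have hub := hs.pos (hr.trans_le hrb)
  have hur := hs.pos hr
  have ha0 : 0 ≤ a := hs.1.trans (hs.core_le ha)
  rcases le_or_gt r a with hra | hra
  · have h1 : 1 ≤ a / r := (one_le_div hr0).2 hra
    have h2 : 0 ≤ b * u r / (r * u b) := by positivity
    linarith
  -- The derivative has the sign of `(t - a) u' - u ≤ 0`. Hence `u(r)/(r - a) ≥ u(b)/(b - a) ≥
  -- u(b)/b`.
  have hanti : AntitoneOn (fun t => u t / (t - a)) (Icc r b) := by
    have hne : ∀ t ∈ Icc r b, t - a ≠ 0 := fun t ht => by linarith [ht.1]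
    refine antitoneOn_of_deriv_nonpos (convex_Icc r b) ?_ ?_ ?_
    · exact (hs.continuousOn_self hr).div (by fun_prop) hne
    · intro t ht
      rw [interior_Icc] at ht
      exact ((hs.hasDerivAt (hr.trans ht.1)).div ((hasDerivAt_id t).sub_const a)
        (hne t (Ioo_subset_Icc_self ht))).differentiableAt.differentiableWithinAt
    · intro t ht
      rw [interior_Icc] at ht
      have hdt := hr.trans ht.1
      have h1 := (hs.hasDerivAt hdt).div ((hasDerivAt_id t).sub_const a)
        (hne t (Ioo_subset_Icc_self ht))
      have h2 : deriv (fun t => u t / (t - a)) t = _ := h1.deriv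
      rw [h2]
      have := hs.intercept_le ha hdt
      refine div_nonpos_of_nonpos_of_nonneg ?_ (sq_nonneg _)
      simp only [id]
      linarith
  have h1 : u b / (b - a) ≤ u r / (r - a) :=
    hanti (left_mem_Icc.2 hrb) (right_mem_Icc.2 hrb) hrb
  rw [div_le_div_iff₀ (by linarith) (by linarith)] at h1
  have e : 1 - a / r = (r - a) / r := by field_simp
  rw [e, div_le_div_iff₀ hr0 (by positivity)]
  have h2 : u r * (b - a) ≤ u r * b := by gcongr; linarith
  nlinarith

end IsScatteringSolution

theorem HasScatteringLength.scaled {v₁ : ℝ → ℝ≥0∞} {a₁ a : ℝ} (h : HasScatteringLength v₁ a₁)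
    (hv : Measurable v₁) (ha₁ : 0 < a₁) (ha : 0 < a) :
    HasScatteringLength (scaledInteraction v₁ a₁ a) a := by
  obtain ⟨d, u, u', hs, hlim⟩ := h
  set l := a₁ / a with hl
  have hl0 : 0 < l := by positivity
  have hmul : ∀ {r : ℝ}, d / l < r → d < l * r := fun {r} hr => by
    rw [div_lt_iff₀ hl0] at hr; linarith
  have harg : ∀ r, a₁ * r / a = l * r := fun r => by rw [hl]; ring
  refine ⟨d / l, fun r => u (l * r), fun r => l * u' (l * r), ⟨div_nonneg hs.1 hl0.le, ?_, ?_, ?_,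
    ?_, fun r hr => hs.pos (hmul hr), ?_, ?_⟩, ?_⟩
  · intro r hr
    rw [scaledInteraction, harg, hs.2.1 (l * r) ⟨mul_nonneg hl0.le hr.1, by
      have := hr.2; rw [lt_div_iff₀ hl0] at this; linarith⟩, ENNReal.mul_top]
    exact (ENNReal.ofReal_pos.2 (by positivity)).ne'
  · intro r s hr hrs
    have h1 := hs.2.2.1 (l * r) (l * s) (hmul hr) (by gcongr)
    simp only [scaledInteraction, harg]
    rw [lintegral_const_mul _ (f := fun t => v₁ (l * t)) (hv.comp (measurable_const_mul l))]
    refine ENNReal.mul_lt_top ENNReal.ofReal_lt_top ?_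
    have hmap := Real.smul_map_volume_mul_left hl0.ne'
    have e1 : ∫⁻ t in Icc r s, v₁ (l * t) = ∫⁻ t, (Icc (l * r) (l * s)).indicator v₁ (l * t) := by
      rw [← lintegral_indicator measurableSet_Icc]
      refine lintegral_congr fun t => ?_
      simp only [indicator, mem_Icc, mul_le_mul_iff_right₀ hl0]
    rw [e1, ← lintegral_map (hv.indicator measurableSet_Icc) (measurable_const_mul l)]
    have e2 : Measure.map (fun x => l * x) volume = ENNReal.ofReal |l⁻¹| • (volume : Measure ℝ) := by
      exact Real.map_volume_mul_left hl0.ne'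
    rw [e2, lintegral_smul_measure, lintegral_indicator measurableSet_Icc, smul_eq_mul]
    exact ENNReal.mul_lt_top ENNReal.ofReal_lt_top h1
  · exact hs.2.2.2.1.comp (by fun_prop) fun r hr => mul_nonneg hl0.le hr
  · intro r hr
    refine hs.2.2.2.2.1 (l * r) ⟨mul_nonneg hl0.le hr.1, ?_⟩
    have := hr.2; rw [le_div_iff₀ hl0] at this; linarith
  · intro r hr
    have h1 := (hs.hasDerivAt (hmul hr)).comp r ((hasDerivAt_id r).const_mul l)
    exact h1.congr_deriv (by ring)
  · intro r s hr hrs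
    rw [← mul_sub, hs.deriv_sub (hmul hr) (by gcongr : l * r ≤ l * s),
      ← intervalIntegral.mul_integral_comp_mul_left (f := fun t => 1 / 2 * (v₁ t).toReal * u t),
      ← mul_assoc, ← intervalIntegral.integral_const_mul]
    refine intervalIntegral.integral_congr fun t _ => ?_
    simp only [scaledInteraction, harg, ENNReal.toReal_mul]
    rw [ENNReal.toReal_ofReal (sq_nonneg _)]
    ring
  · have h1 := (hlim.comp (tendsto_id.const_mul_atTop hl0)).const_mul (1 / l)
    have e : 1 / l * a₁ = a := by rw [hl]; field_simp
    rw [e] at h1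
    refine h1.congr fun r => ?_
    simp only [Function.comp_apply, id]
    rw [mul_sub, ← mul_assoc, one_div, inv_mul_cancel₀ hl0.ne', one_mul]
    congr 1
    rw [← div_eq_inv_mul, div_div, mul_comm (u' _)]

/-- Integration of radial functions. -/
theorem lintegral_fun_norm {H : ℝ → ℝ≥0∞} (hH : Measurable H) :
    ∫⁻ z : Space3, H ‖z‖
      = ENNReal.ofReal (4 * Real.pi) * ∫⁻ t in Ioi (0 : ℝ), H t * ENNReal.ofReal (t ^ 2) := by
  have hmp := (volume : Measure Space3).measurePreserving_homeomorphUnitSphereProd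
  have hfr : Module.finrank ℝ Space3 = 3 := by simp
  have h1 : ∫⁻ z : Space3, H ‖z‖
      = ∫⁻ z : ({0}ᶜ : Set Space3), H ‖(z : Space3)‖ ∂(volume.comap Subtype.val) := by
    rw [lintegral_subtype_comap (measurableSet_singleton _).compl (fun z : Space3 => H ‖z‖),
      restrict_compl_singleton]
  have h2 := hmp.lintegral_comp (f := fun p => H p.2.1) (by fun_prop)
  have h3 : ∀ z : ({0}ᶜ : Set Space3),
      ((homeomorphUnitSphereProd Space3 z).2 : ℝ) = ‖(z : Space3)‖ := fun z => by
    simp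
  simp only [h3] at h2
  rw [h1, h2, lintegral_prod _ (by fun_prop)]
  simp only [lintegral_const]
  rw [Measure.toSphere_apply_univ, hfr, mul_comm]
  congr 1
  · rw [EuclideanSpace.volume_ball_fin_three, ← ENNReal.ofReal_natCast, ENNReal.ofReal_one,
      one_pow, one_mul, ← ENNReal.ofReal_mul (by positivity)]
    congr 1; push_cast; ring
  · rw [Measure.volumeIoiPow, lintegral_withDensity_eq_lintegral_mul _ (by fun_prop) (by fun_prop)]
    simp only [Pi.mul_apply, show 3 - 1 = 2 from rfl]
    rw [lintegral_subtype_comap measurableSet_Ioi (fun r : ℝ => ENNReal.ofReal (r ^ 2) * H r)]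
    simp only [mul_comm]

theorem sum_sq_apply_unitVec_le_one {L : Space3 →L[ℝ] ℝ} (hL : ‖L‖ ≤ 1) :
    ∑ k, L (unitVec k) ^ 2 ≤ 1 := by
  set x : Space3 := ∑ k, L (unitVec k) • unitVec k with hx
  have hxk : ∀ j, x j = L (unitVec j) := fun j => by simp [hx, Pi.single_apply]
  have h1 : L x = ∑ k, L (unitVec k) ^ 2 := by
    rw [hx, map_sum]; simp [pow_two]
  have h2 : ‖x‖ ^ 2 = ∑ k, L (unitVec k) ^ 2 := by
    rw [EuclideanSpace.real_norm_sq_eq]; simp only [hxk]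
  have h3 : L x ≤ 1 * ‖x‖ := (le_abs_self _).trans (L.le_of_opNorm_le hL x)
  rw [h1, ← h2] at h3
  rw [← h2]
  nlinarith [norm_nonneg x]

/-- Line derivatives of radial functions. -/
theorem sum_sq_lineDeriv_comp_norm_le {F : ℝ → ℝ} {Q : ℝ} {z : Space3} (hz : z ≠ 0)
    (hF : HasDerivAt F Q ‖z‖) :
    ∑ k, lineDeriv ℝ (fun z : Space3 => F ‖z‖) z (unitVec k) ^ 2 ≤ Q ^ 2 := by
  have hn : DifferentiableAt ℝ (fun z : Space3 => ‖z‖) z := differentiableAt_id.norm ℝ hz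
  have hL : ‖fderiv ℝ (fun z : Space3 => ‖z‖) z‖ ≤ 1 := by
    simpa using norm_fderiv_le_of_lipschitz ℝ (x₀ := z) (lipschitzWith_one_norm (E := Space3))
  have h1 := hF.comp_hasFDerivAt z hn.hasFDerivAt
  have h2 : ∀ k, lineDeriv ℝ (fun z : Space3 => F ‖z‖) z (unitVec k)
      = Q * fderiv ℝ (fun z : Space3 => ‖z‖) z (unitVec k) := fun k => by
    have := (h1.hasLineDerivAt (unitVec k)).lineDeriv
    simpa [Function.comp_def] using this
  simp only [h2, mul_pow, ← Finset.mul_sum]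
  exact mul_le_of_le_one_right (sq_nonneg _) (sum_sq_apply_unitVec_le_one hL)

namespace IsScatteringSolution

variable {v : ℝ → ℝ≥0∞} {d a b : ℝ} {u u' : ℝ → ℝ}

theorem lintegral_energy_core_le (ha : Tendsto (fun r => r - u r / u' r) atTop (𝓝 a))
    (hs : IsScatteringSolution v d u u') (hv : Measurable v) (hab : a < b) :
    ∫⁻ t in Ioc d b, (ENNReal.ofReal (2 * (b / u b) ^ 2 * (u' t - u t / t) ^ 2)
        + v t * ENNReal.ofReal ((b / u b) ^ 2 * u t ^ 2))
      ≤ ENNReal.ofReal (2 * ((b - u b / u' b) / (1 - a / b))) := by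
  have hdb : d < b := (hs.core_le ha).trans_lt hab
  have hU : Ioc d b = ⋃ n : ℕ, Ioc (d + (b - d) * (1 / ((n : ℝ) + 1))) b := by
    ext t
    simp only [mem_Ioc, mem_iUnion]
    constructor
    · rintro ⟨h1, h2⟩
      have h3 := (L2WeakDeriv.tendsto_inv_nat_zero.const_mul (b - d)).const_add d
      rw [mul_zero, add_zero] at h3
      obtain ⟨n, hn⟩ := (h3.eventually (gt_mem_nhds h1)).exists
      exact ⟨n, hn, h2⟩
    · rintro ⟨n, h1, h2⟩
      have : 0 ≤ (b - d) * (1 / ((n : ℝ) + 1)) := mul_nonneg (by linarith) (by positivity)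
      exact ⟨by linarith, h2⟩
  rw [hU, setLIntegral_iUnion_of_directed _ (directed_of_isDirected_le fun m n hmn =>
    Ioc_subset_Ioc_left (by
      have : 0 ≤ b - d := by linarith
      gcongr))]
  refine iSup_le fun n => hs.lintegral_energy_le ha hv ?_ ?_ hab
  · have : 0 < (b - d) * (1 / ((n : ℝ) + 1)) := mul_pos (by linarith) (by positivity)
    linarith
  · have h1 : 1 / ((n : ℝ) + 1) ≤ 1 := by
      rw [div_le_one (by positivity)]
      linarith [(Nat.cast_nonneg n : (0 : ℝ) ≤ n)]
    nlinarith

theorem lintegral_tail_infinite_le (ha : Tendsto (fun r => r - u r / u' r) atTop (𝓝 a))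
    (hs : IsScatteringSolution v d u u') (hv : Measurable v) (hab : a < b) :
    ∫⁻ t in Ioi b, v t * ENNReal.ofReal (t ^ 2)
      ≤ ENNReal.ofReal (2 * ((a - (b - u b / u' b)) / (1 - a / b) ^ 2)) := by
  have hU : Ioi b = ⋃ n : ℕ, Ioc b (b + n) := by
    ext t
    simp only [mem_Ioi, mem_iUnion, mem_Ioc]
    constructor
    · intro h
      obtain ⟨n, hn⟩ := exists_nat_ge (t - b)
      exact ⟨n, h, by linarith⟩
    · rintro ⟨n, h, -⟩
      exact h
  rw [hU, setLIntegral_iUnion_of_directed _ (directed_of_isDirected_le fun m n hmn =>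
    Ioc_subset_Ioc_right (by gcongr))]
  exact iSup_le fun n => hs.lintegral_tail_le ha hv (by simp) hab

end IsScatteringSolution

/-- A Lipschitz approximation of the zero energy scattering function. -/
theorem exists_scattering_function {v : ℝ → ℝ≥0∞} {a b η : ℝ} (hv : Measurable v)
    (h : HasScatteringLength v a) (hab : a < b) (hη : 0 < η) :
    ∃ (Γ : Space3 → ℝ) (L : ℝ≥0), LipschitzWith L Γ ∧ (∀ z, 0 ≤ Γ z) ∧ (∀ z, Γ z ≤ 1) ∧
      (∀ z, b ≤ ‖z‖ → 1 - η ≤ Γ z) ∧ (∀ z, z ≠ 0 → 1 - a / ‖z‖ - η ≤ Γ z) ∧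
      ∫⁻ z, (ENNReal.ofReal (2 * ∑ k, lineDeriv ℝ Γ z (unitVec k) ^ 2)
        + v ‖z‖ * ENNReal.ofReal (Γ z ^ 2))
        ≤ ENNReal.ofReal (8 * Real.pi * a / (1 - a / b) ^ 2) := by
  obtain ⟨d, u, u', hs, ha⟩ := h
  have hda := hs.core_le ha
  have hd0 := hs.1
  have ha0 : 0 ≤ a := hd0.trans hda
  have hdb : d < b := hda.trans_lt hab
  have hb0 : 0 < b := hd0.trans_lt hdb
  have hub := hs.pos hdb
  set f : ℝ → ℝ := fun t => b * u t / (t * u b) with hf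
  set q : ℝ → ℝ := fun t => b / u b * (u' t - u t / t) / t with hq
  have hfd : ∀ t, d < t → HasDerivAt f (q t) t := fun t ht => by
    have ht0 : t ≠ 0 := (hd0.trans_lt ht).ne'
    have h1 := ((hs.hasDerivAt ht).const_mul b).div ((hasDerivAt_id t).mul_const (u b))
      (mul_ne_zero ht0 hub.ne')
    refine h1.congr_deriv ?_
    have := hub.ne'
    simp only [hq, id]
    field_simp
  have hfm : ∀ s t, d < s → s ≤ t → f s ≤ f t := fun s t hs' hst => by
    have h1 := hs.div_self_mono hs' hst
    have e : ∀ t, f t = b / u b * (u t / t) := fun t => by simp only [hf]; ring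
    rw [e, e]
    gcongr
  have hfb : f b = 1 := by simp only [hf]; field_simp
  have hf0 : ∀ t, d < t → 0 < f t := fun t ht => by
    have := hs.pos ht
    have := hd0.trans_lt ht
    simp only [hf]; positivity
  -- The scattering function `f` may fail to be Lipschitz near the core. It is replaced below `r₀`
  -- by a constant `c₀` under its values, within `η` of `f r₀`. For a genuine hard core `c₀` must be
  -- zero, since the interaction is infinite there; without core `c₀` is the infimum of `f`.
  obtain ⟨c₀, hc0, hc1, hc2, r₀, hr0, hr1⟩ : ∃ c₀ : ℝ, 0 ≤ c₀ ∧ (∀ t, d < t → c₀ ≤ f t) ∧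
      (0 < d → c₀ = 0) ∧ ∃ r₀ ∈ Ioo d b, f r₀ ≤ c₀ + η := by
    rcases hd0.eq_or_lt with hd | hd
    · refine ⟨sInf (f '' Ioi d), Real.sInf_nonneg (by
        rintro _ ⟨t, ht, rfl⟩; exact (hf0 t ht).le), fun t ht => csInf_le ⟨0, by
        rintro _ ⟨t, ht, rfl⟩; exact (hf0 t ht).le⟩ ⟨t, ht, rfl⟩, fun h => absurd h (by
        rw [← hd]; exact lt_irrefl _), ?_⟩
      obtain ⟨_, ⟨t, ht, rfl⟩, h2⟩ := exists_lt_of_csInf_lt (s := f '' Ioi d)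
        ⟨_, b, hdb, rfl⟩ (lt_add_of_pos_right _ hη)
      have ht' : d < t := ht
      refine ⟨(d + min t b) / 2, ⟨?_, ?_⟩, (hfm _ t ?_ ?_).trans h2.le⟩
      · have := lt_min ht' hdb; linarith
      · have := min_le_right t b; linarith
      · have := lt_min ht' hdb; linarith
      · have := min_le_left t b; linarith
    · refine ⟨0, le_rfl, fun t ht => (hf0 t ht).le, fun _ => rfl, ?_⟩
      have hcont : ContinuousWithinAt f (Ioi d) d := by
        refine ContinuousWithinAt.div (continuousWithinAt_const.mul ((hs.2.2.2.1 d hd0).mono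
          fun t ht => (hd0.trans (le_of_lt ht)))) (by fun_prop) (by positivity)
      have h1 : f d = 0 := by simp only [hf]; rw [hs.apply_core]; simp
      have h2 : ∀ᶠ t in 𝓝[>] d, f t < η := by
        have : Tendsto f (𝓝[>] d) (𝓝 0) := h1 ▸ hcont
        exact this.eventually (gt_mem_nhds hη)
      obtain ⟨t, h3, h4⟩ := (h2.and (Ioo_mem_nhdsGT hdb)).exists
      exact ⟨t, h4, by linarith⟩
  -- `f` is frozen below `r₀` and beyond `b` and lowered by `f r₀ - c₀ ≤ η`. Lowering, rather than
  -- raising, keeps `F ≤ f` on `(d, b]`, so the interaction energy does not increase.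
  set F : ℝ → ℝ := fun t => c₀ - f r₀ + f (max r₀ (min t b)) with hF
  have hclamp : ∀ t, max r₀ (min t b) ∈ Icc r₀ b := fun t =>
    ⟨le_max_left _ _, max_le hr0.2.le (min_le_right _ _)⟩
  have hFlow : ∀ t, t ≤ r₀ → F t = c₀ := fun t ht => by
    simp only [hF]
    rw [min_eq_left (ht.trans hr0.2.le), max_eq_left ht]; ring
  have hFmid : ∀ t, r₀ ≤ t → t ≤ b → F t = c₀ - f r₀ + f t := fun t h1 h2 => by
    simp only [hF]
    rw [min_eq_left h2, max_eq_right h1]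
  have hFhigh : ∀ t, b ≤ t → F t = c₀ - f r₀ + 1 := fun t ht => by
    simp only [hF]
    rw [min_eq_right ht, max_eq_right hr0.2.le, hfb]
  obtain ⟨L, hL⟩ : ∃ L : ℝ≥0, LipschitzWith L F := by
    have hqc : ContinuousOn q (Icc r₀ b) := by
      have h0 : ∀ t ∈ Icc r₀ b, t ≠ 0 := fun t ht =>
        ((hd0.trans_lt hr0.1).trans_le ht.1).ne'
      exact ((continuousOn_const.mul ((hs.continuousOn_deriv hv hr0.1 hr0.2.le).sub
        ((hs.continuousOn_self hr0.1).div continuousOn_id h0))).div continuousOn_id h0)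
    obtain ⟨C, hC⟩ := isCompact_Icc.exists_bound_of_continuousOn hqc
    have h1 : LipschitzOnWith C.toNNReal f (Icc r₀ b) := by
      refine (convex_Icc r₀ b).lipschitzOnWith_of_nnnorm_hasDerivWithin_le
        (fun t ht => (hfd t (hr0.1.trans_le ht.1)).hasDerivWithinAt) fun t ht => ?_
      rw [← NNReal.coe_le_coe, coe_nnnorm]
      exact (hC t ht).trans (Real.le_coe_toNNReal C)
    have h2 : LipschitzWith 1 fun t : ℝ => max r₀ (min t b) :=
      (LipschitzWith.id.min_const b).const_max r₀
    refine ⟨C.toNNReal, LipschitzWith.of_dist_le_mul fun s t => ?_⟩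
    have h3 := h1.dist_le_mul _ (hclamp s) _ (hclamp t)
    have h4 := h2.dist_le_mul s t
    simp only [hF, dist_add_left]
    refine h3.trans ?_
    gcongr
    simpa using h4
  have hFle : ∀ t, d < t → t ≤ b → F t ≤ f t := fun t h1 h2 => by
    rcases le_total t r₀ with h3 | h3
    · rw [hFlow t h3]; exact hc1 t h1
    · rw [hFmid t h3 h2]; linarith [hc1 r₀ hr0.1]
  have hFc : ∀ t, c₀ ≤ F t := fun t => by
    have := hfm r₀ _ hr0.1 (hclamp t).1
    simp only [hF]; linarith
  have hF1 : ∀ t, F t ≤ 1 := fun t => by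
    have := hfm _ b (hr0.1.trans_le (hclamp t).1) (hclamp t).2
    have := hc1 r₀ hr0.1
    simp only [hF]; linarith
  have hFlower : ∀ t, 0 < t → 1 - a / t - η ≤ F t := fun t ht => by
    rcases le_or_gt t d with h1 | h1
    · have : 1 ≤ a / t := (one_le_div ht).2 (h1.trans hda)
      linarith [hFc t]
    rcases le_or_gt b t with h2 | h2
    · have : 0 ≤ a / t := by positivity
      rw [hFhigh t h2]; linarith
    have h3 : 1 - a / t ≤ f t := hs.one_sub_div_le ha h1 h2.le hab
    rcases le_total t r₀ with h4 | h4
    · rw [hFlow t h4]; linarith [hfm t r₀ h1 h4]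
    · rw [hFmid t h4 h2.le]; linarith
  have hFd1 : ∀ t, t < r₀ → HasDerivAt F 0 t := fun t ht =>
    (hasDerivAt_const t c₀).congr_of_eventuallyEq (by
      filter_upwards [gt_mem_nhds ht] with s hs' using hFlow s (le_of_lt hs'))
  have hFd2 : ∀ t, r₀ < t → t < b → HasDerivAt F (q t) t := fun t h1 h2 =>
    ((hfd t (hr0.1.trans h1)).const_add (c₀ - f r₀)).congr_of_eventuallyEq (by
      filter_upwards [Ioo_mem_nhds h1 h2] with s hs' using hFmid s hs'.1.le hs'.2.le)
  have hFd3 : ∀ t, b < t → HasDerivAt F 0 t := fun t ht =>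
    (hasDerivAt_const t (c₀ - f r₀ + 1)).congr_of_eventuallyEq (by
      filter_upwards [lt_mem_nhds ht] with s hs' using hFhigh s (le_of_lt hs'))
  -- Continuity of `u'` is known only on `(d, ∞)`; extension by zero gives globally measurable
  -- functions for the radial integral.
  set uu := (Ioi d).indicator u with huu
  set uu' := (Ioi d).indicator u' with huu'
  have huum : Measurable uu := by
    classical
    rw [huu, ← piecewise_eq_indicator]
    exact ContinuousOn.measurable_piecewise (hs.2.2.2.1.mono fun t ht => hd0.trans (le_of_lt ht))
      continuousOn_const measurableSet_Ioi
  have huum' : Measurable uu' := by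
    classical
    rw [huu', ← piecewise_eq_indicator]
    refine ContinuousOn.measurable_piecewise (fun t ht => ?_) continuousOn_const measurableSet_Ioi
    have ht' : d < t := ht
    exact ((hs.continuousOn_deriv hv (r := (d + t) / 2) (s := t + 1) (by linarith)
      (by linarith)).continuousAt (Icc_mem_nhds (by linarith) (by linarith))).continuousWithinAt
  set W : ℝ → ℝ≥0∞ := fun t => (Ioc d b).indicator (fun t =>
    ENNReal.ofReal (2 * (b / u b * (uu' t - uu t / t) / t) ^ 2)
      + v t * ENNReal.ofReal ((b * uu t / (t * u b)) ^ 2)) t + (Ioi b).indicator v t with hW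
  have hWm : Measurable W := by
    refine Measurable.add (Measurable.indicator ?_ measurableSet_Ioc)
      (hv.indicator measurableSet_Ioi)
    fun_prop
  have hWle : ∫⁻ t in Ioi (0 : ℝ), W t * ENNReal.ofReal (t ^ 2)
      ≤ ENNReal.ofReal (2 * (a / (1 - a / b) ^ 2)) := by
    have e1 : ∀ t, W t * ENNReal.ofReal (t ^ 2)
        = (Ioc d b).indicator (fun t => ENNReal.ofReal (2 * (b / u b) ^ 2 * (u' t - u t / t) ^ 2)
          + v t * ENNReal.ofReal ((b / u b) ^ 2 * u t ^ 2)) t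
          + (Ioi b).indicator (fun t => v t * ENNReal.ofReal (t ^ 2)) t := fun t => by
      simp only [hW, add_mul]
      congr 1
      · by_cases ht : t ∈ Ioc d b
        · have ht0 : 0 < t := hd0.trans_lt ht.1
          have e2 : uu t = u t := indicator_of_mem ht.1 _
          have e3 : uu' t = u' t := indicator_of_mem ht.1 _
          rw [indicator_of_mem ht, indicator_of_mem ht, e2, e3, add_mul, mul_assoc,
            ← ENNReal.ofReal_mul (by positivity), ← ENNReal.ofReal_mul (by positivity)]
          have hne := ht0.ne'
          have e4 : 2 * (b / u b * (u' t - u t / t) / t) ^ 2 * t ^ 2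
              = 2 * (b / u b) ^ 2 * (u' t - u t / t) ^ 2 := by field_simp
          have e5 : (b * u t / (t * u b)) ^ 2 * t ^ 2 = (b / u b) ^ 2 * u t ^ 2 := by field_simp
          rw [e4, e5]
        · rw [indicator_of_notMem ht, indicator_of_notMem ht, zero_mul]
      · by_cases ht : t ∈ Ioi b
        · rw [indicator_of_mem ht, indicator_of_mem ht]
        · rw [indicator_of_notMem ht, indicator_of_notMem ht, zero_mul]
    simp only [e1]
    have hθ : 0 < 1 - a / b := by
      have : a / b < 1 := (div_lt_one hb0).2 hab
      linarith
    have hA1 : 0 ≤ b - u b / u' b := by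
      have h1 := hs.le_mul_deriv hdb
      have h2 := hs.deriv_pos hdb
      rw [sub_nonneg, div_le_iff₀ h2]
      nlinarith
    have hA2 : b - u b / u' b ≤ a := by
      have h1 := hs.intercept_le ha hdb
      have h2 := hs.deriv_pos hdb
      have : b - a ≤ u b / u' b := by rwa [le_div_iff₀ h2]
      linarith
    refine (setLIntegral_le_lintegral _ _).trans ?_
    have hvt : Measurable fun t => v t * ENNReal.ofReal (t ^ 2) := hv.mul (by fun_prop)
    rw [lintegral_add_right _ (hvt.indicator measurableSet_Ioi),
      lintegral_indicator measurableSet_Ioc, lintegral_indicator measurableSet_Ioi]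
    refine (add_le_add (hs.lintegral_energy_core_le ha hv hab)
      (hs.lintegral_tail_infinite_le ha hv hab)).trans ?_
    rw [← ENNReal.ofReal_add (by positivity) (mul_nonneg (by norm_num) (div_nonneg
      (by linarith) (by positivity)))]
    refine ENNReal.ofReal_le_ofReal ?_
    rw [← mul_add]
    gcongr
    have h1 : (b - u b / u' b) / (1 - a / b) ≤ (b - u b / u' b) / (1 - a / b) ^ 2 := by
      refine div_le_div_of_nonneg_left hA1 (by positivity) ?_
      have : 1 - a / b ≤ 1 := by
        have : 0 ≤ a / b := by positivity
        linarith
      nlinarith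
    calc (b - u b / u' b) / (1 - a / b) + (a - (b - u b / u' b)) / (1 - a / b) ^ 2
        ≤ (b - u b / u' b) / (1 - a / b) ^ 2 + (a - (b - u b / u' b)) / (1 - a / b) ^ 2 := by
          gcongr
      _ = a / (1 - a / b) ^ 2 := by rw [← add_div]; congr 1; ring
  refine ⟨fun z => F ‖z‖, L, ?_, fun z => hc0.trans (hFc _), fun z => hF1 _, fun z hz => ?_,
    fun z hz => hFlower _ (norm_pos_iff.2 hz), ?_⟩
  · simpa [Function.comp_def] using hL.comp (lipschitzWith_one_norm (E := Space3))
  · simp only; rw [hFhigh _ hz]; linarith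
  have hnull : ∀ r : ℝ, ∀ᵐ z : Space3, ‖z‖ ≠ r := fun r => by
    rw [ae_iff]
    have : {z : Space3 | ¬ ‖z‖ ≠ r} = Metric.sphere 0 r := by ext z; simp
    rw [this]
    exact Measure.addHaar_sphere _ _ _
  have hpt : ∀ᵐ z : Space3, ENNReal.ofReal (2 * ∑ k, lineDeriv ℝ (fun z : Space3 => F ‖z‖) z
      (unitVec k) ^ 2) + v ‖z‖ * ENNReal.ofReal (F ‖z‖ ^ 2) ≤ W ‖z‖ := by
    filter_upwards [hnull 0, hnull r₀, hnull b] with z h0 h1 h2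
    have hz : z ≠ 0 := fun h => h0 (by rw [h, norm_zero])
    have ht0 : 0 < ‖z‖ := norm_pos_iff.2 hz
    set t := ‖z‖ with ht
    rcases lt_or_gt_of_ne h2 with h3 | h3
    · rcases le_or_gt t d with h4 | h4
      -- Inside the core `F` is zero, so an infinite interaction contributes `∞ · 0 = 0`.
      · have hd : 0 < d := ht0.trans_le h4
        have e1 := sum_sq_lineDeriv_comp_norm_le hz (hFd1 t (h4.trans_lt hr0.1))
        rw [hFlow t (h4.trans hr0.1.le), hc2 hd, ENNReal.ofReal_of_nonpos (by nlinarith)]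
        simp
      · have e2 : uu t = u t := indicator_of_mem (show t ∈ Ioi d from h4) _
        have e3 : uu' t = u' t := indicator_of_mem (show t ∈ Ioi d from h4) _
        have e4 : ∑ k, lineDeriv ℝ (fun z : Space3 => F ‖z‖) z (unitVec k) ^ 2 ≤ q t ^ 2 := by
          rcases lt_or_gt_of_ne h1 with h5 | h5
          · refine (sum_sq_lineDeriv_comp_norm_le hz (hFd1 t h5)).trans ?_
            rw [zero_pow two_ne_zero]; exact sq_nonneg _
          · exact sum_sq_lineDeriv_comp_norm_le hz (hFd2 t h5 h3)
        simp only [hW]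
        rw [indicator_of_mem (show t ∈ Ioc d b from ⟨h4, h3.le⟩),
          indicator_of_notMem (show t ∉ Ioi b from not_lt.2 h3.le), add_zero, e2, e3]
        gcongr
        · exact hc0.trans (hFc t)
        · exact hFle t h4 h3.le
    · have e1 := sum_sq_lineDeriv_comp_norm_le hz (hFd3 t h3)
      simp only [hW]
      rw [ENNReal.ofReal_of_nonpos (by nlinarith), zero_add,
        indicator_of_notMem (fun h : t ∈ Ioc d b => absurd h.2 (not_le.2 h3)), zero_add,
        indicator_of_mem (show t ∈ Ioi b from h3)]
      refine mul_le_of_le_one_right' ?_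
      rw [← ENNReal.ofReal_one]
      exact ENNReal.ofReal_le_ofReal (pow_le_one₀ (hc0.trans (hFc t)) (hF1 t))
  refine (lintegral_mono_ae hpt).trans ?_
  rw [lintegral_fun_norm hWm]
  refine (mul_le_mul_right hWle _).trans ?_
  rw [← ENNReal.ofReal_mul (by positivity)]
  exact ENNReal.ofReal_le_ofReal (le_of_eq (by ring))

/-! ### Changes of variables and tensor products. -/

namespace L2WeakDeriv

section Transfer

variable {X Y : Type*} [NormedAddCommGroup X] [NormedSpace ℝ X] [MeasureSpace X]
  [NormedAddCommGroup Y] [NormedSpace ℝ Y] [MeasureSpace Y]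
  [FiniteDimensional ℝ X] [BorelSpace X] [(volume : Measure X).IsAddHaarMeasure]
  [FiniteDimensional ℝ Y] [BorelSpace Y] [(volume : Measure Y).IsAddHaarMeasure]

/-- Weak derivatives are transported by measure preserving linear isomorphisms. -/
theorem comp_equiv (L : Y ≃L[ℝ] X) (hL : MeasurePreserving L) {U : Set X} {w : Y}
    (hU : MeasurableSet U) {f g : X → ℝ} (h : L2WeakDeriv U (L w) f g) :
    L2WeakDeriv (L ⁻¹' U) w (f ∘ L) (g ∘ L) := by
  have hp : MeasurePreserving L (volume.restrict (L ⁻¹' U)) (volume.restrict U) :=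
    hL.restrict_preimage hU
  have hemb : MeasurableEmbedding L := L.toHomeomorph.measurableEmbedding
  refine ⟨h.1.comp_measurePreserving hp, h.2.1.comp_measurePreserving hp, fun η h1 h2 h3 => ?_⟩
  have hη : ContDiff ℝ ∞ (η ∘ L.symm) := h1.comp L.symm.contDiff
  have hc : HasCompactSupport (η ∘ L.symm) := h2.comp_homeomorph L.symm.toHomeomorph
  have hs : tsupport (η ∘ L.symm) ⊆ U := by
    have := tsupport_comp_subset_preimage η L.symm.continuous
    refine this.trans fun x hx => ?_
    simpa using h3 hx
  have key := h.2.2 _ hη hc hs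
  rw [← hp.integral_comp hemb, ← hp.integral_comp hemb] at key
  convert key using 3 with x
  · have : fderiv ℝ (η ∘ L.symm) (L x) = (fderiv ℝ η x).comp (L.symm : X →L[ℝ] Y) := by
      rw [ContinuousLinearEquiv.comp_right_fderiv]
      simp
    rw [this]
    simp
  · simp

instance isAddHaarMeasure_volume_prod : (volume : Measure (X × Y)).IsAddHaarMeasure :=
  inferInstanceAs ((volume : Measure X).prod (volume : Measure Y)).IsAddHaarMeasure

theorem memLp_two_tensor {U : Set X} {W : Set Y} {f : X → ℝ} {ψ : Y → ℝ}
    (hf : MemLp f 2 (volume.restrict U)) (hψ : MemLp ψ 2 (volume.restrict W)) :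
    MemLp (fun p : X × Y => f p.1 * ψ p.2) 2 ((volume.restrict U).prod (volume.restrict W)) := by
  refine memLp_two_of_lintegral (hf.1.comp_fst.mul hψ.1.comp_snd) ?_
  simp_rw [enorm_mul, mul_pow]
  rw [lintegral_prod_mul (f := fun x => ‖f x‖ₑ ^ 2) (g := fun y => ‖ψ y‖ₑ ^ 2)
    (hf.1.enorm.pow_const 2) (hψ.1.enorm.pow_const 2)]
  exact ENNReal.mul_ne_top (lintegral_ne_top_of_memLp_two hf) (lintegral_ne_top_of_memLp_two hψ)

/-- By Fubini: for fixed `y` the section `η (·, y)` of a test function is a test function on `U`. -/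
theorem tensor_left {U : Set X} {W : Set Y} {w : X} {f g : X → ℝ} {ψ : Y → ℝ}
    (h : L2WeakDeriv U w f g) (hψ : MemLp ψ 2 (volume.restrict W)) :
    L2WeakDeriv (U ×ˢ W) ((w, 0) : X × Y) (fun p => f p.1 * ψ p.2) (fun p => g p.1 * ψ p.2) := by
  have hr : (volume.restrict (U ×ˢ W) : Measure (X × Y)) =
      (volume.restrict U).prod (volume.restrict W) := (Measure.prod_restrict U W).symm
  have hf := memLp_two_tensor h.1 hψ
  have hg := memLp_two_tensor h.2.1 hψ
  rw [← hr] at hf hg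
  refine ⟨hf, hg, fun η h1 h2 h3 => ?_⟩
  have i1 := integrable_deriv_test_mul (w := ((w, 0) : X × Y)) h1 h2 hf
  have i2 := integrable_test_mul h1.continuous h2 hg
  rw [hr] at i1 i2 ⊢
  rw [integral_prod_symm _ i1, integral_prod_symm _ i2, ← integral_neg]
  congr 1
  ext y
  have hι : ContDiff ℝ ∞ (fun x : X => (x, y)) := contDiff_id.prodMk contDiff_const
  have hcl : IsClosedEmbedding (fun x : X => (x, y)) :=
    Function.LeftInverse.isClosedEmbedding (f := Prod.fst) (fun _ => rfl) continuous_fst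
      (by fun_prop)
  have key := h.2.2 (fun x => η (x, y)) (h1.comp hι) (h2.comp_isClosedEmbedding hcl) (by
    refine (tsupport_comp_subset_preimage η hι.continuous).trans fun x hx => ?_
    exact (h3 hx).1)
  have hd (x : X) : fderiv ℝ (fun x => η (x, y)) x w = fderiv ℝ η (x, y) (w, 0) := by
    have h4 : HasFDerivAt (fun x : X => (x, y)) (ContinuousLinearMap.inl ℝ X Y) x :=
      hasFDerivAt_prodMk_left x y
    have h5 := ((h1.differentiable (by simp) (x, y)).hasFDerivAt).comp x h4
    rw [show (fun x => η (x, y)) = η ∘ fun x : X => (x, y) from rfl, h5.fderiv]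
    simp
  simp_rw [hd] at key
  have e1 (x : X) : fderiv ℝ η (x, y) (w, 0) * (f x * ψ y) =
      (fderiv ℝ η (x, y) (w, 0) * f x) * ψ y := by ring
  have e2 (x : X) : η (x, y) * (g x * ψ y) = (η (x, y) * g x) * ψ y := by ring
  simp_rw [e1, e2, integral_mul_const, key]
  ring

theorem tensor_right {U : Set X} {W : Set Y} (hU : MeasurableSet U) (hW : MeasurableSet W) {w : Y}
    {f : X → ℝ} {ψ G : Y → ℝ}
    (h : L2WeakDeriv W w ψ G) (hf : MemLp f 2 (volume.restrict U)) :
    L2WeakDeriv (U ×ˢ W) ((0, w) : X × Y) (fun p => f p.1 * ψ p.2) (fun p => f p.1 * G p.2) := by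
  have := comp_equiv (ContinuousLinearEquiv.prodComm ℝ X Y) Measure.measurePreserving_swap
    (w := (0, w)) (hW.prod hU) (by simpa using tensor_left h hf)
  have hpre : (ContinuousLinearEquiv.prodComm ℝ X Y) ⁻¹' (W ×ˢ U) = U ×ˢ W := by
    ext p; simp [and_comm]
  rw [hpre] at this
  convert this using 2 with p p <;> simp [mul_comm]

end Transfer

end L2WeakDeriv

/-! ### Configuration spaces: splitting off a particle and relabelling. -/

section Config

variable {Ω : Set Space3}

theorem configSpace_eq_pi (Ω : Set Space3) (N : ℕ) :
    configSpace Ω N = Set.univ.pi fun _ => Ω := by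
  ext x; simp [configSpace]

theorem isOpen_configSpace (hΩ : IsOpen Ω) (N : ℕ) : IsOpen (configSpace Ω N) := by
  rw [configSpace_eq_pi]
  exact isOpen_set_pi Set.finite_univ fun _ _ => hΩ

/-- Separates the first particle from the others. -/
noncomputable def splitConfig (N : ℕ) :
    (Fin (N + 1) → Space3) ≃L[ℝ] Space3 × (Fin N → Space3) :=
  (Fin.consEquivL ℝ (fun _ : Fin (N + 1) => Space3)).symm

theorem splitConfig_apply {N : ℕ} (y : Fin (N + 1) → Space3) :
    splitConfig N y = (y 0, fun j => y j.succ) := rfl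

theorem measurePreserving_splitConfig (N : ℕ) : MeasurePreserving (splitConfig N) := by
  have := volume_preserving_piFinSuccAbove (fun _ : Fin (N + 1) => Space3) 0
  convert this using 1
  ext y <;> simp [splitConfig_apply, MeasurableEquiv.piFinSuccAbove, Fin.insertNthEquiv, Fin.tail]

theorem preimage_splitConfig (Ω : Set Space3) (N : ℕ) :
    splitConfig N ⁻¹' (Ω ×ˢ configSpace Ω N) = configSpace Ω (N + 1) := by
  ext y
  simp [splitConfig_apply, configSpace, Fin.forall_fin_succ]

theorem splitConfig_single_zero (N : ℕ) (w : Space3) :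
    splitConfig N (Pi.single 0 w) = (w, 0) := by
  ext <;> simp [splitConfig_apply]

theorem splitConfig_single_succ {N : ℕ} (j : Fin N) (w : Space3) :
    splitConfig N (Pi.single j.succ w) = (0, Pi.single j w) := by
  rw [splitConfig_apply]
  refine Prod.ext ?_ ?_
  · simp
  · funext i
    simp [Pi.single_apply]

theorem lintegral_configSpace_succ (hΩ : MeasurableSet Ω) (N : ℕ)
    (h : Space3 × (Fin N → Space3) → ℝ≥0∞) :
    ∫⁻ y in configSpace Ω (N + 1), h (splitConfig N y) =
      ∫⁻ p in Ω ×ˢ configSpace Ω N, h p := by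
  have hm : MeasurableSet (Ω ×ˢ configSpace Ω N) := by
    refine hΩ.prod ?_
    rw [configSpace_eq_pi]
    exact MeasurableSet.univ_pi fun _ => hΩ
  have := (measurePreserving_splitConfig N).restrict_preimage hm
  rw [preimage_splitConfig] at this
  exact this.lintegral_comp_emb (splitConfig N).toHomeomorph.measurableEmbedding h

/-- Relabels the particles. -/
noncomputable def permConfig {N : ℕ} (σ : Equiv.Perm (Fin N)) :
    (Fin N → Space3) ≃L[ℝ] (Fin N → Space3) :=
  (LinearEquiv.funCongrLeft ℝ Space3 σ).toContinuousLinearEquiv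

theorem permConfig_apply {N : ℕ} (σ : Equiv.Perm (Fin N)) (x : Fin N → Space3) :
    permConfig σ x = x ∘ σ := rfl

theorem measurePreserving_permConfig {N : ℕ} (σ : Equiv.Perm (Fin N)) :
    MeasurePreserving (permConfig σ) := by
  have := volume_measurePreserving_piCongrLeft (fun _ : Fin N => Space3) σ.symm
  have hfun : (permConfig σ : (Fin N → Space3) → Fin N → Space3) =
      MeasurableEquiv.piCongrLeft (fun _ : Fin N => Space3) σ.symm := by
    funext x i
    rw [permConfig_apply]
    have := MeasurableEquiv.piCongrLeft_apply_apply (β := fun _ : Fin N => Space3) σ.symm x (σ i)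
    simp only [Equiv.symm_apply_apply] at this
    simp [this]
  rw [hfun]
  exact this

theorem preimage_permConfig (Ω : Set Space3) {N : ℕ} (σ : Equiv.Perm (Fin N)) :
    permConfig σ ⁻¹' configSpace Ω N = configSpace Ω N := by
  ext y
  simp only [configSpace, Set.mem_preimage, Set.mem_ofPred_eq, permConfig_apply, Function.comp]
  exact ⟨fun h i => by simpa using h (σ.symm i), fun h i => h _⟩

theorem permConfig_single {N : ℕ} (σ : Equiv.Perm (Fin N)) (i : Fin N) (w : Space3) :
    permConfig σ (Pi.single i w) = Pi.single (σ.symm i) w := by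
  funext j
  simp only [permConfig_apply, Function.comp, Pi.single_apply, Equiv.eq_symm_apply]

theorem lintegral_permConfig (hΩ : IsOpen Ω) {N : ℕ} (σ : Equiv.Perm (Fin N))
    (h : (Fin N → Space3) → ℝ≥0∞) :
    ∫⁻ y in configSpace Ω N, h (permConfig σ y) = ∫⁻ y in configSpace Ω N, h y := by
  have := (measurePreserving_permConfig σ).restrict_preimage
    (isOpen_configSpace hΩ N).measurableSet
  rw [preimage_permConfig] at this
  exact this.lintegral_comp_emb (permConfig σ).toHomeomorph.measurableEmbedding h

end Config

/-- The multiplication operator in the many-body Hamiltonian. -/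
noncomputable def manyBodyPotential (V : Space3 → ℝ) (v : ℝ → ℝ≥0∞) (N : ℕ)
    (x : Fin N → Space3) : ℝ≥0∞ :=
  (∑ i, ENNReal.ofReal (V (x i))) + ∑ i, ∑ j ∈ Finset.Ioi i, v (dist (x i) (x j))

/-! ### The bosonic energy as a bound for functions without symmetry. -/

section ManyBody

variable {Ω : Set Space3} {V : Space3 → ℝ} {v : ℝ → ℝ≥0∞} {N : ℕ}

theorem measurable_manyBodyPotential (hV : Measurable V) (hv : Measurable v) :
    Measurable (manyBodyPotential V v N) := by
  unfold manyBodyPotential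
  refine Measurable.add (Finset.measurable_sum _ fun i _ => ?_)
    (Finset.measurable_sum _ fun i _ => Finset.measurable_sum _ fun j _ => ?_)
  · exact (hV.comp (measurable_pi_apply i)).ennreal_ofReal
  · exact hv.comp ((measurable_pi_apply i).dist (measurable_pi_apply j))

theorem manyBodyForm_eq (hV : Measurable V) (hv : Measurable v) {ψ : (Fin N → Space3) → ℂ}
    (hψ : AEMeasurable (fun x => ‖ψ x‖ₑ ^ 2) (volume.restrict (configSpace Ω N))) :
    manyBodyForm Ω V v N ψ =
      (∑ i, ∑ k, weakDerivSq (configSpace Ω N) (Pi.single i (unitVec k)) ψ) +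
        ∫⁻ x in configSpace Ω N, manyBodyPotential V v N x * ‖ψ x‖ₑ ^ 2 := by
  have m1 (i : Fin N) : Measurable fun x : Fin N → Space3 => ENNReal.ofReal (V (x i)) :=
    (hV.comp (measurable_pi_apply i)).ennreal_ofReal
  have m2 (i j : Fin N) : Measurable fun x : Fin N → Space3 => v (dist (x i) (x j)) :=
    hv.comp ((measurable_pi_apply i).dist (measurable_pi_apply j))
  have e : ∫⁻ x in configSpace Ω N, manyBodyPotential V v N x * ‖ψ x‖ₑ ^ 2 =
      (∑ i : Fin N, ∫⁻ x in configSpace Ω N, ENNReal.ofReal (V (x i)) * ‖ψ x‖ₑ ^ 2)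
    + ∑ i : Fin N, ∑ j ∈ Finset.Ioi i,
        ∫⁻ x in configSpace Ω N, v (dist (x i) (x j)) * ‖ψ x‖ₑ ^ 2 := by
    have n1 (i : Fin N) : AEMeasurable (fun x => ENNReal.ofReal (V (x i)) * ‖ψ x‖ₑ ^ 2)
      (volume.restrict (configSpace Ω N)) := (m1 i).aemeasurable.mul hψ
    have n2 (i j : Fin N) : AEMeasurable (fun x => v (dist (x i) (x j)) * ‖ψ x‖ₑ ^ 2)
      (volume.restrict (configSpace Ω N)) := (m2 i j).aemeasurable.mul hψ
    simp_rw [manyBodyPotential, add_mul, Finset.sum_mul]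
    rw [lintegral_add_left' (Finset.aemeasurable_fun_sum _ fun i _ => n1 i),
      lintegral_finsetSum' _ fun i _ => n1 i,
      lintegral_finsetSum' _ fun i _ => Finset.aemeasurable_fun_sum _ fun j _ => n2 i j]
    congr 1
    refine Finset.sum_congr rfl fun i _ => ?_
    rw [lintegral_finsetSum' _ fun j _ => n2 i j]
  rw [e, ← add_assoc]
  rfl

/-- The sum over `i < j` is not visibly invariant under relabelling, while the doubled sum over `i ≠
j` is. -/
theorem two_mul_sum_Ioi {s : Fin N → Fin N → ℝ≥0∞} (hs : ∀ i j, s i j = s j i) :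
    2 * ∑ i, ∑ j ∈ Finset.Ioi i, s i j = ∑ i, ∑ j, if i = j then 0 else s i j := by
  have h1 : ∑ i, ∑ j ∈ Finset.Ioi i, s i j = ∑ i, ∑ j, if i < j then s i j else 0 := by
    refine Finset.sum_congr rfl fun i _ => ?_
    rw [← Finset.sum_filter]
    congr 1
    ext j; simp
  have h2 : ∑ i, ∑ j ∈ Finset.Ioi i, s i j = ∑ i, ∑ j, if j < i then s i j else 0 := by
    rw [h1, Finset.sum_comm]
    exact Finset.sum_congr rfl fun i _ => Finset.sum_congr rfl fun j _ => by rw [hs]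
  rw [two_mul]
  nth_rw 1 [h1]
  rw [h2, ← Finset.sum_add_distrib]
  refine Finset.sum_congr rfl fun i _ => ?_
  rw [← Finset.sum_add_distrib]
  refine Finset.sum_congr rfl fun j _ => ?_
  rcases lt_trichotomy i j with h | h | h
  · simp [h, h.ne, h.le.not_gt]
  · simp [h]
  · simp [h, h.ne', h.le.not_gt]

theorem manyBodyPotential_perm (σ : Equiv.Perm (Fin N)) (x : Fin N → Space3) :
    manyBodyPotential V v N (permConfig σ x) = manyBodyPotential V v N x := by
  simp only [manyBodyPotential, permConfig_apply, Function.comp]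
  congr 1
  · exact Equiv.sum_comp σ fun i => ENNReal.ofReal (V (x i))
  · refine (ENNReal.mul_right_inj two_ne_zero ENNReal.ofNat_ne_top).1 ?_
    rw [two_mul_sum_Ioi fun i j => by rw [dist_comm], two_mul_sum_Ioi fun i j => by rw [dist_comm]]
    refine Eq.trans (Finset.sum_congr rfl fun i _ => ?_)
      (Equiv.sum_comp σ fun i => ∑ j, if i = j then 0 else v (dist (x i) (x j)))
    refine Eq.trans (Finset.sum_congr rfl fun j _ => ?_)
      (Equiv.sum_comp σ fun j => if σ i = j then 0 else v (dist (x (σ i)) (x j)))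
    simp

/-- The bosonic ground state energy bounds the quadratic form from below on all real functions,
symmetric or not. -/
theorem bosonEnergy_mul_le (hΩ : IsOpen Ω) (hV : Measurable V) (hv : Measurable v) (hN : 0 < N)
    {ξ : (Fin N → Space3) → ℝ} {G : Fin N → Fin 3 → (Fin N → Space3) → ℝ}
    (h : ∀ i k, L2WeakDeriv (configSpace Ω N) (Pi.single i (unitVec k)) ξ (G i k)) :
    bosonEnergy Ω V v N * ∫⁻ x in configSpace Ω N, ‖ξ x‖ₑ ^ 2 ≤
      (∑ i, ∑ k, ∫⁻ x in configSpace Ω N, ‖G i k x‖ₑ ^ 2) +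
        ∫⁻ x in configSpace Ω N, manyBodyPotential V v N x * ‖ξ x‖ₑ ^ 2 := by
  set U := configSpace Ω N with hUdef
  have hU : IsOpen U := isOpen_configSpace hΩ N
  have hmU := measurable_manyBodyPotential (N := N) hV hv
  set M := ∫⁻ x in U, ‖ξ x‖ₑ ^ 2 with hM
  have hMtop : M ≠ ⊤ := lintegral_ne_top_of_memLp_two (h ⟨0, hN⟩ 0).1
  rcases eq_or_ne M 0 with h0 | h0
  · simp [h0]
  set n : ℝ≥0∞ := (Fintype.card (Equiv.Perm (Fin N)) : ℝ≥0∞) with hn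
  have hn0 : n ≠ 0 := by simp [hn]
  have hnt : n ≠ ⊤ := by simp [hn]
  have hder (σ : Equiv.Perm (Fin N)) (i : Fin N) (k : Fin 3) :
      L2WeakDeriv U (Pi.single i (unitVec k)) (ξ ∘ permConfig σ) (G (σ.symm i) k ∘ permConfig σ) := by
    have := L2WeakDeriv.comp_equiv (permConfig σ) (measurePreserving_permConfig σ)
      (w := Pi.single i (unitVec k)) hU.measurableSet
      (by rw [permConfig_single]; exact h (σ.symm i) k)
    rwa [preimage_permConfig] at this
  -- `S` is symmetric for any `ξ`. Mass and potential energy are exactly `n = N!` times those of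
  -- `ξ`, and the kinetic energy is at most `n` times that of `ξ`; after normalization `S` is
  -- admissible for the bosonic infimum.
  set S : (Fin N → Space3) → ℝ := fun x => √(∑ σ, (ξ ∘ permConfig σ) x ^ 2) with hS
  set S' : Fin N → Fin 3 → (Fin N → Space3) → ℝ := fun i k x =>
    (∑ σ, (ξ ∘ permConfig σ) x * (G (σ.symm i) k ∘ permConfig σ) x) /
      √(∑ σ, (ξ ∘ permConfig σ) x ^ 2) with hS'
  have hSd (i k) : L2WeakDeriv U (Pi.single i (unitVec k)) S (S' i k) :=
    L2WeakDeriv.sqrt_sum_sq hU fun σ => hder σ i k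
  have hSsq (x) : ‖S x‖ₑ ^ 2 = ∑ σ, ‖ξ (permConfig σ x)‖ₑ ^ 2 := by
    rw [enorm_sq_eq_ofReal, hS]
    simp only
    rw [Real.sq_sqrt (Finset.sum_nonneg fun _ _ => sq_nonneg _),
      ENNReal.ofReal_sum_of_nonneg fun _ _ => sq_nonneg _]
    simp [enorm_sq_eq_ofReal]
  have hmξ (σ : Equiv.Perm (Fin N)) :
      AEMeasurable (fun x => ‖ξ (permConfig σ x)‖ₑ ^ 2) (volume.restrict U) :=
    (hder σ ⟨0, hN⟩ 0).1.1.enorm.pow_const 2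
  have hmass : ∫⁻ x in U, ‖S x‖ₑ ^ 2 = n * M := by
    simp_rw [hSsq]
    rw [lintegral_finsetSum' _ fun σ _ => hmξ σ]
    rw [Finset.sum_congr rfl fun σ _ => lintegral_permConfig hΩ σ fun x => ‖ξ x‖ₑ ^ 2]
    simp [hn, hM, hUdef]
  have hpot : ∫⁻ x in U, manyBodyPotential V v N x * ‖S x‖ₑ ^ 2 =
      n * ∫⁻ x in U, manyBodyPotential V v N x * ‖ξ x‖ₑ ^ 2 := by
    simp_rw [hSsq, Finset.mul_sum]
    have hm (σ : Equiv.Perm (Fin N)) :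
        AEMeasurable (fun x => manyBodyPotential V v N x * ‖ξ (permConfig σ x)‖ₑ ^ 2)
          (volume.restrict U) := hmU.aemeasurable.mul (hmξ σ)
    rw [lintegral_finsetSum' _ fun σ _ => hm σ]
    have (σ : Equiv.Perm (Fin N)) :
        ∫⁻ x in U, manyBodyPotential V v N x * ‖ξ (permConfig σ x)‖ₑ ^ 2 =
          ∫⁻ x in U, manyBodyPotential V v N x * ‖ξ x‖ₑ ^ 2 := by
      rw [← lintegral_permConfig hΩ σ fun x => manyBodyPotential V v N x * ‖ξ x‖ₑ ^ 2]
      simp_rw [manyBodyPotential_perm]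
      rfl
    simp_rw [this]
    simp [hn]
  have hkin : ∑ i, ∑ k, ∫⁻ x in U, ‖S' i k x‖ₑ ^ 2 ≤ n * ∑ i, ∑ k, ∫⁻ x in U, ‖G i k x‖ₑ ^ 2 := by
    have h1 (i k) : ∫⁻ x in U, ‖S' i k x‖ₑ ^ 2 ≤
        ∑ σ : Equiv.Perm (Fin N), ∫⁻ x in U, ‖G (σ.symm i) k x‖ₑ ^ 2 := by
      calc ∫⁻ x in U, ‖S' i k x‖ₑ ^ 2
          ≤ ∫⁻ x in U, ∑ σ : Equiv.Perm (Fin N), ‖G (σ.symm i) k (permConfig σ x)‖ₑ ^ 2 := by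
            refine lintegral_mono fun x => ?_
            rw [enorm_sq_eq_ofReal]
            refine (ENNReal.ofReal_le_ofReal (L2WeakDeriv.sq_div_sqrt_sum_le _ _)).trans (le_of_eq ?_)
            rw [ENNReal.ofReal_sum_of_nonneg fun _ _ => sq_nonneg _]
            simp [enorm_sq_eq_ofReal]
        _ = _ := by
            have hm (σ : Equiv.Perm (Fin N)) :
                AEMeasurable (fun x => ‖G (σ.symm i) k (permConfig σ x)‖ₑ ^ 2)
                  (volume.restrict U) := (hder σ i k).2.1.1.enorm.pow_const 2
            rw [lintegral_finsetSum' _ fun σ _ => hm σ]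
            exact Finset.sum_congr rfl fun σ _ =>
              lintegral_permConfig hΩ σ fun x => ‖G (σ.symm i) k x‖ₑ ^ 2
    refine (Finset.sum_le_sum fun i _ => Finset.sum_le_sum fun k _ => h1 i k).trans (le_of_eq ?_)
    calc _ = ∑ σ : Equiv.Perm (Fin N), ∑ i, ∑ k, ∫⁻ x in U, ‖G (σ.symm i) k x‖ₑ ^ 2 := by
            exact (Finset.sum_congr rfl fun i _ => Finset.sum_comm).trans Finset.sum_comm
      _ = ∑ σ : Equiv.Perm (Fin N), ∑ i, ∑ k, ∫⁻ x in U, ‖G i k x‖ₑ ^ 2 :=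
            Finset.sum_congr rfl fun σ _ =>
              Equiv.sum_comp σ.symm fun i => ∑ k, ∫⁻ x in U, ‖G i k x‖ₑ ^ 2
      _ = _ := by simp [hn]
  set c : ℝ := √(n * M)⁻¹.toReal with hc
  have hnM0 : n * M ≠ 0 := mul_ne_zero hn0 h0
  have hnMt : n * M ≠ ⊤ := ENNReal.mul_ne_top hnt hMtop
  have hcsq : ‖c‖ₑ ^ 2 = (n * M)⁻¹ := by
    rw [enorm_sq_eq_ofReal, hc, Real.sq_sqrt ENNReal.toReal_nonneg,
      ENNReal.ofReal_toReal (ENNReal.inv_ne_top.2 hnM0)]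
  have hle : bosonEnergy Ω V v N ≤ manyBodyForm Ω V v N fun x => ((c * S x : ℝ) : ℂ) := by
    refine iInf₂_le (fun x => ((c * S x : ℝ) : ℂ)) ⟨fun σ x => ?_, ?_⟩
    · have : S (x ∘ σ) = S x := by
        simp only [hS, Function.comp_apply]
        congr 1
        exact Equiv.sum_comp (Equiv.mulLeft σ) fun τ => ξ (permConfig τ x) ^ 2
      simp only [this]
    · simp_rw [enorm_complex_ofReal, enorm_mul, mul_pow]
      rw [lintegral_const_mul' _ _ (by finiteness), hmass, hcsq, ENNReal.inv_mul_cancel hnM0 hnMt]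
  have hform : manyBodyForm Ω V v N (fun x => ((c * S x : ℝ) : ℂ)) ≤
      (n * M)⁻¹ * (n * ((∑ i, ∑ k, ∫⁻ x in U, ‖G i k x‖ₑ ^ 2) +
        ∫⁻ x in U, manyBodyPotential V v N x * ‖ξ x‖ₑ ^ 2)) := by
    rw [manyBodyForm_eq hV hv]
    · rw [mul_add n, mul_add, ← hpot]
      refine add_le_add ?_ (le_of_eq ?_)
      · refine le_trans ?_ (mul_le_mul_right hkin _)
        simp_rw [Finset.mul_sum]
        refine Finset.sum_le_sum fun i _ => Finset.sum_le_sum fun k _ => ?_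
        refine (((hSd i k).const_mul c).weakDerivSq_le).trans (le_of_eq ?_)
        simp_rw [enorm_mul, mul_pow]
        rw [lintegral_const_mul' _ _ (by finiteness), hcsq]
      · simp_rw [enorm_complex_ofReal, enorm_mul, mul_pow, mul_left_comm _ (‖c‖ₑ ^ 2)]
        rw [lintegral_const_mul' _ _ (by finiteness), hcsq]
    · simp_rw [enorm_complex_ofReal]
      exact ((hSd ⟨0, hN⟩ 0).const_mul c).1.1.enorm.pow_const 2
  have hfin := hle.trans hform
  rw [← mul_assoc, ENNReal.mul_inv (Or.inl hn0) (Or.inl hnt), mul_right_comm n⁻¹,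
    ENNReal.inv_mul_cancel hn0 hnt, one_mul, mul_comm, ← div_eq_mul_inv] at hfin
  exact (ENNReal.le_div_iff_mul_le (Or.inl h0) (Or.inl hMtop)).1 hfin

/-- Approximate bosonic ground states may be taken to be nonnegative. -/
theorem exists_near_minimizer (hΩ : IsOpen Ω) (hV : Measurable V) (hv : Measurable v) (hN : 0 < N)
    (hE : bosonEnergy Ω V v N ≠ ⊤) {θ : ℝ≥0∞} (hθ : θ ≠ 0) :
    ∃ (ψ : (Fin N → Space3) → ℝ) (G : Fin N → Fin 3 → (Fin N → Space3) → ℝ),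
      (∀ i k, L2WeakDeriv (configSpace Ω N) (Pi.single i (unitVec k)) ψ (G i k)) ∧
      ∫⁻ x in configSpace Ω N, ‖ψ x‖ₑ ^ 2 = 1 ∧
      (∑ i, ∑ k, ∫⁻ x in configSpace Ω N, ‖G i k x‖ₑ ^ 2) +
        ∫⁻ x in configSpace Ω N, manyBodyPotential V v N x * ‖ψ x‖ₑ ^ 2 ≤
          bosonEnergy Ω V v N + θ := by
  have hU : IsOpen (configSpace Ω N) := isOpen_configSpace hΩ N
  have hlt : bosonEnergy Ω V v N < bosonEnergy Ω V v N + θ := ENNReal.lt_add_right hE hθ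
  conv_lhs at hlt => unfold bosonEnergy
  simp only [iInf_lt_iff] at hlt
  obtain ⟨Ψ, ⟨-, hmass⟩, hlt⟩ := hlt
  have hkin : ∑ i, ∑ k, weakDerivSq (configSpace Ω N) (Pi.single i (unitVec k)) Ψ ≠ ⊤ := by
    refine ne_top_of_le_ne_top hlt.ne_top ?_
    unfold manyBodyForm
    rw [add_assoc]
    exact le_self_add
  have hfin (i k) : weakDerivSq (configSpace Ω N) (Pi.single i (unitVec k)) Ψ ≠ ⊤ :=
    ENNReal.sum_ne_top.1 (ENNReal.sum_ne_top.1 hkin i (Finset.mem_univ _)) k (Finset.mem_univ _)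
  choose G hG hGle using fun i k => exists_l2WeakDeriv_norm hU (by simp [hmass]) (hfin i k)
  refine ⟨fun x => ‖Ψ x‖, G, hG, by simpa using hmass, ?_⟩
  refine le_trans ?_ hlt.le
  rw [manyBodyForm_eq hV hv]
  · simp_rw [enorm_norm]
    gcongr with i _ k _
    exact hGle i k
  · simpa using (hG ⟨0, hN⟩ 0).1.1.enorm.pow_const 2

end ManyBody

/-! ### Energy cost of a Lipschitz multiplier. -/

section Multiplier

variable {Ω : Set Space3} {V : Space3 → ℝ} {f : Space3 → ℝ} {g : Fin 3 → Space3 → ℝ}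

theorem InFormDomain.lipschitz_mul (hΩ : IsOpen Ω) (hV : ∀ x, 0 ≤ V x) (hVm : Measurable V)
    (h : InFormDomain Ω V f g) {ϕ : Space3 → ℝ} {L : ℝ≥0} (hϕ : LipschitzWith L ϕ)
    {B : ℝ} (hB : ∀ x, |ϕ x| ≤ B) :
    InFormDomain Ω V (fun x => ϕ x * f x)
      (fun k x => ϕ x * g k x + lineDeriv ℝ ϕ x (unitVec k) * f x) := by
  refine inFormDomain_of_memLp_sqrt_mul hV (fun k => (h.deriv k).lipschitz_mul hΩ hϕ hB) ?_
  refine (memLp_two_mul_of_bounded hϕ.continuous.aestronglyMeasurable hB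
    (h.memLp_sqrt_mul hV hVm)).ae_eq (Eventually.of_forall fun x => ?_)
  simp only; ring

/-- Multiplying a minimizer by a Lipschitz cutoff raises the energy at most by the energy of the
gradient of the cutoff. -/
theorem IsStarMin.lintegral_multiplier_le {A e m : ℝ} (h : IsStarMin Ω V A e f g m) (he : 0 ≤ e)
    (hΩ : IsOpen Ω) (hV : ∀ x, 0 ≤ V x) (hVm : Measurable V) {ϕ : Space3 → ℝ} {L : ℝ≥0}
    (hϕ : LipschitzWith L ϕ) (h0 : ∀ x, 0 ≤ ϕ x) (h1 : ∀ x, ϕ x ≤ 1) :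
    ∫⁻ x in Ω, ((∑ k, ‖ϕ x * g k x + lineDeriv ℝ ϕ x (unitVec k) * f x‖ₑ ^ 2)
      + ENNReal.ofReal (V x) * ‖ϕ x * f x‖ₑ ^ 2) ≤
    ENNReal.ofReal (formEnergy Ω V f g)
      + ∫⁻ x in Ω, ∑ k, ‖lineDeriv ℝ ϕ x (unitVec k) * f x‖ₑ ^ 2 := by
  have hB (x) : |ϕ x| ≤ 1 := by rw [abs_of_nonneg (h0 x)]; exact h1 x
  have d1 := h.dom.lipschitz_mul hΩ hV hVm hϕ hB
  have d2 := d1.lipschitz_mul hΩ hV hVm hϕ hB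
  have d3 := h.dom.add_mul hV hVm d2 (-1)
  have key := h.formInner_nonneg he hΩ hV hVm d3 (Eventually.of_forall fun x => by
    have : ϕ x * (ϕ x * f x) ≤ f x := by
      nlinarith [h.nonneg x, h0 x, h1 x, mul_nonneg (h0 x) (h.nonneg x)]
    linarith)
  have hD (k) : MemLp (fun x => lineDeriv ℝ ϕ x (unitVec k) * f x) 2 (volume.restrict Ω) :=
    memLp_two_mul_of_bounded (hϕ.memLp_lineDeriv _).1 (abs_lineDeriv_le_of_lipschitz hϕ _) h.dom.memLp
  -- Localization identity: `∇f · ∇(ϕ² f) = |∇(ϕ f)|² - |∇ϕ|² f²`. The test function `f - ϕ² f` is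
  -- nonnegative because `0 ≤ ϕ ≤ 1`.
  have ident : formInner Ω V f g (fun x => f x + -1 * (ϕ x * (ϕ x * f x))) (fun k x => g k x
      + -1 * (ϕ x * (ϕ x * g k x + lineDeriv ℝ ϕ x (unitVec k) * f x)
        + lineDeriv ℝ ϕ x (unitVec k) * (ϕ x * f x))) =
      formEnergy Ω V f g + (∑ k, ∫ x in Ω, (lineDeriv ℝ ϕ x (unitVec k) * f x) ^ 2)
        - formEnergy Ω V (fun x => ϕ x * f x)
          (fun k x => ϕ x * g k x + lineDeriv ℝ ϕ x (unitVec k) * f x) := by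
    have e1 (k) : ∫ x in Ω, g k x * (g k x + -1 * (ϕ x * (ϕ x * g k x
        + lineDeriv ℝ ϕ x (unitVec k) * f x) + lineDeriv ℝ ϕ x (unitVec k) * (ϕ x * f x))) =
        (∫ x in Ω, g k x ^ 2) + (∫ x in Ω, (lineDeriv ℝ ϕ x (unitVec k) * f x) ^ 2)
        - ∫ x in Ω, (ϕ x * g k x + lineDeriv ℝ ϕ x (unitVec k) * f x) ^ 2 := by
      have i12 : Integrable (fun x => g k x ^ 2 + (lineDeriv ℝ ϕ x (unitVec k) * f x) ^ 2)
        (volume.restrict Ω) := (h.dom.deriv k).2.1.integrable_sq.add (hD k).integrable_sq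
      rw [← integral_add (h.dom.deriv k).2.1.integrable_sq (hD k).integrable_sq, ← integral_sub
        i12 (d1.deriv k).2.1.integrable_sq]
      congr 1; ext x; ring
    have e2 : ∫ x in Ω, V x * (f x * (f x + -1 * (ϕ x * (ϕ x * f x)))) =
        (∫ x in Ω, V x * f x ^ 2) - ∫ x in Ω, V x * (ϕ x * f x) ^ 2 := by
      rw [← integral_sub h.dom.pot d1.pot]
      congr 1; ext x; ring
    rw [formInner, e2, Finset.sum_congr rfl fun k _ => e1 k, Finset.sum_sub_distrib,
      Finset.sum_add_distrib]
    simp only [formEnergy]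
    ring
  rw [ident] at key
  have hle := ENNReal.ofReal_le_ofReal (sub_nonneg.1 key)
  rw [ofReal_formEnergy hV d1, ENNReal.ofReal_add (formEnergy_nonneg hV f g)
    (Finset.sum_nonneg fun k _ => integral_nonneg fun x => sq_nonneg _),
    ENNReal.ofReal_sum_of_nonneg fun k _ => integral_nonneg fun x => sq_nonneg _] at hle
  have m1 (k) : AEMeasurable (fun x => ‖ϕ x * g k x + lineDeriv ℝ ϕ x (unitVec k) * f x‖ₑ ^ 2)
    (volume.restrict Ω) := (d1.deriv k).2.1.1.enorm.pow_const 2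
  have m2 (k) : AEMeasurable (fun x => ‖lineDeriv ℝ ϕ x (unitVec k) * f x‖ₑ ^ 2)
    (volume.restrict Ω) := (hD k).1.enorm.pow_const 2
  rw [lintegral_add_left' (Finset.aemeasurable_fun_sum _ fun k _ => m1 k),
    lintegral_finsetSum' _ fun k _ => m1 k, lintegral_finsetSum' _ fun k _ => m2 k]
  refine hle.trans (le_of_eq ?_)
  congr 1
  exact Finset.sum_congr rfl fun k _ => (lintegral_enorm_sq_eq (hD k)).symm

end Multiplier

section NearMinimizer

variable {X ι : Type*} [NormedAddCommGroup X] [NormedSpace ℝ X] [MeasureSpace X]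
  [FiniteDimensional ℝ X] [BorelSpace X] [(volume : Measure X).IsAddHaarMeasure]
  [Fintype ι] [Nonempty ι] {U : Set X} {w : ι → X} {P : X → ℝ≥0∞} {ψ : X → ℝ} {G : ι → X → ℝ}
  {E : ℝ≥0∞}

/-- Multiplying an approximate ground state by a Lipschitz cutoff `F` gives energy at most
`E ∫|Fψ|²`, up to the energy of the gradient of the cutoff. -/
theorem lintegral_multiplier_le_of_near_minimizer (hU : IsOpen U) (hE : E ≠ ⊤) (hP : Measurable P)
    (hw : ∀ l, ‖w l‖ ≤ 1)
    (hlow : ∀ (ξ : X → ℝ) (H : ι → X → ℝ), (∀ l, L2WeakDeriv U (w l) ξ (H l)) →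
      E * ∫⁻ x in U, ‖ξ x‖ₑ ^ 2 ≤
        (∑ l, ∫⁻ x in U, ‖H l x‖ₑ ^ 2) + ∫⁻ x in U, P x * ‖ξ x‖ₑ ^ 2)
    (hd : ∀ l, L2WeakDeriv U (w l) ψ (G l)) (hmass : ∫⁻ x in U, ‖ψ x‖ₑ ^ 2 = 1) {t : ℝ}
    (ht : 0 < t) (ht1 : t ≤ 1)
    (hnear : (∑ l, ∫⁻ x in U, ‖G l x‖ₑ ^ 2) + ∫⁻ x in U, P x * ‖ψ x‖ₑ ^ 2 ≤
      E + ENNReal.ofReal (t ^ 2))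
    {F : X → ℝ} {L : ℝ≥0} (hF : LipschitzWith L F) (h0 : ∀ x, 0 ≤ F x) (h1 : ∀ x, F x ≤ 1) :
    ∫⁻ x in U, ((∑ l, ‖F x * G l x + lineDeriv ℝ F x (w l) * ψ x‖ₑ ^ 2)
      + P x * ‖F x * ψ x‖ₑ ^ 2) ≤
    (∫⁻ x in U, ((∑ l, ‖lineDeriv ℝ F x (w l) * ψ x‖ₑ ^ 2) + E * ‖F x * ψ x‖ₑ ^ 2))
      + ENNReal.ofReal t * (2 * E + 3 + Fintype.card ι * ENNReal.ofReal (8 * L ^ 2)) := by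
  have hB (x) : |F x| ≤ 1 := by rw [abs_of_nonneg (h0 x)]; exact h1 x
  set D : ι → X → ℝ := fun l x => lineDeriv ℝ F x (w l) with hDdef
  have hψ : MemLp ψ 2 (volume.restrict U) := (hd (Classical.arbitrary ι)).1
  have d1 (l) : L2WeakDeriv U (w l) (fun x => F x * ψ x) fun x => F x * G l x + D l x * ψ x :=
    (hd l).lipschitz_mul hU hF hB
  have d2 (l) : L2WeakDeriv U (w l) (fun x => F x * (F x * ψ x)) fun x =>
      F x * (F x * G l x + D l x * ψ x) + D l x * (F x * ψ x) :=
    (d1 l).lipschitz_mul hU hF hB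
  have d3 (l) := (hd l).sub ((d2 l).const_mul t)
  have hDm (l) : MemLp (fun x => D l x * ψ x) 2 (volume.restrict U) :=
    memLp_two_mul_of_bounded (hF.memLp_lineDeriv _).1 (abs_lineDeriv_le_of_lipschitz hF _) hψ
  have hDb (l x) : D l x ^ 2 ≤ L ^ 2 := by
    have := abs_lineDeriv_le_of_lipschitz hF (w l) x
    rw [← sq_abs]
    refine pow_le_pow_left₀ (abs_nonneg _) (this.trans ?_) 2
    exact mul_le_of_le_one_right L.2 (hw l)
  have sq_m {u : X → ℝ} (hu : MemLp u 2 (volume.restrict U)) :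
      AEMeasurable (fun x => ‖u x‖ₑ ^ 2) (volume.restrict U) := hu.1.enorm.pow_const 2
  have hlo := hlow _ _ d3
  -- The competitor replaces an Euler equation for a ground state that need not exist. Since `ψ` is
  -- optimal up to `t²`, dividing the comparison by `2t` leaves an error of order `t`.
  set ξ : X → ℝ := fun x => ψ x - t * (F x * (F x * ψ x)) with hξ
  set H : ι → X → ℝ := fun l x =>
    G l x - t * (F x * (F x * G l x + D l x * ψ x) + D l x * (F x * ψ x)) with hH
  change E * ∫⁻ x in U, ‖ξ x‖ₑ ^ 2 ≤
    (∑ l, ∫⁻ x in U, ‖H l x‖ₑ ^ 2) + ∫⁻ x in U, P x * ‖ξ x‖ₑ ^ 2 at hlo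
  set τ := ENNReal.ofReal (2 * t) with hτ
  set τ2 := ENNReal.ofReal (t ^ 2) with hτ2
  have hτt : τ ≠ ⊤ := ENNReal.ofReal_ne_top
  have hτ2t : τ2 ≠ ⊤ := ENNReal.ofReal_ne_top
  have split (c : ℝ≥0∞) (hc : c ≠ ⊤) (u v : X → ℝ≥0∞) (hu : AEMeasurable u (volume.restrict U)) :
      ∫⁻ x in U, u x + c * v x = (∫⁻ x in U, u x) + c * ∫⁻ x in U, v x := by
    rw [lintegral_add_left' hu, lintegral_const_mul' _ _ hc]
  -- The expansions of the squares are arranged with the negative terms moved across, so that they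
  -- hold in `[0, ∞]`, where some integrals may be infinite.
  have massId (x) : ‖ξ x‖ₑ ^ 2 + τ * ‖F x * ψ x‖ₑ ^ 2 =
      ‖ψ x‖ₑ ^ 2 + τ2 * ‖F x * (F x * ψ x)‖ₑ ^ 2 := by
    simp only [enorm_sq_eq_ofReal, hτ, hτ2]
    rw [← ENNReal.ofReal_mul (by positivity), ← ENNReal.ofReal_mul (by positivity),
      ← ENNReal.ofReal_add (by positivity) (by positivity),
      ← ENNReal.ofReal_add (by positivity) (by positivity)]
    congr 1
    simp only [hξ]; ring
  have kinId (l x) : ‖H l x‖ₑ ^ 2 + τ * ‖F x * G l x + D l x * ψ x‖ₑ ^ 2 =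
      (‖G l x‖ₑ ^ 2 + τ2 * ‖F x * (F x * G l x + D l x * ψ x) + D l x * (F x * ψ x)‖ₑ ^ 2)
        + τ * ‖D l x * ψ x‖ₑ ^ 2 := by
    simp only [enorm_sq_eq_ofReal, hτ, hτ2]
    rw [← ENNReal.ofReal_mul (by positivity), ← ENNReal.ofReal_mul (by positivity),
      ← ENNReal.ofReal_mul (by positivity),
      ← ENNReal.ofReal_add (by positivity) (by positivity),
      ← ENNReal.ofReal_add (by positivity) (by positivity),
      ← ENNReal.ofReal_add (by positivity) (by positivity)]
    congr 1
    simp only [hH]; ring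
  have massInt : 1 ≤ (∫⁻ x in U, ‖ξ x‖ₑ ^ 2) + τ * ∫⁻ x in U, ‖F x * ψ x‖ₑ ^ 2 := by
    rw [← split τ hτt _ _ (sq_m (d3 (Classical.arbitrary ι)).1), ← hmass]
    refine lintegral_mono fun x => ?_
    rw [massId]
    exact le_self_add
  have kinInt : (∑ l, ∫⁻ x in U, ‖H l x‖ₑ ^ 2)
      + τ * ∑ l, ∫⁻ x in U, ‖F x * G l x + D l x * ψ x‖ₑ ^ 2 =
      ((∑ l, ∫⁻ x in U, ‖G l x‖ₑ ^ 2) + τ2 * ∑ l, ∫⁻ x in U,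
        ‖F x * (F x * G l x + D l x * ψ x) + D l x * (F x * ψ x)‖ₑ ^ 2)
      + τ * ∑ l, ∫⁻ x in U, ‖D l x * ψ x‖ₑ ^ 2 := by
    simp_rw [Finset.mul_sum, ← Finset.sum_add_distrib]
    refine Finset.sum_congr rfl fun l _ => ?_
    rw [← split τ hτt _ _ (sq_m (d3 l).2.1), ← split τ2 hτ2t _ _ (sq_m (hd l).2.1),
      ← split τ hτt (fun x => ‖G l x‖ₑ ^ 2 +
        τ2 * ‖F x * (F x * G l x + D l x * ψ x) + D l x * (F x * ψ x)‖ₑ ^ 2) _ ((sq_m (hd l).2.1).add ((sq_m (d2 l).2.1).const_mul τ2))]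
    exact lintegral_congr fun x => kinId l x
  have potInt : (∫⁻ x in U, P x * ‖ξ x‖ₑ ^ 2) + τ * ∫⁻ x in U, P x * ‖F x * ψ x‖ₑ ^ 2 =
      (∫⁻ x in U, P x * ‖ψ x‖ₑ ^ 2) + τ2 * ∫⁻ x in U, P x * ‖F x * (F x * ψ x)‖ₑ ^ 2 := by
    rw [← split τ hτt (fun x => P x * ‖ξ x‖ₑ ^ 2) _
        (hP.aemeasurable.mul (sq_m (d3 (Classical.arbitrary ι)).1)),
      ← split τ2 hτ2t (fun x => P x * ‖ψ x‖ₑ ^ 2) _ (hP.aemeasurable.mul (sq_m hψ))]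
    refine lintegral_congr fun x => ?_
    rw [mul_left_comm τ, mul_left_comm τ2, ← mul_add, ← mul_add, massId]
  have hsmall (x) : ‖F x * (F x * ψ x)‖ₑ ^ 2 ≤ ‖ψ x‖ₑ ^ 2 := by
    simp only [enorm_sq_eq_ofReal]
    refine ENNReal.ofReal_le_ofReal ?_
    have : F x * F x ≤ 1 := by nlinarith [h0 x, h1 x]
    rw [← mul_assoc, mul_pow]
    exact mul_le_of_le_one_left (sq_nonneg _) (pow_le_one₀ (mul_self_nonneg _) this)
  -- The energy of `F² ψ` enters only at second order in `t`; a crude bound by that of `ψ` and the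
  -- Lipschitz constant suffices.
  have hC : (∑ l, ∫⁻ x in U, ‖F x * (F x * G l x + D l x * ψ x) + D l x * (F x * ψ x)‖ₑ ^ 2)
      + ∫⁻ x in U, P x * ‖F x * (F x * ψ x)‖ₑ ^ 2 ≤
      2 * E + 2 + Fintype.card ι * ENNReal.ofReal (8 * L ^ 2) := by
    have a1 (l) : ∫⁻ x in U, ‖F x * (F x * G l x + D l x * ψ x) + D l x * (F x * ψ x)‖ₑ ^ 2 ≤
        2 * (∫⁻ x in U, ‖G l x‖ₑ ^ 2) + ENNReal.ofReal (8 * L ^ 2) := by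
      have : ENNReal.ofReal (8 * L ^ 2) = ENNReal.ofReal (8 * L ^ 2) * ∫⁻ x in U, ‖ψ x‖ₑ ^ 2 := by
        rw [hmass, mul_one]
      rw [this, ← lintegral_const_mul' 2 _ (by simp),
        ← split _ ENNReal.ofReal_ne_top _ _ ((sq_m (hd l).2.1).const_mul 2)]
      refine lintegral_mono fun x => ?_
      simp only [enorm_sq_eq_ofReal]
      rw [show (2 : ℝ≥0∞) = ENNReal.ofReal 2 by simp, ← ENNReal.ofReal_mul (by positivity),
        ← ENNReal.ofReal_mul (by positivity), ← ENNReal.ofReal_add (by positivity) (by positivity)]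
      refine ENNReal.ofReal_le_ofReal ?_
      have b1 : (F x * F x * G l x) ^ 2 ≤ G l x ^ 2 := by
        rw [mul_pow]
        exact mul_le_of_le_one_left (sq_nonneg _)
          (pow_le_one₀ (mul_self_nonneg _) (by nlinarith [h0 x, h1 x]))
      have b2 : (2 * F x * D l x * ψ x) ^ 2 ≤ 4 * L ^ 2 * ψ x ^ 2 := by
        have : F x ^ 2 ≤ 1 := pow_le_one₀ (h0 x) (h1 x)
        have c1 : F x ^ 2 * D l x ^ 2 ≤ L ^ 2 :=
          (mul_le_of_le_one_left (sq_nonneg _) this).trans (hDb l x)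
        calc (2 * F x * D l x * ψ x) ^ 2 = 4 * (F x ^ 2 * D l x ^ 2) * ψ x ^ 2 := by ring
          _ ≤ _ := by gcongr
      nlinarith [sq_nonneg (F x * F x * G l x - 2 * F x * D l x * ψ x)]
    have a2 : ∫⁻ x in U, P x * ‖F x * (F x * ψ x)‖ₑ ^ 2 ≤ 2 * ∫⁻ x in U, P x * ‖ψ x‖ₑ ^ 2 := by
      refine (lintegral_mono fun x => mul_le_mul_right (hsmall x) (P x)).trans ?_
      rw [two_mul]
      exact le_self_add
    calc _ ≤ (∑ l, (2 * (∫⁻ x in U, ‖G l x‖ₑ ^ 2) + ENNReal.ofReal (8 * L ^ 2)))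
          + 2 * ∫⁻ x in U, P x * ‖ψ x‖ₑ ^ 2 := add_le_add (Finset.sum_le_sum fun l _ => a1 l) a2
      _ = 2 * ((∑ l, ∫⁻ x in U, ‖G l x‖ₑ ^ 2) + ∫⁻ x in U, P x * ‖ψ x‖ₑ ^ 2)
          + Fintype.card ι * ENNReal.ofReal (8 * L ^ 2) := by
        rw [Finset.sum_add_distrib, ← Finset.mul_sum]
        simp
        ring
      _ ≤ 2 * (E + 1) + Fintype.card ι * ENNReal.ofReal (8 * L ^ 2) := by
        refine add_le_add (mul_le_mul_right (hnear.trans (add_le_add le_rfl ?_)) 2) le_rfl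
        exact ENNReal.ofReal_le_one.2 (pow_le_one₀ ht.le ht1)
      _ = _ := by ring
  set A := ∑ l, ∫⁻ x in U, ‖F x * G l x + D l x * ψ x‖ₑ ^ 2
  set B := ∫⁻ x in U, P x * ‖F x * ψ x‖ₑ ^ 2
  set R := ∑ l, ∫⁻ x in U, ‖D l x * ψ x‖ₑ ^ 2
  set m := ∫⁻ x in U, ‖F x * ψ x‖ₑ ^ 2
  set C := 2 * E + 2 + Fintype.card ι * ENNReal.ofReal (8 * L ^ 2) with hCdef
  have hτ0 : τ ≠ 0 := by simp [hτ, ht]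
  have hfin : E + τ * (A + B) ≤ E + τ * (R + E * m + ENNReal.ofReal t * (C + 1)) := by
    calc E + τ * (A + B) ≤ E * ((∫⁻ x in U, ‖ξ x‖ₑ ^ 2) + τ * m) + τ * (A + B) := by
          gcongr
          exact le_mul_of_one_le_right' massInt
      _ = E * (∫⁻ x in U, ‖ξ x‖ₑ ^ 2) + (τ * (E * m) + τ * (A + B)) := by ring
      _ ≤ _ := add_le_add_left hlo _
      _ = ((∑ l, ∫⁻ x in U, ‖H l x‖ₑ ^ 2) + τ * A) + ((∫⁻ x in U, P x * ‖ξ x‖ₑ ^ 2) + τ * B)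
          + τ * (E * m) := by ring
      _ = ((∑ l, ∫⁻ x in U, ‖G l x‖ₑ ^ 2) + ∫⁻ x in U, P x * ‖ψ x‖ₑ ^ 2)
          + τ2 * ((∑ l, ∫⁻ x in U, ‖F x * (F x * G l x + D l x * ψ x) + D l x * (F x * ψ x)‖ₑ ^ 2)
            + ∫⁻ x in U, P x * ‖F x * (F x * ψ x)‖ₑ ^ 2) + τ * R + τ * (E * m) := by
          rw [kinInt, potInt]; ring
      _ ≤ (E + τ2) + τ2 * C + τ * R + τ * (E * m) := by gcongr
      _ = E + (τ * (R + E * m) + τ2 * (C + 1)) := by ring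
      _ ≤ E + (τ * (R + E * m) + τ * (ENNReal.ofReal t * (C + 1))) := by
          refine add_le_add le_rfl (add_le_add le_rfl ?_)
          rw [← mul_assoc, hτ, hτ2, ← ENNReal.ofReal_mul (by positivity)]
          gcongr
          nlinarith
      _ = _ := by ring
  have := (ENNReal.mul_le_mul_iff_right hτ0 hτt).1 ((ENNReal.add_le_add_iff_left hE).1 hfin)
  rw [lintegral_add_left' (Finset.aemeasurable_fun_sum _ fun l _ => sq_m (d1 l).2.1),
    lintegral_finsetSum' _ fun l _ => sq_m (d1 l).2.1,
    lintegral_add_left' (Finset.aemeasurable_fun_sum _ fun l _ => sq_m (hDm l)),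
    lintegral_finsetSum' _ fun l _ => sq_m (hDm l), lintegral_const_mul' _ _ hE]
  rwa [show C + 1 = 2 * E + 3 + Fintype.card ι * ENNReal.ofReal (8 * L ^ 2) by
    rw [hCdef]; ring] at this

end NearMinimizer

/-! ### The correlation factor. -/

/-- `G - F` has a minimum at `p` along the line. For a minimum of finitely many functions this
identifies the derivative with that of any function attaining the minimum, with no need to divide
space into regions. -/
theorem lineDeriv_eq_of_le {X : Type*} [NormedAddCommGroup X] [NormedSpace ℝ X] {F G : X → ℝ}
    {p w : X} (hF : LineDifferentiableAt ℝ F p w) (hG : LineDifferentiableAt ℝ G p w)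
    (hle : ∀ q, F q ≤ G q) (heq : F p = G p) : lineDeriv ℝ F p w = lineDeriv ℝ G p w := by
  have hmin : IsLocalMin (fun t : ℝ => G (p + t • w) - F (p + t • w)) 0 :=
    Eventually.of_forall fun t => by simpa [heq] using hle _
  have h0 := hmin.deriv_eq_zero
  have := deriv_fun_sub (x := (0 : ℝ)) hG hF
  rw [h0] at this
  simp only [lineDeriv]
  linarith

/-- The correlation factor between one particle and the others: the least of the values of `Γ` at
the distances from the others. -/
noncomputable def correlation {N : ℕ} (Γ : Space3 → ℝ) (p : Space3 × (Fin N → Space3)) : ℝ :=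
  ⨅ j, Γ (p.1 - p.2 j)

instance isAddHaarMeasure_volume_pair (N : ℕ) :
    (volume : Measure (Space3 × (Fin N → Space3))).IsAddHaarMeasure :=
  L2WeakDeriv.isAddHaarMeasure_volume_prod

section Correlation

variable {N : ℕ} [NeZero N] {Γ : Space3 → ℝ} {L : ℝ≥0}

theorem correlation_le (p : Space3 × (Fin N → Space3)) (j : Fin N) :
    correlation Γ p ≤ Γ (p.1 - p.2 j) :=
  ciInf_le (Set.finite_range _).bddBelow j

theorem exists_correlation_eq (Γ : Space3 → ℝ) (p : Space3 × (Fin N → Space3)) :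
    ∃ j, Γ (p.1 - p.2 j) = correlation Γ p :=
  exists_eq_ciInf_of_finite

theorem correlation_nonneg (h : ∀ z, 0 ≤ Γ z) (p : Space3 × (Fin N → Space3)) :
    0 ≤ correlation Γ p := by
  obtain ⟨j, hj⟩ := exists_correlation_eq Γ p
  exact hj ▸ h _

theorem correlation_le_one (h : ∀ z, Γ z ≤ 1) (p : Space3 × (Fin N → Space3)) :
    correlation Γ p ≤ 1 := by
  obtain ⟨j, hj⟩ := exists_correlation_eq Γ p
  exact hj ▸ h _

theorem lipschitzWith_pair (h : LipschitzWith L Γ) (j : Fin N) :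
    LipschitzWith (L * 2) fun p : Space3 × (Fin N → Space3) => Γ (p.1 - p.2 j) := by
  refine h.comp (LipschitzWith.of_dist_le_mul fun p q => ?_)
  calc dist (p.1 - p.2 j) (q.1 - q.2 j) ≤ dist p.1 q.1 + dist (p.2 j) (q.2 j) :=
        dist_sub_sub_le _ _ _ _
    _ ≤ dist p q + dist p q := by
        rw [Prod.dist_eq]
        exact add_le_add (le_max_left _ _) ((dist_le_pi_dist _ _ _).trans (le_max_right _ _))
    _ = _ := by push_cast; ring

theorem lipschitzWith_correlation (h : LipschitzWith L Γ) :
    LipschitzWith (L * 2) (correlation Γ : Space3 × (Fin N → Space3) → ℝ) := by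
  refine LipschitzWith.of_le_add_mul _ fun p q => ?_
  obtain ⟨j, hj⟩ := exists_correlation_eq Γ q
  exact (correlation_le p j).trans (hj ▸ (lipschitzWith_pair h j).le_add_mul p q)

theorem lineDeriv_pair_fst (p : Space3 × (Fin N → Space3)) (j : Fin N) (w : Space3) :
    lineDeriv ℝ (fun p : Space3 × (Fin N → Space3) => Γ (p.1 - p.2 j)) p (w, 0) =
      lineDeriv ℝ Γ (p.1 - p.2 j) w := by
  simp only [lineDeriv]
  congr 1
  ext t
  simp [add_sub_right_comm]

theorem lineDeriv_pair_snd (p : Space3 × (Fin N → Space3)) (i j : Fin N) (w : Space3) :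
    lineDeriv ℝ (fun p : Space3 × (Fin N → Space3) => Γ (p.1 - p.2 j)) p (0, Pi.single i w) =
      if j = i then -lineDeriv ℝ Γ (p.1 - p.2 j) w else 0 := by
  split_ifs with h
  · subst h
    rw [← lineDeriv_neg]
    simp only [lineDeriv]
    congr 1
    ext t
    simp [sub_eq_add_neg, add_assoc, add_comm]
  · simp [lineDeriv, h]

/-- Almost everywhere the squared gradient of the correlation factor is that of a single pair. -/
theorem ae_gradient_correlation (h : LipschitzWith L Γ) :
    ∀ᵐ p : Space3 × (Fin N → Space3), ∃ j, Γ (p.1 - p.2 j) = correlation Γ p ∧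
      (∑ k, lineDeriv ℝ (correlation Γ) p (unitVec k, 0) ^ 2)
        + ∑ i, ∑ k, lineDeriv ℝ (correlation Γ) p (0, Pi.single i (unitVec k)) ^ 2 =
      2 * ∑ k, lineDeriv ℝ Γ (p.1 - p.2 j) (unitVec k) ^ 2 := by
  have hF := lipschitzWith_correlation (N := N) h
  have a1 : ∀ᵐ p : Space3 × (Fin N → Space3), ∀ k,
      LineDifferentiableAt ℝ (correlation Γ) p (unitVec k, 0) :=
    ae_all_iff.2 fun k => hF.ae_lineDifferentiableAt _
  have a2 : ∀ᵐ p : Space3 × (Fin N → Space3), ∀ i k,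
      LineDifferentiableAt ℝ (correlation Γ) p (0, Pi.single i (unitVec k)) :=
    ae_all_iff.2 fun i => ae_all_iff.2 fun k => hF.ae_lineDifferentiableAt _
  have b1 : ∀ᵐ p : Space3 × (Fin N → Space3), ∀ (j : Fin N) k, LineDifferentiableAt ℝ
      (fun p : Space3 × (Fin N → Space3) => Γ (p.1 - p.2 j)) p (unitVec k, 0) :=
    ae_all_iff.2 fun j => ae_all_iff.2 fun k => (lipschitzWith_pair h j).ae_lineDifferentiableAt _
  have b2 : ∀ᵐ p : Space3 × (Fin N → Space3), ∀ (j : Fin N) i k, LineDifferentiableAt ℝ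
      (fun p : Space3 × (Fin N → Space3) => Γ (p.1 - p.2 j)) p (0, Pi.single i (unitVec k)) :=
    ae_all_iff.2 fun j => ae_all_iff.2 fun i => ae_all_iff.2 fun k =>
      (lipschitzWith_pair h j).ae_lineDifferentiableAt _
  filter_upwards [a1, a2, b1, b2] with p a1 a2 b1 b2
  obtain ⟨j, hj⟩ := exists_correlation_eq Γ p
  refine ⟨j, hj, ?_⟩
  have e1 (k) : lineDeriv ℝ (correlation Γ) p (unitVec k, 0) =
      lineDeriv ℝ Γ (p.1 - p.2 j) (unitVec k) := by
    rw [lineDeriv_eq_of_le (a1 k) (b1 j k) (fun q => correlation_le q j) hj.symm,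
      lineDeriv_pair_fst]
  have e2 (i k) : lineDeriv ℝ (correlation Γ) p (0, Pi.single i (unitVec k)) =
      if j = i then -lineDeriv ℝ Γ (p.1 - p.2 j) (unitVec k) else 0 := by
    rw [lineDeriv_eq_of_le (a2 i k) (b2 j i k) (fun q => correlation_le q j) hj.symm,
      lineDeriv_pair_snd]
  -- The gradient of the active pair appears once in the variable `x` and once, with opposite sign,
  -- in `y_j`; the other particles contribute nothing. This is the factor two.
  simp_rw [e1, e2, two_mul]
  congr 1
  rw [Finset.sum_eq_single j]
  · simp
  · intro i _ hi
    simp [Ne.symm hi]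
  · simp

/-- The energy density of the correlation factor is bounded by the sum of those of the pairs. -/
theorem ae_energy_correlation_le (h : LipschitzWith L Γ) (h0 : ∀ z, 0 ≤ Γ z) (v : ℝ → ℝ≥0∞) :
    ∀ᵐ p : Space3 × (Fin N → Space3),
      (∑ k, ENNReal.ofReal (lineDeriv ℝ (correlation Γ) p (unitVec k, 0) ^ 2))
        + (∑ i, ∑ k, ENNReal.ofReal
            (lineDeriv ℝ (correlation Γ) p (0, Pi.single i (unitVec k)) ^ 2))
        + (∑ j, v (dist p.1 (p.2 j))) * ENNReal.ofReal (correlation Γ p ^ 2) ≤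
      ∑ j, (ENNReal.ofReal (2 * ∑ k, lineDeriv ℝ Γ (p.1 - p.2 j) (unitVec k) ^ 2)
        + v ‖p.1 - p.2 j‖ * ENNReal.ofReal (Γ (p.1 - p.2 j) ^ 2)) := by
  filter_upwards [ae_gradient_correlation h] with p hp
  obtain ⟨j, hj, he⟩ := hp
  simp_rw [← ENNReal.ofReal_sum_of_nonneg fun _ _ => sq_nonneg _]
  rw [← ENNReal.ofReal_sum_of_nonneg fun _ _ => Finset.sum_nonneg fun _ _ => sq_nonneg _,
    ← ENNReal.ofReal_add (Finset.sum_nonneg fun _ _ => sq_nonneg _)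
      (Finset.sum_nonneg fun _ _ => Finset.sum_nonneg fun _ _ => sq_nonneg _), he,
    Finset.sum_add_distrib, Finset.sum_mul]
  -- The gradient part is a single summand of the right-hand side; the interaction with every
  -- particle `i` is treated with `F ≤ Γ (x - y_i)`.
  refine add_le_add ?_ (Finset.sum_le_sum fun i _ => ?_)
  · exact Finset.single_le_sum
      (f := fun j => ENNReal.ofReal (2 * ∑ k, lineDeriv ℝ Γ (p.1 - p.2 j) (unitVec k) ^ 2))
      (fun _ _ => zero_le) (Finset.mem_univ j)
  · rw [dist_eq_norm]
    gcongr
    · exact correlation_nonneg h0 p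
    · exact correlation_le p i

end Correlation

/-! ### Energy of the trial state, particle by particle. -/

section Trial

variable {Ω : Set Space3} {V : Space3 → ℝ} {A e m : ℝ} {f : Space3 → ℝ} {g : Fin 3 → Space3 → ℝ}
  {N : ℕ} {ψ : (Fin N → Space3) → ℝ} {G : Fin N → Fin 3 → (Fin N → Space3) → ℝ}
  {F : Space3 × (Fin N → Space3) → ℝ} {L : ℝ≥0}

theorem lineDeriv_slice_fst (F : Space3 × (Fin N → Space3) → ℝ) (x : Space3)
    (y : Fin N → Space3) (w : Space3) :
    lineDeriv ℝ (fun x => F (x, y)) x w = lineDeriv ℝ F (x, y) (w, 0) := by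
  simp [lineDeriv]

theorem lineDeriv_slice_snd (F : Space3 × (Fin N → Space3) → ℝ) (x : Space3)
    (y w : Fin N → Space3) :
    lineDeriv ℝ (fun y => F (x, y)) y w = lineDeriv ℝ F (x, y) (0, w) := by
  simp [lineDeriv]

theorem L2WeakDeriv.correlated_fst (hΩ : IsOpen Ω) (hF : LipschitzWith L F)
    (hB : ∀ p, |F p| ≤ 1) {k : Fin 3} {g : Space3 → ℝ} (h : L2WeakDeriv Ω (unitVec k) f g)
    (hψ : MemLp ψ 2 (volume.restrict (configSpace Ω N))) :
    L2WeakDeriv (Ω ×ˢ configSpace Ω N) ((unitVec k, 0) : Space3 × (Fin N → Space3))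
      (fun p => F p * (f p.1 * ψ p.2)) fun p => F p * (g p.1 * ψ p.2)
        + lineDeriv ℝ F p (unitVec k, 0) * (f p.1 * ψ p.2) :=
  (h.tensor_left hψ).lipschitz_mul (hΩ.prod (isOpen_configSpace hΩ N)) hF hB

theorem L2WeakDeriv.correlated_snd (hΩ : IsOpen Ω) (hF : LipschitzWith L F)
    (hB : ∀ p, |F p| ≤ 1) {w : Fin N → Space3} {G : (Fin N → Space3) → ℝ}
    (h : L2WeakDeriv (configSpace Ω N) w ψ G) (hf : MemLp f 2 (volume.restrict Ω)) :
    L2WeakDeriv (Ω ×ˢ configSpace Ω N) ((0, w) : Space3 × (Fin N → Space3))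
      (fun p => F p * (f p.1 * ψ p.2)) fun p => F p * (f p.1 * G p.2)
        + lineDeriv ℝ F p (0, w) * (f p.1 * ψ p.2) :=
  (h.tensor_right hΩ.measurableSet (isOpen_configSpace hΩ N).measurableSet hf).lipschitz_mul
    (hΩ.prod (isOpen_configSpace hΩ N)) hF hB

theorem memLp_two_configSpace_tensor (hf : MemLp f 2 (volume.restrict Ω))
    (hψ : MemLp ψ 2 (volume.restrict (configSpace Ω N))) :
    MemLp (fun p : Space3 × (Fin N → Space3) => f p.1 * ψ p.2) 2
      (volume.restrict (Ω ×ˢ configSpace Ω N)) := by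
  have := L2WeakDeriv.memLp_two_tensor hf hψ
  rwa [Measure.prod_restrict] at this

theorem memLp_two_lineDeriv_tensor (hF : LipschitzWith L F) (hf : MemLp f 2 (volume.restrict Ω))
    (hψ : MemLp ψ 2 (volume.restrict (configSpace Ω N))) (w : Space3 × (Fin N → Space3)) :
    MemLp (fun p : Space3 × (Fin N → Space3) => lineDeriv ℝ F p w * (f p.1 * ψ p.2)) 2
      (volume.restrict (Ω ×ˢ configSpace Ω N)) :=
  memLp_two_mul_of_bounded (hF.memLp_lineDeriv _).1 (abs_lineDeriv_le_of_lipschitz hF _)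
    (memLp_two_configSpace_tensor hf hψ)

/-- The part of the energy of the correlated state that belongs to the added particle. -/
theorem IsStarMin.lintegral_correlated_fst_le (h : IsStarMin Ω V A e f g m) (he : 0 ≤ e)
    (hΩ : IsOpen Ω) (hV : ∀ x, 0 ≤ V x) (hVm : Measurable V) (hF : LipschitzWith L F)
    (h0 : ∀ p, 0 ≤ F p) (h1 : ∀ p, F p ≤ 1) (hψ : MemLp ψ 2 (volume.restrict (configSpace Ω N)))
    (hmass : ∫⁻ y in configSpace Ω N, ‖ψ y‖ₑ ^ 2 = 1) :
    ∫⁻ p in Ω ×ˢ configSpace Ω N, ((∑ k, ‖F p * (g k p.1 * ψ p.2)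
        + lineDeriv ℝ F p (unitVec k, 0) * (f p.1 * ψ p.2)‖ₑ ^ 2)
        + ENNReal.ofReal (V p.1) * ‖F p * (f p.1 * ψ p.2)‖ₑ ^ 2) ≤
      ENNReal.ofReal (formEnergy Ω V f g) + ∫⁻ p in Ω ×ˢ configSpace Ω N,
        ∑ k, ‖lineDeriv ℝ F p (unitVec k, 0) * (f p.1 * ψ p.2)‖ₑ ^ 2 := by
  have hB (p) : |F p| ≤ 1 := by rw [abs_of_nonneg (h0 p)]; exact h1 p
  have m1 (k) := ((h.dom.deriv k).correlated_fst hΩ hF hB hψ).2.1.1.enorm.pow_const 2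
  have m2 := ((h.dom.deriv 0).correlated_fst hΩ hF hB hψ).1.1.enorm.pow_const 2
  have m3 (k : Fin 3) :=
    (memLp_two_lineDeriv_tensor hF h.dom.memLp hψ (unitVec k, 0)).1.enorm.pow_const 2
  rw [Measure.volume_eq_prod] at m1 m2 m3 ⊢
  have m5 : AEMeasurable (fun p : Space3 × (Fin N → Space3) => (∑ k, ‖F p * (g k p.1 * ψ p.2)
        + lineDeriv ℝ F p (unitVec k, 0) * (f p.1 * ψ p.2)‖ₑ ^ 2)
        + ENNReal.ofReal (V p.1) * ‖F p * (f p.1 * ψ p.2)‖ₑ ^ 2)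
      ((volume.prod volume).restrict (Ω ×ˢ configSpace Ω N)) :=
    (Finset.aemeasurable_fun_sum _ fun k _ => m1 k).add
      ((hVm.comp measurable_fst).ennreal_ofReal.aemeasurable.mul m2)
  rw [setLIntegral_prod_symm _ m5,
    setLIntegral_prod_symm _ (Finset.aemeasurable_fun_sum _ fun k _ => m3 k)]
  have hT : ENNReal.ofReal (formEnergy Ω V f g) =
      ∫⁻ y in configSpace Ω N, ‖ψ y‖ₑ ^ 2 * ENNReal.ofReal (formEnergy Ω V f g) := by
    rw [lintegral_mul_const' _ _ ENNReal.ofReal_ne_top, hmass, one_mul]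
  rw [hT, ← lintegral_add_left' ((hψ.1.enorm.pow_const 2).mul_const _)]
  refine lintegral_mono fun y => ?_
  have hslice : LipschitzWith (L * 1) fun x => F (x, y) := hF.comp (LipschitzWith.prodMk_right y)
  -- With the old particles fixed, `x ↦ F (x, y)` is a Lipschitz multiplier of the minimizer, and `ψ
  -- y` is a constant factor.
  have key := h.lintegral_multiplier_le he hΩ hV hVm hslice (fun x => h0 _) fun x => h1 _
  simp_rw [lineDeriv_slice_fst] at key
  have hψt : ‖ψ y‖ₑ ^ 2 ≠ ⊤ := by finiteness
  calc _ = ∫⁻ x in Ω, ‖ψ y‖ₑ ^ 2 * ((∑ k, ‖F (x, y) * g k x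
        + lineDeriv ℝ F (x, y) (unitVec k, 0) * f x‖ₑ ^ 2)
        + ENNReal.ofReal (V x) * ‖F (x, y) * f x‖ₑ ^ 2) := by
        refine lintegral_congr fun x => ?_
        rw [mul_add, Finset.mul_sum, mul_left_comm (‖ψ y‖ₑ ^ 2)]
        simp only [← mul_pow, ← enorm_mul]
        congr 1
        · refine Finset.sum_congr rfl fun k _ => ?_
          congr 2; ring
        · congr 3; ring
    _ ≤ ‖ψ y‖ₑ ^ 2 * (ENNReal.ofReal (formEnergy Ω V f g) + ∫⁻ x in Ω,
          ∑ k, ‖lineDeriv ℝ F (x, y) (unitVec k, 0) * f x‖ₑ ^ 2) := by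
        rw [lintegral_const_mul' _ _ hψt]
        exact mul_le_mul_right key _
    _ = _ := by
        rw [mul_add, ← lintegral_const_mul' _ _ hψt]
        congr 1
        refine lintegral_congr fun x => ?_
        rw [Finset.mul_sum]
        refine Finset.sum_congr rfl fun k _ => ?_
        rw [← mul_pow, ← enorm_mul]
        congr 2; ring

/-- The part of the energy of the correlated state that belongs to the old particles. -/
theorem lintegral_correlated_snd_le [NeZero N] (hΩ : IsOpen Ω) (hVm : Measurable V)
    {v : ℝ → ℝ≥0∞} (hv : Measurable v) (hf : MemLp f 2 (volume.restrict Ω))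
    (hfmass : ∫⁻ x in Ω, ‖f x‖ₑ ^ 2 = 1) (hF : LipschitzWith L F)
    (h0 : ∀ p, 0 ≤ F p) (h1 : ∀ p, F p ≤ 1) (hE : bosonEnergy Ω V v N ≠ ⊤)
    (hd : ∀ i k, L2WeakDeriv (configSpace Ω N) (Pi.single i (unitVec k)) ψ (G i k))
    (hmass : ∫⁻ y in configSpace Ω N, ‖ψ y‖ₑ ^ 2 = 1) {t : ℝ} (ht : 0 < t) (ht1 : t ≤ 1)
    (hnear : (∑ i, ∑ k, ∫⁻ x in configSpace Ω N, ‖G i k x‖ₑ ^ 2) +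
        ∫⁻ x in configSpace Ω N, manyBodyPotential V v N x * ‖ψ x‖ₑ ^ 2 ≤
          bosonEnergy Ω V v N + ENNReal.ofReal (t ^ 2)) :
    ∫⁻ p in Ω ×ˢ configSpace Ω N, ((∑ i, ∑ k, ‖F p * (f p.1 * G i k p.2)
        + lineDeriv ℝ F p (0, Pi.single i (unitVec k)) * (f p.1 * ψ p.2)‖ₑ ^ 2)
        + manyBodyPotential V v N p.2 * ‖F p * (f p.1 * ψ p.2)‖ₑ ^ 2) ≤
      (∫⁻ p in Ω ×ˢ configSpace Ω N,
        ((∑ i, ∑ k, ‖lineDeriv ℝ F p (0, Pi.single i (unitVec k)) * (f p.1 * ψ p.2)‖ₑ ^ 2)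
          + bosonEnergy Ω V v N * ‖F p * (f p.1 * ψ p.2)‖ₑ ^ 2))
      + ENNReal.ofReal t * (2 * bosonEnergy Ω V v N + 3
          + (N * 3 : ℕ) * ENNReal.ofReal (8 * L ^ 2)) := by
  have hB (p) : |F p| ≤ 1 := by rw [abs_of_nonneg (h0 p)]; exact h1 p
  have hψ : MemLp ψ 2 (volume.restrict (configSpace Ω N)) := (hd 0 0).1
  have m1 (i k) := ((hd i k).correlated_snd hΩ hF hB hf).2.1.1.enorm.pow_const 2
  have m2 := ((hd 0 0).correlated_snd hΩ hF hB hf).1.1.enorm.pow_const 2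
  have m3 (i : Fin N) (k : Fin 3) :=
    (memLp_two_lineDeriv_tensor hF hf hψ (0, Pi.single i (unitVec k))).1.enorm.pow_const 2
  have hPm := measurable_manyBodyPotential (N := N) hVm hv
  rw [Measure.volume_eq_prod] at m1 m2 m3 ⊢
  have m4 : AEMeasurable (fun p : Space3 × (Fin N → Space3) =>
        (∑ i, ∑ k, ‖lineDeriv ℝ F p (0, Pi.single i (unitVec k)) * (f p.1 * ψ p.2)‖ₑ ^ 2)
          + bosonEnergy Ω V v N * ‖F p * (f p.1 * ψ p.2)‖ₑ ^ 2)
      ((volume.prod volume).restrict (Ω ×ˢ configSpace Ω N)) := (Finset.aemeasurable_fun_sum Finset.univ fun i _ =>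
    Finset.aemeasurable_fun_sum Finset.univ fun k _ => m3 i k).add
      (m2.const_mul (bosonEnergy Ω V v N))
  have m5 : AEMeasurable (fun p : Space3 × (Fin N → Space3) =>
      (∑ i, ∑ k, ‖F p * (f p.1 * G i k p.2)
        + lineDeriv ℝ F p (0, Pi.single i (unitVec k)) * (f p.1 * ψ p.2)‖ₑ ^ 2)
        + manyBodyPotential V v N p.2 * ‖F p * (f p.1 * ψ p.2)‖ₑ ^ 2)
      ((volume.prod volume).restrict (Ω ×ˢ configSpace Ω N)) :=
    (Finset.aemeasurable_fun_sum _ fun i _ => Finset.aemeasurable_fun_sum _ fun k _ => m1 i k).add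
      ((hPm.comp measurable_snd).aemeasurable.mul m2)
  rw [setLIntegral_prod _ m5, setLIntegral_prod _ m4]
  set err := ENNReal.ofReal t * (2 * bosonEnergy Ω V v N + 3
          + (N * 3 : ℕ) * ENNReal.ofReal (8 * L ^ 2)) with herr
  have herrt : err ≠ ⊤ := by rw [herr]; finiteness
  have hT : err = ∫⁻ x in Ω, ‖f x‖ₑ ^ 2 * err := by
    rw [lintegral_mul_const' _ _ herrt, hfmass, one_mul]
  rw [hT, ← lintegral_add_right' _ ((hf.1.enorm.pow_const 2).mul_const _)]
  refine lintegral_mono fun x => ?_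
  have hslice : LipschitzWith (L * 1) fun y => F (x, y) := hF.comp (LipschitzWith.prodMk_left x)
  -- With the added particle fixed, `y ↦ F (x, y)` multiplies the approximate ground state. The
  -- competitors are not assumed symmetric, which the symmetrization lemma `bosonEnergy_mul_le`
  -- permits.
  have key := lintegral_multiplier_le_of_near_minimizer (ι := Fin N × Fin 3)
    (w := fun l => Pi.single l.1 (unitVec l.2)) (G := fun l => G l.1 l.2)
    (isOpen_configSpace hΩ N) hE hPm
    (fun l => by simp [Pi.norm_single, unitVec])
    (fun ξ H hH => by
      rw [Fintype.sum_prod_type]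
      exact bosonEnergy_mul_le hΩ hVm hv (NeZero.pos N) (G := fun i k => H (i, k))
        fun i k => hH (i, k))
    (fun l => hd l.1 l.2) hmass ht ht1 (by rw [Fintype.sum_prod_type]; exact hnear)
    hslice (fun y => h0 _) fun y => h1 _
  simp_rw [lineDeriv_slice_snd, Fintype.sum_prod_type, mul_one, Fintype.card_prod,
    Fintype.card_fin, ← herr] at key
  have hft : ‖f x‖ₑ ^ 2 ≠ ⊤ := by finiteness
  calc _ = ∫⁻ y in configSpace Ω N, ‖f x‖ₑ ^ 2 * ((∑ i, ∑ k, ‖F (x, y) * G i k y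
        + lineDeriv ℝ F (x, y) (0, Pi.single i (unitVec k)) * ψ y‖ₑ ^ 2)
        + manyBodyPotential V v N y * ‖F (x, y) * ψ y‖ₑ ^ 2) := by
        refine lintegral_congr fun y => ?_
        simp only [mul_add, Finset.mul_sum, mul_left_comm (‖f x‖ₑ ^ 2), ← mul_pow, ← enorm_mul]
        congr 1
        · refine Finset.sum_congr rfl fun i _ => Finset.sum_congr rfl fun k _ => ?_
          congr 2; ring
        · congr 3; ring
    _ ≤ ‖f x‖ₑ ^ 2 * ((∫⁻ y in configSpace Ω N,
          ((∑ i, ∑ k, ‖lineDeriv ℝ F (x, y) (0, Pi.single i (unitVec k)) * ψ y‖ₑ ^ 2)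
            + bosonEnergy Ω V v N * ‖F (x, y) * ψ y‖ₑ ^ 2)) + err) := by
        rw [lintegral_const_mul' _ _ hft]
        exact mul_le_mul_right key _
    _ = _ := by
        rw [mul_add, ← lintegral_const_mul' _ _ hft]
        congr 1
        refine lintegral_congr fun y => ?_
        simp only [mul_add, Finset.mul_sum, mul_left_comm (‖f x‖ₑ ^ 2), ← mul_pow, ← enorm_mul]
        congr 1
        · refine Finset.sum_congr rfl fun i _ => Finset.sum_congr rfl fun k _ => ?_
          congr 2; ring
        · congr 3; ring

end Trial

/-! ### Assembling the energy of `N + 1` particles. -/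

section Combined

variable {Ω : Set Space3} {V : Space3 → ℝ} {v : ℝ → ℝ≥0∞} {N : ℕ}

theorem manyBodyPotential_succ (y : Fin (N + 1) → Space3) :
    manyBodyPotential V v (N + 1) y = ENNReal.ofReal (V (splitConfig N y).1)
      + manyBodyPotential V v N (splitConfig N y).2
      + ∑ j, v (dist (splitConfig N y).1 ((splitConfig N y).2 j)) := by
  simp only [manyBodyPotential, splitConfig_apply, Fin.sum_univ_succ, Fin.sum_Ioi_zero,
    Fin.sum_Ioi_succ]
  ring

/-- The energy density of a pair with correlation factor `Γ`. -/
noncomputable def pairEnergy (v : ℝ → ℝ≥0∞) (Γ : Space3 → ℝ) (z : Space3) : ℝ≥0∞ :=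
  ENNReal.ofReal (2 * ∑ k, lineDeriv ℝ Γ z (unitVec k) ^ 2) + v ‖z‖ * ENNReal.ofReal (Γ z ^ 2)

theorem measurable_pairEnergy (hv : Measurable v) {Γ : Space3 → ℝ} (hΓ : Continuous Γ) :
    Measurable (pairEnergy v Γ) := by
  unfold pairEnergy
  refine Measurable.add (Measurable.ennreal_ofReal (Measurable.const_mul
    (Finset.measurable_sum _ fun k _ => (measurable_lineDeriv hΓ).pow_const 2) 2)) ?_
  exact (hv.comp measurable_norm).mul (hΓ.measurable.pow_const 2).ennreal_ofReal

/-- Integrals of pair functions against a product state with bounded first factor. -/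
theorem lintegral_pair_tensor_le {H : Space3 → ℝ≥0∞} (hH : Measurable H) {f : Space3 → ℝ} {m : ℝ}
    (hf : MemLp f 2 (volume.restrict Ω)) (hf0 : ∀ x, 0 ≤ f x)
    (hfm : ∀ᵐ x ∂volume.restrict Ω, f x ≤ m) {ψ : (Fin N → Space3) → ℝ}
    (hψ : MemLp ψ 2 (volume.restrict (configSpace Ω N)))
    (hmass : ∫⁻ y in configSpace Ω N, ‖ψ y‖ₑ ^ 2 = 1) :
    ∫⁻ p in Ω ×ˢ configSpace Ω N, (∑ j, H (p.1 - p.2 j)) * ‖f p.1 * ψ p.2‖ₑ ^ 2 ≤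
      N * (ENNReal.ofReal (m ^ 2) * ∫⁻ z, H z) := by
  have hsm : Measurable fun p : Space3 × (Fin N → Space3) => ∑ j, H (p.1 - p.2 j) :=
    Finset.measurable_fun_sum _ fun j _ => hH.comp
      (measurable_fst.sub ((measurable_pi_apply j).comp measurable_snd))
  have hm := hsm.aemeasurable.mul ((memLp_two_configSpace_tensor hf hψ).1.enorm.pow_const 2)
  rw [Measure.volume_eq_prod] at hm ⊢
  have hm' : AEMeasurable (fun p : Space3 × (Fin N → Space3) =>
      (∑ j, H (p.1 - p.2 j)) * ‖f p.1 * ψ p.2‖ₑ ^ 2)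
      ((volume.prod volume).restrict (Ω ×ˢ configSpace Ω N)) := hm
  rw [setLIntegral_prod_symm _ hm']
  have hsl (y : Fin N → Space3) : ∫⁻ x in Ω, (∑ j, H (x - y j)) * ‖f x * ψ y‖ₑ ^ 2 ≤
      ‖ψ y‖ₑ ^ 2 * (N * (ENNReal.ofReal (m ^ 2) * ∫⁻ z, H z)) := by
    calc _ ≤ ∫⁻ x in Ω, (‖ψ y‖ₑ ^ 2 * ENNReal.ofReal (m ^ 2)) * ∑ j, H (x - y j) := by
          refine lintegral_mono_ae ?_
          filter_upwards [hfm] with x hx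
          rw [mul_comm, enorm_mul, mul_pow, mul_comm (‖f x‖ₑ ^ 2)]
          gcongr
          rw [enorm_sq_eq_ofReal]
          exact ENNReal.ofReal_le_ofReal (pow_le_pow_left₀ (hf0 x) hx 2)
      _ = (‖ψ y‖ₑ ^ 2 * ENNReal.ofReal (m ^ 2)) * ∑ j, ∫⁻ x in Ω, H (x - y j) := by
          have hHm (j : Fin N) : Measurable fun x => H (x - y j) :=
            hH.comp (measurable_id.sub_const _)
          rw [lintegral_const_mul' _ _ (by finiteness), lintegral_finsetSum _ fun j _ => hHm j]
      _ ≤ (‖ψ y‖ₑ ^ 2 * ENNReal.ofReal (m ^ 2)) * ∑ _j : Fin N, ∫⁻ z, H z := by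
          refine mul_le_mul_right (Finset.sum_le_sum fun j _ => ?_) _
          exact (setLIntegral_le_lintegral _ _).trans (lintegral_sub_right_eq_self H (y j)).le
      _ = _ := by
          simp only [Finset.sum_const, Finset.card_univ, Fintype.card_fin, nsmul_eq_mul]
          ring
  refine (lintegral_mono hsl).trans (le_of_eq ?_)
  rw [lintegral_mul_const'' _ (hψ.1.enorm.pow_const 2), hmass, one_mul]

/-- The energy of `N + 1` particles is estimated by that of the correlated product of a one-particle
minimizer and an approximate ground state of `N` particles. -/
theorem IsStarMin.bosonEnergy_succ_mul_le [NeZero N] {A e m : ℝ} {f : Space3 → ℝ}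
    {g : Fin 3 → Space3 → ℝ} (h : IsStarMin Ω V A e f g m) (he : 0 ≤ e) (hΩ : IsOpen Ω)
    (hV : ∀ x, 0 ≤ V x) (hVm : Measurable V) (hv : Measurable v)
    {Γ : Space3 → ℝ} {L : ℝ≥0} (hΓ : LipschitzWith L Γ) (h0 : ∀ z, 0 ≤ Γ z) (h1 : ∀ z, Γ z ≤ 1)
    (hE : bosonEnergy Ω V v N ≠ ⊤) {ψ : (Fin N → Space3) → ℝ}
    {G : Fin N → Fin 3 → (Fin N → Space3) → ℝ}
    (hd : ∀ i k, L2WeakDeriv (configSpace Ω N) (Pi.single i (unitVec k)) ψ (G i k))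
    (hmass : ∫⁻ y in configSpace Ω N, ‖ψ y‖ₑ ^ 2 = 1) {t : ℝ} (ht : 0 < t) (ht1 : t ≤ 1)
    (hnear : (∑ i, ∑ k, ∫⁻ x in configSpace Ω N, ‖G i k x‖ₑ ^ 2) +
        ∫⁻ x in configSpace Ω N, manyBodyPotential V v N x * ‖ψ x‖ₑ ^ 2 ≤
          bosonEnergy Ω V v N + ENNReal.ofReal (t ^ 2)) :
    bosonEnergy Ω V v (N + 1) *
        (∫⁻ p in Ω ×ˢ configSpace Ω N, ‖correlation Γ p * (f p.1 * ψ p.2)‖ₑ ^ 2) ≤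
      bosonEnergy Ω V v N *
        (∫⁻ p in Ω ×ˢ configSpace Ω N, ‖correlation Γ p * (f p.1 * ψ p.2)‖ₑ ^ 2)
      + (ENNReal.ofReal (formEnergy Ω V f g)
        + N * (ENNReal.ofReal (m ^ 2) * ∫⁻ z, pairEnergy v Γ z)
        + ENNReal.ofReal t * (2 * bosonEnergy Ω V v N + 3
          + (N * 3 : ℕ) * ENNReal.ofReal (8 * ((L * 2 : ℝ≥0) : ℝ) ^ 2))) := by
  set F : Space3 × (Fin N → Space3) → ℝ := correlation Γ with hFdef
  have hF : LipschitzWith (L * 2) F := lipschitzWith_correlation hΓ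
  have hF0 : ∀ p, 0 ≤ F p := correlation_nonneg h0
  have hF1 : ∀ p, F p ≤ 1 := correlation_le_one h1
  have hB (p) : |F p| ≤ 1 := by rw [abs_of_nonneg (hF0 p)]; exact hF1 p
  have hψ : MemLp ψ 2 (volume.restrict (configSpace Ω N)) := (hd 0 0).1
  have hf := h.dom.memLp
  have hfmass : ∫⁻ x in Ω, ‖f x‖ₑ ^ 2 = 1 := by
    rw [lintegral_enorm_sq_eq hf, h.mass, ENNReal.ofReal_one]
  set S := Ω ×ˢ configSpace Ω N with hS
  have hSm : MeasurableSet S := hΩ.measurableSet.prod (isOpen_configSpace hΩ N).measurableSet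
  have dx (k) := (h.dom.deriv k).correlated_fst hΩ hF hB hψ
  have dy (i k) := (hd i k).correlated_snd hΩ hF hB hf
  set Ψ : Space3 × (Fin N → Space3) → ℝ := fun p => F p * (f p.1 * ψ p.2) with hΨ
  set X : Fin 3 → Space3 × (Fin N → Space3) → ℝ := fun k p => F p * (g k p.1 * ψ p.2)
        + lineDeriv ℝ F p (unitVec k, 0) * (f p.1 * ψ p.2) with hX
  set Y : Fin N → Fin 3 → Space3 × (Fin N → Space3) → ℝ := fun i k p => F p * (f p.1 * G i k p.2)
        + lineDeriv ℝ F p (0, Pi.single i (unitVec k)) * (f p.1 * ψ p.2) with hY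
  -- The trial state singles out particle zero. It is inserted without symmetrization into the lower
  -- bound for general real functions.
  have hconf : ∀ i k, L2WeakDeriv (configSpace Ω (N + 1)) (Pi.single i (unitVec k))
      (Ψ ∘ splitConfig N) (Fin.cases X Y i k ∘ splitConfig N) := by
    intro i k
    rw [← preimage_splitConfig]
    refine L2WeakDeriv.comp_equiv (splitConfig N) (measurePreserving_splitConfig N) hSm ?_
    refine Fin.cases ?_ (fun i => ?_) i
    · rw [splitConfig_single_zero]
      exact dx k
    · rw [splitConfig_single_succ]
      exact dy i k
  have key := bosonEnergy_mul_le hΩ hVm hv N.succ_pos hconf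
  have eX (k) : ∫⁻ y in configSpace Ω (N + 1), ‖X k (splitConfig N y)‖ₑ ^ 2 = ∫⁻ p in S, ‖X k p‖ₑ ^ 2 :=
    lintegral_configSpace_succ hΩ.measurableSet N fun p => ‖X k p‖ₑ ^ 2
  have eY (i k) : ∫⁻ y in configSpace Ω (N + 1), ‖Y i k (splitConfig N y)‖ₑ ^ 2 =
      ∫⁻ p in S, ‖Y i k p‖ₑ ^ 2 :=
    lintegral_configSpace_succ hΩ.measurableSet N fun p => ‖Y i k p‖ₑ ^ 2
  rw [Fin.sum_univ_succ] at key
  simp only [Function.comp_apply, Fin.cases_zero, Fin.cases_succ, manyBodyPotential_succ, eX,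
    eY] at key
  rw [lintegral_configSpace_succ hΩ.measurableSet N fun p => ‖Ψ p‖ₑ ^ 2,
    lintegral_configSpace_succ hΩ.measurableSet N fun p => (ENNReal.ofReal (V p.1)
      + manyBodyPotential V v N p.2 + ∑ j, v (dist p.1 (p.2 j))) * ‖Ψ p‖ₑ ^ 2] at key
  refine key.trans ?_
  have mX (k) : AEMeasurable (fun p => ‖X k p‖ₑ ^ 2) (volume.restrict S) :=
    (dx k).2.1.1.enorm.pow_const 2
  have mY (i k) : AEMeasurable (fun p => ‖Y i k p‖ₑ ^ 2) (volume.restrict S) :=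
    (dy i k).2.1.1.enorm.pow_const 2
  have mΨ : AEMeasurable (fun p => ‖Ψ p‖ₑ ^ 2) (volume.restrict S) := (dx 0).1.1.enorm.pow_const 2
  have mV : AEMeasurable (fun p => ENNReal.ofReal (V p.1) * ‖Ψ p‖ₑ ^ 2) (volume.restrict S) :=
    (hVm.comp measurable_fst).ennreal_ofReal.aemeasurable.mul mΨ
  have mP : AEMeasurable (fun p => manyBodyPotential V v N p.2 * ‖Ψ p‖ₑ ^ 2) (volume.restrict S) :=
    ((measurable_manyBodyPotential hVm hv).comp measurable_snd).aemeasurable.mul mΨ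
  have mDX (k : Fin 3) : AEMeasurable (fun p : Space3 × (Fin N → Space3) =>
      ‖lineDeriv ℝ F p (unitVec k, 0) * (f p.1 * ψ p.2)‖ₑ ^ 2) (volume.restrict S) :=
    (memLp_two_lineDeriv_tensor hF hf hψ (unitVec k, 0)).1.enorm.pow_const 2
  have mDY (i : Fin N) (k : Fin 3) : AEMeasurable (fun p : Space3 × (Fin N → Space3) =>
      ‖lineDeriv ℝ F p (0, Pi.single i (unitVec k)) * (f p.1 * ψ p.2)‖ₑ ^ 2) (volume.restrict S) :=
    (memLp_two_lineDeriv_tensor hF hf hψ (0, Pi.single i (unitVec k))).1.enorm.pow_const 2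
  have mDX' := Finset.aemeasurable_fun_sum Finset.univ fun k _ => mDX k
  have mDY' := Finset.aemeasurable_fun_sum Finset.univ fun i _ =>
    Finset.aemeasurable_fun_sum Finset.univ fun k _ => mDY i k
  have hfst := h.lintegral_correlated_fst_le he hΩ hV hVm hF hF0 hF1 hψ hmass
  have hsnd := lintegral_correlated_snd_le hΩ hVm hv hf hfmass hF hF0 hF1 hE hd hmass ht ht1 hnear
  rw [lintegral_add_left' (Finset.aemeasurable_fun_sum _ fun k _ => mX k),
    lintegral_finsetSum' _ fun k _ => mX k] at hfst
  rw [lintegral_add_left' (Finset.aemeasurable_fun_sum _ fun i _ =>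
      Finset.aemeasurable_fun_sum _ fun k _ => mY i k), lintegral_add_left' mDY',
    lintegral_const_mul' _ _ hE] at hsnd
  have hYsum : ∫⁻ p in S, ∑ i, ∑ k, ‖Y i k p‖ₑ ^ 2 = ∑ i, ∑ k, ∫⁻ p in S, ‖Y i k p‖ₑ ^ 2 := by
    rw [lintegral_finsetSum' _ fun i _ => Finset.aemeasurable_fun_sum _ fun k _ => mY i k]
    exact Finset.sum_congr rfl fun i _ => lintegral_finsetSum' _ fun k _ => mY i k
  have hpot : ∫⁻ p in S, (ENNReal.ofReal (V p.1) + manyBodyPotential V v N p.2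
      + ∑ j, v (dist p.1 (p.2 j))) * ‖Ψ p‖ₑ ^ 2 =
      (∫⁻ p in S, ENNReal.ofReal (V p.1) * ‖Ψ p‖ₑ ^ 2)
      + (∫⁻ p in S, manyBodyPotential V v N p.2 * ‖Ψ p‖ₑ ^ 2)
      + ∫⁻ p in S, (∑ j, v (dist p.1 (p.2 j))) * ‖Ψ p‖ₑ ^ 2 := by
    simp_rw [add_mul]
    have mVP : AEMeasurable (fun p => ENNReal.ofReal (V p.1) * ‖Ψ p‖ₑ ^ 2
      + manyBodyPotential V v N p.2 * ‖Ψ p‖ₑ ^ 2) (volume.restrict S) := mV.add mP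
    rw [lintegral_add_left' mVP, lintegral_add_left' mV]
  -- The gradients of `F` left over in both sets of variables and the interaction of the new
  -- particle with the old ones combine pointwise into pair energies. The bound `f ≤ m` and
  -- translation invariance reduce them to `N` copies of one integral.
  have hcorr : (∫⁻ p in S, ∑ k, ‖lineDeriv ℝ F p (unitVec k, 0) * (f p.1 * ψ p.2)‖ₑ ^ 2)
      + (∫⁻ p in S, ∑ i, ∑ k,
        ‖lineDeriv ℝ F p (0, Pi.single i (unitVec k)) * (f p.1 * ψ p.2)‖ₑ ^ 2)
      + (∫⁻ p in S, (∑ j, v (dist p.1 (p.2 j))) * ‖Ψ p‖ₑ ^ 2) ≤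
      N * (ENNReal.ofReal (m ^ 2) * ∫⁻ z, pairEnergy v Γ z) := by
    refine le_trans ?_ (lintegral_pair_tensor_le (measurable_pairEnergy hv hΓ.continuous) hf
      h.nonneg h.le_sup hψ hmass)
    rw [← lintegral_add_left' mDX', ← lintegral_add_left' (by exact mDX'.add mDY')]
    refine lintegral_mono_ae ?_
    filter_upwards [ae_restrict_of_ae (ae_energy_correlation_le hΓ h0 v)] with p hp
    refine le_trans (le_of_eq ?_) (mul_le_mul_left hp (‖f p.1 * ψ p.2‖ₑ ^ 2))
    have esq (a b : ℝ) : ‖a * b‖ₑ ^ 2 = ENNReal.ofReal (a ^ 2) * ‖b‖ₑ ^ 2 := by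
      rw [enorm_mul, mul_pow, enorm_sq_eq_ofReal a]
    simp only [hΨ, hFdef, add_mul, Finset.sum_mul, esq, mul_assoc]
  rw [hpot]
  rw [hYsum] at hsnd
  set D := ∫⁻ p in S, ‖Ψ p‖ₑ ^ 2
  set err := ENNReal.ofReal t * (2 * bosonEnergy Ω V v N + 3
          + (N * 3 : ℕ) * ENNReal.ofReal (8 * ((L * 2 : ℝ≥0) : ℝ) ^ 2))
  set a1 := ∑ k, ∫⁻ p in S, ‖X k p‖ₑ ^ 2
  set a2 := ∑ i, ∑ k, ∫⁻ p in S, ‖Y i k p‖ₑ ^ 2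
  set b1 := ∫⁻ p in S, ENNReal.ofReal (V p.1) * ‖Ψ p‖ₑ ^ 2
  set b2 := ∫⁻ p in S, manyBodyPotential V v N p.2 * ‖Ψ p‖ₑ ^ 2
  set b3 := ∫⁻ p in S, (∑ j, v (dist p.1 (p.2 j))) * ‖Ψ p‖ₑ ^ 2
  set c1 := ∫⁻ p in S, ∑ k, ‖lineDeriv ℝ F p (unitVec k, 0) * (f p.1 * ψ p.2)‖ₑ ^ 2
  set c2 := ∫⁻ p in S, ∑ i, ∑ k,
        ‖lineDeriv ℝ F p (0, Pi.single i (unitVec k)) * (f p.1 * ψ p.2)‖ₑ ^ 2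
  set T := ENNReal.ofReal (formEnergy Ω V f g)
  calc a1 + a2 + (b1 + b2 + b3) = (a1 + b1) + (a2 + b2) + b3 := by ring
    _ ≤ (T + c1) + (c2 + bosonEnergy Ω V v N * D + err) + b3 :=
        add_le_add (add_le_add hfst hsnd) le_rfl
    _ = bosonEnergy Ω V v N * D + (T + (c1 + c2 + b3) + err) := by ring
    _ ≤ _ := by gcongr

end Combined

/-- The bound `2a / r`, cut off at distance `b`, on the deviation of the pair function from one. -/
noncomputable def hole (a b r : ℝ) : ℝ≥0∞ :=
  if r < b then ENNReal.ofReal (2 * a) * (ENNReal.ofReal r)⁻¹ else 0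

theorem measurable_hole (a b : ℝ) : Measurable (hole a b) :=
  Measurable.ite measurableSet_Iio (measurable_const.mul ENNReal.measurable_ofReal.inv)
    measurable_const

theorem lintegral_hole {a b : ℝ} (ha : 0 < a) (hb : 0 < b) :
    ∫⁻ z : Space3, hole a b ‖z‖ = ENNReal.ofReal (4 * Real.pi * a * b ^ 2) := by
  rw [lintegral_fun_norm (measurable_hole a b)]
  have h1 : ∫⁻ t in Ioi (0 : ℝ), hole a b t * ENNReal.ofReal (t ^ 2) =
      ∫⁻ t in Ioo 0 b, ENNReal.ofReal (2 * a * t) := by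
    have hIoo : Ioo 0 b = Ioi (0 : ℝ) ∩ Iio b := Ioi_inter_Iio.symm
    rw [hIoo, inter_comm, ← Measure.restrict_restrict measurableSet_Iio,
      ← lintegral_indicator measurableSet_Iio]
    refine setLIntegral_congr_fun measurableSet_Ioi fun t ht => ?_
    have ht : (0 : ℝ) < t := ht
    by_cases h : t < b
    · simp only [hole, h, if_true, indicator, mem_Iio]
      rw [pow_two, ENNReal.ofReal_mul (p := t) ht.le, ENNReal.ofReal_mul (p := 2 * a) (by positivity),
        mul_assoc, ← mul_assoc (ENNReal.ofReal t)⁻¹,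
        ENNReal.inv_mul_cancel (by simpa using ht) ENNReal.ofReal_ne_top, one_mul]
    · simp [hole, h]
  have h2 : ∫⁻ t in Ioo 0 b, ENNReal.ofReal (2 * a * t) = ENNReal.ofReal (a * b ^ 2) := by
    rw [restrict_Ioo_eq_restrict_Ioc, ← ofReal_integral_eq_lintegral_ofReal]
    · congr 1
      rw [← intervalIntegral.integral_of_le hb.le, intervalIntegral.integral_const_mul, integral_id]
      ring
    · exact (Continuous.integrableOn_Icc (by fun_prop)).mono_set Ioc_subset_Icc_self
    · filter_upwards [ae_restrict_mem measurableSet_Ioc] with t ht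
      have := ht.1
      positivity
  rw [h1, h2, ← ENNReal.ofReal_mul (by positivity)]
  congr 1; ring

/-! ### Lower bound on the norm and the cost of adding a particle. -/

section Final

variable {Ω : Set Space3} {V : Space3 → ℝ} {v : ℝ → ℝ≥0∞} {N : ℕ}

/-- From `F² ≥ 1 - 2(1 - F)`, where `F` is the value of `Γ` at one pair: the deviation from one is
at most `η` beyond `b` and `a/r + η` inside. The hole of that single pair suffices, and the sum over
all pairs dominates it. -/
theorem one_le_correlation_sq_add [NeZero N] {Γ : Space3 → ℝ} {a b η : ℝ} (ha : 0 < a)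
    (hη : 0 < η) (hfar : ∀ z, b ≤ ‖z‖ → 1 - η ≤ Γ z)
    (hnear : ∀ z ≠ 0, 1 - a / ‖z‖ - η ≤ Γ z) (p : Space3 × (Fin N → Space3)) :
    1 ≤ ENNReal.ofReal (correlation Γ p ^ 2) + ENNReal.ofReal (2 * η)
      + ∑ j, hole a b ‖p.1 - p.2 j‖ := by
  obtain ⟨j, hj⟩ := exists_correlation_eq Γ p
  set z := p.1 - p.2 j with hz
  have hle : hole a b ‖z‖ ≤ ∑ j, hole a b ‖p.1 - p.2 j‖ :=
    Finset.single_le_sum (f := fun j => hole a b ‖p.1 - p.2 j‖) (fun _ _ => zero_le)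
      (Finset.mem_univ j)
  refine le_trans ?_ (add_le_add le_rfl hle)
  rw [← hj]
  rcases le_or_gt b ‖z‖ with hb | hb
  · refine le_trans ?_ le_self_add
    rw [← ENNReal.ofReal_add (sq_nonneg _) (by positivity), ENNReal.one_le_ofReal]
    nlinarith [hfar z hb, sq_nonneg (1 - Γ z)]
  · rcases eq_or_ne z 0 with hz0 | hz0
    -- At coinciding points `hole` is infinite, the inverse of zero in `[0, ∞]`, and the inequality
    -- is trivial.
    · refine le_trans ?_ le_add_self
      have hb0 : 0 < b := by simpa [hz0] using hb
      simp [hole, hz0, hb0, ENNReal.mul_top, ha]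
    · have hn : 0 < ‖z‖ := norm_pos_iff.2 hz0
      have he : hole a b ‖z‖ = ENNReal.ofReal (2 * (a / ‖z‖)) := by
        rw [hole, if_pos hb, ← ENNReal.ofReal_inv_of_pos hn, ← ENNReal.ofReal_mul (by positivity)]
        congr 1; ring
      have hq : 0 ≤ a / ‖z‖ := by positivity
      rw [he, ← ENNReal.ofReal_add (sq_nonneg _) (by positivity),
        ← ENNReal.ofReal_add (by positivity) (by positivity), ENNReal.one_le_ofReal]
      nlinarith [hnear z hz0, sq_nonneg (1 - Γ z)]

theorem IsStarMin.one_le_correlated_mass [NeZero N] {A e m : ℝ} {f : Space3 → ℝ}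
    {g : Fin 3 → Space3 → ℝ} (h : IsStarMin Ω V A e f g m) {ψ : (Fin N → Space3) → ℝ} (hψ : MemLp ψ 2 (volume.restrict (configSpace Ω N)))
    (hmass : ∫⁻ y in configSpace Ω N, ‖ψ y‖ₑ ^ 2 = 1) {Γ : Space3 → ℝ}
    {L : ℝ≥0} (hΓ : LipschitzWith L Γ) {a b η : ℝ} (ha : 0 < a) (hb : 0 < b)
    (hη : 0 < η) (hfar : ∀ z, b ≤ ‖z‖ → 1 - η ≤ Γ z)
    (hnear : ∀ z ≠ 0, 1 - a / ‖z‖ - η ≤ Γ z) :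
    1 ≤ (∫⁻ p in Ω ×ˢ configSpace Ω N, ‖correlation Γ p * (f p.1 * ψ p.2)‖ₑ ^ 2)
      + ENNReal.ofReal (2 * η + N * m ^ 2 * (4 * Real.pi * a * b ^ 2)) := by
  have hf := h.dom.memLp
  have hT := memLp_two_configSpace_tensor hf hψ
  have hTm : AEMeasurable (fun p : Space3 × (Fin N → Space3) => ‖f p.1 * ψ p.2‖ₑ ^ 2)
    (volume.restrict (Ω ×ˢ configSpace Ω N)) := hT.1.enorm.pow_const 2
  have hTot : ∫⁻ p in Ω ×ˢ configSpace Ω N, ‖f p.1 * ψ p.2‖ₑ ^ 2 = 1 := by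
    rw [Measure.volume_eq_prod, ← Measure.prod_restrict]
    simp_rw [enorm_mul, mul_pow]
    rw [lintegral_prod_mul (f := fun x => ‖f x‖ₑ ^ 2) (g := fun y => ‖ψ y‖ₑ ^ 2)
      (hf.1.enorm.pow_const 2) (hψ.1.enorm.pow_const 2), hmass, lintegral_enorm_sq_eq hf, h.mass]
    simp
  have hpair := lintegral_pair_tensor_le ((measurable_hole a b).comp measurable_norm) hf h.nonneg
    h.le_sup hψ hmass
  simp only [Function.comp_apply] at hpair
  rw [show ∫⁻ z : Space3, hole a b ‖z‖ = _ from lintegral_hole ha hb] at hpair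
  have hFm : AEMeasurable (fun p : Space3 × (Fin N → Space3) =>
      ‖correlation Γ p * (f p.1 * ψ p.2)‖ₑ ^ 2) (volume.restrict (Ω ×ˢ configSpace Ω N)) :=
    (((lipschitzWith_correlation hΓ).continuous.aestronglyMeasurable.mul hT.1).enorm).pow_const 2
  have hFm2 : AEMeasurable (fun p : Space3 × (Fin N → Space3) =>
      ‖correlation Γ p * (f p.1 * ψ p.2)‖ₑ ^ 2 + ENNReal.ofReal (2 * η) * ‖f p.1 * ψ p.2‖ₑ ^ 2)
      (volume.restrict (Ω ×ˢ configSpace Ω N)) := hFm.add (hTm.const_mul _)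
  calc (1 : ℝ≥0∞) = ∫⁻ p in Ω ×ˢ configSpace Ω N, ‖f p.1 * ψ p.2‖ₑ ^ 2 := hTot.symm
    _ ≤ ∫⁻ p in Ω ×ˢ configSpace Ω N, (‖correlation Γ p * (f p.1 * ψ p.2)‖ₑ ^ 2
        + ENNReal.ofReal (2 * η) * ‖f p.1 * ψ p.2‖ₑ ^ 2
        + (∑ j, hole a b ‖p.1 - p.2 j‖) * ‖f p.1 * ψ p.2‖ₑ ^ 2) := by
        refine lintegral_mono fun p => ?_
        have := mul_le_mul_left (one_le_correlation_sq_add (N := N) ha hη hfar hnear p)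
          (‖f p.1 * ψ p.2‖ₑ ^ 2)
        rw [one_mul] at this
        refine this.trans (le_of_eq ?_)
        rw [add_mul, add_mul, enorm_mul (correlation Γ p), mul_pow,
          enorm_sq_eq_ofReal (correlation Γ p)]
    _ = (∫⁻ p in Ω ×ˢ configSpace Ω N, ‖correlation Γ p * (f p.1 * ψ p.2)‖ₑ ^ 2)
        + ENNReal.ofReal (2 * η) + ∫⁻ p in Ω ×ˢ configSpace Ω N,
          (∑ j, hole a b ‖p.1 - p.2 j‖) * ‖f p.1 * ψ p.2‖ₑ ^ 2 := by
        rw [lintegral_add_left' hFm2, lintegral_add_left' hFm,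
          lintegral_const_mul' _ _ ENNReal.ofReal_ne_top, hTot, mul_one]
    _ ≤ _ := by
        rw [add_assoc]
        refine add_le_add le_rfl ((add_le_add le_rfl hpair).trans (le_of_eq ?_))
        rw [ENNReal.ofReal_add (by positivity) (by positivity), ENNReal.ofReal_mul (p := N * m ^ 2)
          (by positivity), ENNReal.ofReal_mul (p := (N : ℝ)) (by positivity),
          ENNReal.ofReal_natCast, mul_assoc (N : ℝ≥0∞)]

/-- The energy needed for adding one particle. -/
theorem IsStarMin.bosonEnergy_succ_le [NeZero N] {A e m : ℝ} {f : Space3 → ℝ}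
    {g : Fin 3 → Space3 → ℝ} (h : IsStarMin Ω V A e f g m) (he : 0 ≤ e) (hΩ : IsOpen Ω)
    (hV : ∀ x, 0 ≤ V x) (hVm : Measurable V) (hv : Measurable v) {a b : ℝ}
    (hs : HasScatteringLength v a) (ha : 0 < a) (hab : a < b)
    (hq : N * m ^ 2 * (4 * Real.pi * a * b ^ 2) < 1) :
    bosonEnergy Ω V v (N + 1) ≤ bosonEnergy Ω V v N +
      ENNReal.ofReal ((formEnergy Ω V f g + N * m ^ 2 * (8 * Real.pi * a / (1 - a / b) ^ 2))
        / (1 - N * m ^ 2 * (4 * Real.pi * a * b ^ 2))) := by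
  rcases eq_or_ne (bosonEnergy Ω V v N) ⊤ with hE | hE
  · simp [hE]
  have hb : 0 < b := ha.trans hab
  set q := N * m ^ 2 * (4 * Real.pi * a * b ^ 2) with hqdef
  set B := formEnergy Ω V f g + N * m ^ 2 * (8 * Real.pi * a / (1 - a / b) ^ 2) with hB
  have hT0 := formEnergy_nonneg (Ω := Ω) hV f g
  have hI0 : 0 ≤ 8 * Real.pi * a / (1 - a / b) ^ 2 := by positivity
  have hB0 : 0 ≤ B := by positivity
  -- One parameter `ε` covers both the regularization of the scattering function and the
  -- non-optimality of `ψ`; it tends to zero at the end.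
  have hstep : ∀ ε : ℝ, 0 < ε → ε < 1 - q → bosonEnergy Ω V v (N + 1) ≤
      bosonEnergy Ω V v N + ENNReal.ofReal ((B + ε) / (1 - q - ε)) := by
    intro ε hε hεq
    obtain ⟨Γ, L, hL, h0, h1, hfar, hnear, hI⟩ :=
      exists_scattering_function (η := ε / 2) hv hs hab (by positivity)
    set C := 2 * bosonEnergy Ω V v N + 3
      + (N * 3 : ℕ) * ENNReal.ofReal (8 * ((L * 2 : ℝ≥0) : ℝ) ^ 2) with hC
    have hCt : C ≠ ⊤ := by rw [hC]; finiteness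
    -- `ψ` is chosen after `Γ`, since the error constant contains the Lipschitz constant of `Γ`, for
    -- which no bound uniform in `ε` is available.
    set t := min 1 (ε / (C.toReal + 1)) with ht
    have hC0 : 0 ≤ C.toReal := ENNReal.toReal_nonneg
    have ht0 : 0 < t := lt_min one_pos (by positivity)
    have htC : ENNReal.ofReal t * C ≤ ENNReal.ofReal ε := by
      rw [← ENNReal.ofReal_toReal hCt, ← ENNReal.ofReal_mul ht0.le]
      refine ENNReal.ofReal_le_ofReal ?_
      calc t * C.toReal ≤ ε / (C.toReal + 1) * C.toReal :=
            mul_le_mul_of_nonneg_right (min_le_right _ _) hC0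
        _ ≤ ε := by rw [div_mul_eq_mul_div, div_le_iff₀ (by positivity)]; nlinarith
    obtain ⟨ψ, G, hd, hmass, hlow⟩ := exists_near_minimizer hΩ hVm hv (NeZero.pos N) hE
      (θ := ENNReal.ofReal (t ^ 2)) (by simpa using ht0.ne')
    have hψ : MemLp ψ 2 (volume.restrict (configSpace Ω N)) := (hd 0 0).1
    have key := h.bosonEnergy_succ_mul_le he hΩ hV hVm hv hL h0 h1 hE hd hmass ht0
      (min_le_left _ _) hlow
    have hone := h.one_le_correlated_mass hψ hmass hL ha hb
      (by positivity : 0 < ε / 2) hfar hnear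
    rw [mul_div_cancel₀ _ (two_ne_zero), ← hqdef] at hone
    set D := ∫⁻ p in Ω ×ˢ configSpace Ω N, ‖correlation Γ p * (f p.1 * ψ p.2)‖ₑ ^ 2 with hD
    have hDt : D ≠ ⊤ := by
      have hm : MemLp (fun p : Space3 × (Fin N → Space3) => correlation Γ p * (f p.1 * ψ p.2)) 2
          (volume.restrict (Ω ×ˢ configSpace Ω N)) :=
        memLp_two_mul_of_bounded (B := 1) (lipschitzWith_correlation hL).continuous.aestronglyMeasurable
          (fun p => by
            rw [abs_of_nonneg (correlation_nonneg h0 p)]; exact correlation_le_one h1 p)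
          (memLp_two_configSpace_tensor h.dom.memLp hψ)
      exact lintegral_ne_top_of_memLp_two hm
    have hq0 : 0 ≤ q := by positivity
    have hDlow : ENNReal.ofReal (1 - q - ε) ≤ D := by
      rw [show 1 - q - ε = 1 - (ε + q) by ring, ENNReal.ofReal_sub _ (by positivity),
        ENNReal.ofReal_one]
      exact tsub_le_iff_right.2 hone
    have hd0 : 0 < 1 - q - ε := by linarith
    have hD0 : D ≠ 0 := fun h => by
      rw [h] at hDlow
      exact absurd (ENNReal.ofReal_eq_zero.1 (le_antisymm hDlow zero_le)) (not_le.2 hd0)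
    have hR : ENNReal.ofReal (formEnergy Ω V f g) + N * (ENNReal.ofReal (m ^ 2)
        * ∫⁻ z, pairEnergy v Γ z) + ENNReal.ofReal t * C ≤ ENNReal.ofReal (B + ε) := by
      rw [ENNReal.ofReal_add hB0 hε.le, hB, ENNReal.ofReal_add hT0 (by positivity),
        ENNReal.ofReal_mul (p := N * m ^ 2) (by positivity), ENNReal.ofReal_mul (p := (N : ℝ))
        (by positivity), ENNReal.ofReal_natCast, mul_assoc (N : ℝ≥0∞)]
      refine add_le_add (add_le_add le_rfl ?_) htC
      exact mul_le_mul_right (mul_le_mul_right hI _) _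
    have hfin : bosonEnergy Ω V v (N + 1) * D ≤
        (bosonEnergy Ω V v N + ENNReal.ofReal ((B + ε) / (1 - q - ε))) * D := by
      refine key.trans ?_
      rw [add_mul]
      refine add_le_add le_rfl (hR.trans ?_)
      calc ENNReal.ofReal (B + ε) = ENNReal.ofReal ((B + ε) / (1 - q - ε))
            * ENNReal.ofReal (1 - q - ε) := by
            rw [← ENNReal.ofReal_mul (by positivity), div_mul_cancel₀ _ hd0.ne']
        _ ≤ _ := mul_le_mul_right hDlow _
    exact (ENNReal.mul_le_mul_iff_left hD0 hDt).1 hfin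
  have hlim : Tendsto (fun ε : ℝ => bosonEnergy Ω V v N
      + ENNReal.ofReal ((B + ε) / (1 - q - ε))) (𝓝[>] 0)
      (𝓝 (bosonEnergy Ω V v N + ENNReal.ofReal (B / (1 - q)))) := by
    refine Tendsto.const_add _ (ENNReal.tendsto_ofReal ?_)
    have : ContinuousAt (fun ε : ℝ => (B + ε) / (1 - q - ε)) 0 := by
      refine ContinuousAt.div (by fun_prop) (by fun_prop) ?_
      simp only [sub_zero]
      linarith
    simpa [ContinuousAt] using this.tendsto.mono_left (nhdsWithin_le_nhds (s := Ioi 0))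
  refine ge_of_tendsto hlim ?_
  filter_upwards [Ioo_mem_nhdsGT (show (0 : ℝ) < 1 - q by linarith)] with ε hε
  exact hstep ε hε.1 hε.2

end Final

theorem measurable_scaledInteraction {v₁ : ℝ → ℝ≥0∞} (hv : Measurable v₁) (a₁ a : ℝ) :
    Measurable (scaledInteraction v₁ a₁ a) :=
  (hv.comp ((measurable_const.mul measurable_id).div_const a)).const_mul _

/-- The number `m` is only known to bound `f`. Minimality compared with the same function and the
bound `K` shows, as `A > 0`, that `m` is no larger than any other bound. -/
theorem IsStarMin.sup_sq_le {Ω : Set Space3} {V : Space3 → ℝ} {A e m K : ℝ} {f : Space3 → ℝ}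
    {g : Fin 3 → Space3 → ℝ} (h : IsStarMin Ω V A e f g m) (hA : 0 < A) (hK : 0 ≤ K)
    (hf : ∀ᵐ x ∂volume.restrict Ω, f x ≤ K) : m ^ 2 ≤ K ^ 2 := by
  have h1 := h.lower f g K h.dom hK (hf.mono fun x hx => by rwa [abs_of_nonneg (h.nonneg x)])
  rw [h.mass, mul_one] at h1
  have h2 : 8 * Real.pi * A * m ^ 2 ≤ 8 * Real.pi * A * K ^ 2 := by linarith [h.energy_le]
  exact le_of_mul_le_mul_left h2 (by positivity)

/-- The geometric factor in the upper bound is linear in the small parameter. -/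
theorem inv_one_sub_sq_mul_le {s k : ℝ} (hs : 0 ≤ s) (hk : 0 ≤ k)
    (hδ : s ≤ 1 / (2 * (2 + k))) :
    k * s < 1 ∧ s < 1 ∧ 1 / ((1 - s) ^ 2 * (1 - k * s)) ≤ 1 + 2 * (2 + k) * s := by
  have h1 : (2 + k) * s ≤ 1 / 2 := by
    calc (2 + k) * s ≤ (2 + k) * (1 / (2 * (2 + k))) := by gcongr
      _ = 1 / 2 := by field_simp
  have hks : 0 ≤ k * s := by positivity
  have h2 : k * s < 1 := by linarith
  have h3 : s < 1 := by linarith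
  -- Linearize the denominator; for `P = (2 + k) s ≤ 1/2` one then has `1 / (1 - P) ≤ 1 + 2P`, which
  -- gives the constant `2 (2 + k)`.
  have h4 : 1 - (2 + k) * s ≤ (1 - s) ^ 2 * (1 - k * s) := by
    nlinarith [mul_nonneg hs hks, mul_nonneg (mul_nonneg hs hks) (by linarith : 0 ≤ 2 - s),
      sq_nonneg s, mul_nonneg (sq_nonneg s) (by linarith : 0 ≤ 1 - k * s)]
  refine ⟨h2, h3, ?_⟩
  rw [div_le_iff₀ (mul_pos (by nlinarith) (by linarith))]
  set P := (2 + k) * s with hP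
  have hP0 : 0 ≤ P := by positivity
  calc (1 : ℝ) ≤ (1 + 2 * P) * (1 - P) := by nlinarith
    _ ≤ (1 + 2 * P) * ((1 - s) ^ 2 * (1 - k * s)) := by gcongr
    _ = _ := by rw [hP]; ring

theorem theorem3p2 (Ω : Set Space3) (V : Space3 → ℝ)
    (hV_meas : Measurable V) (hV_nonneg : ∀ x, 0 ≤ V x)
    (hV_locBdd : ∀ R : ℝ, ∃ M : ℝ, ∀ x, ‖x‖ ≤ R → V x ≤ M)
    (hΩ : (Ω = Set.univ ∧ Filter.Tendsto V (Filter.cocompact Space3) Filter.atTop) ∨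
      ∃ p q : Fin 3 → ℝ, (∀ k, p k < q k) ∧ Ω = openBox p q) :
    (∀ (N : ℕ) (a : ℝ), 1 ≤ N → 0 < a →
      ∃ φ : Space3 → ℝ, IsPositiveStarMinimizer Ω V N a φ) ∧
    ∀ κ : ℝ, ∃ C δ : ℝ, 0 < δ ∧
      ∀ (v₁ : ℝ → ENNReal) (a₁ : ℝ), Measurable v₁ → 0 < a₁ → HasScatteringLength v₁ a₁ →
      ∀ (N : ℕ) (a : ℝ), 1 ≤ N → 0 < a → N * a ≤ κ →
      ∀ φ : Space3 → ℝ, IsPositiveStarMinimizer Ω V N a φ →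
        a * meanDensity Ω N φ ^ (1 / 3 : ℝ) ≤ δ →
        bosonEnergy Ω V (scaledInteraction v₁ a₁ a) (N + 1) ≤
          bosonEnergy Ω V (scaledInteraction v₁ a₁ a) N
            + starEnergy Ω V 1 (N * a)
              * ENNReal.ofReal (1 + C * (a * meanDensity Ω N φ ^ (1 / 3 : ℝ))) := by
  have hT : IsTrap Ω V := hΩ
  have hV := hV_nonneg
  refine ⟨fun N a hN ha => (starEnergy_eq hT hV hV_meas hV_locBdd hN ha).2, fun κ => ?_⟩
  obtain ⟨E, hE0, hE⟩ := exists_starEnergy_bound hT hV hV_meas hV_locBdd κ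
  obtain ⟨K, hK0, hK⟩ := exists_sup_bound hT hV hV_meas E hE0
  obtain ⟨c, hc0, hc⟩ := exists_integral_pow_four_lower hT hV hV_meas E hE0
  -- `K² / c` compares the maximal density with the mean density. It depends on `Ω`, `V` and `κ`
  -- alone, through the energy bound `E`.
  set k := 4 * Real.pi * (K ^ 2 / c) with hk
  have hk0 : 0 ≤ k := by positivity
  refine ⟨2 * (2 + k), 1 / (2 * (2 + k)), by positivity, ?_⟩
  intro v₁ a₁ hv₁ ha₁ hs₁ N a hN ha hNa φ hφ hδ
  have hN0 : (0 : ℝ) < N := by exact_mod_cast hN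
  have : NeZero N := ⟨by omega⟩
  have hA : 0 < N * a := by positivity
  have he0 : 0 ≤ (starEnergy Ω V 1 (N * a)).toReal := ENNReal.toReal_nonneg
  have heE := hE _ hA.le hNa
  obtain ⟨g, m, h⟩ := hφ.exists_isStarMin hT hV hV_meas hV_locBdd hN ha
  have hmK := h.sup_sq_le hA hK0.le (hK _ _ _ _ _ h he0 heE)
  have hlow := hc _ _ _ _ _ hA.le h heE
  set e := (starEnergy Ω V 1 (N * a)).toReal with he
  have hee : starEnergy Ω V 1 (N * a) = ENNReal.ofReal e :=
    (ENNReal.ofReal_toReal (starEnergy_ne_top hT hV hV_meas hV_locBdd hA.le)).symm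
  set ρ := meanDensity Ω N φ with hρ
  have hρeq : ∫ x in Ω, ((√(N : ℝ))⁻¹ * |φ x|) ^ 4 = ρ / N := by
    have h4 (x) : ((√(N : ℝ))⁻¹ * |φ x|) ^ 4 = (1 / (N : ℝ) ^ 2) * φ x ^ 4 := by
      rw [mul_pow, show (4 : ℕ) = 2 * 2 by norm_num, pow_mul, pow_mul, inv_pow,
        Real.sq_sqrt hN0.le, sq_abs, pow_mul, inv_pow, one_div]
    simp_rw [h4, integral_const_mul, hρ, meanDensity]
    field_simp
  rw [hρeq, le_div_iff₀ hN0] at hlow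
  have hρ0 : 0 < ρ := lt_of_lt_of_le (by positivity) hlow
  set r := ρ ^ (1 / 3 : ℝ) with hr
  have hr0 : 0 < r := Real.rpow_pos_of_pos hρ0 _
  have hr3 : r ^ 3 = ρ := by
    rw [hr, ← Real.rpow_natCast, ← Real.rpow_mul hρ0.le]
    norm_num
  set s := a * r with hs
  have hs0 : 0 < s := by positivity
  obtain ⟨hks, hs1, hbound⟩ := inv_one_sub_sq_mul_le hs0.le hk0 hδ
  -- The freezing radius is `b = r⁻¹ = ρ^(-1/3)`, the mean particle distance. Then `a / b = s`, and
  -- the norm deficit, of order `ρ a b²`, is also of order `s`.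
  have hab : a < r⁻¹ := by rwa [lt_inv_comm₀ ha hr0, ← one_div, lt_div_iff₀ ha, mul_comm]
  have hdiv : a / r⁻¹ = s := by rw [div_inv_eq_mul]
  have hq : N * m ^ 2 * (4 * Real.pi * a * r⁻¹ ^ 2) ≤ k * s := by
    have h1 : N * m ^ 2 ≤ K ^ 2 / c * ρ := by
      calc N * m ^ 2 ≤ N * K ^ 2 := by gcongr
        _ = K ^ 2 / c * (c * N) := by field_simp
        _ ≤ _ := by gcongr
    calc N * m ^ 2 * (4 * Real.pi * a * r⁻¹ ^ 2) ≤ K ^ 2 / c * ρ * (4 * Real.pi * a * r⁻¹ ^ 2) := by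
          gcongr
      _ = k * s := by rw [hk, hs, ← hr3]; field_simp
  refine (h.bosonEnergy_succ_le he0 hT.isOpen hV hV_meas (measurable_scaledInteraction hv₁ a₁ a)
    (hs₁.scaled hv₁ ha₁ ha) ha hab (hq.trans_lt hks)).trans ?_
  rw [hee, hdiv, ← ENNReal.ofReal_mul he0]
  refine add_le_add le_rfl (ENNReal.ofReal_le_ofReal ?_)
  have hT0 := formEnergy_nonneg (Ω := Ω) hV (fun x => (√(N : ℝ))⁻¹ * |φ x|) g
  have hs2 : 0 < (1 - s) ^ 2 := by nlinarith
  -- The interaction term reproduces `8πA m²` with `A = N a`, so kinetic, potential and supremum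
  -- terms add up to at most `e`; the factor `1 / (1 - s)²` is also granted to the form energy,
  -- which needs none.
  have hnum : formEnergy Ω V (fun x => (√(N : ℝ))⁻¹ * |φ x|) g
      + N * m ^ 2 * (8 * Real.pi * a / (1 - s) ^ 2) ≤ e / (1 - s) ^ 2 := by
    rw [le_div_iff₀ hs2, add_mul]
    have h1 : N * m ^ 2 * (8 * Real.pi * a / (1 - s) ^ 2) * (1 - s) ^ 2 =
        8 * Real.pi * (N * a) * m ^ 2 := by
      have : 1 - s ≠ 0 := by linarith
      field_simp
    have h2 : (1 - s) ^ 2 ≤ 1 := by nlinarith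
    rw [h1]
    nlinarith [h.energy_le, mul_le_of_le_one_right hT0 h2]
  calc _ ≤ e / (1 - s) ^ 2 / (1 - k * s) := by
        refine div_le_div₀ (by positivity) hnum (by linarith) (by linarith)
    _ = e * (1 / ((1 - s) ^ 2 * (1 - k * s))) := by
        have : 1 - k * s ≠ 0 := by linarith
        field_simp
    _ ≤ e * (1 + 2 * (2 + k) * s) := by gcongr
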